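/- An interval representation over a finite set $V$ is a linear order on the points $\bot,\top,l_v,r_v$ ($v\in V$) with $\bot<l_v<r_v<\top$ for all $v$; its interval graph has vertex set $V$, and distinct $u,v$ are adjacent iff $l_u<r_v$ and $l_v<r_u$. Interval-Edge-Deletion asks, for a finite simple graph $G=(V,E)$, for the minimum $c\in\mathbb N$ such that some interval graph $G'=(V,E')$ with $E'\subseteq E$ satisfies $|E|-|E'|=c$. A tree decomposition (width = maximum bag size minus one) is nice if it is rooted, the root and the leaves have empty bags, and every non-leaf node either introduces one vertex to the bag of its only child, or forgets one vertex of the bag of its only child, or is a join node with two children having the same bag as itself; a nice path decomposition is one without join nodes. Theorem. There is an algorithm (on a random access machine with words of logarithmic length and unit-cost operations) which, given a graph $G=(V,E)$ with $V\neq\emptyset$ as an edge list together with a nice tree decomposition of $G$ of width $k$ with $O((k+1)|V|)$ nodes, solves Interval-Edge-Deletion on $G$ in time $$O\bigl(|V|\,(2k)!\;2^{7.76k}\,\mathrm{poly}(k)\bigr)$$ for some polynomial $\mathrm{poly}$. If the given decomposition is a nice path decomposition of width $k$, the algorithm runs in time $$O\bigl(|V|\,(2k)!\;2^{3.38k}\,\mathrm{poly}(k)\bigr).$$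 -/

import Mathlib

/-! ### Interval graphs and the edge-deletion problem -/

/-- The points `⊥`, `l_v`, `r_v` (`v : V`) and `⊤` that an interval representation orders. -/
inductive LR (V : Type*) where
  | bot : LR V
  | l (v : V) : LR V
  | r (v : V) : LR V
  | top : LR V

/-- An interval representation over `V`: a linear order on `LR V` in which
`⊥ < l_v < r_v < ⊤` for every `v`. -/
structure IntervalRepresentation (V : Type*) where
  order : LinearOrder (LR V)
  bot_lt_l : ∀ v, order.lt LR.bot (LR.l v)
  l_lt_r : ∀ v, order.lt (LR.l v) (LR.r v)
  r_lt_top : ∀ v, order.lt (LR.r v) LR.top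
  bot_lt_top : order.lt LR.bot LR.top

/-- The intervals `(p₁, q₁)` and `(p₂, q₂)` intersect. -/
def IntervalRepresentation.Intersect {V : Type*} (π : IntervalRepresentation V)
    (I₁ I₂ : LR V × LR V) : Prop :=
  π.order.lt I₁.1 I₂.2 ∧ π.order.lt I₂.1 I₁.2

/-- The interval graph of an interval representation. -/
def IntervalRepresentation.graph {V : Type*} (π : IntervalRepresentation V) : SimpleGraph V where
  Adj u v := u ≠ v ∧ π.Intersect (LR.l u, LR.r u) (LR.l v, LR.r v)
  symm := ⟨fun _ _ h => ⟨h.1.symm, h.2.2, h.2.1⟩⟩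
  loopless := ⟨fun _ h => h.1 rfl⟩

/-- A graph is an interval graph if it is the graph of some interval representation. -/
def IsIntervalGraph {V : Type*} (G : SimpleGraph V) : Prop :=
  ∃ π : IntervalRepresentation V, π.graph = G

/-- `c` is the solution of Interval-Edge-Deletion on `G`: the least number of edges whose
deletion turns `G` into an interval graph (on the same vertex set). -/
def IsIntervalEdgeDeletionNumber {V : Type*} (G : SimpleGraph V) (c : ℕ) : Prop :=
  IsLeast {c : ℕ | ∃ G' : SimpleGraph V, G' ≤ G ∧ IsIntervalGraph G' ∧
    G'.edgeSet.ncard + c = G.edgeSet.ncard} c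

/-! ### Tree decompositions -/

/-- `(T, X)` is a tree decomposition of `G`: `T` is a tree, the nodes whose bags contain a given
vertex are closed under taking paths, and both ends of every edge of `G` lie in a common bag.
Isolated vertices of `G` are not required to lie in a bag; decompositions in which all vertices
do are a special case. -/
structure IsTreeDecomposition {V ι : Type*} (G : SimpleGraph V) (T : SimpleGraph ι)
    (X : ι → Finset V) : Prop where
  isTree : T.IsTree
  mem_of_path : ∀ (u : V) (i j : ι) (w : T.Walk i j), w.IsPath → u ∈ X i → u ∈ X j →
    ∀ m ∈ w.support, u ∈ X m
  exists_bag : ∀ u v : V, G.Adj u v → ∃ i, u ∈ X i ∧ v ∈ X i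

/-- Rooted trees whose nodes are leaf nodes, introduce nodes (adding the vertex `x` to the bag of
the only child), forget nodes (removing `x` from the bag of the only child) and join nodes. -/
inductive NiceTree (V : Type*) where
  | leaf : NiceTree V
  | introduce (x : V) (t : NiceTree V) : NiceTree V
  | forget (x : V) (t : NiceTree V) : NiceTree V
  | join (t₁ t₂ : NiceTree V) : NiceTree V

namespace NiceTree

variable {V : Type*}

/-- The bag assigned to the root. -/
def bag [DecidableEq V] : NiceTree V → Finset V
  | leaf => ∅
  | introduce x t => insert x t.bag
  | forget x t => t.bag.erase x
  | join t₁ _ => t₁.bag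

/-- Introduce nodes add a new vertex, forget nodes remove a vertex that is present, and the
children of a join node have the same bag. -/
def WellFormed [DecidableEq V] : NiceTree V → Prop
  | leaf => True
  | introduce x t => x ∉ t.bag ∧ t.WellFormed
  | forget x t => x ∈ t.bag ∧ t.WellFormed
  | join t₁ t₂ => t₁.bag = t₂.bag ∧ t₁.WellFormed ∧ t₂.WellFormed

/-- The subtree below the node with a given address; an address is the list of steps from the
root, where an only child is reached by `false`. -/
def subtree : NiceTree V → List Bool → Option (NiceTree V)
  | t, [] => some t
  | introduce _ t, false :: p => t.subtree p
  | forget _ t, false :: p => t.subtree p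
  | join t₁ _, false :: p => t₁.subtree p
  | join _ t₂, true :: p => t₂.subtree p
  | _, _ => none

/-- The nodes of the tree. -/
def Node (t : NiceTree V) : Type := {p : List Bool // (t.subtree p).isSome}

/-- The bag assigned to a node. -/
def bagAt [DecidableEq V] (t : NiceTree V) (i : t.Node) : Finset V :=
  ((t.subtree i.1).get i.2).bag

/-- The tree as a graph on its nodes: a node is adjacent to its children and to its parent. -/
def graph (t : NiceTree V) : SimpleGraph t.Node where
  Adj i j := (∃ b : Bool, j.1 = i.1 ++ [b]) ∨ (∃ b : Bool, i.1 = j.1 ++ [b])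
  symm := ⟨fun _ _ h => h.symm⟩
  loopless := ⟨fun i h => by rcases h with ⟨b, h⟩ | ⟨b, h⟩ <;> simp at h⟩

/-- `t` is a nice tree decomposition of `G`. -/
structure IsNiceTreeDecomposition [DecidableEq V] (t : NiceTree V) (G : SimpleGraph V) : Prop where
  wellFormed : t.WellFormed
  root_bag : t.bag = ∅
  isTreeDecomposition : IsTreeDecomposition G t.graph t.bagAt

/-- The number of nodes. -/
def numNodes : NiceTree V → ℕ
  | leaf => 1
  | introduce _ t => t.numNodes + 1
  | forget _ t => t.numNodes + 1
  | join t₁ t₂ => t₁.numNodes + t₂.numNodes + 1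

/-- The largest cardinality of a bag. -/
def maxBagCard [DecidableEq V] : NiceTree V → ℕ
  | leaf => 0
  | introduce x t => max (introduce x t).bag.card t.maxBagCard
  | forget x t => max (forget x t).bag.card t.maxBagCard
  | join t₁ t₂ => max (join t₁ t₂).bag.card (max t₁.maxBagCard t₂.maxBagCard)

/-- The width: the largest cardinality of a bag minus one (read as `0` if all bags are empty). -/
def width [DecidableEq V] (t : NiceTree V) : ℕ := t.maxBagCard - 1

/-- There is no join node, so that the tree is a path. -/
def IsPath : NiceTree V → Prop
  | leaf => True
  | introduce _ t => t.IsPath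
  | forget _ t => t.IsPath
  | join _ _ => False

/-- The nodes in postorder, each one given by its kind (0 leaf, 1 introduce, 2 forget, 3 join) and
the introduced or forgotten vertex (0 for leaf and join nodes). -/
def code {n : ℕ} : NiceTree (Fin n) → List (ℕ × ℕ)
  | leaf => [(0, 0)]
  | introduce x t => t.code ++ [(1, (x : ℕ))]
  | forget x t => t.code ++ [(2, (x : ℕ))]
  | join t₁ t₂ => t₁.code ++ t₂.code ++ [(3, 0)]

end NiceTree

/-! ### Random access machines -/

namespace RAM

/-- The memory of the machine: registers and arrays, all holding natural numbers. A program
mentions only finitely many registers and arrays; arrays are unbounded. -/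
structure State where
  reg : ℕ → ℕ
  arr : ℕ → ℕ → ℕ

/-- The arithmetic operations: subtraction is truncated, division rounds down. -/
inductive Op where
  | add | sub | mul | div | mod

/-- The value of an operation; as for natural numbers in Lean, `a / 0 = 0` and `a % 0 = a`. -/
def Op.eval : Op → ℕ → ℕ → ℕ
  | add, a, b => a + b
  | sub, a, b => a - b
  | mul, a, b => a * b
  | div, a, b => a / b
  | mod, a, b => a % b

/-- Programs: elementary instructions, sequential composition, branches and loops. -/
inductive Program where
  /-- do nothing -/
  | skip : Program
  /-- `reg d := c` -/
  | const (d c : ℕ) : Program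
  /-- `reg d := reg a ∘ reg b` -/
  | op (o : Op) (d a b : ℕ) : Program
  /-- `reg d := arr A [reg i]` -/
  | load (d A i : ℕ) : Program
  /-- `arr A [reg i] := reg a` -/
  | store (A i a : ℕ) : Program
  /-- first `P`, then `Q` -/
  | seq (P Q : Program) : Program
  /-- `if reg a < reg b then P else Q` -/
  | ite (a b : ℕ) (P Q : Program) : Program
  /-- `while reg a < reg b do P` -/
  | loop (a b : ℕ) (P : Program) : Program

/-- `reg d := x` -/
def State.setReg (s : State) (d x : ℕ) : State :=
  { s with reg := Function.update s.reg d x }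

/-- `arr A [i] := x` -/
def State.setArr (s : State) (A i x : ℕ) : State :=
  { s with arr := Function.update s.arr A (Function.update (s.arr A) i x) }

/-- `Exec B P s τ s'`: started in state `s`, the program `P` halts in state `s'` after exactly `τ`
steps, and no number that it computes on the way is larger than `B`. Every elementary instruction
and every evaluation of a test is one step. -/
inductive Exec (B : ℕ) : Program → State → ℕ → State → Prop where
  | skip (s) : Exec B .skip s 1 s
  | const (s d c) : c ≤ B → Exec B (.const d c) s 1 (s.setReg d c)
  | op (s o d a b) : o.eval (s.reg a) (s.reg b) ≤ B →
      Exec B (.op o d a b) s 1 (s.setReg d (o.eval (s.reg a) (s.reg b)))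
  | load (s d A i) : s.arr A (s.reg i) ≤ B →
      Exec B (.load d A i) s 1 (s.setReg d (s.arr A (s.reg i)))
  | store (s A i a) : s.reg a ≤ B →
      Exec B (.store A i a) s 1 (s.setArr A (s.reg i) (s.reg a))
  | seq {P Q s s' s'' τ τ'} : Exec B P s τ s' → Exec B Q s' τ' s'' →
      Exec B (.seq P Q) s (τ + τ') s''
  | ite_true {a b P Q s s' τ} : s.reg a < s.reg b → Exec B P s τ s' →
      Exec B (.ite a b P Q) s (τ + 1) s'
  | ite_false {a b P Q s s' τ} : ¬ s.reg a < s.reg b → Exec B Q s τ s' →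
      Exec B (.ite a b P Q) s (τ + 1) s'
  | loop_true {a b P s s' s'' τ τ'} : s.reg a < s.reg b → Exec B P s τ s' →
      Exec B (.loop a b P) s' τ' s'' → Exec B (.loop a b P) s (τ + τ' + 1) s''
  | loop_false {a b P s} : ¬ s.reg a < s.reg b → Exec B (.loop a b P) s 1 s

/-- Started in state `s`, the program `P` halts within time `T`, and its output, the final content
of register `0`, satisfies `Q`. The machine has words of `O(log T)` bits: all numbers that occur
are at most `T ^ d`. -/
def HaltsWithin (P : Program) (s : State) (T : ℝ) (d : ℕ) (Q : ℕ → Prop) : Prop :=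
  ∃ (B τ : ℕ) (s' : State), Exec B P s τ s' ∧ (τ : ℝ) ≤ T ∧ (B : ℝ) ≤ T ^ d ∧ Q (s'.reg 0)

end RAM

/-- `E` lists every edge of `G` exactly once, in any order and with its ends in any order. -/
def IsEdgeList {n : ℕ} (E : List (Fin n × Fin n)) (G : SimpleGraph (Fin n)) : Prop :=
  (∀ e : Sym2 (Fin n), e ∈ G.edgeSet ↔ e ∈ E.map (fun a => s(a.1, a.2))) ∧
    (E.map (fun a => s(a.1, a.2))).Nodup

/-- The initial state of the machine on a graph with vertices `0, …, n - 1`, edge list `E` and nice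
tree decomposition `t`. Registers `0`, `1`, `2` hold the numbers of vertices, of edges and of tree
nodes; arrays `0` and `1` hold the first and the second ends of the edges, arrays `2` and `3` the
kinds and the vertices of the tree nodes in postorder. Everything else is `0`. -/
def inputState {n : ℕ} (E : List (Fin n × Fin n)) (t : NiceTree (Fin n)) : RAM.State where
  reg
    | 0 => n
    | 1 => E.length
    | 2 => t.numNodes
    | _ => 0
  arr
    | 0, i => (E.map (fun a => (a.1 : ℕ))).getD i 0
    | 1, i => (E.map (fun a => (a.2 : ℕ))).getD i 0
    | 2, i => (t.code.map Prod.fst).getD i 0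
    | 3, i => (t.code.map Prod.snd).getD i 0
    | _, _ => 0

/-! An interval representation amounts to a word in which every vertex occurs twice (`exists_word`,
`exists_representation`). The task is therefore to find a word in which only neighbours in `G`
intersect and the number of intersecting pairs is largest. This is done by dynamic programming along
the decomposition.

At a node with bag `B` and set `P` of forgotten vertices, the rest of the tree only sees the order
of the ends of the bag vertices and the places that are covered by intervals of `P`: vertices
outside `P` and `B` have no neighbours in `P`, so their intervals must avoid the covered places.
Each change between covered and uncovered is recorded by a star, and the parity of the stars to the
right of a place is its colour. Nonempty runs of stars in one gap matter only through their parity: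
an uncovered stretch between two adjacent stars can be declared covered when nothing ends in it, and
an empty covered stretch can be added at any uncovered place. So runs are cut down to at most two
stars. With `b` vertices in the bag this leaves `(2b)! / 2 ^ b` orders of the ends and three
possibilities for each of `2b + 1` gaps (`length_bagWords`).

The words at a node are computed from those at its children by `intro`, `fg` and `Joins`, which
together define the derivations `Der`. The value of a word counts the ordered intersecting pairs
with an end in `P`; it grows only at forget nodes, where the bag vertices that meet `x` can be read
off the word. Completeness (`der_canon`): the words `canon P B w` cut out of a fixed `w` form a
derivation. Soundness (`Der.wit`): each derived word is refined by an actual arrangement of the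
intervals of `P` and `B` with exactly the stated value; the main work is to shuffle two such
arrangements at a join node (`Lift.gap`). So the largest value at the root is twice the number of
edges of a best interval subgraph (`deletionNumber_of_isGreatest`).

For the running time, one table per node holds the best value of each word. At introduce and forget
nodes the work per word is polynomial in `b`, for a total of about `(9/2) ^ b (2b)!` per node. At a
join node the partners of a word of the first child are enumerated; there are three choices per gap,
hence another factor of order `9 ^ b`, for a total of about `(81/2) ^ b (2b)!`. The bases are
bounded by `8 = 2 ^ 3` and `128 = 2 ^ 7`, which leaves room below the exponents `3.38` and `7.76`.
Passing from `b = k + 1` to `k` costs only a factor polynomial in `k`.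

To obtain a program for the machine, the algorithm is written in a small language of total functions
on binary trees, with loops over lists and one global dictionary indexed by trees. Its compiler
stores trees with maximal sharing, so that equal trees have equal addresses; comparisons and
dictionary accesses of whole words then take constant time. Compiled terms need time linear in their
cost and numbers quadratic in it (`sim`), so that it suffices to bound costs in the language. -/

set_option linter.unusedSimpArgs false
set_option linter.unusedSectionVars false

/-! ### A total functional language on trees and its compilation to random access machines -/

namespace TreeLang

open RAM

/-- Binary trees with natural numbers at the leaves. -/
inductive Dat where
  | num (n : ℕ) : Dat
  | cons (a b : Dat) : Dat

noncomputable instance : DecidableEq Dat := Classical.decEq _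

namespace Dat

def fst : Dat → Dat
  | num _ => num 0
  | cons a _ => a

def snd : Dat → Dat
  | num _ => num 0
  | cons _ b => b

def toNat : Dat → ℕ
  | num n => n
  | cons _ _ => 0

def natSteps : ℕ → List (Dat × Dat)
  | 0 => []
  | n + 1 => (num n, num n) :: natSteps n

/-- The iterations of a loop over a tree: the current element and what remains. A tree
`cons x r` is a list with head `x`, and a number `n` counts as the list `n - 1, …, 0`. -/
def steps : Dat → List (Dat × Dat)
  | num n => natSteps n
  | cons x r => (x, r) :: r.steps

end Dat

/-- Terms; variables are de Bruijn levels, and the values of the arguments that have already been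
computed also occupy places in the environment. -/
inductive Tm where
  | var (i : ℕ) : Tm
  | num (c : ℕ) : Tm
  | pair (a b : Tm) : Tm
  | fst (a : Tm) : Tm
  | snd (a : Tm) : Tm
  | add (a b c : Tm) : Tm
  | inp (A : ℕ) (i : Tm) : Tm
  | ifEq (a b t e : Tm) : Tm
  | ifLt (a b t e : Tm) : Tm
  | lett (a b : Tm) : Tm
  | loop (l i b : Tm) : Tm
  | get (k : Tm) : Tm
  | put (k v : Tm) : Tm

abbrev Dict := Dat → Dat

/-- Evaluation: the value, the new dictionary and the cost. `I` holds the input arrays. -/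
noncomputable def eval (I : ℕ → ℕ → ℕ) : Tm → List Dat → Dict → Dat × Dict × ℕ
  | .var i, ρ, δ => (ρ.getD i (.num 0), δ, 1)
  | .num c, _, δ => (.num c, δ, c + 1)
  | .pair a b, ρ, δ =>
    let r := eval I a ρ δ
    let q := eval I b (ρ ++ [r.1]) r.2.1
    (.cons r.1 q.1, q.2.1, r.2.2 + q.2.2 + 1)
  | .fst a, ρ, δ =>
    let r := eval I a ρ δ
    (r.1.fst, r.2.1, r.2.2 + 1)
  | .snd a, ρ, δ =>
    let r := eval I a ρ δ
    (r.1.snd, r.2.1, r.2.2 + 1)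
  | .add a b c, ρ, δ =>
    let r := eval I a ρ δ
    let q := eval I b (ρ ++ [r.1]) r.2.1
    let p := eval I c (ρ ++ [r.1] ++ [q.1]) q.2.1
    (.num (min (r.1.toNat + q.1.toNat) p.1.toNat), p.2.1, r.2.2 + q.2.2 + p.2.2 + 1)
  | .inp A i, ρ, δ =>
    let r := eval I i ρ δ
    (.num (I (A % 4) r.1.toNat + 2), r.2.1, r.2.2 + 1)
  | .ifEq a b t e, ρ, δ =>
    let r := eval I a ρ δ
    let q := eval I b (ρ ++ [r.1]) r.2.1
    let p := if r.1 = q.1 then eval I t ρ q.2.1 else eval I e ρ q.2.1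
    (p.1, p.2.1, r.2.2 + q.2.2 + p.2.2 + 1)
  | .ifLt a b t e, ρ, δ =>
    let r := eval I a ρ δ
    let q := eval I b (ρ ++ [r.1]) r.2.1
    let p := if r.1.toNat < q.1.toNat then eval I t ρ q.2.1 else eval I e ρ q.2.1
    (p.1, p.2.1, r.2.2 + q.2.2 + p.2.2 + 1)
  | .lett a b, ρ, δ =>
    let r := eval I a ρ δ
    let q := eval I b (ρ ++ [r.1]) r.2.1
    (q.1, q.2.1, r.2.2 + q.2.2 + 1)
  | .loop l i b, ρ, δ =>
    let r := eval I l ρ δ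
    let q := eval I i (ρ ++ [r.1]) r.2.1
    r.1.steps.foldl (fun st x =>
      let p := eval I b (ρ ++ [x.2] ++ [st.1] ++ [x.1]) st.2.1
      (p.1, p.2.1, st.2.2 + p.2.2 + 1)) (q.1, q.2.1, r.2.2 + q.2.2 + 1)
  | .get k, ρ, δ =>
    let r := eval I k ρ δ
    (r.2.1 r.1, r.2.1, r.2.2 + 1)
  | .put k v, ρ, δ =>
    let r := eval I k ρ δ
    let q := eval I v (ρ ++ [r.1]) r.2.1
    (.num 0, Function.update q.2.1 r.1 q.1, r.2.2 + q.2.2 + 1)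

/-! #### The compiler

Register `3` holds `0`, register `4` holds `2`, register `5` the next free cell and registers
`6`, `7` are scratch; place `i` of the environment is register `10 + i`. A number `n` is
represented by `2 n`, a pair by an odd address `x` with components `arr 4 x` and `arr 5 x`. Array
`6` is the hash table which makes representations unique, array `7` is the dictionary. -/

def movC (d a : ℕ) : Program := .op .add d a 3

def toNatC (d : ℕ) : Program := .seq (.op .mod 6 d 4) (.ite 3 6 (.const d 0) .skip)

def consC (d : ℕ) : Program :=
  .seq (.op .add 6 d (d + 1)) <| .seq (.op .mul 6 6 6) <| .seq (.op .add 6 6 (d + 1)) <|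
  .seq (.load 7 6 6) <|
  .ite 3 7 (movC d 7) <|
    .seq (.store 4 5 d) <| .seq (.store 5 5 (d + 1)) <| .seq (.store 6 6 5) <|
    .seq (movC d 5) (.op .add 5 5 4)

def compile : Tm → ℕ → Program
  | .var i, m => if i < m then movC (10 + m) (10 + i) else .const (10 + m) 0
  | .num c, m => .const (10 + m) (2 * c)
  | .pair a b, m => .seq (compile a m) <| .seq (compile b (m + 1)) (consC (10 + m))
  | .fst a, m => .seq (compile a m) (.load (10 + m) 4 (10 + m))
  | .snd a, m => .seq (compile a m) (.load (10 + m) 5 (10 + m))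
  | .add a b c, m => .seq (compile a m) <| .seq (compile b (m + 1)) <|
      .seq (compile c (m + 1 + 1)) <|
      .seq (toNatC (10 + m)) <| .seq (toNatC (10 + m + 1)) <| .seq (toNatC (10 + m + 2)) <|
      .seq (.op .add (10 + m) (10 + m) (10 + m + 1)) <|
      .ite (10 + m + 2) (10 + m) (movC (10 + m) (10 + m + 2)) .skip
  | .inp A i, m => .seq (compile i m) <| .seq (toNatC (10 + m)) <|
      .seq (.op .div (10 + m) (10 + m) 4) <| .seq (.load (10 + m) (A % 4) (10 + m)) <|
      .seq (.op .add (10 + m) (10 + m) (10 + m)) <| .seq (.op .add (10 + m) (10 + m) 4) <|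
      .op .add (10 + m) (10 + m) 4
  | .ifEq a b t e, m => .seq (compile a m) <| .seq (compile b (m + 1)) <|
      .seq (.op .sub 6 (10 + m) (10 + m + 1)) <| .seq (.op .sub 7 (10 + m + 1) (10 + m)) <|
      .seq (.op .add 6 6 7) <| .ite 3 6 (compile e m) (compile t m)
  | .ifLt a b t e, m => .seq (compile a m) <| .seq (compile b (m + 1)) <|
      .seq (toNatC (10 + m)) <| .seq (toNatC (10 + m + 1)) <|
      .ite (10 + m) (10 + m + 1) (compile t m) (compile e m)
  | .lett a b, m => .seq (compile a m) <| .seq (compile b (m + 1)) (movC (10 + m) (10 + m + 1))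
  | .loop l i b, m => .seq (compile l m) <| .seq (compile i (m + 1)) <|
      .seq (.loop 3 (10 + m) <|
        .seq (.op .mod 6 (10 + m) 4) <|
        .seq (.ite 3 6 (.seq (.load (10 + m + 2) 4 (10 + m)) (.load (10 + m) 5 (10 + m)))
          (.seq (.op .sub (10 + m) (10 + m) 4) (movC (10 + m + 2) (10 + m)))) <|
        .seq (compile b (m + 1 + 1 + 1)) (movC (10 + m + 1) (10 + m + 3))) <|
      movC (10 + m) (10 + m + 1)
  | .get k, m => .seq (compile k m) (.load (10 + m) 7 (10 + m))
  | .put k v, m => .seq (compile k m) <| .seq (compile v (m + 1)) <|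
      .seq (.store 7 (10 + m) (10 + m + 1)) (.const (10 + m) 0)

/-! #### Representation of trees -/

def hashIdx (a b : ℕ) : ℕ := (a + b) * (a + b) + b

/-- As `b ≤ a + b`, the index lies between the squares of `a + b` and `a + b + 1`, so it determines
first `a + b` and then `b`. The hash table hence has no collisions. -/
theorem hashIdx_inj {a b c d : ℕ} (h : hashIdx a b = hashIdx c d) : a = c ∧ b = d := by
  unfold hashIdx at h
  have h1 : a + b = c + d := by
    by_contra hne
    rcases Nat.lt_or_gt_of_ne hne with hlt | hlt
    · have : (a + b + 1) * (a + b + 1) ≤ (c + d) * (c + d) := Nat.mul_le_mul hlt hlt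
      nlinarith
    · have : (c + d + 1) * (c + d + 1) ≤ (a + b) * (a + b) := Nat.mul_le_mul hlt hlt
      nlinarith
  rw [h1] at h
  omega

/-- The number `x` represents a tree. -/
def Rep (s : State) : Dat → ℕ → Prop
  | .num n, x => x = 2 * n
  | .cons a b, x => x % 2 = 1 ∧ x < s.reg 5 ∧ Rep s a (s.arr 4 x) ∧ Rep s b (s.arr 5 x)

/-- Cells allocated in `s` are still there in `s'`. -/
def Ext (s s' : State) : Prop :=
  s.reg 5 ≤ s'.reg 5 ∧ ∀ x, x < s.reg 5 → s'.arr 4 x = s.arr 4 x ∧ s'.arr 5 x = s.arr 5 x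

theorem Ext.trans {s s' s'' : State} (h : Ext s s') (h' : Ext s' s'') : Ext s s'' :=
  ⟨h.1.trans h'.1, fun x hx =>
    ⟨(h'.2 x (hx.trans_le h.1)).1.trans (h.2 x hx).1,
      (h'.2 x (hx.trans_le h.1)).2.trans (h.2 x hx).2⟩⟩

theorem Rep.ext {s s' : State} (h : Ext s s') {d : Dat} : ∀ {x : ℕ}, Rep s d x → Rep s' d x := by
  induction d with
  | num n => exact fun h => h
  | cons a b iha ihb =>
    intro x hx
    obtain ⟨h1, h2, h3, h4⟩ := hx
    refine ⟨h1, h2.trans_le h.1, ?_, ?_⟩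
    · rw [(h.2 x h2).1]; exact iha h3
    · rw [(h.2 x h2).2]; exact ihb h4

theorem Rep.functional {s : State} {d : Dat} : ∀ {d' : Dat} {x : ℕ}, Rep s d x → Rep s d' x →
    d = d' := by
  induction d with
  | num n =>
    intro d' x h h'
    cases d' with
    | num m => simp only [Rep] at h h'; congr 1; omega
    | cons a b => simp only [Rep] at h h'; omega
  | cons a b iha ihb =>
    intro d' x h h'
    cases d' with
    | num m => simp only [Rep] at h h'; omega
    | cons a' b' => rw [iha h.2.2.1 h'.2.2.1, ihb h.2.2.2 h'.2.2.2]

/-- The invariant of compiled programs. -/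
structure Inv (I : ℕ → ℕ → ℕ) (δ : Dict) (s : State) : Prop where
  zero : s.reg 3 = 0
  two : s.reg 4 = 2
  odd : s.reg 5 % 2 = 1
  hash : ∀ x, x < s.reg 5 → x % 2 = 1 → s.arr 6 (hashIdx (s.arr 4 x) (s.arr 5 x)) = x
  hash' : ∀ z, s.arr 6 z ≠ 0 → s.arr 6 z % 2 = 1 ∧ s.arr 6 z < s.reg 5 ∧
    z = hashIdx (s.arr 4 (s.arr 6 z)) (s.arr 5 (s.arr 6 z))
  even : ∀ x, x % 2 = 0 → s.arr 4 x = 0 ∧ s.arr 5 x = 0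
  rep : ∀ x, x < s.reg 5 → x % 2 = 1 → ∃ d, Rep s d x
  dict : ∀ d x, Rep s d x → Rep s (δ d) (s.arr 7 x)
  dict_default : ∀ d, (¬ ∃ x, Rep s d x) → δ d = .num 0
  fresh : ∀ x, s.reg 5 ≤ x → x % 2 = 1 → s.arr 7 x = 0
  inp : ∀ A, A < 4 → s.arr A = I A

/-- The hash table gives back the address of a pair from the numbers of its components, so by
induction a tree has only one address. Together with `Rep.functional` this reduces equality of trees
to equality of numbers and makes addresses usable as dictionary keys. -/
theorem Rep.unique {I : ℕ → ℕ → ℕ} {δ : Dict} {s : State} (hI : Inv I δ s) {d : Dat} :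
    ∀ {x y : ℕ}, Rep s d x → Rep s d y → x = y := by
  induction d with
  | num n => intro x y h h'; exact h.trans h'.symm
  | cons a b iha ihb =>
    intro x y h h'
    rw [← hI.hash x h.2.1 h.1, ← hI.hash y h'.2.1 h'.1, iha h.2.2.1 h'.2.2.1,
      ihb h.2.2.2 h'.2.2.2]

/-- All numbers in the environment, in the arrays and the allocation pointer are at most `κ`. -/
structure Bounded (κ : ℕ) (s : State) : Prop where
  free : s.reg 5 ≤ κ
  env : ∀ i, 10 ≤ i → s.reg i ≤ κ
  arr : ∀ A x, s.arr A x ≤ κ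

theorem Bounded.mono {κ κ' : ℕ} {s : State} (h : Bounded κ s) (hκ : κ ≤ κ') : Bounded κ' s :=
  ⟨h.free.trans hκ, fun i hi => (h.env i hi).trans hκ, fun A x => (h.arr A x).trans hκ⟩

/-- `P` halts within time `T` in a state that satisfies `Q`. -/
def Runs (B : ℕ) (P : Program) (s : State) (T : ℕ) (Q : State → Prop) : Prop :=
  ∃ τ s', Exec B P s τ s' ∧ τ ≤ T ∧ Q s'

theorem Runs.mono {B : ℕ} {P : Program} {s : State} {T T' : ℕ} {Q Q' : State → Prop}
    (h : Runs B P s T Q) (hT : T ≤ T') (hQ : ∀ s', Q s' → Q' s') : Runs B P s T' Q' := by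
  obtain ⟨τ, s', h1, h2, h3⟩ := h
  exact ⟨τ, s', h1, h2.trans hT, hQ _ h3⟩

theorem Runs.seq {B : ℕ} {P P' : Program} {s : State} {T T' : ℕ} {Q Q' : State → Prop}
    (h : Runs B P s T Q) (h' : ∀ s', Q s' → Runs B P' s' T' Q') :
    Runs B (.seq P P') s (T + T') Q' := by
  obtain ⟨τ, s', h1, h2, h3⟩ := h
  obtain ⟨τ', s'', h1', h2', h3'⟩ := h' s' h3
  exact ⟨τ + τ', s'', .seq h1 h1', by omega, h3'⟩

theorem Runs.step {B : ℕ} {P P' : Program} {s s' : State} {T : ℕ} {Q : State → Prop}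
    (h : Exec B P s 1 s') (h' : Runs B P' s' T Q) : Runs B (.seq P P') s (T + 1) Q := by
  obtain ⟨τ, s'', h1, h2, h3⟩ := h'
  exact ⟨1 + τ, s'', .seq h h1, by omega, h3⟩

theorem Runs.last {B : ℕ} {P : Program} {s s' : State} {Q : State → Prop}
    (h : Exec B P s 1 s') (h' : Q s') : Runs B P s 1 Q := ⟨1, s', h, le_rfl, h'⟩

theorem Runs.ite {B a b : ℕ} {P P' : Program} {s : State} {T : ℕ} {Q : State → Prop}
    (h : s.reg a < s.reg b → Runs B P s T Q) (h' : ¬ s.reg a < s.reg b → Runs B P' s T Q) :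
    Runs B (.ite a b P P') s (T + 1) Q := by
  by_cases hab : s.reg a < s.reg b
  · obtain ⟨τ, s', h1, h2, h3⟩ := h hab
    exact ⟨τ + 1, s', .ite_true hab h1, by omega, h3⟩
  · obtain ⟨τ, s', h1, h2, h3⟩ := h' hab
    exact ⟨τ + 1, s', .ite_false hab h1, by omega, h3⟩

@[simp] theorem setReg_reg (s : State) (d x i : ℕ) :
    (s.setReg d x).reg i = if i = d then x else s.reg i := by
  simp [State.setReg, Function.update_apply]

@[simp] theorem setReg_arr (s : State) (d x : ℕ) : (s.setReg d x).arr = s.arr := rfl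

@[simp] theorem setArr_reg (s : State) (A i x : ℕ) : (s.setArr A i x).reg = s.reg := rfl

theorem setArr_arr (s : State) (A i x A' i' : ℕ) :
    (s.setArr A i x).arr A' i' = if A' = A ∧ i' = i then x else s.arr A' i' := by
  simp only [State.setArr, Function.update_apply]
  split_ifs <;> simp_all

/-- `s'` differs from `s` only in scratch registers and in the environment from place `m` on. -/
def Same (m : ℕ) (s s' : State) : Prop :=
  s'.arr = s.arr ∧ ∀ i, i ≠ 6 → i ≠ 7 → i < 10 + m → s'.reg i = s.reg i

theorem Same.rep {m : ℕ} {s s' : State} (h : Same m s s') {d : Dat} :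
    ∀ {x : ℕ}, Rep s' d x ↔ Rep s d x := by
  have h5 : s'.reg 5 = s.reg 5 := h.2 5 (by omega) (by omega) (by omega)
  induction d with
  | num n => intro x; rfl
  | cons a b iha ihb => intro x; simp only [Rep, h5, h.1, iha, ihb]

theorem Same.inv {m : ℕ} {s s' : State} (h : Same m s s') {I : ℕ → ℕ → ℕ} {δ : Dict}
    (hI : Inv I δ s) : Inv I δ s' := by
  have h5 : s'.reg 5 = s.reg 5 := h.2 5 (by omega) (by omega) (by omega)
  have h4 : s'.reg 4 = s.reg 4 := h.2 4 (by omega) (by omega) (by omega)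
  have h3 : s'.reg 3 = s.reg 3 := h.2 3 (by omega) (by omega) (by omega)
  obtain ⟨a1, a2, a3, a4, a5, a6, a7, a8, a9, a10, a11⟩ := hI
  constructor <;> simp only [h.rep, h5, h4, h3, h.1] <;> assumption

theorem Same.ext {m : ℕ} {s s' : State} (h : Same m s s') : Ext s s' := by
  have h5 : s'.reg 5 = s.reg 5 := h.2 5 (by omega) (by omega) (by omega)
  exact ⟨h5.ge, fun x _ => by simp [h.1]⟩

theorem Same.trans {m : ℕ} {s s' s'' : State} (h : Same m s s') (h' : Same m s' s'') :
    Same m s s'' :=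
  ⟨h'.1.trans h.1, fun i h6 h7 hi => (h'.2 i h6 h7 hi).trans (h.2 i h6 h7 hi)⟩

theorem same_setReg (s : State) {m d x : ℕ} (h : d = 6 ∨ d = 7 ∨ 10 + m ≤ d) :
    Same m s (s.setReg d x) :=
  ⟨rfl, fun i h6 h7 hi => by simp only [setReg_reg]; rw [if_neg]; omega⟩

theorem Bounded.setReg {κ : ℕ} {s : State} (h : Bounded κ s) {d x : ℕ} (hd : d = 6 ∨ d = 7 ∨ x ≤ κ) :
    Bounded κ (s.setReg d x) := by
  refine ⟨?_, fun i hi => ?_, h.arr⟩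
  · simp only [setReg_reg]; split_ifs with h'
    · omega
    · exact h.free
  · simp only [setReg_reg]; split_ifs with h'
    · omega
    · exact h.env i hi

end TreeLang

/-! ### Elementary code fragments and the allocation of shared pairs -/

namespace TreeLang

open RAM

theorem exec_mov {B : ℕ} {s : State} {d a : ℕ} (h3 : s.reg 3 = 0) (h : s.reg a ≤ B) :
    Exec B (movC d a) s 1 (s.setReg d (s.reg a)) := by
  have := Exec.op (B := B) s .add d a 3 (by simpa [Op.eval, h3] using h)
  simpa [Op.eval, h3, movC] using this

theorem runs_toNatC {B : ℕ} {s : State} {d : ℕ} {I : ℕ → ℕ → ℕ} {δ : Dict} {v : Dat}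
    (hI : Inv I δ s) (hd : 10 ≤ d) (hv : Rep s v (s.reg d)) (hB : 2 ≤ B) :
    Runs B (toNatC d) s 4 (fun s' => s'.arr = s.arr ∧ s'.reg d = 2 * v.toNat ∧
      ∀ i, i ≠ 6 → i ≠ d → s'.reg i = s.reg i) := by
  have h4 := hI.two
  have h3 := hI.zero
  refine Runs.mono (Runs.step (T := 2)
    (Exec.op s .mod 6 d 4 (by simp only [Op.eval, h4]; omega)) (Runs.ite ?_ ?_)) (by omega)
    (fun _ h => h)
  · intro h
    refine Runs.last (Exec.const _ d 0 (by omega)) ⟨rfl, ?_, fun i h6 hid => by simp [h6, hid]⟩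
    cases v with
    | num n =>
      exfalso
      simp only [Rep] at hv
      simp [Op.eval, h4, h3] at h
      omega
    | cons a b => simp [Dat.toNat]
  · intro h
    refine Runs.last (Exec.skip _) ⟨rfl, ?_, fun i h6 hid => by simp [h6]⟩
    cases v with
    | num n => simp only [Rep] at hv; simp [Dat.toNat, hv, show d ≠ 6 by omega]
    | cons a b =>
      exfalso
      simp only [Rep] at hv
      simp [Op.eval, h4, h3] at h
      omega

/-- The effect of running a compiled term at level `m`. -/
structure Post (I : ℕ → ℕ → ℕ) (m κ : ℕ) (δ : Dict) (v : Dat) (s s' : State) : Prop where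
  inv : Inv I δ s'
  bd : Bounded κ s'
  ext : Ext s s'
  same : ∀ i, (i < 3 ∨ 10 ≤ i) → i < 10 + m → s'.reg i = s.reg i
  val : Rep s' v (s'.reg (10 + m))

/-- A nonzero table entry at the index of the two components is an existing cell with these
components and is reused. Otherwise a cell is allocated at the free address, which stays odd since
it advances by two. The only numbers that may exceed the bound `κ` afterwards come from the
allocation pointer; the index itself, quadratic in `κ`, is kept only in scratch registers. -/
theorem runs_consC {B K κ m : ℕ} {s : State} {I : ℕ → ℕ → ℕ} {δ : Dict} {a b : Dat}
    (hI : Inv I δ s) (hb : Bounded κ s) (ha : Rep s a (s.reg (10 + m)))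
    (hb' : Rep s b (s.reg (10 + m + 1))) (hκ : κ + 4 ≤ K) (hB : (2 * K) * (2 * K) + 2 * K ≤ B) :
    Runs B (consC (10 + m)) s 10 (Post I m (κ + 4) δ (.cons a b) s) := by
  obtain ⟨z, hz⟩ : ∃ z, z = hashIdx (s.reg (10 + m)) (s.reg (10 + m + 1)) := ⟨_, rfl⟩
  have e1 := hb.env (10 + m) (by omega)
  have e2 := hb.env (10 + m + 1) (by omega)
  have hsum : (s.reg (10 + m) + s.reg (10 + m + 1)) * (s.reg (10 + m) + s.reg (10 + m + 1)) ≤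
      (2 * K) * (2 * K) := Nat.mul_le_mul (by omega) (by omega)
  have h3 := hI.zero
  have h4 := hI.two
  have hfp := hb.free
  have n5 : ¬ 10 + m = 5 := by omega
  have n4 : ¬ 4 = 10 + m := by omega
  refine Runs.mono (Runs.step (T := 9) (Exec.op s .add 6 (10 + m) (10 + m + 1) ?_) <|
    Runs.step (T := 8) (Exec.op _ .mul 6 6 6 ?_) <|
    Runs.step (T := 7) (Exec.op _ .add 6 6 (10 + m + 1) ?_) <|
    Runs.step (T := 6) (Exec.load _ 7 6 6 ?_) <| Runs.ite (T := 5) ?_ ?_) (by omega) (fun _ h => h)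
  · simp only [Op.eval]; omega
  · simp only [Op.eval, setReg_reg]; simp; omega
  · simp only [Op.eval, setReg_reg]; simp [n5]; omega
  · have := hb.arr 6; simp only [setReg_arr]; exact (this _).trans (by omega)
  · intro h
    have hq : s.arr 6 z ≠ 0 := by
      simpa [Op.eval, h3, hz, hashIdx, Nat.pos_iff_ne_zero, n5] using h
    obtain ⟨q1, q2, q3⟩ := hI.hash' z hq
    -- Injectivity of the index shows that the cell found has the wanted components.
    have hh := hashIdx_inj (hz.symm.trans q3)
    refine Runs.mono (Runs.last (exec_mov (by simp [h3]) ?_) ?_) (by omega) (fun _ h => h)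
    · have := hb.arr 6; simp; exact (this _).trans (by omega)
    · have hs : ∀ x y w z t, Same m s (((((s.setReg 6 x).setReg 6 y).setReg 6 z).setReg 7 w).setReg
        (10 + m) t) := fun x y w z t =>
          ((((same_setReg s (by omega)).trans (same_setReg _ (by omega))).trans
            (same_setReg _ (by omega))).trans (same_setReg _ (by omega))).trans
              (same_setReg _ (by omega))
      refine ⟨(hs _ _ _ _ _).inv hI, ?_, (hs _ _ _ _ _).ext, fun i hi hi' => ?_, ?_⟩
      · refine ((((hb.setReg (by omega)).setReg (by omega)).setReg (by omega)).setReg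
          (by omega)).setReg (Or.inr (Or.inr ?_)) |>.mono (by omega)
        simp only [setReg_reg, setReg_arr]
        simpa using hb.arr 6 _
      · exact (hs _ _ _ _ _).2 i (by omega) (by omega) hi'
      · rw [(hs _ _ _ _ _).rep]
        have : ∀ t : State, (t.setReg (10 + m) (t.reg 7)).reg (10 + m) = t.reg 7 := by simp
        rw [this]
        simp only [setReg_reg, setReg_arr]
        simp only [Op.eval]
        simp [n5]
        rw [← hashIdx, ← hz]
        exact ⟨q1, q2, hh.1 ▸ ha, hh.2 ▸ hb'⟩
  · intro h
    have hq : s.arr 6 z = 0 := by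
      simpa [Op.eval, h3, hz, hashIdx, Nat.pos_iff_ne_zero, n5] using h
    set s4 := (((s.setReg 6 _).setReg 6 _).setReg 6 _).setReg 7 _ with hs4
    have hS : Same m s s4 := (((same_setReg s (by omega)).trans (same_setReg _ (by omega))).trans
      (same_setReg _ (by omega))).trans (same_setReg _ (by omega))
    have hbd4 : Bounded κ s4 := (((hb.setReg (by omega)).setReg (by omega)).setReg
      (by omega)).setReg (by omega)
    have r6 : s4.reg 6 = z := by simp [hs4, Op.eval, hz, hashIdx, n5]
    have rE : ∀ i, i ≠ 6 → i ≠ 7 → s4.reg i = s.reg i := fun i h6 h7 => by simp [hs4, h6, h7]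
    have hI4 := hS.inv hI
    have ha4 := hS.rep.2 ha
    have hb4 := hS.rep.2 hb'
    rw [← rE (10 + m) (by omega) (by omega)] at ha4
    rw [← rE (10 + m + 1) (by omega) (by omega)] at hb4
    have hz4 : z = hashIdx (s4.reg (10 + m)) (s4.reg (10 + m + 1)) := by
      rw [rE _ (by omega) (by omega), rE _ (by omega) (by omega)]; exact hz
    have hq4 : s4.arr 6 z = 0 := by rw [hS.1]; exact hq
    have hext4 := hS.ext
    have hsame4 : ∀ i, (i < 3 ∨ 10 ≤ i) → i < 10 + m → s4.reg i = s.reg i :=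
      fun i hi hi' => hS.2 i (by omega) (by omega) hi'
    clear_value s4
    clear hS hs4 h hq hz ha hb' rE
    have fb := hbd4.free
    have f1 := hbd4.env (10 + m) (by omega)
    have f2 := hbd4.env (10 + m + 1) (by omega)
    have z4 := hI4.zero
    have t4 := hI4.two
    refine Runs.mono (Runs.step (T := 4) (Exec.store _ 4 5 _ (by omega)) <|
      Runs.step (T := 3) (Exec.store _ 5 5 _ (by simp; omega)) <|
      Runs.step (T := 2) (Exec.store _ 6 6 5 (by simp; omega)) <|
      Runs.step (T := 1) (exec_mov (by simp [z4]) (by simp; omega)) <|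
      Runs.last (Exec.op _ .add 5 5 4 (by simp [Op.eval, t4, n4]; omega)) ?_) (by omega)
      (fun _ h => h)
    simp only [setArr_reg, Op.eval, setReg_reg, r6]
    simp only [show (5 : ℕ) ≠ 10 + m by omega, show (4 : ℕ) ≠ 10 + m by omega, if_false, t4]
    set p := s4.reg 5 with hp
    obtain ⟨s', hs'⟩ : ∃ s', s' = ((((s4.setArr 4 p (s4.reg (10 + m))).setArr 5 p
      (s4.reg (10 + m + 1))).setArr 6 z p).setReg (10 + m) p).setReg 5 (p + 2) := ⟨_, rfl⟩
    rw [← hs']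
    have g5 : s'.reg 5 = p + 2 := by simp [hs']
    have gm : s'.reg (10 + m) = p := by simp [hs', n5]
    have gE : ∀ i, i ≠ 5 → i ≠ 10 + m → s'.reg i = s4.reg i := fun i h1 h2 => by
      simp [hs', h1, h2]
    have gA : ∀ A x, s'.arr A x = if A = 6 ∧ x = z then p else if A = 5 ∧ x = p then
        s4.reg (10 + m + 1) else if A = 4 ∧ x = p then s4.reg (10 + m) else s4.arr A x := by
      intro A x
      simp only [hs', setReg_arr, setArr_arr]
    clear hs'
    have g4 : ∀ x, s'.arr 4 x = if x = p then s4.reg (10 + m) else s4.arr 4 x := fun x => by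
      simp [gA]
    have g5' : ∀ x, s'.arr 5 x = if x = p then s4.reg (10 + m + 1) else s4.arr 5 x := fun x => by
      simp [gA]
    have g6 : ∀ x, s'.arr 6 x = if x = z then p else s4.arr 6 x := fun x => by simp [gA]
    have g7 : ∀ A x, A ≠ 4 → A ≠ 5 → A ≠ 6 → s'.arr A x = s4.arr A x := fun A x h1 h2 h3 => by
      simp [gA, h1, h2, h3]
    have podd := hI4.odd
    rw [← hp] at podd
    have hext : Ext s4 s' := ⟨by rw [g5, ← hp]; omega, fun x hx => by
      rw [g4, g5', if_neg (by omega), if_neg (by omega)]; exact ⟨rfl, rfl⟩⟩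
    have hnew : Rep s' (.cons a b) p := by
      refine ⟨podd, by omega, ?_, ?_⟩
      · rw [g4, if_pos rfl]; exact ha4.ext hext
      · rw [g5', if_pos rfl]; exact hb4.ext hext
    -- An old odd address already represented some tree, and a number represents at most one tree,
    -- so apart from `p` nothing represents anything new.
    have hold : ∀ d x, x ≠ p → Rep s' d x → Rep s4 d x := by
      intro d x hx hr
      cases d with
      | num n => exact hr
      | cons d1 d2 =>
        obtain ⟨o1, o2, -, -⟩ := id hr
        obtain ⟨d', hd'⟩ := hI4.rep x (by omega) o1
        rwa [hr.functional (hd'.ext hext)]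
    -- If the pair had an address, the table entry at `z` would be that odd number and not zero. So
    -- the pair was never a key, its dictionary value is the default `num 0`, and the untouched zero
    -- of array `7` at `p` represents it.
    have hnot : ¬ ∃ x, Rep s4 (.cons a b) x := by
      rintro ⟨x, hx⟩
      have := hI4.hash x hx.2.1 hx.1
      rw [hx.2.2.1.unique hI4 ha4, hx.2.2.2.unique hI4 hb4, ← hz4, hq4] at this
      have := hx.1
      omega
    refine ⟨⟨?_, ?_, ?_, ?_, ?_, ?_, ?_, ?_, ?_, ?_, ?_⟩, ⟨?_, ?_, ?_⟩, hext4.trans hext, ?_, ?_⟩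
    · rw [gE _ (by omega) (by omega), z4]
    · rw [gE _ (by omega) (by omega), t4]
    · omega
    · intro x hx hx1
      by_cases hxp : x = p
      · rw [g4, g5', if_pos hxp, if_pos hxp, ← hz4, g6, if_pos rfl, hxp]
      · rw [g4, g5', if_neg hxp, if_neg hxp, g6]
        have := hI4.hash x (by omega) hx1
        split_ifs with hxz
        · rw [hxz, hq4] at this; omega
        · exact this
    · intro y hy
      rw [g6] at hy ⊢
      split_ifs at hy ⊢ with hyz
      · refine ⟨podd, by omega, ?_⟩
        rw [g4, g5', if_pos rfl, if_pos rfl, hyz, hz4]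
      · obtain ⟨y1, y2, y3⟩ := hI4.hash' y hy
        refine ⟨y1, by omega, ?_⟩
        rw [g4, g5', if_neg (by omega), if_neg (by omega)]
        exact y3
    · intro x hx
      rw [g4, g5', if_neg (by omega), if_neg (by omega)]
      exact hI4.even x hx
    · intro x hx hx1
      by_cases hxp : x = p
      · exact ⟨_, hxp ▸ hnew⟩
      · obtain ⟨d, hd⟩ := hI4.rep x (by omega) hx1
        exact ⟨d, hd.ext hext⟩
    · intro d x hd
      rw [g7 7 x (by omega) (by omega) (by omega)]
      by_cases hxp : x = p
      · subst hxp
        rw [hd.functional hnew, hI4.dict_default _ hnot, hI4.fresh p le_rfl podd]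
        rfl
      · exact (hI4.dict d x (hold d x hxp hd)).ext hext
    · intro d hd
      exact hI4.dict_default d fun ⟨x, hx⟩ => hd ⟨x, hx.ext hext⟩
    · intro x hx hx1
      rw [g7 7 x (by omega) (by omega) (by omega)]
      exact hI4.fresh x (by omega) hx1
    · intro A hA
      rw [← hI4.inp A hA]
      funext x
      exact g7 A x (by omega) (by omega) (by omega)
    · omega
    · intro i hi
      by_cases him : i = 10 + m
      · subst him; omega
      · rw [gE i (by omega) him]; exact (hbd4.env i hi).trans (by omega)
    · intro A x
      have := hbd4.arr A x
      rw [gA]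
      split_ifs <;> omega
    · intro i hi hi'
      rw [gE i (by omega) (by omega)]
      exact hsame4 i hi hi'
    · rw [gm]; exact hnew

end TreeLang

/-! ### Simulation of the term constructors -/

namespace TreeLang

open RAM

/-- The registers from `10` on represent the environment. -/
def EnvOk (ρ : List Dat) (s : State) : Prop :=
  ∀ i (h : i < ρ.length), Rep s ρ[i] (s.reg (10 + i))

/-- A value in place `m` survives computations at higher places: its register is untouched, and
cells are never overwritten. -/
theorem Post.comp {I : ℕ → ℕ → ℕ} {m κ κ' : ℕ} {δ δ' : Dict} {v v' : Dat} {s s' s'' : State}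
    (h : Post I m κ δ v s s') {k : ℕ} (h' : Post I (m + k) κ' δ' v' s' s'') (hk : 0 < k) :
    Post I m κ' δ' v s s'' :=
  ⟨h'.inv, h'.bd, h.ext.trans h'.ext, fun i hi hi' =>
    (h'.same i hi (by omega)).trans (h.same i hi hi'),
    (h'.same (10 + m) (by omega) (by omega)) ▸ h.val.ext h'.ext⟩

theorem Post.trans {I : ℕ → ℕ → ℕ} {m κ κ' : ℕ} {δ δ' : Dict} {v v' : Dat} {s s' s'' : State}
    (h : Post I m κ δ v s s') (h' : Post I m κ' δ' v' s' s'') : Post I m κ' δ' v' s s'' :=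
  ⟨h'.inv, h'.bd, h.ext.trans h'.ext, fun i hi hi' =>
    (h'.same i hi (by omega)).trans (h.same i hi hi'), h'.val⟩

theorem EnvOk.post {I : ℕ → ℕ → ℕ} {κ : ℕ} {δ : Dict} {v : Dat} {s s' : State} {ρ : List Dat}
    (h : EnvOk ρ s) (hp : Post I ρ.length κ δ v s s') : EnvOk ρ s' := fun i hi => by
  rw [hp.same (10 + i) (by omega) (by omega)]
  exact (h i hi).ext hp.ext

theorem EnvOk.snoc {s : State} {ρ : List Dat} {v : Dat} (h : EnvOk ρ s)
    (hv : Rep s v (s.reg (10 + ρ.length))) : EnvOk (ρ ++ [v]) s := fun i hi => by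
  rw [List.length_append, List.length_singleton] at hi
  by_cases hi' : i < ρ.length
  · rw [List.getElem_append_left hi']; exact h i hi'
  · obtain rfl : i = ρ.length := by omega
    simpa using hv

/-- Changing scratch registers and the environment from place `m` on. -/
theorem Post.of_same {I : ℕ → ℕ → ℕ} {m κ κ' : ℕ} {δ : Dict} {v : Dat} {s s' : State}
    (hI : Inv I δ s) (hb : Bounded κ s) (h : Same m s s')
    (hκ : κ ≤ κ') (hr : ∀ i, 10 + m ≤ i → s'.reg i ≤ κ') (hv : Rep s' v (s'.reg (10 + m))) :
    Post I m κ' δ v s s' := by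
  refine ⟨h.inv hI, ⟨?_, fun i hi => ?_, fun A x => ?_⟩, h.ext, fun i hi hi' =>
    h.2 i (by omega) (by omega) hi', hv⟩
  · rw [h.2 5 (by omega) (by omega) (by omega)]; exact hb.free.trans hκ
  · by_cases him : i < 10 + m
    · rw [h.2 i (by omega) (by omega) him]; exact (hb.env i hi).trans hκ
    · exact hr i (by omega)
  · rw [h.1]; exact (hb.arr A x).trans hκ

theorem Post.step {I : ℕ → ℕ → ℕ} {m κ κ' : ℕ} {δ : Dict} {v v' : Dat} {s s' s'' : State}
    (hp : Post I m κ δ v s s') (h : Same m s' s'') (hκ : κ ≤ κ')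
    (hr : ∀ i, 10 + m ≤ i → s''.reg i ≤ κ' ) (hv : Rep s' v' (s''.reg (10 + m))) :
    Post I m κ' δ v' s s'' :=
  hp.trans (Post.of_same hp.inv hp.bd h hκ hr (h.rep.2 hv))

theorem Rep.toNat_le {s : State} {d : Dat} {x : ℕ} (h : Rep s d x) : 2 * d.toNat ≤ x := by
  cases d with
  | num n => exact h.ge
  | cons a b => exact Nat.zero_le _

/-- The compiled code of `t` simulates the evaluation of `t`. -/
def Sim (I : ℕ → ℕ → ℕ) (B K : ℕ) (t : Tm) : Prop :=
  ∀ ρ δ s κ, Inv I δ s → Bounded κ s → EnvOk ρ s → (∀ A i, A < 4 → 2 * I A i + 4 ≤ κ) →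
    κ + 4 * (eval I t ρ δ).2.2 ≤ K →
    Runs B (compile t ρ.length) s (40 * (eval I t ρ δ).2.2)
      (Post I ρ.length (κ + 4 * (eval I t ρ δ).2.2) (eval I t ρ δ).2.1 (eval I t ρ δ).1 s)

theorem Sim.after {I : ℕ → ℕ → ℕ} {B K : ℕ} {t : Tm} (h : Sim I B K t) {ρ : List Dat} {δ : Dict}
    {s s₀ : State} {κ κ₀ : ℕ} {v : Dat} (hp : Post I ρ.length κ δ v s₀ s) (hρ : EnvOk ρ s₀)
    (hin : ∀ A i, A < 4 → 2 * I A i + 4 ≤ κ₀) (hκ : κ₀ ≤ κ)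
    (hK : κ + 4 * (eval I t (ρ ++ [v]) δ).2.2 ≤ K) :
    Runs B (compile t (ρ.length + 1)) s (40 * (eval I t (ρ ++ [v]) δ).2.2)
      (Post I (ρ.length + 1) (κ + 4 * (eval I t (ρ ++ [v]) δ).2.2) (eval I t (ρ ++ [v]) δ).2.1
        (eval I t (ρ ++ [v]) δ).1 s) := by
  have := h (ρ ++ [v]) δ s κ hp.inv hp.bd ((hρ.post hp).snoc hp.val)
    (fun A i hA => (hin A i hA).trans hκ) hK
  simpa using this

theorem Sim.after_after {I : ℕ → ℕ → ℕ} {B K : ℕ} {t : Tm} (h : Sim I B K t) {ρ : List Dat}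
    {δ δ' : Dict} {s s' s₀ : State} {κ κ' κ₀ : ℕ} {v v' : Dat} (hp : Post I ρ.length κ δ v s₀ s)
    (hp' : Post I (ρ.length + 1) κ' δ' v' s s') (hρ : EnvOk ρ s₀)
    (hin : ∀ A i, A < 4 → 2 * I A i + 4 ≤ κ₀) (hκ : κ₀ ≤ κ')
    (hK : κ' + 4 * (eval I t (ρ ++ [v] ++ [v']) δ').2.2 ≤ K) :
    Runs B (compile t (ρ.length + 1 + 1)) s' (40 * (eval I t (ρ ++ [v] ++ [v']) δ').2.2)
      (Post I (ρ.length + 1 + 1) (κ' + 4 * (eval I t (ρ ++ [v] ++ [v']) δ').2.2)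
        (eval I t (ρ ++ [v] ++ [v']) δ').2.1 (eval I t (ρ ++ [v] ++ [v']) δ').1 s') := by
  have := h.after (ρ := ρ ++ [v]) (s := s') (by simpa using hp') ((hρ.post hp).snoc hp.val) hin hκ hK
  simpa using this

theorem sim_pair {I : ℕ → ℕ → ℕ} {B K : ℕ} (hB : (2 * K) * (2 * K) + 2 * K ≤ B) {a b : Tm}
    (ha : Sim I B K a) (hb : Sim I B K b) : Sim I B K (.pair a b) := by
  intro ρ δ s κ hI hbd hρ hin hK
  simp only [eval] at hK ⊢
  refine Runs.mono (Runs.seq (ha ρ δ s κ hI hbd hρ hin (by omega)) fun s1 h1 =>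
    Runs.seq (hb.after h1 hρ hin (by omega) (by omega)) fun s2 h2 =>
    (runs_consC (B := B) (K := K) h2.inv h2.bd (h1.comp h2 one_pos).val h2.val (by omega) hB).mono
      le_rfl fun s3 h3 => (h1.comp h2 one_pos).trans h3) (by omega) fun s3 h3 => ?_
  rwa [show ∀ a b c : ℕ, c + 4 * (a + b + 1) = c + 4 * a + 4 * b + 4 by intros; omega]

theorem sim_load {I : ℕ → ℕ → ℕ} {B κ K m : ℕ} {s s1 : State} {δ : Dict} {v v' : Dat}
    (hB : (2 * K) * (2 * K) + 2 * K ≤ B) (h1 : Post I m κ δ v s s1) (hκ : κ ≤ K) (A : ℕ)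
    (hv : Rep s1 v' (s1.arr A (s1.reg (10 + m)))) :
    Runs B (.load (10 + m) A (10 + m)) s1 1 (Post I m κ δ v' s) := by
  refine Runs.last (Exec.load s1 _ _ _ ((h1.bd.arr _ _).trans (by omega))) ?_
  refine h1.step (same_setReg _ (by omega)) le_rfl ?_ (by simpa using hv)
  intro i hi
  have := h1.bd.env i (by omega)
  have := h1.bd.arr A (s1.reg (10 + m))
  simp only [setReg_reg]; split_ifs <;> omega

theorem sim_mov {I : ℕ → ℕ → ℕ} {B κ K m j : ℕ} {s s1 : State} {δ : Dict} {v v' : Dat}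
    (hB : (2 * K) * (2 * K) + 2 * K ≤ B) (h1 : Post I m κ δ v s s1) (hκ : κ ≤ K) (hj : 10 ≤ j)
    (hv : Rep s1 v' (s1.reg j)) :
    Runs B (movC (10 + m) j) s1 1 (Post I m κ δ v' s) := by
  refine Runs.last (exec_mov h1.inv.zero ((h1.bd.env _ hj).trans (by omega))) ?_
  refine h1.step (same_setReg _ (by omega)) le_rfl ?_ (by simpa using hv)
  intro i hi
  have := h1.bd.env i (by omega)
  have := h1.bd.env j hj
  simp only [setReg_reg]; split_ifs <;> omega

/-- Numbers are represented by even addresses, where the component arrays are always zero. This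
matches the convention that the components of a number are `num 0`, so no test is needed. -/
theorem sim_fst {I : ℕ → ℕ → ℕ} {B K : ℕ} (hB : (2 * K) * (2 * K) + 2 * K ≤ B) {a : Tm}
    (ha : Sim I B K a) : Sim I B K (.fst a) := by
  intro ρ δ s κ hI hbd hρ hin hK
  simp only [eval] at hK ⊢
  refine Runs.mono (Runs.seq (ha ρ δ s κ hI hbd hρ hin (by omega)) fun s1 h1 =>
    (sim_load (v' := (eval I a ρ δ).1.fst) hB h1 (by omega) 4 ?_)) (by omega) fun s2 h2 =>
      ⟨h2.inv, h2.bd.mono (by omega), h2.ext, h2.same, h2.val⟩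
  have hv := h1.val
  generalize (eval I a ρ δ).1 = v at hv
  cases v with
  | num n => exact (h1.inv.even _ (by rw [hv]; omega : s1.reg (10 + ρ.length) % 2 = 0)).1
  | cons x y => exact hv.2.2.1

theorem sim_snd {I : ℕ → ℕ → ℕ} {B K : ℕ} (hB : (2 * K) * (2 * K) + 2 * K ≤ B) {a : Tm}
    (ha : Sim I B K a) : Sim I B K (.snd a) := by
  intro ρ δ s κ hI hbd hρ hin hK
  simp only [eval] at hK ⊢
  refine Runs.mono (Runs.seq (ha ρ δ s κ hI hbd hρ hin (by omega)) fun s1 h1 =>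
    (sim_load (v' := (eval I a ρ δ).1.snd) hB h1 (by omega) 5 ?_)) (by omega) fun s2 h2 =>
      ⟨h2.inv, h2.bd.mono (by omega), h2.ext, h2.same, h2.val⟩
  have hv := h1.val
  generalize (eval I a ρ δ).1 = v at hv
  cases v with
  | num n => exact (h1.inv.even _ (by rw [hv]; omega : s1.reg (10 + ρ.length) % 2 = 0)).2
  | cons x y => exact hv.2.2.2

theorem sim_get {I : ℕ → ℕ → ℕ} {B K : ℕ} (hB : (2 * K) * (2 * K) + 2 * K ≤ B) {a : Tm}
    (ha : Sim I B K a) : Sim I B K (.get a) := by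
  intro ρ δ s κ hI hbd hρ hin hK
  simp only [eval] at hK ⊢
  exact Runs.mono (Runs.seq (ha ρ δ s κ hI hbd hρ hin (by omega)) fun s1 h1 =>
    (sim_load hB h1 (by omega) 7 (h1.inv.dict _ _ h1.val))) (by omega) fun s2 h2 =>
      ⟨h2.inv, h2.bd.mono (by omega), h2.ext, h2.same, h2.val⟩

theorem sim_lett {I : ℕ → ℕ → ℕ} {B K : ℕ} (hB : (2 * K) * (2 * K) + 2 * K ≤ B) {a b : Tm}
    (ha : Sim I B K a) (hb : Sim I B K b) : Sim I B K (.lett a b) := by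
  intro ρ δ s κ hI hbd hρ hin hK
  simp only [eval] at hK ⊢
  exact Runs.mono (Runs.seq (ha ρ δ s κ hI hbd hρ hin (by omega)) fun s1 h1 =>
    Runs.seq (hb.after h1 hρ hin (by omega) (by omega)) fun s2 h2 =>
    sim_mov (j := 10 + ρ.length + 1) hB (h1.comp h2 one_pos) (by omega) (by omega) h2.val)
    (by omega) fun s2 h2 => ⟨h2.inv, h2.bd.mono (by omega), h2.ext, h2.same, h2.val⟩

theorem sim_var {I : ℕ → ℕ → ℕ} {B K : ℕ} (hB : (2 * K) * (2 * K) + 2 * K ≤ B) (i : ℕ) :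
    Sim I B K (.var i) := by
  intro ρ δ s κ hI hbd hρ hin hK
  simp only [eval, compile] at hK ⊢
  split_ifs with hi
  · refine Runs.mono (Runs.last (exec_mov hI.zero
      ((hbd.env _ (by omega)).trans (by nlinarith))) ?_) (by omega) fun s2 h2 => h2
    have hs : Same ρ.length s (s.setReg (10 + ρ.length) (s.reg (10 + i))) :=
      same_setReg _ (by omega)
    refine Post.of_same hI hbd hs (by omega) ?_ ?_
    · intro j hj
      have := hbd.env j (by omega)
      have := hbd.env (10 + i) (by omega)
      simp only [setReg_reg]; split_ifs <;> omega
    · rw [hs.rep, List.getD_eq_getElem _ _ hi]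
      simpa using hρ i hi
  · refine Runs.mono (Runs.last (Exec.const _ _ _ (by omega)) ?_) (by omega) fun s2 h2 => h2
    have hs : Same ρ.length s (s.setReg (10 + ρ.length) 0) := same_setReg _ (by omega)
    refine Post.of_same hI hbd hs (by omega) ?_ ?_
    · intro j hj
      have := hbd.env j (by omega)
      simp only [setReg_reg]; split_ifs <;> omega
    · rw [hs.rep, List.getD_eq_default _ _ (by omega)]
      simp [Rep]

/-- A literal `c` becomes the number `2 * c`. Charging `c + 1` for it keeps all stored numbers
within the initial bound plus four times the cost. -/
theorem sim_num {I : ℕ → ℕ → ℕ} {B K : ℕ} (hB : (2 * K) * (2 * K) + 2 * K ≤ B) (c : ℕ) :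
    Sim I B K (.num c) := by
  intro ρ δ s κ hI hbd hρ hin hK
  simp only [eval, compile] at hK ⊢
  refine Runs.mono (Runs.last (Exec.const _ _ _ (by omega)) ?_) (by omega) fun s2 h2 => h2
  have hs : Same ρ.length s (s.setReg (10 + ρ.length) (2 * c)) := same_setReg _ (by omega)
  refine Post.of_same hI hbd hs (by omega) ?_ ?_
  · intro j hj
    have := hbd.env j (by omega)
    simp only [setReg_reg]; split_ifs <;> omega
  · rw [hs.rep]; simp [Rep]

/-- The key has the address `x`, and by `Rep.unique` no other tree has it. Writing array `7` at `x`
thus changes the dictionary at this one tree. -/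
theorem sim_put {I : ℕ → ℕ → ℕ} {B K : ℕ} (hB : (2 * K) * (2 * K) + 2 * K ≤ B) {a b : Tm}
    (ha : Sim I B K a) (hb : Sim I B K b) : Sim I B K (.put a b) := by
  intro ρ δ s κ hI hbd hρ hin hK
  simp only [eval] at hK ⊢
  refine Runs.mono (Runs.seq (ha ρ δ s κ hI hbd hρ hin (by omega)) fun s1 h1 =>
    Runs.seq (hb.after h1 hρ hin (by omega) (by omega)) fun s2 h2 =>
    Runs.step (T := 1) (Exec.store s2 7 (10 + ρ.length) (10 + ρ.length + 1)
      ((h2.bd.env (10 + ρ.length + 1) (by omega)).trans (by omega))) (Runs.last (Exec.const _ (10 + ρ.length) 0 (by omega))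
      (Q := Post I ρ.length (κ + 4 * _) _ _ s) ?_)) (by omega) fun s3 h3 => h3
  have hk : Rep s2 (eval I a ρ δ).1 (s2.reg (10 + ρ.length)) :=
    (h2.same (10 + ρ.length) (by omega) (by omega)) ▸ h1.val.ext h2.ext
  have hv := h2.val
  generalize (eval I b (ρ ++ [(eval I a ρ δ).1]) (eval I a ρ δ).2.1).1 = v at *
  generalize (eval I b (ρ ++ [(eval I a ρ δ).1]) (eval I a ρ δ).2.1).2.2 = c at *
  generalize (eval I b (ρ ++ [(eval I a ρ δ).1]) (eval I a ρ δ).2.1).2.1 = δ2 at *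
  generalize (eval I a ρ δ).1 = k at *
  obtain ⟨x, hx⟩ : ∃ x, x = s2.reg (10 + ρ.length) := ⟨_, rfl⟩
  rw [← hx] at hk
  set s' := (s2.setArr 7 (s2.reg (10 + ρ.length)) (s2.reg (10 + ρ.length + 1))).setReg
    (10 + ρ.length) 0 with hs'
  have gA : ∀ A y, s'.arr A y = if A = 7 ∧ y = x then s2.reg (10 + ρ.length + 1)
      else s2.arr A y := fun A y => by simp [hs', setArr_arr, hx]
  have gR : ∀ i, i ≠ 10 + ρ.length → s'.reg i = s2.reg i := fun i hi => by simp [hs', hi]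
  have gm : s'.reg (10 + ρ.length) = 0 := by simp [hs']
  clear_value s'
  have gA' : ∀ A y, A ≠ 7 → s'.arr A y = s2.arr A y := fun A y h => by simp [gA, h]
  have g7 : ∀ y, s'.arr 7 y = if y = x then s2.reg (10 + ρ.length + 1) else s2.arr 7 y :=
    fun y => by simp [gA]
  have g5 := gR 5 (by omega)
  have hrep : ∀ {d : Dat} {y : ℕ}, Rep s' d y ↔ Rep s2 d y := by
    intro d
    induction d with
    | num n => intro y; rfl
    | cons d1 d2 ih1 ih2 =>
      intro y
      simp only [Rep, g5, gA' 4 _ (by omega), gA' 5 _ (by omega), ih1, ih2]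
  have hext : Ext s2 s' := ⟨g5.ge, fun y _ => ⟨gA' _ _ (by omega), gA' _ _ (by omega)⟩⟩
  have hI2 := h2.inv
  refine ⟨⟨?_, ?_, ?_, ?_, ?_, ?_, ?_, ?_, ?_, ?_, ?_⟩, ⟨?_, ?_, ?_⟩,
    h1.ext.trans (h2.ext.trans hext), ?_, ?_⟩
  · rw [gR _ (by omega), hI2.zero]
  · rw [gR _ (by omega), hI2.two]
  · rw [g5]; exact hI2.odd
  · simp only [g5, gA' 4 _ (by omega), gA' 5 _ (by omega), gA' 6 _ (by omega)]; exact hI2.hash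
  · simp only [g5, gA' 4 _ (by omega), gA' 5 _ (by omega), gA' 6 _ (by omega)]; exact hI2.hash'
  · simp only [gA' 4 _ (by omega), gA' 5 _ (by omega)]; exact hI2.even
  · simp only [g5, hrep]; exact hI2.rep
  · intro d y hd
    rw [hrep] at hd ⊢
    rw [g7]
    by_cases hy : y = x
    · subst hy
      rw [hd.functional hk, Function.update_self, if_pos rfl]
      exact hv
    · rw [if_neg hy, Function.update_of_ne]
      · exact hI2.dict _ _ hd
      · rintro rfl
        exact hy (hd.unique hI2 hk)
  · intro d hd
    simp only [hrep] at hd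
    rw [Function.update_of_ne]
    · exact hI2.dict_default d hd
    · rintro rfl
      exact hd ⟨x, hk⟩
  · intro y hy hy1
    rw [g5] at hy
    rw [g7, if_neg]
    · exact hI2.fresh y hy hy1
    · rintro rfl
      -- An address is even or below the free pointer, so the zeros of array `7` at unallocated
      -- cells persist.
      cases k with
      | num n => simp only [Rep] at hk; omega
      | cons k1 k2 => have := hk.2.1; omega
  · intro A hA
    rw [← hI2.inp A hA]
    funext y
    exact gA' A y (by omega)
  · rw [g5]; exact h2.bd.free.trans (by omega)
  · intro i hi
    by_cases him : i = 10 + ρ.length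
    · rw [him, gm]; omega
    · rw [gR i him]; exact (h2.bd.env i hi).trans (by omega)
  · intro A y
    rw [gA]
    split_ifs
    · exact (h2.bd.env _ (by omega)).trans (by omega)
    · exact (h2.bd.arr _ _).trans (by omega)
  · intro i hi hi'
    exact (gR i (by omega)).trans ((h2.same i hi (by omega)).trans (h1.same i hi hi'))
  · rw [gm]; rfl


theorem sim_toNat {I : ℕ → ℕ → ℕ} {B κ m k : ℕ} {s s1 : State} {δ : Dict} {v w : Dat}
    (h1 : Post I m κ δ v s s1) (hw : Rep s1 w (s1.reg (10 + m + k))) (hB : 2 ≤ B) :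
    Runs B (toNatC (10 + m + k)) s1 4 (fun s2 =>
      Post I m κ δ (if k = 0 then .num w.toNat else v) s s2 ∧ (∀ d x, Rep s2 d x ↔ Rep s1 d x) ∧
      s2.reg (10 + m + k) = 2 * w.toNat ∧
      ∀ i, i ≠ 6 → i ≠ 10 + m + k → s2.reg i = s1.reg i) := by
  refine Runs.mono (runs_toNatC h1.inv (by omega) hw hB) le_rfl fun s2 h2 => ?_
  obtain ⟨h2a, h2d, h2r⟩ := h2
  have hs : Same m s1 s2 := ⟨h2a, fun i h6 h7 hi => h2r i h6 (by omega)⟩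
  refine ⟨h1.step hs le_rfl ?_ ?_, fun d x => hs.rep, h2d, h2r⟩
  · intro i hi
    by_cases hi' : i = 10 + m + k
    · rw [hi', h2d]; exact hw.toNat_le.trans (h1.bd.env _ (by omega))
    · rw [h2r i (by omega) hi']; exact h1.bd.env i (by omega)
  · split_ifs with hk
    · subst hk; exact h2d
    · rw [h2r _ (by omega) (by omega)]; exact h1.val

/-- Inputs are shifted by two, so that `0` and `1` remain available for the end of a list and for
the star. In the doubled representation the shift is by four. -/
theorem sim_inp {I : ℕ → ℕ → ℕ} {B K : ℕ} (hB : (2 * K) * (2 * K) + 2 * K ≤ B) {a : Tm} (A : ℕ)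
    (ha : Sim I B K a) : Sim I B K (.inp A a) := by
  intro ρ δ s κ hI hbd hρ hin hK
  simp only [eval] at hK ⊢
  have hA4 : A % 4 < 4 := by omega
  have hKB : 4 ≤ K := (le_trans (by omega) (hin 0 0 (by omega))).trans (by omega : κ ≤ K)
  refine Runs.mono (Runs.seq (ha ρ δ s κ hI hbd hρ hin (by omega)) fun s1 h1 =>
    Runs.seq (T' := 6) (Q' := Post I ρ.length (κ + 4 * (eval I a ρ δ).2.2) _ _ s)
      (sim_toNat (k := 0) h1 h1.val (by omega)) fun s2 h2 => ?_) (by omega) fun s2 h2 =>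
      ⟨h2.inv, h2.bd.mono (by omega), h2.ext, h2.same, h2.val⟩
  obtain ⟨h2, -, hd, -⟩ := h2
  simp only [add_zero] at hd
  generalize (eval I a ρ δ).1.toNat = n at *
  generalize hc : (eval I a ρ δ).2.2 = c at *
  have h4 := h2.inv.two
  have n4 : ¬ 4 = 10 + ρ.length := by omega
  have hn := h2.bd.env (10 + ρ.length) (by omega)
  have hin' := hin (A % 4) n hA4
  have hload : s2.arr (A % 4) n = I (A % 4) n := by rw [h2.inv.inp _ hA4]
  have hdn : 2 * n / 2 = n := by omega
  refine Runs.mono (Runs.step (T := 4) (Exec.op s2 .div _ _ 4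
      (by simp only [Op.eval, hd, h4]; omega)) <|
    Runs.step (T := 3) (Exec.load _ _ _ _ (by simp [Op.eval, hd, h4, hdn, hload]; omega)) <|
    Runs.step (T := 2) (Exec.op _ .add _ _ _
      (by simp [Op.eval, hd, h4, hdn, hload]; omega)) <|
    Runs.step (T := 1) (Exec.op _ .add _ _ 4
      (by simp [Op.eval, hd, h4, hdn, hload, n4]; omega)) <|
    Runs.last (Exec.op _ .add _ _ 4
      (by simp [Op.eval, hd, h4, hdn, hload, n4]; omega)) ?_) (by omega) (fun _ h => h)
  refine h2.step (((((same_setReg _ (by omega)).trans (same_setReg _ (by omega))).trans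
    (same_setReg _ (by omega))).trans (same_setReg _ (by omega))).trans
    (same_setReg _ (by omega))) le_rfl ?_ ?_
  · intro i hi
    have := h2.bd.env i (by omega)
    simp [Op.eval, hd, h4, hdn, hload, n4]
    split_ifs <;> omega
  · simp [Op.eval, hd, h4, hdn, hload, n4, Rep]
    omega

/-- The cap is the reason why addition has three arguments: the result does not exceed a number that
is already there, so repeated additions cannot produce numbers beyond the linear bound. Only the
intermediate sum may be twice as large, and `B` leaves room for it. -/
theorem sim_add {I : ℕ → ℕ → ℕ} {B K : ℕ} (hB : (2 * K) * (2 * K) + 2 * K ≤ B) {a b c : Tm}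
    (ha : Sim I B K a) (hb : Sim I B K b) (hc : Sim I B K c) : Sim I B K (.add a b c) := by
  intro ρ δ s κ hI hbd hρ hin hK
  simp only [eval] at hK ⊢
  have hKB : 4 ≤ K := (le_trans (by omega) (hin 0 0 (by omega))).trans (by omega : κ ≤ K)
  refine Runs.mono (Runs.seq (ha ρ δ s κ hI hbd hρ hin (by omega)) fun s1 h1 =>
    Runs.seq (hb.after h1 hρ hin (by omega) (by omega)) fun s2 h2 =>
    Runs.seq (T' := 16) (hc.after_after h1 h2 hρ hin (by omega) (by omega)) fun s3 h3 => ?_)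
    ?_ fun s2 h2 => h2
  · have h12 := h1.comp h2 one_pos
    have h123 := h12.comp (k := 2) h3 two_pos
    have hb3 := (h2.comp (k := 1) h3 one_pos).val
    have hc3 := h3.val
    generalize (eval I a ρ δ).1 = va at *
    generalize (eval I b (ρ ++ [va]) _).1 = vb at *
    generalize (eval I b (ρ ++ [va]) _).2.2 = cb at *
    generalize (eval I b (ρ ++ [va]) _).2.1 = δb at *
    generalize (eval I c (ρ ++ [va] ++ [vb]) _).1 = vc at *
    generalize (eval I c (ρ ++ [va] ++ [vb]) _).2.2 = cc at *
    generalize (eval I c (ρ ++ [va] ++ [vb]) _).2.1 = δc at *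
    generalize (eval I a ρ δ).2.2 = ca at *
    have e : κ + 4 * ca + 4 * cb + 4 * cc ≤ κ + 4 * (ca + cb + cc + 1) := by omega
    refine Runs.mono (Runs.seq (sim_toNat (B := B) (k := 0) h123 h123.val (by omega)) fun s4 h4 =>
      Runs.seq (sim_toNat (B := B) (k := 1) h4.1 ((h4.2.1 _ _).2
        ((h4.2.2.2 (10 + ρ.length + 1) (by omega) (by omega)).symm ▸ hb3)) (by omega)) fun s5 h5 =>
      Runs.seq (T' := 3) (Q' := Post I ρ.length (κ + 4 * (ca + cb + cc + 1)) _ _ s)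
        (sim_toNat (B := B) (k := 2) h5.1 ((h5.2.1 _ _).2 ((h4.2.1 _ _).2
        (((h5.2.2.2 (10 + ρ.length + 2) (by omega) (by omega)).trans
          (h4.2.2.2 (10 + ρ.length + 2) (by omega) (by omega))).symm ▸ hc3)))
        (by omega)) fun s6 h6 => ?_) (by omega) fun _ h => h
    have r0 : s6.reg (10 + ρ.length) = 2 * va.toNat := by
      rw [h6.2.2.2 _ (by omega) (by omega), h5.2.2.2 _ (by omega) (by omega)]
      exact h4.2.2.1
    have r1 : s6.reg (10 + ρ.length + 1) = 2 * vb.toNat := by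
      rw [h6.2.2.2 _ (by omega) (by omega)]
      exact h5.2.2.1
    have r2 : s6.reg (10 + ρ.length + 2) = 2 * vc.toNat := h6.2.2.1
    have hp := h6.1
    have b0 := hp.bd.env (10 + ρ.length) (by omega)
    have b1 := hp.bd.env (10 + ρ.length + 1) (by omega)
    have b2 := hp.bd.env (10 + ρ.length + 2) (by omega)
    have n3 : ¬ 3 = 10 + ρ.length := by omega
    refine Runs.step (T := 2) (Exec.op s6 .add _ _ _ (by simp only [Op.eval]; omega))
      (Runs.ite (T := 1) (fun hlt => ?_) (fun hlt => ?_))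
    · refine Runs.last (exec_mov (by simp [hp.inv.zero, n3]) (by simp; omega)) ?_
      simp [Op.eval, r0, r1, r2] at hlt
      refine hp.step ((same_setReg _ (by omega)).trans (same_setReg _ (by omega))) e ?_ ?_
      · intro i hi
        have := hp.bd.env i (by omega)
        simp; split_ifs <;> omega
      · simp [Rep, r2]; omega
    · refine Runs.last (Exec.skip _) ?_
      simp [Op.eval, r0, r1, r2] at hlt
      refine hp.step (same_setReg _ (by omega)) e ?_ ?_
      · intro i hi
        have := hp.bd.env i (by omega)
        simp [Op.eval]; split_ifs <;> omega
      · simp [Rep, r0, r1, Op.eval]; omega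
  · omega

end TreeLang

/-! ### Simulation of tests and loops -/

namespace TreeLang

open RAM

/-- The sum of the two truncated differences vanishes exactly when the addresses agree, and by
uniqueness and functionality of the representation this means that the trees agree. The branches
overwrite the places of the two operands. -/
theorem sim_ifEq {I : ℕ → ℕ → ℕ} {B K : ℕ} (hB : (2 * K) * (2 * K) + 2 * K ≤ B) {a b t e : Tm}
    (ha : Sim I B K a) (hb : Sim I B K b) (ht : Sim I B K t) (he : Sim I B K e) :
    Sim I B K (.ifEq a b t e) := by
  intro ρ δ s κ hI hbd hρ hin hK
  simp only [eval] at hK ⊢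
  refine Runs.mono (Runs.seq (ha ρ δ s κ hI hbd hρ hin (by omega)) fun s1 h1 =>
    Runs.seq (T' := 40 * (if (eval I a ρ δ).1 =
      (eval I b (ρ ++ [(eval I a ρ δ).1]) (eval I a ρ δ).2.1).1 then
      eval I t ρ (eval I b (ρ ++ [(eval I a ρ δ).1]) (eval I a ρ δ).2.1).2.1 else
      eval I e ρ (eval I b (ρ ++ [(eval I a ρ δ).1]) (eval I a ρ δ).2.1).2.1).2.2 + 4)
    (hb.after h1 hρ hin (by omega) (by omega)) fun s2 h2 => ?_) (by omega) fun s2 h2 => h2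
  have h12 := h1.comp h2 one_pos
  have hb2 : Rep s2 _ (s2.reg (10 + ρ.length + 1)) := h2.val
  have hρ2 := hρ.post h12
  generalize (eval I a ρ δ).1 = va at *
  generalize (eval I b (ρ ++ [va]) _).1 = vb at *
  generalize (eval I b (ρ ++ [va]) _).2.2 = cb at *
  generalize (eval I b (ρ ++ [va]) _).2.1 = δb at *
  generalize (eval I a ρ δ).2.2 = ca at *
  have e0 := h12.bd.env (10 + ρ.length) (by omega)
  have e1 := h12.bd.env (10 + ρ.length + 1) (by omega)
  have n3 : ¬ 10 + ρ.length = 5 := by omega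
  have n6 : ¬ 10 + ρ.length = 6 := by omega
  have n7 : ¬ 10 + ρ.length = 7 := by omega
  refine Runs.step (T := _ + 3) (Exec.op s2 .sub 6 _ _ (by simp only [Op.eval]; omega)) <|
    Runs.step (T := _ + 2) (Exec.op _ .sub 7 _ _
      (by simp only [Op.eval, setReg_reg]; split_ifs <;> omega)) <|
    Runs.step (T := _ + 1) (Exec.op _ .add 6 6 7
      (by simp [Op.eval, setReg_reg, n3]; omega)) ?_
  set s3 := ((s2.setReg 6 _).setReg 7 _).setReg 6 _ with hs3
  have hs : Same ρ.length s2 s3 := ((same_setReg _ (by omega)).trans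
    (same_setReg _ (by omega))).trans (same_setReg _ (by omega))
  have h6 : s3.reg 6 = (s2.reg (10 + ρ.length) - s2.reg (10 + ρ.length + 1)) +
      (s2.reg (10 + ρ.length + 1) - s2.reg (10 + ρ.length)) := by
    simp [hs3, Op.eval, n3, n6, n7]
  have h3 := h12.step (κ' := κ + 4 * ca + 4 * cb) (v' := va) hs le_rfl (fun i hi => by
    have := h12.bd.env i (by omega)
    have : s3.reg i = s2.reg i := by simp [hs3, show i ≠ 6 by omega, show i ≠ 7 by omega]
    omega) (by
    have : s3.reg (10 + ρ.length) = s2.reg (10 + ρ.length) := by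
      simp [hs3, show 10 + ρ.length ≠ 6 by omega, show 10 + ρ.length ≠ 7 by omega]
    rw [this]; exact h12.val)
  clear_value s3
  have hz : s3.reg 3 = 0 := h3.inv.zero
  have hiff : s3.reg 3 < s3.reg 6 ↔ va ≠ vb := by
    rw [hz, h6]
    constructor
    · rintro h rfl
      have := h12.val.unique h12.inv hb2
      omega
    · intro h
      by_contra hcon
      refine h (h12.val.functional (x := s2.reg (10 + ρ.length)) ?_)
      rw [show s2.reg (10 + ρ.length) = s2.reg (10 + ρ.length + 1) by omega]
      exact hb2
  refine Runs.ite (fun h => ?_) (fun h => ?_)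
  · have hne := hiff.1 h
    simp only [if_neg hne] at hK ⊢
    refine (he ρ δb s3 _ h3.inv h3.bd (hρ.post h3) (fun A i hA => (hin A i hA).trans (by omega))
      (by omega)).mono le_rfl fun s4 h4 => ?_
    have := h3.trans h4
    exact ⟨this.inv, this.bd.mono (by omega), this.ext, this.same, this.val⟩
  · have heq : va = vb := not_not.1 fun hc => h (hiff.2 hc)
    simp only [if_pos heq] at hK ⊢
    refine (ht ρ δb s3 _ h3.inv h3.bd (hρ.post h3) (fun A i hA => (hin A i hA).trans (by omega))
      (by omega)).mono le_rfl fun s4 h4 => ?_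
    have := h3.trans h4
    exact ⟨this.inv, this.bd.mono (by omega), this.ext, this.same, this.val⟩

theorem sim_ifLt {I : ℕ → ℕ → ℕ} {B K : ℕ} (hB : (2 * K) * (2 * K) + 2 * K ≤ B) {a b t e : Tm}
    (ha : Sim I B K a) (hb : Sim I B K b) (ht : Sim I B K t) (he : Sim I B K e) :
    Sim I B K (.ifLt a b t e) := by
  intro ρ δ s κ hI hbd hρ hin hK
  simp only [eval] at hK ⊢
  have hKB : 4 ≤ K := (le_trans (by omega) (hin 0 0 (by omega))).trans (by omega : κ ≤ K)
  refine Runs.mono (Runs.seq (ha ρ δ s κ hI hbd hρ hin (by omega)) fun s1 h1 =>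
    Runs.seq (T' := 40 * (if (eval I a ρ δ).1.toNat <
      (eval I b (ρ ++ [(eval I a ρ δ).1]) (eval I a ρ δ).2.1).1.toNat then
      eval I t ρ (eval I b (ρ ++ [(eval I a ρ δ).1]) (eval I a ρ δ).2.1).2.1 else
      eval I e ρ (eval I b (ρ ++ [(eval I a ρ δ).1]) (eval I a ρ δ).2.1).2.1).2.2 + 9)
    (hb.after h1 hρ hin (by omega) (by omega)) fun s2 h2 => ?_) (by omega) fun s2 h2 => h2
  have h12 := h1.comp h2 one_pos
  have hb2 : Rep s2 _ (s2.reg (10 + ρ.length + 1)) := h2.val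
  have hρ2 := hρ.post h12
  generalize (eval I a ρ δ).1 = va at *
  generalize (eval I b (ρ ++ [va]) _).1 = vb at *
  generalize (eval I b (ρ ++ [va]) _).2.2 = cb at *
  generalize (eval I b (ρ ++ [va]) _).2.1 = δb at *
  generalize (eval I a ρ δ).2.2 = ca at *
  refine Runs.mono (Runs.seq (sim_toNat (B := B) (k := 0) h12 h12.val (by omega)) fun s4 h4 =>
      Runs.seq (sim_toNat (B := B) (k := 1) h4.1 ((h4.2.1 _ _).2
        ((h4.2.2.2 (10 + ρ.length + 1) (by omega) (by omega)).symm ▸ hb2)) (by omega)) fun s3 h5 =>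
      Runs.ite (fun h => ?_) (fun h => ?_)) (by omega : 4 + (4 + (40 * (if va.toNat < vb.toNat
      then eval I t ρ δb else eval I e ρ δb).2.2 + 1)) ≤ _) (fun _ h => h)
  all_goals
    have h3 := h5.1
    rw [h5.2.2.1, h5.2.2.2 _ (by omega) (by omega), show s4.reg (10 + ρ.length) = _ from h4.2.2.1]
      at h
  · simp only [if_pos (show va.toNat < vb.toNat by omega)] at hK ⊢
    refine (ht ρ δb s3 _ h3.inv h3.bd (hρ.post h3) (fun A i hA => (hin A i hA).trans (by omega))
      (by omega)).mono le_rfl fun s4 h4 => ?_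
    have := h3.trans h4
    exact ⟨this.inv, this.bd.mono (by omega), this.ext, this.same, this.val⟩
  · simp only [if_neg (show ¬ va.toNat < vb.toNat by omega)] at hK ⊢
    refine (he ρ δb s3 _ h3.inv h3.bd (hρ.post h3) (fun A i hA => (hin A i hA).trans (by omega))
      (by omega)).mono le_rfl fun s4 h4 => ?_
    have := h3.trans h4
    exact ⟨this.inv, this.bd.mono (by omega), this.ext, this.same, this.val⟩

/-- The accumulated value, dictionary and cost of a loop. -/
noncomputable def loopStep (I : ℕ → ℕ → ℕ) (b : Tm) (ρ : List Dat) (st : Dat × Dict × ℕ)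
    (x : Dat × Dat) : Dat × Dict × ℕ :=
  ((eval I b (ρ ++ [x.2] ++ [st.1] ++ [x.1]) st.2.1).1,
    (eval I b (ρ ++ [x.2] ++ [st.1] ++ [x.1]) st.2.1).2.1,
    st.2.2 + (eval I b (ρ ++ [x.2] ++ [st.1] ++ [x.1]) st.2.1).2.2 + 1)

theorem le_loopStep_foldl (I : ℕ → ℕ → ℕ) (b : Tm) (ρ : List Dat) (l : List (Dat × Dat)) :
    ∀ st : Dat × Dict × ℕ, st.2.2 ≤ (l.foldl (loopStep I b ρ) st).2.2 := by
  induction l with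
  | nil => exact fun st => le_rfl
  | cons x l ih => exact fun st => le_trans (by simp [loopStep]; omega) (ih _)

/-- Place `m` holds what remains of the list, place `m + 1` the accumulator and place `m + 2` the
current element. The remainder is represented by zero only if it is `num 0`, when the iterations are
over. Its parity tells whether to take head and tail of a pair or to count down. -/
theorem sim_loop_aux {I : ℕ → ℕ → ℕ} {B K : ℕ} (hB : (2 * K) * (2 * K) + 2 * K ≤ B) {b : Tm}
    (hb : Sim I B K b) {ρ : List Dat} {s₀ : State} (hρ : EnvOk ρ s₀) {κ : ℕ}
    (hin : ∀ A i, A < 4 → 2 * I A i + 4 ≤ κ) (l : List (Dat × Dat)) :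
    ∀ (d : Dat) (st : Dat × Dict × ℕ) (s : State), d.steps = l →
      Post I ρ.length (κ + 4 * st.2.2) st.2.1 d s₀ s →
      Rep s st.1 (s.reg (10 + ρ.length + 1)) →
      κ + 4 * (l.foldl (loopStep I b ρ) st).2.2 ≤ K →
      Runs B (.loop 3 (10 + ρ.length) <|
        .seq (.op .mod 6 (10 + ρ.length) 4) <|
        .seq (.ite 3 6 (.seq (.load (10 + ρ.length + 2) 4 (10 + ρ.length))
            (.load (10 + ρ.length) 5 (10 + ρ.length)))
          (.seq (.op .sub (10 + ρ.length) (10 + ρ.length) 4)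
            (movC (10 + ρ.length + 2) (10 + ρ.length)))) <|
        .seq (compile b (ρ.length + 1 + 1 + 1)) (movC (10 + ρ.length + 1) (10 + ρ.length + 3))) s
        (40 * ((l.foldl (loopStep I b ρ) st).2.2 - st.2.2) + 1)
        (fun s' => Post I ρ.length (κ + 4 * (l.foldl (loopStep I b ρ) st).2.2)
          (l.foldl (loopStep I b ρ) st).2.1 (.num 0) s₀ s' ∧
          Rep s' (l.foldl (loopStep I b ρ) st).1 (s'.reg (10 + ρ.length + 1))) := by
  induction l with
  | nil =>
    intro d st s hd hp hacc hK
    have hd0 : d = .num 0 := by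
      cases d with
      | num n => cases n with
        | zero => rfl
        | succ n => simp [Dat.steps, Dat.natSteps] at hd
      | cons x r => simp [Dat.steps] at hd
    subst hd0
    have h0 : s.reg (10 + ρ.length) = 0 := hp.val
    exact Runs.mono (Runs.last (Exec.loop_false (by rw [h0]; omega)) ⟨hp, hacc⟩) (by omega)
      (fun _ h => h)
  | cons x l ih =>
    intro d st s hd hp hacc hK
    simp only [List.foldl_cons] at hK ⊢
    have hle := le_loopStep_foldl I b ρ l (loopStep I b ρ st x)
    have hst : (loopStep I b ρ st x).2.2 = st.2.2 +
      (eval I b (ρ ++ [x.2] ++ [st.1] ++ [x.1]) st.2.1).2.2 + 1 := rfl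
    have hst1 : (loopStep I b ρ st x).1 =
      (eval I b (ρ ++ [x.2] ++ [st.1] ++ [x.1]) st.2.1).1 := rfl
    have hst2 : (loopStep I b ρ st x).2.1 =
      (eval I b (ρ ++ [x.2] ++ [st.1] ++ [x.1]) st.2.1).2.1 := rfl
    have hz := hp.inv.zero
    have ht := hp.inv.two
    have hpos : s.reg 3 < s.reg (10 + ρ.length) := by
      rw [hz]
      have := hp.val
      cases d with
      | num n =>
        cases n with
        | zero => simp [Dat.steps, Dat.natSteps] at hd
        | succ n => simp only [Rep] at this; omega
      | cons y r => have := this.1; omega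
    have n2 : ¬ 10 + ρ.length = 5 := by omega
    have n3 : ¬ 3 = 10 + ρ.length := by omega
    have n4 : ¬ 4 = 10 + ρ.length := by omega
    have n4' : ¬ 10 + ρ.length = 4 := by omega
    have n6 : ¬ 10 + ρ.length = 6 := by omega
    have e0 := hp.bd.env (10 + ρ.length) (by omega)
    have a4 := hp.bd.arr 4 (s.reg (10 + ρ.length))
    have a5 := hp.bd.arr 5 (s.reg (10 + ρ.length))
    have hbody : Runs B (.seq (.op .mod 6 (10 + ρ.length) 4) <|
        .seq (.ite 3 6 (.seq (.load (10 + ρ.length + 2) 4 (10 + ρ.length))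
            (.load (10 + ρ.length) 5 (10 + ρ.length)))
          (.seq (.op .sub (10 + ρ.length) (10 + ρ.length) 4)
            (movC (10 + ρ.length + 2) (10 + ρ.length)))) <|
        .seq (compile b (ρ.length + 1 + 1 + 1)) (movC (10 + ρ.length + 1) (10 + ρ.length + 3))) s
        (40 * (eval I b (ρ ++ [x.2] ++ [st.1] ++ [x.1]) st.2.1).2.2 + 5)
        (fun s' => ∃ d', d'.steps = l ∧
          Post I ρ.length (κ + 4 * (loopStep I b ρ st x).2.2) (loopStep I b ρ st x).2.1 d' s₀ s' ∧
          Rep s' (loopStep I b ρ st x).1 (s'.reg (10 + ρ.length + 1))) := by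
      refine Runs.mono (Runs.step (T := 3 + (_ + 1)) (Exec.op s .mod 6 _ 4 ?_) <|
        Runs.seq (Q := fun s' => x.2.steps = l ∧ Post I ρ.length (κ + 4 * st.2.2) st.2.1 x.2 s₀ s' ∧
          Rep s' st.1 (s'.reg (10 + ρ.length + 1)) ∧ Rep s' x.1 (s'.reg (10 + ρ.length + 2)))
        (Runs.ite (T := 2) ?_ ?_) ?_) (by omega : 3 + (40 * (eval I b (ρ ++ [x.2] ++ [st.1] ++
          [x.1]) st.2.1).2.2 + 1) + 1 ≤ _) (fun _ h => h)
      · simp only [Op.eval, ht]; omega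
      · intro hodd
        cases d with
        | num n =>
          have hv := hp.val
          simp only [Rep] at hv
          simp [Op.eval, hz, ht, hv] at hodd
        | cons y r =>
          simp only [Dat.steps, List.cons.injEq] at hd
          obtain ⟨rfl, hl⟩ := hd
          have hv := hp.val
          refine Runs.step (T := 1) (Exec.load _ _ 4 _ (by simp [n2, n4', n6]; omega)) <|
            Runs.last (Exec.load _ _ 5 _ (by simp [n4', n6]; omega)) ?_
          have hs : ∀ p q r, Same ρ.length s (((s.setReg 6 p).setReg (10 + ρ.length + 2) q).setReg
            (10 + ρ.length) r) := fun p q r => ((same_setReg _ (by omega)).trans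
              (same_setReg _ (by omega))).trans (same_setReg _ (by omega))
          refine ⟨hl, hp.step (hs _ _ _) le_rfl ?_ ?_, ?_, ?_⟩
          · intro i hi
            have := hp.bd.env i (by omega)
            simp [n4', n6, n2]; split_ifs <;> omega
          · simpa [n2, n4', n6] using hv.2.2.2
          · rw [(hs _ _ _).rep]; simpa [n2, n4', n6] using hacc
          · rw [(hs _ _ _).rep]; simpa [n2, n4', n6] using hv.2.2.1
      · intro hodd
        cases d with
        | cons y r =>
          have hv := hp.val
          simp [Op.eval, hz, ht, hv.1] at hodd
        | num n =>
          cases n with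
          | zero => simp [Dat.steps, Dat.natSteps] at hd
          | succ n =>
            simp only [Dat.steps, Dat.natSteps, List.cons.injEq] at hd
            obtain ⟨rfl, hl⟩ := hd
            have hv := hp.val
            simp only [Rep] at hv
            refine Runs.step (T := 1) (Exec.op _ .sub _ _ 4 (by simp [Op.eval, ht, n4, n4', n6]; omega)) <|
              Runs.last (exec_mov (by simp [hz, n3]) (by simp [Op.eval, n4, n6, ht]; omega)) ?_
            have hs : ∀ p q r, Same ρ.length s (((s.setReg 6 p).setReg (10 + ρ.length) q).setReg
              (10 + ρ.length + 2) r) := fun p q r => ((same_setReg _ (by omega)).trans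
                (same_setReg _ (by omega))).trans (same_setReg _ (by omega))
            refine ⟨hl, hp.step (hs _ _ _) le_rfl ?_ ?_, ?_, ?_⟩
            · intro i hi
              have := hp.bd.env i (by omega)
              simp [Op.eval, n4, n6, ht]; split_ifs <;> omega
            · simp [Op.eval, Rep, hv, ht, n2, n4, n4', n6]; omega
            · rw [(hs _ _ _).rep]; simpa [n2, n4', n6] using hacc
            · rw [(hs _ _ _).rep]; simp [Op.eval, Rep, hv, ht, n2, n4, n4', n6]; omega
      · rintro s2 ⟨hl, h2, hacc2, hx2⟩
        have henv : EnvOk (ρ ++ [x.2] ++ [st.1] ++ [x.1]) s2 :=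
          (((hρ.post h2).snoc h2.val).snoc (by simpa [add_assoc] using hacc2)).snoc (by simpa [add_assoc] using hx2)
        have hrun := hb (ρ ++ [x.2] ++ [st.1] ++ [x.1]) st.2.1 s2 _ h2.inv h2.bd henv
          (fun A i hA => (hin A i hA).trans (by omega)) (by omega)
        have hlen : (ρ ++ [x.2] ++ [st.1] ++ [x.1]).length = ρ.length + 3 := by simp
        rw [hlen] at hrun
        refine Runs.seq hrun fun s3 h3 => ?_
        have h23 := h2.comp (k := 3) h3 (by omega)
        refine Runs.last (exec_mov h23.inv.zero ((h23.bd.env _ (by omega)).trans (by omega))) ?_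
        have hs : Same ρ.length s3 (s3.setReg (10 + ρ.length + 1) (s3.reg (10 + ρ.length + 3))) :=
          same_setReg _ (by omega)
        refine ⟨x.2, hl, ?_, ?_⟩
        · refine h23.step hs (by omega) ?_ ?_
          · intro i hi
            have := h23.bd.env i (by omega)
            have := h23.bd.env (10 + ρ.length + 3) (by omega)
            simp; split_ifs <;> omega
          · simpa [n2] using h23.val
        · rw [hs.rep]
          simpa [hst1, add_assoc] using h3.val
    obtain ⟨τ, s', hex, hτ, d', hd', hp', hacc'⟩ := hbody
    obtain ⟨τ', s'', hex', hτ', hQ⟩ := ih d' _ s' hd' hp' hacc' hK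
    exact ⟨τ + τ' + 1, s'', Exec.loop_true hpos hex hex', by omega, hQ⟩

theorem sim_loop {I : ℕ → ℕ → ℕ} {B K : ℕ} (hB : (2 * K) * (2 * K) + 2 * K ≤ B) {a i b : Tm}
    (ha : Sim I B K a) (hi : Sim I B K i) (hb : Sim I B K b) : Sim I B K (.loop a i b) := by
  intro ρ δ s κ hI hbd hρ hin hK
  simp only [eval] at hK ⊢
  change κ + 4 * (List.foldl (loopStep I b ρ) _ _).2.2 ≤ K at hK
  change Runs B _ s (40 * (List.foldl (loopStep I b ρ) _ _).2.2) (Post I ρ.length (κ + 4 *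
    (List.foldl (loopStep I b ρ) _ _).2.2) (List.foldl (loopStep I b ρ) _ _).2.1
    (List.foldl (loopStep I b ρ) _ _).1 s)
  have hle := le_loopStep_foldl I b ρ (eval I a ρ δ).1.steps
    ((eval I i (ρ ++ [(eval I a ρ δ).1]) (eval I a ρ δ).2.1).1,
      (eval I i (ρ ++ [(eval I a ρ δ).1]) (eval I a ρ δ).2.1).2.1, (eval I a ρ δ).2.2 +
      (eval I i (ρ ++ [(eval I a ρ δ).1]) (eval I a ρ δ).2.1).2.2 + 1)
  simp only at hle
  refine Runs.mono (Runs.seq (ha ρ δ s κ hI hbd hρ hin (by omega)) fun s1 h1 =>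
    Runs.seq (hi.after h1 hρ hin (by omega) (by omega)) fun s2 h2 =>
    Runs.seq (sim_loop_aux hB hb hρ hin (eval I a ρ δ).1.steps _
      ((eval I i (ρ ++ [(eval I a ρ δ).1]) (eval I a ρ δ).2.1).1,
      (eval I i (ρ ++ [(eval I a ρ δ).1]) (eval I a ρ δ).2.1).2.1, (eval I a ρ δ).2.2 +
      (eval I i (ρ ++ [(eval I a ρ δ).1]) (eval I a ρ δ).2.1).2.2 + 1) s2 rfl ?_ h2.val hK)
    fun s3 h3 => sim_mov (j := 10 + ρ.length + 1) hB h3.1 hK (by omega) h3.2)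
    (by simp only; omega) fun _ h => h
  have h12 := h1.comp h2 one_pos
  exact ⟨h12.inv, h12.bd.mono (by simp only; omega), h12.ext, h12.same, h12.val⟩

/-- Compiled programs are correct: the number of steps is linear in the cost, and the numbers that
occur are quadratic in it. -/
theorem sim {I : ℕ → ℕ → ℕ} {B K : ℕ} (hB : (2 * K) * (2 * K) + 2 * K ≤ B) (t : Tm) :
    Sim I B K t := by
  induction t with
  | var i => exact sim_var hB i
  | num c => exact sim_num hB c
  | pair a b iha ihb => exact sim_pair hB iha ihb
  | fst a ih => exact sim_fst hB ih
  | snd a ih => exact sim_snd hB ih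
  | add a b c iha ihb ihc => exact sim_add hB iha ihb ihc
  | inp A i ih => exact sim_inp hB A ih
  | ifEq a b t e iha ihb iht ihe => exact sim_ifEq hB iha ihb iht ihe
  | ifLt a b t e iha ihb iht ihe => exact sim_ifLt hB iha ihb iht ihe
  | lett a b iha ihb => exact sim_lett hB iha ihb
  | loop l i b ihl ihi ihb => exact sim_loop hB ihl ihi ihb
  | get k ih => exact sim_get hB ih
  | put k v ihk ihv => exact sim_put hB ihk ihv

end TreeLang

/-! ### Terms with bound variables, and rules for values and costs -/

namespace TreeLang

/-- Terms that are told the number of places in use. -/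
abbrev T := ℕ → Tm

def varE (x : ℕ) : T := fun _ => .var x
def numE (c : ℕ) : T := fun _ => .num c
def pairE (a b : T) : T := fun m => .pair (a m) (b (m + 1))
def fstE (a : T) : T := fun m => .fst (a m)
def sndE (a : T) : T := fun m => .snd (a m)
def addE (a b c : T) : T := fun m => .add (a m) (b (m + 1)) (c (m + 1 + 1))
def inpE (A : ℕ) (i : T) : T := fun m => .inp A (i m)
def ifEqE (a b t e : T) : T := fun m => .ifEq (a m) (b (m + 1)) (t m) (e m)
def ifLtE (a b t e : T) : T := fun m => .ifLt (a m) (b (m + 1)) (t m) (e m)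
def letE (a : T) (f : ℕ → T) : T := fun m => .lett (a m) (f m (m + 1))
-- The body receives the places of the current element and of the accumulator; the place below these
-- two holds the remainder of the list and is not exposed.
def loopE (l i : T) (f : ℕ → ℕ → T) : T :=
  fun m => .loop (l m) (i (m + 1)) (f (m + 1 + 1) (m + 1) (m + 1 + 1 + 1))
def getE (k : T) : T := fun m => .get (k m)
def putE (k v : T) : T := fun m => .put (k m) (v (m + 1))

/-- In every environment in which the variables in `L` have the given values, the term `t` is
evaluated at cost at most `c`, and the value and the new dictionary satisfy `Q`. -/
def Ev (I : ℕ → ℕ → ℕ) (L : List (ℕ × Dat)) (δ : Dict) (t : T) (c : ℕ) (Q : Dat → Dict → Prop) :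
    Prop :=
  ∀ ρ : List Dat, (∀ p ∈ L, ρ[p.1]? = some p.2) →
    (eval I (t ρ.length) ρ δ).2.2 ≤ c ∧ Q (eval I (t ρ.length) ρ δ).1 (eval I (t ρ.length) ρ δ).2.1

/-- `t` has the value `v` and does not use the dictionary. -/
def Pu (I : ℕ → ℕ → ℕ) (L : List (ℕ × Dat)) (t : T) (v : Dat) (c : ℕ) : Prop :=
  ∀ δ, Ev I L δ t c fun w δ' => w = v ∧ δ' = δ

section rules

variable {I : ℕ → ℕ → ℕ} {L : List (ℕ × Dat)} {δ : Dict} {t a b e l i : T} {c c' ca cb : ℕ}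
  {Q Q' : Dat → Dict → Prop} {v w va vb : Dat}

theorem getElem?_snoc {ρ : List Dat} (h : ∀ p ∈ L, ρ[p.1]? = some p.2) (v : Dat) :
    ∀ p ∈ L, (ρ ++ [v])[p.1]? = some p.2 := fun p hp => by
  obtain ⟨hl, he⟩ := List.getElem?_eq_some_iff.1 (h p hp)
  rw [List.getElem?_append_left hl]
  exact h p hp

theorem Ev.mono (h : Ev I L δ t c Q) (hc : c ≤ c') (hQ : ∀ v δ', Q v δ' → Q' v δ') :
    Ev I L δ t c' Q' := fun ρ hρ => ⟨(h ρ hρ).1.trans hc, hQ _ _ (h ρ hρ).2⟩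

theorem Ev.weaken (h : Ev I L δ t c Q) (L' : List (ℕ × Dat)) (hL : ∀ p ∈ L, p ∈ L') :
    Ev I L' δ t c Q := fun ρ hρ => h ρ fun p hp => hρ p (hL p hp)

theorem Pu.weaken (h : Pu I L t v c) {L' : List (ℕ × Dat)} (hL : ∀ p ∈ L, p ∈ L') :
    Pu I L' t v c := fun δ => (h δ).weaken L' hL

theorem Pu.weak (h : Pu I L t v c) (p : ℕ × Dat) : Pu I (p :: L) t v c :=
  h.weaken fun _ => List.mem_cons_of_mem _

theorem Pu.congr (h : Pu I L t v c) (hv : v = w) (hc : c ≤ c') : Pu I L t w c' :=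
  fun δ => (h δ).mono hc fun _ _ h => ⟨h.1.trans hv, h.2⟩

theorem Pu.ev (h : Pu I L t v c) (hQ : Q v δ) : Ev I L δ t c Q :=
  (h δ).mono le_rfl fun _ _ h => by rw [h.1, h.2]; exact hQ

theorem Pu.var {x : ℕ} (h : (x, v) ∈ L) : Pu I L (varE x) v 1 := fun δ ρ hρ => by
  refine ⟨le_rfl, ?_, rfl⟩
  simp only [varE, eval, List.getD_eq_getElem?_getD, hρ _ h, Option.getD_some]

theorem Pu.num (n : ℕ) : Pu I L (numE n) (.num n) (n + 1) := fun _ _ _ => ⟨le_rfl, rfl, rfl⟩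

theorem Ev.pair (ha : Pu I L a va ca) (hb : Ev I L δ b cb fun v δ' => Q (.cons va v) δ') :
    Ev I L δ (pairE a b) (ca + cb + 1) Q := fun ρ hρ => by
  obtain ⟨h1, h2, h3⟩ := ha δ ρ hρ
  have := hb _ (getElem?_snoc hρ va)
  simp only [List.length_append, List.length_singleton] at this
  simp only [pairE, eval, h2, h3]
  exact ⟨by omega, this.2⟩

theorem Pu.pair (ha : Pu I L a va ca) (hb : Pu I L b vb cb) :
    Pu I L (pairE a b) (.cons va vb) (ca + cb + 1) := fun δ =>
  Ev.pair ha ((hb δ).mono le_rfl fun _ _ h => ⟨by rw [h.1], h.2⟩)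

theorem Pu.fst (ha : Pu I L a va ca) : Pu I L (fstE a) va.fst (ca + 1) := fun δ ρ hρ => by
  obtain ⟨h1, h2, h3⟩ := ha δ ρ hρ
  simp only [fstE, eval]
  exact ⟨by omega, by rw [h2], h3⟩

theorem Pu.snd (ha : Pu I L a va ca) : Pu I L (sndE a) va.snd (ca + 1) := fun δ ρ hρ => by
  obtain ⟨h1, h2, h3⟩ := ha δ ρ hρ
  simp only [sndE, eval]
  exact ⟨by omega, by rw [h2], h3⟩

theorem Pu.add {d : T} {vd : Dat} {cd : ℕ} (ha : Pu I L a va ca) (hb : Pu I L b vb cb)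
    (hd : Pu I L d vd cd) :
    Pu I L (addE a b d) (.num (min (va.toNat + vb.toNat) vd.toNat)) (ca + cb + cd + 1) :=
  fun δ ρ hρ => by
    obtain ⟨h1, h2, h3⟩ := ha δ ρ hρ
    obtain ⟨h4, h5, h6⟩ := hb δ _ (getElem?_snoc hρ va)
    obtain ⟨h7, h8, h9⟩ := hd δ _ (getElem?_snoc (getElem?_snoc hρ va) vb)
    simp only [List.length_append, List.length_singleton] at h4 h5 h6 h7 h8 h9
    simp only [addE, eval, h2, h3, h5, h6, h8, h9]
    exact ⟨by omega, trivial, trivial⟩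

theorem Pu.inp {A n : ℕ} (hA : A < 4) (ha : Pu I L a (.num n) ca) :
    Pu I L (inpE A a) (.num (I A n + 2)) (ca + 1) := fun δ ρ hρ => by
  obtain ⟨h1, h2, h3⟩ := ha δ ρ hρ
  simp only [inpE, eval]
  exact ⟨by omega, by rw [h2, Nat.mod_eq_of_lt hA]; rfl, h3⟩

theorem Ev.ifEq (ha : Pu I L a va ca) (hb : Pu I L b vb cb)
    (ht : va = vb → Ev I L δ t c Q) (he : va ≠ vb → Ev I L δ e c Q) :
    Ev I L δ (ifEqE a b t e) (ca + cb + c + 1) Q := fun ρ hρ => by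
  obtain ⟨h1, h2, h3⟩ := ha δ ρ hρ
  obtain ⟨h4, h5, h6⟩ := hb δ _ (getElem?_snoc hρ va)
  simp only [List.length_append, List.length_singleton] at h4 h5 h6
  simp only [ifEqE, eval, h2, h3, h5, h6]
  split_ifs with h
  · have := ht h ρ hρ; exact ⟨by omega, this.2⟩
  · have := he h ρ hρ; exact ⟨by omega, this.2⟩

theorem Pu.ifEq (ha : Pu I L a va ca) (hb : Pu I L b vb cb)
    (ht : va = vb → Pu I L t v c) (he : va ≠ vb → Pu I L e v c) :
    Pu I L (ifEqE a b t e) v (ca + cb + c + 1) := fun δ =>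
  Ev.ifEq ha hb (fun h => ht h δ) (fun h => he h δ)

theorem Ev.ifLt (ha : Pu I L a va ca) (hb : Pu I L b vb cb)
    (ht : va.toNat < vb.toNat → Ev I L δ t c Q) (he : ¬ va.toNat < vb.toNat → Ev I L δ e c Q) :
    Ev I L δ (ifLtE a b t e) (ca + cb + c + 1) Q := fun ρ hρ => by
  obtain ⟨h1, h2, h3⟩ := ha δ ρ hρ
  obtain ⟨h4, h5, h6⟩ := hb δ _ (getElem?_snoc hρ va)
  simp only [List.length_append, List.length_singleton] at h4 h5 h6
  simp only [ifLtE, eval, h2, h3, h5, h6]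
  split_ifs with h
  · have := ht h ρ hρ; exact ⟨by omega, this.2⟩
  · have := he h ρ hρ; exact ⟨by omega, this.2⟩

theorem Ev.lett {f : ℕ → T} (ha : Ev I L δ a ca Q')
    (hf : ∀ x v δ', Q' v δ' → Ev I ((x, v) :: L) δ' (f x) c Q) :
    Ev I L δ (letE a f) (ca + c + 1) Q := fun ρ hρ => by
  obtain ⟨h1, h2⟩ := ha ρ hρ
  have := hf ρ.length _ _ h2 (ρ ++ [(eval I (a ρ.length) ρ δ).1]) (by
    intro p hp
    rcases List.mem_cons.1 hp with rfl | hp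
    · simp
    · exact getElem?_snoc hρ _ p hp)
  simp only [List.length_append, List.length_singleton] at this
  simp only [letE, eval]
  exact ⟨by omega, this.2⟩

theorem Ev.letPu {f : ℕ → T} (ha : Pu I L a va ca)
    (hf : ∀ x, Ev I ((x, va) :: L) δ (f x) c Q) : Ev I L δ (letE a f) (ca + c + 1) Q :=
  Ev.lett (ha δ) fun x v δ' h => by rw [h.1, h.2]; exact hf x

theorem Pu.lett {f : ℕ → T} (ha : Pu I L a va ca)
    (hf : ∀ x, Pu I ((x, va) :: L) (f x) v c) : Pu I L (letE a f) v (ca + c + 1) := fun δ =>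
  Ev.letPu ha fun x => hf x δ

theorem Ev.get (ha : Pu I L a va ca) (hQ : Q (δ va) δ) : Ev I L δ (getE a) (ca + 1) Q :=
  fun ρ hρ => by
    obtain ⟨h1, h2, h3⟩ := ha δ ρ hρ
    simp only [getE, eval, h2, h3]
    exact ⟨by omega, hQ⟩

theorem Ev.put (ha : Pu I L a va ca) (hb : Pu I L b vb cb)
    (hQ : Q (.num 0) (Function.update δ va vb)) : Ev I L δ (putE a b) (ca + cb + 1) Q :=
  fun ρ hρ => by
    obtain ⟨h1, h2, h3⟩ := ha δ ρ hρ
    obtain ⟨h4, h5, h6⟩ := hb δ _ (getElem?_snoc hρ va)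
    simp only [List.length_append, List.length_singleton] at h4 h5 h6
    simp only [putE, eval, h2, h3, h5, h6]
    exact ⟨by omega, hQ⟩

/-- Every iteration starts in the same environment extended by three places, so one bound `c` for
the body serves all of them. The invariant `J` may depend on the steps that remain, on the
accumulator and on the dictionary. -/
theorem Ev.loopSteps {f : ℕ → ℕ → T} {d : Dat} (hl : Pu I L l d ca) (hi : Ev I L δ i cb Q')
    (J : List (Dat × Dat) → Dat → Dict → Prop) (h0 : ∀ v δ', Q' v δ' → J d.steps v δ')
    (hstep : ∀ x r acc δ' xi ai, J (x :: r) acc δ' →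
      Ev I ((xi, x.1) :: (ai, acc) :: L) δ' (f xi ai) c (J r))
    (hQ : ∀ v δ', J [] v δ' → Q v δ') :
    Ev I L δ (loopE l i f) (ca + cb + 1 + d.steps.length * (c + 1)) Q := fun ρ hρ => by
  obtain ⟨h1, h2, h3⟩ := hl δ ρ hρ
  obtain ⟨h4, h5⟩ := hi _ (getElem?_snoc hρ d)
  simp only [List.length_append, List.length_singleton] at h4 h5
  have key : ∀ (s : List (Dat × Dat)) (st : Dat × Dict × ℕ), J s st.1 st.2.1 →
      (s.foldl (loopStep I (f (ρ.length + 1 + 1) (ρ.length + 1) (ρ.length + 1 + 1 + 1)) ρ) st).2.2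
        ≤ st.2.2 + s.length * (c + 1) ∧
      J [] (s.foldl (loopStep I (f (ρ.length + 1 + 1) (ρ.length + 1) (ρ.length + 1 + 1 + 1)) ρ)
        st).1 (s.foldl (loopStep I (f (ρ.length + 1 + 1) (ρ.length + 1)
          (ρ.length + 1 + 1 + 1)) ρ) st).2.1 := by
    intro s
    induction s with
    | nil => intro st hst; exact ⟨by simp, hst⟩
    | cons x r ih =>
      intro st hst
      have hs := hstep x r st.1 st.2.1 (ρ.length + 1 + 1) (ρ.length + 1) hst
        (ρ ++ [x.2] ++ [st.1] ++ [x.1]) (by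
          intro p hp
          rcases List.mem_cons.1 hp with rfl | hp
          · rw [List.getElem?_append_right (by simp)]; simp
          rcases List.mem_cons.1 hp with rfl | hp
          · rw [List.getElem?_append_left (by simp), List.getElem?_append_right (by simp)]; simp
          · exact getElem?_snoc (getElem?_snoc (getElem?_snoc hρ _) _) _ p hp)
      rw [show (ρ ++ [x.2] ++ [st.1] ++ [x.1]).length = ρ.length + 1 + 1 + 1 by simp] at hs
      obtain ⟨i1, i2⟩ := ih (loopStep I _ ρ st x) hs.2
      refine ⟨i1.trans ?_, i2⟩
      have h2 := hs.1
      simp only [loopStep, List.length_cons, Nat.add_mul, one_mul]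
      omega
  obtain ⟨k1, k2⟩ := key d.steps (_, _, (eval I (l ρ.length) ρ δ).2.2 +
    (eval I (i (ρ.length + 1)) (ρ ++ [d]) δ).2.2 + 1) (h0 _ _ h5)
  simp only [loopE, eval, h2, h3]
  exact ⟨k1.trans (by simp only; omega), hQ _ _ k2⟩

/-- The tree that stands for a list. -/
def encL : List Dat → Dat
  | [] => .num 0
  | x :: r => .cons x (encL r)

theorem steps_encL (l : List Dat) : (encL l).steps.map Prod.fst = l := by
  induction l with
  | nil => rfl
  | cons x r ih => simp [encL, Dat.steps, ih]

theorem steps_num (n : ℕ) : (Dat.num n).steps.map Prod.fst = (List.range n).reverse.map .num := by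
  induction n with
  | zero => rfl
  | succ n ih =>
    simp only [Dat.steps] at ih
    simp [Dat.steps, Dat.natSteps, ih, List.range_succ]

theorem Ev.loop {f : ℕ → ℕ → T} {d : Dat} {xs : List Dat} (hl : Pu I L l d ca)
    (hd : d.steps.map Prod.fst = xs) (hi : Ev I L δ i cb Q')
    (J : List Dat → Dat → Dict → Prop) (h0 : ∀ v δ', Q' v δ' → J xs v δ')
    (hstep : ∀ x r acc δ' xi ai, J (x :: r) acc δ' →
      Ev I ((xi, x) :: (ai, acc) :: L) δ' (f xi ai) c (J r))
    (hQ : ∀ v δ', J [] v δ' → Q v δ') :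
    Ev I L δ (loopE l i f) (ca + cb + 1 + xs.length * (c + 1)) Q := by
  have := Ev.loopSteps hl hi (fun s => J (s.map Prod.fst)) (by rw [hd]; exact h0)
    (fun x r acc δ' xi ai h => hstep _ _ _ _ _ _ h) (c := c) (Q := Q) hQ
  rwa [← hd, List.length_map]

/-- A loop over a list that computes a right fold of the reversed list. -/
theorem Pu.foldl {α : Type*} {enc : α → Dat} {f : ℕ → ℕ → T} {xs : List α}
    (hl : Pu I L l (encL (xs.map enc)) ca) (F : List α → Dat) (hi : Pu I L i (F []) cb)
    (hstep : ∀ a w xi ai, (a :: w) <:+ xs.reverse →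
      Pu I ((xi, enc a) :: (ai, F w) :: L) (f xi ai) (F (a :: w)) c) :
    Pu I L (loopE l i f) (F xs.reverse) (ca + cb + 1 + xs.length * (c + 1)) := fun δ => by
  have := Ev.loop (δ := δ) hl (steps_encL _) (hi δ)
    (fun r v δ' => ∃ u w, xs.reverse = u.reverse ++ w ∧ r = u.map enc ∧ v = F w ∧ δ' = δ)
    (fun v δ' h => ⟨xs, [], by simp, rfl, h⟩) (c := c) (f := f)
    (Q := fun w δ' => w = F xs.reverse ∧ δ' = δ) ?_ ?_
  · simpa using this
  · rintro x r acc δ' xi ai ⟨u, w, h1, h2, rfl, rfl⟩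
    cases u with
    | nil => simp at h2
    | cons a u =>
      simp only [List.map_cons, List.cons.injEq] at h2
      obtain ⟨rfl, rfl⟩ := h2
      refine (hstep a w xi ai ⟨u.reverse, by simp [h1]⟩ δ').mono le_rfl fun v δ'' h => ?_
      exact ⟨u, a :: w, by simp [h1], rfl, h.1, h.2⟩
  · rintro v δ' ⟨u, w, h1, h2, h3, h4⟩
    obtain rfl : u = [] := by simpa using h2.symm
    simp only [List.reverse_nil, List.nil_append] at h1
    exact ⟨by rw [h1]; exact h3, h4⟩

def revE (l : T) : T := loopE l (numE 0) fun x acc => pairE (varE x) (varE acc)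

theorem Pu.rev {α : Type*} {enc : α → Dat} {xs : List α} (hl : Pu I L l (encL (xs.map enc)) ca) :
    Pu I L (revE l) (encL (xs.reverse.map enc)) (ca + 2 + xs.length * 4) :=
  (Pu.foldl hl (fun w => encL (w.map enc)) (Pu.num 0) fun a w xi ai _ =>
    Pu.pair (Pu.var (by simp)) (Pu.var (by simp))).congr rfl (by omega)

/-- A right fold. -/
def foldrE (l i : T) (f : ℕ → ℕ → T) : T := loopE (revE l) i f

/-- A loop meets the head of a list first, whereas functions of words are defined by recursion from
the end. The list is therefore reversed beforehand, which accounts for four more units per element.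
-/
theorem Pu.foldr {α : Type*} {enc : α → Dat} {f : ℕ → ℕ → T} {xs : List α}
    (hl : Pu I L l (encL (xs.map enc)) ca) (F : List α → Dat) (hi : Pu I L i (F []) cb)
    (hstep : ∀ a w xi ai, (a :: w) <:+ xs →
      Pu I ((xi, enc a) :: (ai, F w) :: L) (f xi ai) (F (a :: w)) c) :
    Pu I L (foldrE l i f) (F xs) (ca + cb + 3 + xs.length * (c + 5)) := by
  have := Pu.foldl (hl.rev) F hi (c := c) (f := f) (by simpa using hstep)
  rw [List.reverse_reverse] at this
  refine this.congr rfl ?_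
  rw [List.length_reverse, Nat.mul_add, Nat.mul_add]
  omega

/-- The images of the elements of `l`, consed onto the list `i`. -/
def mapOntoE (l i : T) (f : ℕ → T) : T := loopE l i fun x acc => pairE (f x) (varE acc)

/-- The images are consed one after the other and so end up in reverse order. `rightsLoop` and
`introLoop` are defined with the same reversals. -/
theorem Pu.mapOnto {α β : Type*} {enc : α → Dat} {enc' : β → Dat} {g : α → β} {f : ℕ → T}
    {xs : List α} {ys : List β} (hl : Pu I L l (encL (xs.map enc)) ca)
    (hi : Pu I L i (encL (ys.map enc')) cb)
    (hf : ∀ a xi ai w, a ∈ xs → Pu I ((xi, enc a) :: (ai, w) :: L) (f xi) (enc' (g a)) c) :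
    Pu I L (mapOntoE l i f) (encL (((xs.map g).reverse ++ ys).map enc'))
      (ca + cb + 1 + xs.length * (c + 3)) := by
  have := Pu.foldl hl (fun w => encL ((w.map g ++ ys).map enc')) (by simpa using hi) (c := c + 2)
    (f := fun x acc => pairE (f x) (varE acc)) (fun a w xi ai hs =>
      (Pu.pair (hf a xi ai _ (by
        have := hs.mem (List.mem_cons_self)
        simpa using this)) (Pu.var (v := encL ((w.map g ++ ys).map enc')) (by simp))).congr
          (by simp [encL]) (by omega))
  exact this.congr (by rw [List.map_reverse]) le_rfl

end rules

end TreeLang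

/-! ### Words that describe interval representations -/

/-- A word lists ends of intervals; `none` is a star, which marks that the colour changes. -/
abbrev Word (V : Type*) := List (Option V)

namespace Word

section defs

variable {V : Type*}

/-- Prepending a letter; three stars in a row are replaced by one. -/
def ncons : Option V → Word V → Word V
  | none, none :: none :: s => none :: s
  | a, w => a :: w

/-- The parity of the number of stars. -/
def par : Word V → Bool
  | [] => false
  | none :: w => !par w
  | some _ :: w => par w

/-- The word with all runs of stars shortened to at most two. -/
def nrm : Word V → Word V
  | [] => []
  | a :: w => ncons a (nrm w)

/-- Prepending `k` stars. -/
def nst : ℕ → Word V → Word V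
  | 0, w => w
  | k + 1, w => ncons none (nst k w)

/-- There are no three stars in a row. -/
def Norm : Word V → Prop
  | [] => True
  | some _ :: w => Norm w
  | none :: w => Norm w ∧ ∀ s, w ≠ none :: none :: s

variable [DecidableEq V]

/-- The interval of `v` is open at the beginning of the word, when it is read from its end. -/
def opn (v : V) : Word V → Bool
  | [] => false
  | a :: w => if a = some v then !opn v w else opn v w

/-- The intervals of `u` and `v` intersect. -/
def meets (u v : V) : Word V → Bool
  | [] => false
  | a :: w => (opn u (a :: w) && opn v (a :: w)) || meets u v w

/-- The interval of some vertex in `P` is open at the beginning of the word. -/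
def Cov (P : Finset V) (w : Word V) : Prop := ∃ u ∈ P, opn u w = true

/-- Recolouring a word when the vertex `x` is forgotten. -/
def fg (x : V) : Word V → Word V
  | [] => []
  | none :: w => if opn x w then fg x w else ncons none (fg x w)
  | some y :: w =>
    if y = x then (if par w then fg x w else ncons none (fg x w)) else some y :: fg x w

/-- The words in which the right end of `x` is placed at the beginning. -/
def newEnd (x : V) (s : Word V) : List (Word V) :=
  if par s then [] else [some x :: s, some x :: ncons none (ncons none s)]

/-- The words in which the right end of `x` is placed with no star left of it. -/
def rights (x : V) : Word V → List (Word V)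
  | [] => newEnd x []
  | none :: w => newEnd x (none :: w)
  | some a :: w => newEnd x (some a :: w) ++ (rights x w).map (some a :: ·)

/-- Placing the left end of `x` at the beginning. -/
def leftEnd (x : V) (l : List (Word V)) : List (Word V) :=
  l.map (some x :: ·) ++ l.map (fun w => ncons none (ncons none (some x :: w)))

/-- The words that arise by introducing `x`. -/
def intro (x : V) : Word V → List (Word V)
  | [] => leftEnd x (rights x [])
  | a :: w => leftEnd x (rights x (a :: w)) ++ (intro x w).map (ncons a)

/-- The condition under which gaps with `t` and `d` stars, which end with the colours `c` and `e`,
can be merged. -/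
def gapOk (c : Bool) (t : ℕ) (e : Bool) (d : ℕ) : Prop :=
  ¬ (c ∧ e) ∧ (t = 0 → c → d = 0) ∧ (d = 0 → e → t = 0)

/-- Merging words that start with letters. -/
inductive Merge : Word V → Word V → Word V → Prop where
  | nil : Merge [] [] []
  | cons {w₁ w₂ w : Word V} (a : V) (t d : ℕ) : Merge w₁ w₂ w → t ≤ 2 → d ≤ 2 →
      gapOk (par w₁) t (par w₂) d →
      Merge (some a :: (List.replicate t none ++ w₁)) (some a :: (List.replicate d none ++ w₂))
        (some a :: nst (t + d) w)

/-- Merging words. -/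
def Joins (σ₁ σ₂ σ : Word V) : Prop :=
  ∃ w₁ w₂ w t d, Merge w₁ w₂ w ∧ t ≤ 2 ∧ d ≤ 2 ∧ gapOk (par w₁) t (par w₂) d ∧
    σ₁ = List.replicate t none ++ w₁ ∧ σ₂ = List.replicate d none ++ w₂ ∧ σ = nst (t + d) w

/-- The number of ends of intervals other than `x` that intersect `x`. -/
def gain (x : V) (σ : Word V) : ℕ :=
  σ.countP fun a => a.any fun y => y ≠ x && meets x y σ

open Classical in
/-- The letters in `B`, and stars that tell where intervals of vertices in `P` are open. -/
noncomputable def canon (P B : Finset V) : Word V → Word V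
  | [] => []
  | a :: w => if ∃ b ∈ B, a = some b then a :: canon P B w
    else if (Cov P (a :: w) ↔ Cov P w) then canon P B w else ncons none (canon P B w)

end defs

variable {V : Type*}

@[simp] theorem ncons_some (a : V) (w : Word V) : ncons (some a) w = some a :: w := by
  cases w <;> simp [ncons]

theorem ncons_none_eq (w : Word V) : ncons none w = none :: w ∨
    ∃ s, w = none :: none :: s ∧ ncons none w = none :: s := by
  unfold ncons; split <;> simp_all

theorem Norm.tail {a : Option V} {w : Word V} (h : Norm (a :: w)) : Norm w := by
  cases a with
  | none => exact h.1
  | some a => exact h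

theorem Norm.letter (a : V) {w : Word V} (h : Norm w) : Norm (some a :: w) := h

theorem Norm.ncons (a : Option V) {w : Word V} (h : Norm w) : Norm (ncons a w) := by
  cases a with
  | some a => rw [ncons_some]; exact h
  | none =>
    unfold Word.ncons
    split
    · exact h.tail
    · rename_i h1; exact ⟨h, fun s hs => h1 s rfl hs⟩
    
theorem ncons_three {w : Word V} (h : Norm w) :
    ncons none (ncons none (ncons none w)) = ncons none w := by
  match w, h with
  | [], _ => rfl
  | some a :: w, _ => rfl
  | [none], _ => rfl
  | none :: some a :: w, _ => rfl
  | none :: none :: [], _ => rfl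
  | none :: none :: some a :: w, _ => rfl
  | none :: none :: none :: w, h => exact absurd rfl (h.2 w)

theorem Norm.nst {w : Word V} (h : Norm w) (k : ℕ) : Norm (nst k w) := by
  induction k with
  | zero => exact h
  | succ k ih => exact ih.ncons none

theorem par_ncons (a : Option V) (w : Word V) : par (ncons a w) = par (a :: w) := by
  cases a with
  | some a => simp
  | none => rcases ncons_none_eq w with h | ⟨s, rfl, h⟩ <;> rw [h]; simp [par]

theorem par_append (u w : Word V) : par (u ++ w) = xor (par u) (par w) := by
  induction u with
  | nil => simp [par]
  | cons a u ih => cases a <;> simp [par, ih]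

theorem par_replicate (k : ℕ) (w : Word V) :
    par (List.replicate k none ++ w) = xor (k % 2 = 1) (par w) := by
  induction k with
  | zero => simp [nst]
  | succ k ih =>
    rw [List.replicate_succ, List.cons_append, par, ih]
    rcases Nat.mod_two_eq_zero_or_one k with h | h <;> simp [Nat.add_mod, h]

variable [DecidableEq V]

@[simp] theorem opn_none (v : V) (w : Word V) : opn v (none :: w) = opn v w := by simp [opn]

theorem opn_ne {u v : V} (h : u ≠ v) (w : Word V) : opn v (some u :: w) = opn v w := by
  simp [opn, h]

@[simp] theorem opn_self (v : V) (w : Word V) : opn v (some v :: w) = !opn v w := by simp [opn]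

theorem opn_ncons (v : V) (a : Option V) (w : Word V) : opn v (ncons a w) = opn v (a :: w) := by
  cases a with
  | some a => simp
  | none => rcases ncons_none_eq w with h | ⟨s, rfl, h⟩ <;> rw [h]; simp [opn]

theorem meets_of_opn {u v : V} {w : Word V} (hu : opn u w = true) (hv : opn v w = true) :
    meets u v w = true := by
  cases w with
  | nil => simp [opn] at hu
  | cons a w => simp [meets, hu, hv]

theorem meets_comm (u v : V) (w : Word V) : meets u v w = meets v u w := by
  induction w with
  | nil => rfl
  | cons a w ih => simp only [meets, ih, Bool.and_comm]

theorem meets_skip {u v : V} {a : Option V} (hu : a ≠ some u) (hv : a ≠ some v) (w : Word V) :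
    meets u v (a :: w) = meets u v w := by
  simp only [meets, opn, hu, hv, if_false]
  cases h1 : opn u w <;> cases h2 : opn v w <;> simp
  exact meets_of_opn h1 h2

theorem opn_filter {p : Option V → Bool} {v : V} (h : p (some v) = true) (w : Word V) :
    opn v (w.filter p) = opn v w := by
  induction w with
  | nil => rfl
  | cons a w ih =>
    by_cases ha : p a = true
    · simp only [List.filter_cons, ha, if_true, opn, ih]
    · have : a ≠ some v := by rintro rfl; exact ha h
      simpa [List.filter_cons, ha, opn, this] using ih

theorem meets_filter {p : Option V → Bool} {u v : V} (hu : p (some u) = true)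
    (hv : p (some v) = true) (w : Word V) : meets u v (w.filter p) = meets u v w := by
  induction w with
  | nil => rfl
  | cons a w ih =>
    by_cases ha : p a = true
    · simp only [List.filter_cons, ha, if_true]
      have := opn_filter hu (a :: w)
      have h2 := opn_filter hv (a :: w)
      simp only [List.filter_cons, ha, if_true] at this h2
      simp only [meets, ih, this, h2]
    · rw [meets_skip (by rintro rfl; exact ha hu) (by rintro rfl; exact ha hv), ← ih]
      simp [List.filter_cons, ha]

theorem cov_nil (P : Finset V) : ¬ Cov P [] := by simp [Cov, opn]

theorem cov_skip {P : Finset V} {a : Option V} (h : ∀ u ∈ P, a ≠ some u) (w : Word V) :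
    Cov P (a :: w) ↔ Cov P w := by
  refine exists_congr fun u => and_congr_right fun hu => ?_
  simp [opn, h u hu]

/-! ### The word of a node, and forgetting a vertex -/

section canon

variable {P B : Finset V}

theorem norm_canon (w : Word V) : Norm (canon P B w) := by
  induction w with
  | nil => trivial
  | cons a w ih =>
    rw [canon]
    split_ifs with h
    · obtain ⟨b, _, rfl⟩ := h; exact ih
    · exact ih
    · exact ih.ncons none

/-- Nothing is covered at the end of the word, each change of coverage adds a star, and shortening
runs keeps their parity. Letters of `B` do not change coverage since `P` and `B` are disjoint. -/
theorem par_canon (h : Disjoint P B) (w : Word V) : par (canon P B w) = true ↔ Cov P w := by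
  induction w with
  | nil => simp [canon, par, cov_nil]
  | cons a w ih =>
    rw [canon]
    split_ifs with h1 h2
    · obtain ⟨b, hb, rfl⟩ := h1
      rw [par, ih, cov_skip]
      intro u hu e
      rw [Option.some_inj] at e
      exact Finset.disjoint_left.1 h hu (e ▸ hb)
    · rw [ih, h2]
    · rw [par_ncons, par]
      cases hp : par (canon P B w) <;> simp_all

theorem opn_canon {v : V} (hv : v ∈ B) (w : Word V) : opn v (canon P B w) = opn v w := by
  induction w with
  | nil => rfl
  | cons a w ih =>
    rw [canon]
    split_ifs with h1 h2
    · simp only [opn, ih]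
    all_goals
      have : a ≠ some v := by rintro rfl; exact h1 ⟨v, hv, rfl⟩
      simp [opn_ncons, opn, ih, this]

theorem meets_ncons {u v : V} (w : Word V) : meets u v (ncons none w) = meets u v w := by
  rcases ncons_none_eq w with h | ⟨s, rfl, h⟩ <;> rw [h] <;>
    simp only [meets_skip (u := u) (v := v) (a := none) (by simp) (by simp)]

theorem meets_canon {u v : V} (hu : u ∈ B) (hv : v ∈ B) (w : Word V) :
    meets u v (canon P B w) = meets u v w := by
  induction w with
  | nil => rfl
  | cons a w ih =>
    rw [canon]
    split_ifs with h1 h2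
    · simp only [meets, ih, opn, opn_canon hu, opn_canon hv]
    all_goals
      rw [meets_skip (a := a) (by rintro rfl; exact h1 ⟨u, hu, rfl⟩)
        (by rintro rfl; exact h1 ⟨v, hv, rfl⟩)]
      simp only [meets_ncons, ih]

theorem count_canon {v : V} (hv : v ∈ B) (w : Word V) :
    (canon P B w).count (some v) = w.count (some v) := by
  induction w with
  | nil => rfl
  | cons a w ih =>
    rw [canon]
    split_ifs with h1 h2
    · simp [List.count_cons, ih]
    all_goals
      have : a ≠ some v := by rintro rfl; exact h1 ⟨v, hv, rfl⟩
      rw [List.count_cons_of_ne (by simpa using this), ← ih]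
    rcases ncons_none_eq (canon P B w) with h | ⟨s, hs, h⟩ <;> rw [h]
    · simp
    · rw [hs]; simp

theorem mem_canon {v : V} {w : Word V} (hv : some v ∈ canon P B w) : v ∈ B := by
  induction w with
  | nil => simp [canon] at hv
  | cons a w ih =>
    rw [canon] at hv
    split_ifs at hv with h1 h2
    · obtain ⟨b, hb, rfl⟩ := h1
      rcases List.mem_cons.1 hv with h | h
      · rw [Option.some_inj] at h; rwa [h]
      · exact ih h
    · exact ih hv
    · rcases ncons_none_eq (canon P B w) with h | ⟨s, hs, h⟩ <;> rw [h] at hv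
      · exact ih (by simpa using hv)
      · exact ih (by rw [hs]; simpa using hv)

theorem norm_fg (x : V) (w : Word V) : Norm (fg x w) := by
  induction w with
  | nil => trivial
  | cons a w ih =>
    cases a with
    | none => rw [fg]; split_ifs; exacts [ih, ih.ncons _]
    | some y =>
      rw [fg]
      split_ifs
      · exact ih
      · exact ih.ncons none
      · exact ih

theorem fg_ncons (x : V) (w : Word V) :
    fg x (ncons none w) = if opn x w then fg x w else ncons none (fg x w) := by
  rcases ncons_none_eq w with h | ⟨s, rfl, h⟩ <;> rw [h]
  · rw [fg]
  · simp only [fg, opn_none]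
    split_ifs
    · rfl
    · rw [ncons_three (norm_fg x s)]

-- After `x` is forgotten, a place is covered if it was covered by `P` or lies in the interval of
-- `x`. Both can be read off the old word: the former from the parity, the latter from the letters
-- `x`. Hence stars inside the interval of `x` disappear, and an end of `x` becomes a star unless
-- `P` covers it.
open Classical in
theorem canon_forget {x : V} (hP : x ∉ P) (hB : x ∉ B) (h : Disjoint P B) (w : Word V) :
    canon (insert x P) B w = fg x (canon P (insert x B) w) := by
  have hd : Disjoint P (insert x B) := by simp [h, hP]
  have hcov : ∀ w, Cov (insert x P) w ↔ opn x w = true ∨ Cov P w := fun w => by simp [Cov]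
  induction w with
  | nil => rfl
  | cons a w ih =>
    by_cases ha : ∃ b ∈ B, a = some b
    · obtain ⟨b, hb, rfl⟩ := ha
      have : b ≠ x := by rintro rfl; exact hB hb
      rw [canon, if_pos ⟨b, hb, rfl⟩, canon, if_pos ⟨b, by simp [hb], rfl⟩, fg, if_neg this, ih]
    rw [canon, if_neg ha]
    by_cases hx : a = some x
    · subst hx
      have hs : Cov P (some x :: w) ↔ Cov P w :=
        cov_skip (fun u hu e => hP (by rw [Option.some_inj] at e; rwa [e])) w
      have hR : canon P (insert x B) (some x :: w) = some x :: canon P (insert x B) w := by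
        rw [canon, if_pos ⟨x, by simp, rfl⟩]
      rw [hR, fg, if_pos rfl, hcov, hcov, hs, ih]
      have := par_canon hd w
      by_cases hc : Cov P w
      · rw [if_pos (by simp [hc]), if_pos (this.2 hc)]
      · rw [if_neg (by simp [hc]), if_neg (fun e => hc (this.1 e))]
    · have hR : canon P (insert x B) (a :: w) = if (Cov P (a :: w) ↔ Cov P w)
          then canon P (insert x B) w else ncons none (canon P (insert x B) w) := by
        rw [canon, if_neg (by simpa [hx] using ha)]
      rw [hR, hcov, hcov, ih]
      have ho : opn x (a :: w) = opn x w := by simp [opn, hx]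
      have ho2 := opn_canon (P := P) (Finset.mem_insert_self x B) w
      by_cases hc : Cov P (a :: w) ↔ Cov P w
      · rw [if_pos hc, if_pos (by rw [ho, hc])]
      · rw [if_neg hc, fg_ncons, ho, ho2]
        cases hxo : opn x w <;> simp
        tauto

end canon

/-! ### Introducing a vertex -/

section introduce

variable {P B : Finset V} {x : V}

theorem norm_rights {w l : Word V} (hw : Norm w) (hl : l ∈ rights x w) : Norm l := by
  have hn : ∀ {w l : Word V}, Norm w → l ∈ newEnd x w → Norm l := fun {w l} hw hl => by
    unfold newEnd at hl
    split_ifs at hl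
    · simp at hl
    · simp only [List.mem_cons, List.not_mem_nil, or_false] at hl
      rcases hl with rfl | rfl
      · exact hw
      · exact (hw.ncons none).ncons none
  induction w generalizing l with
  | nil => exact hn hw hl
  | cons a w ih =>
    cases a with
    | none => exact hn hw hl
    | some a =>
      simp only [rights, List.mem_append, List.mem_map] at hl
      rcases hl with hl | ⟨s, hs, rfl⟩
      · exact hn hw hl
      · exact (ih hw.tail hs).letter a

theorem mem_leftEnd {L : List (Word V)} {l : Word V} : l ∈ leftEnd x L ↔
    ∃ s ∈ L, l = some x :: s ∨ l = ncons none (ncons none (some x :: s)) := by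
  simp only [leftEnd, List.mem_append, List.mem_map]
  constructor
  · rintro (⟨s, hs, rfl⟩ | ⟨s, hs, rfl⟩)
    exacts [⟨s, hs, .inl rfl⟩, ⟨s, hs, .inr rfl⟩]
  · rintro ⟨s, hs, rfl | rfl⟩
    exacts [.inl ⟨s, hs, rfl⟩, .inr ⟨s, hs, rfl⟩]

theorem leftEnd_subset_intro {w l : Word V} (h : l ∈ leftEnd x (rights x w)) : l ∈ intro x w := by
  cases w with
  | nil => exact h
  | cons a w => exact List.mem_append_left _ h

theorem newEnd_subset_rights {w l : Word V} (h : l ∈ newEnd x w) : l ∈ rights x w := by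
  match w with
  | [] => exact h
  | none :: w => exact h
  | some a :: w => exact List.mem_append_left _ h

theorem norm_intro {w l : Word V} (hw : Norm w) (hl : l ∈ intro x w) : Norm l := by
  have hn : ∀ {w l : Word V}, Norm w → l ∈ leftEnd x (rights x w) → Norm l := fun {w l} hw hl => by
    obtain ⟨s, hs, rfl | rfl⟩ := mem_leftEnd.1 hl
    · exact (norm_rights hw hs).letter x
    · exact Norm.ncons _ (Norm.ncons _ ((norm_rights hw hs).letter x))
  induction w generalizing l with
  | nil => exact hn hw hl
  | cons a w ih =>
    simp only [intro, List.mem_append, List.mem_map] at hl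
    rcases hl with hl | ⟨s, hs, rfl⟩
    · exact hn hw hl
    · exact (ih hw.tail hs).ncons a

/-- This reconciles introducing with shortening runs. The critical case is a star in front of two
stars, where the three become one: positions of `x` around the vanished stars have to be available
around the remaining one. The variants with additional double stars in `newEnd` and `leftEnd` exist
for this purpose. -/
theorem ncons_mem_intro {w l : Word V} (hw : Norm w) (hl : l ∈ intro x w) :
    ncons none l ∈ intro x (ncons none w) := by
  rcases ncons_none_eq w with h | ⟨s, rfl, h⟩ <;> rw [h]
  · exact List.mem_append_right _ (List.mem_map_of_mem hl)
  have hs : Norm s := hw.tail.tail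
  have h2 : ncons none (ncons none s) = none :: none :: s := by
    match s, hw with
    | [], _ => rfl
    | some a :: s, _ => rfl
    | none :: s, hw => exact absurd rfl (hw.2 s)
  have h3 : ncons none (ncons none (none :: none :: s)) = none :: none :: s := by
    match s, hw with
    | [], _ => rfl
    | some a :: s, _ => rfl
    | none :: s, hw => exact absurd rfl (hw.2 s)
  simp only [intro, List.mem_append, List.mem_map] at hl
  rcases hl with hl | ⟨τ, hτ, rfl⟩
  · have key : ncons none (some x :: some x :: none :: none :: s) ∈ intro x (none :: s) := by
      by_cases hp : par s = true
      · obtain ⟨r, hr, _⟩ := mem_leftEnd.1 hl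
        simp [rights, newEnd, par, hp] at hr
      · refine List.mem_append_right _ (List.mem_map_of_mem (leftEnd_subset_intro ?_))
        refine mem_leftEnd.2 ⟨_, newEnd_subset_rights ?_, .inl rfl⟩
        simp [newEnd, hp, h2]
    obtain ⟨r, hr, hl⟩ := mem_leftEnd.1 hl
    have hr2 : r = some x :: none :: none :: s := by
      simp only [rights, newEnd] at hr
      split_ifs at hr
      · simp at hr
      · simpa [h3] using hr
    subst hr2
    rcases hl with rfl | rfl
    · exact key
    · rwa [ncons_three (by exact hw)]
  · rcases hτ with hτ | hτ
    -- The left end of `x` is between the two stars. After shortening it is placed left of the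
    -- remaining star, with a double star added in front.
    · obtain ⟨r, hr, rfl | rfl⟩ := mem_leftEnd.1 hτ
      · exact leftEnd_subset_intro (mem_leftEnd.2 ⟨r, hr, .inr rfl⟩)
      · refine leftEnd_subset_intro (mem_leftEnd.2 ⟨r, hr, .inr ?_⟩)
        rw [ncons_three ((norm_rights (w := none :: s) hw.tail hr).letter x)]
    -- The interval of `x` is right of both stars, and three stars in front of it shorten to one.
    · obtain ⟨υ, hυ, rfl⟩ := hτ
      rw [ncons_three (norm_intro hs hυ)]
      exact List.mem_append_right _ (List.mem_map_of_mem hυ)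

theorem opn_eq_count (v : V) (w : Word V) : opn v w = decide (w.count (some v) % 2 = 1) := by
  induction w with
  | nil => rfl
  | cons a w ih =>
    by_cases h : a = some v
    · subst h
      rw [opn_self, ih, List.count_cons_self]
      rcases Nat.mod_two_eq_zero_or_one (w.count (some v)) with h | h <;> simp [Nat.add_mod, h]
    · rw [List.count_cons_of_ne (by simpa using h), ← ih]
      simp [opn, h]

open Classical in
theorem canon_insert {a : Option V} (ha : a ≠ some x) (w : Word V) :
    canon P (insert x B) (a :: w) = if ∃ b ∈ B, a = some b then a :: canon P (insert x B) w
    else if (Cov P (a :: w) ↔ Cov P w) then canon P (insert x B) w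
      else ncons none (canon P (insert x B) w) := by
  rw [canon]
  congr 1
  simp [ha]

/-- The word is read from its end, and the number of letters `x` seen so far tells whether no end,
the right end or both ends have been placed. Since `x` meets no vertex of `P`, the right end lies at
an uncovered place, and coverage does not change before the left end. This is what `rights` and
`intro` demand. -/
theorem canon_introduce (hP : x ∉ P) (hB : x ∉ B) (h : Disjoint P B) {w : Word V}
    (hw : w.count (some x) ≤ 2) (hm : ∀ u ∈ P, meets u x w = false) :
    (w.count (some x) = 0 → canon P (insert x B) w = canon P B w) ∧
    (w.count (some x) = 1 → canon P (insert x B) w ∈ rights x (canon P B w)) ∧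
    (w.count (some x) = 2 → canon P (insert x B) w ∈ intro x (canon P B w)) := by
  have hx : ∀ w, canon P B (some x :: w) = canon P B w ∧
      canon P (insert x B) (some x :: w) = some x :: canon P (insert x B) w := fun w => by
    constructor
    · rw [canon, if_neg (by simpa using hB),
        if_pos (cov_skip (fun u hu e => hP (by rw [Option.some_inj] at e; rwa [e])) w)]
    · rw [canon, if_pos ⟨x, by simp, rfl⟩]
  induction w with
  | nil => simp [canon]
  | cons a w ih =>
    have hw2 : w.count (some x) ≤ 2 := (List.count_le_count_cons).trans hw
    have hm2 : ∀ u ∈ P, meets u x w = false := fun u hu => by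
      have := hm u hu; simp only [meets, Bool.or_eq_false_iff] at this; exact this.2
    obtain ⟨ih0, ih1, ih2⟩ := ih hw2 hm2
    by_cases ha : a = some x
    · subst ha
      rw [List.count_cons_self, (hx w).1, (hx w).2]
      refine ⟨by omega, fun h1 => ?_, fun h2 => ?_⟩
      · rw [ih0 (by omega)]
        -- At an odd colour some interval of `P` is open and would meet the interval of `x`, which
        -- opens here.
        have : ¬ par (canon P B w) = true := fun hp => by
          obtain ⟨u, hu, ho⟩ := (par_canon h w).1 hp
          have h2 := hm u hu
          have h3 : u ≠ x := by rintro rfl; exact hP hu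
          rw [meets_of_opn (by rw [opn_ne h3.symm]; exact ho)
            (by rw [opn_eq_count]; simp [h1])] at h2
          simp at h2
        exact newEnd_subset_rights (by simp [newEnd, this])
      · exact leftEnd_subset_intro (mem_leftEnd.2 ⟨_, ih1 (by omega), .inl rfl⟩)
    · rw [List.count_cons_of_ne (by simpa using ha), canon_insert ha]
      rw [canon]
      split_ifs with h1 h2
      · obtain ⟨b, hb, rfl⟩ := h1
        refine ⟨fun h => by rw [ih0 h], fun h => ?_, fun h => ?_⟩
        · exact List.mem_append_right _ (List.mem_map_of_mem (ih1 h))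
        · have := List.mem_map_of_mem (f := ncons (some b)) (ih2 h)
          rw [ncons_some] at this
          exact List.mem_append_right _ this
      · exact ⟨ih0, ih1, ih2⟩
      · refine ⟨fun h => by rw [ih0 h], fun h => ?_, fun h => ncons_mem_intro (norm_canon w) (ih2 h)⟩
        -- While `x` is open, neither side of `a` is covered by `P`; so the coverage cannot change
        -- here.
        refine absurd (iff_of_false ?_ ?_) h2 <;> rintro ⟨u, hu, ho⟩
        · have := hm u hu
          rw [meets_of_opn ho (by rw [opn_eq_count, List.count_cons_of_ne (by simpa using ha)]
                                  simp [h])] at this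
          simp at this
        · have := hm2 u hu
          rw [meets_of_opn ho (by rw [opn_eq_count]; simp [h])] at this
          simp at this

end introduce

/-! ### Joining the words of two children -/

section join

variable {P₁ P₂ B : Finset V}

theorem Merge.head {w₁ w₂ w : Word V} (h : Merge w₁ w₂ w) :
    (∀ s, w₁ ≠ none :: s) ∧ (∀ s, w₂ ≠ none :: s) ∧ (∀ s, w ≠ none :: s) ∧ Norm w := by
  induction h with
  | nil => simp [Norm]
  | cons a t d _ _ _ _ ih => exact ⟨by simp, by simp, by simp, ih.2.2.2.nst _⟩

theorem ncons_replicate {w : Word V} (h : ∀ s, w ≠ none :: s) {t : ℕ} (ht : t ≤ 2) :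
    ncons none (List.replicate t none ++ w) =
      List.replicate (if t = 2 then 1 else t + 1) none ++ w := by
  match t, w, ht with
  | 0, [], _ => rfl
  | 0, some a :: w, _ => rfl
  | 0, none :: w, _ => exact absurd rfl (h w)
  | 1, [], _ => rfl
  | 1, some a :: w, _ => rfl
  | 1, none :: w, _ => exact absurd rfl (h w)
  | 2, _, _ => rfl

/-- Cutting a run down in one of the words before merging has the same effect as cutting down the
merged run, since three stars count as one in both places. -/
theorem nst_cap {w : Word V} (h : Norm w) (t d : ℕ) :
    nst ((if t = 2 then 1 else t + 1) + d) w = nst (t + d + 1) w := by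
  split_ifs with ht
  · subst ht
    rw [show 2 + d + 1 = d + 3 by omega, show 1 + d = d + 1 by omega]
    exact (ncons_three (h.nst d)).symm
  · rw [show t + 1 + d = t + d + 1 by omega]

/-- While the second colour is even, the first may change freely. The last clause of `gapOk` is not
violated: a gap without stars in the second word has the same colour at both sides, here even. -/
theorem Joins.left {σ₁ σ₂ σ : Word V} (h : Joins σ₁ σ₂ σ) (h2 : par σ₂ = false) :
    Joins (ncons none σ₁) σ₂ (ncons none σ) := by
  obtain ⟨w₁, w₂, w, t, d, hm, ht, hd, hg, rfl, rfl, rfl⟩ := h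
  refine ⟨w₁, w₂, w, if t = 2 then 1 else t + 1, d, hm, by split_ifs <;> omega, hd, ?_,
    ncons_replicate hm.head.1 ht, rfl, (nst_cap hm.head.2.2.2 t d).symm⟩
  have h1 : (if t = 2 then 1 else t + 1) ≠ 0 := by split_ifs <;> omega
  refine ⟨hg.1, fun h0 => absurd h0 h1, fun h0 he => ?_⟩
  subst h0
  simp_all

theorem Joins.symm {σ₁ σ₂ σ : Word V} (h : Joins σ₁ σ₂ σ) : Joins σ₂ σ₁ σ := by
  have hg : ∀ {c t e d}, gapOk c t e d → gapOk e d c t := fun h =>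
    ⟨fun h' => h.1 h'.symm, h.2.2, h.2.1⟩
  have key : ∀ {w₁ w₂ w : Word V}, Merge w₁ w₂ w → Merge w₂ w₁ w := fun h => by
    induction h with
    | nil => exact .nil
    | cons a t d _ h1 h2 h3 ih => rw [Nat.add_comm]; exact ih.cons a d t h2 h1 (hg h3)
  obtain ⟨w₁, w₂, w, t, d, hm, ht, hd, h, rfl, rfl, rfl⟩ := h
  exact ⟨w₂, w₁, w, d, t, key hm, hd, ht, hg h, rfl, rfl, by rw [Nat.add_comm]⟩

/-- Intervals of `P₁` and `P₂` never meet, so no place is covered by both, and the coverage by the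
union changes exactly where one of the two changes. Each such change is a star in one of the words,
appended while the other colour is even. -/
theorem joins_canon (h₁ : Disjoint P₁ B) (h₂ : Disjoint P₂ B) (h : Disjoint P₁ P₂) {w : Word V}
    (hm : ∀ u ∈ P₁, ∀ v ∈ P₂, meets u v w = false) :
    Joins (canon P₁ B w) (canon P₂ B w) (canon (P₁ ∪ P₂) B w) := by
  have hcov : ∀ w, Cov (P₁ ∪ P₂) w ↔ Cov P₁ w ∨ Cov P₂ w := fun w => by
    simp only [Cov, Finset.mem_union, or_and_right, exists_or]
  have hnot : ∀ {w : Word V}, (∀ u ∈ P₁, ∀ v ∈ P₂, meets u v w = false) →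
      ¬ (Cov P₁ w ∧ Cov P₂ w) := by
    rintro w hm ⟨⟨u, hu, h1⟩, v, hv, h2⟩
    have := hm u hu v hv
    rw [meets_of_opn h1 h2] at this
    simp at this
  induction w with
  | nil => exact ⟨[], [], [], 0, 0, .nil, by simp, by simp, by simp [gapOk, par], rfl, rfl, rfl⟩
  | cons a w ih =>
    have hm2 : ∀ u ∈ P₁, ∀ v ∈ P₂, meets u v w = false := fun u hu v hv => by
      have := hm u hu v hv; simp only [meets, Bool.or_eq_false_iff] at this; exact this.2
    specialize ih hm2
    rw [canon, canon, canon]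
    split_ifs with ha c1 c2 c3 c3 c2 c3 c3
    · obtain ⟨b, hb, rfl⟩ := ha
      have hp := hnot hm2
      rw [← par_canon h₁, ← par_canon h₂] at hp
      obtain ⟨w₁, w₂, w, t, d, hm, ht, hd, hg, e1, e2, e3⟩ := ih
      refine ⟨_, _, _, 0, 0, hm.cons b t d ht hd hg, by simp, by simp, ⟨?_, by simp, by simp⟩,
        by rw [e1]; rfl, by rw [e2]; rfl, by rw [e3]; rfl⟩
      simp only [par]
      rw [← e1, ← e2]
      exact hp
    · exact ih
    · exact absurd (by rw [hcov, hcov, c1, c2]) c3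
    · have h1 := hnot hm; have h2 := hnot hm2
      rw [hcov, hcov] at c3
      exfalso; tauto
    · refine (ih.symm.left ?_).symm
      rw [← Bool.not_eq_true, par_canon h₁]
      have h1 := hnot hm; have h2 := hnot hm2; tauto
    · have h1 := hnot hm; have h2 := hnot hm2
      rw [hcov, hcov] at c3
      exfalso; tauto
    · refine ih.left ?_
      rw [← Bool.not_eq_true, par_canon h₂]
      have h1 := hnot hm; have h2 := hnot hm2; tauto
    -- Both coverages would change at `a`, but `a` is an end of at most one vertex, which is not in
    -- both sets.
    all_goals
      exfalso
      have : (∀ u ∈ P₁, a ≠ some u) ∨ (∀ u ∈ P₂, a ≠ some u) := by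
        by_contra! hc
        obtain ⟨⟨u, hu, rfl⟩, v, hv, e⟩ := hc
        rw [Option.some_inj] at e
        exact Finset.disjoint_left.1 h hu (e ▸ hv)
      rcases this with h | h
      · exact c1 (cov_skip h w)
      · exact c2 (cov_skip h w)

end join

end Word

/-! ### Forgotten vertices and derivations along the tree -/

namespace NiceTree

variable {V : Type*} [DecidableEq V]

/-- The vertices that are forgotten in the tree. -/
def past : NiceTree V → Finset V
  | leaf => ∅
  | introduce _ t => t.past
  | forget x t => insert x t.past
  | join t₁ t₂ => t₁.past ∪ t₂.past

/-- The tree is well formed, and the bags separate the forgotten vertices from the others. -/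
def Separated (G : SimpleGraph V) : NiceTree V → Prop
  | leaf => True
  | introduce x t => x ∉ t.bag ∧ x ∉ t.past ∧ t.Separated G
  | forget x t => x ∈ t.bag ∧ (∀ y, G.Adj x y → y ∈ t.past ∪ t.bag) ∧ t.Separated G
  | join t₁ t₂ => t₁.bag = t₂.bag ∧ Disjoint t₁.past t₂.past ∧ t₁.Separated G ∧ t₂.Separated G

theorem Separated.disjoint {G : SimpleGraph V} {t : NiceTree V} (h : t.Separated G) :
    Disjoint t.past t.bag := by
  induction t with
  | leaf => simp [past]
  | introduce x t ih => simp [past, bag, h.2.1, ih h.2.2]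
  | forget x t ih =>
    rw [past, bag, Finset.disjoint_insert_left]
    exact ⟨by simp, (ih h.2.2).mono_right (Finset.erase_subset _ _)⟩
  | join t₁ t₂ ih₁ ih₂ =>
    rw [past, bag, Finset.disjoint_union_left]
    exact ⟨ih₁ h.2.2.1, h.1 ▸ ih₂ h.2.2.2⟩

theorem Separated.mem {G : SimpleGraph V} {t : NiceTree V} (h : t.Separated G) {u v : V}
    (hu : u ∈ t.past) (huv : G.Adj u v) : v ∈ t.past ∪ t.bag := by
  induction t with
  | leaf => simp [past] at hu
  | introduce x t ih =>
    have := ih h.2.2 hu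
    simp only [past, bag, Finset.mem_union, Finset.mem_insert] at this ⊢
    tauto
  | forget x t ih =>
    have h2 : v ∈ t.past ∪ t.bag := by
      rcases Finset.mem_insert.1 hu with rfl | hu
      · exact h.2.1 v huv
      · exact ih h.2.2 hu
    simp only [past, bag, Finset.mem_union, Finset.mem_insert, Finset.mem_erase] at h2 ⊢
    tauto
  | join t₁ t₂ ih₁ ih₂ =>
    rcases Finset.mem_union.1 hu with hu | hu
    · have := ih₁ h.2.2.1 hu
      simp only [past, bag, Finset.mem_union] at this ⊢
      tauto
    · have := ih₂ h.2.2.2 hu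
      rw [← h.1] at this
      simp only [past, bag, Finset.mem_union] at this ⊢
      tauto

open Word in
/-- The words and values that are computed at the root of the tree. -/
inductive Der (G : SimpleGraph V) : NiceTree V → Word V → ℕ → Prop where
  | leaf : Der G leaf [] 0
  | introduce {t σ v τ} (x : V) : Der G t σ v → τ ∈ intro x σ → Der G (introduce x t) τ v
  | forget {t σ v} (x : V) : Der G t σ v →
      (∀ y, y ≠ x → some y ∈ σ → meets x y σ = true → G.Adj x y) →
      Der G (forget x t) (fg x σ) (v + gain x σ)
  | join {t₁ t₂ σ₁ σ₂ σ v₁ v₂} : Der G t₁ σ₁ v₁ → Der G t₂ σ₂ v₂ → Joins σ₁ σ₂ σ →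
      Der G (join t₁ t₂) σ (v₁ + v₂)

end NiceTree

/-! ### Counting intersecting pairs; completeness of the derivations -/

namespace Word

variable {V : Type*} [DecidableEq V]

theorem meets_count {u v : V} {w : Word V} (h : meets u v w = true) : w.count (some u) ≠ 0 := by
  induction w with
  | nil => simp [meets] at h
  | cons a w ih =>
    simp only [meets, Bool.or_eq_true, Bool.and_eq_true] at h
    rcases h with h | h
    · intro h0
      rw [opn_eq_count, h0] at h
      simp at h
    · have := ih h
      have := List.count_le_count_cons (a := some u) (b := a) (l := w)
      omega

theorem meets_count_right {u v : V} {w : Word V} (h : meets u v w = true) :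
    w.count (some v) ≠ 0 := meets_count (by rwa [meets_comm] at h)

variable [Fintype V]

/-- The number of ordered pairs of vertices that are not both outside `P` and whose intervals
intersect. -/
def val (P : Finset V) (w : Word V) : ℕ :=
  (Finset.univ.filter fun p : V × V =>
    p.1 ≠ p.2 ∧ (p.1 ∈ P ∨ p.2 ∈ P) ∧ meets p.1 p.2 w = true).card

theorem countP_any (p : V → Bool) (w : Word V) :
    w.countP (fun a => a.any p) = ∑ y with p y = true, w.count (some y) := by
  induction w with
  | nil => simp
  | cons a w ih =>
    rw [List.countP_cons, ih]
    cases a with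
    | none => simp
    | some a =>
      simp only [List.count_cons, Finset.sum_add_distrib]
      simp [Finset.sum_ite_eq]

/-- Every bag vertex has two ends in the word, so counting ends gives twice the number of vertices.
This fits values that count ordered pairs. -/
theorem gain_eq {B : Finset V} {w : Word V} (hB : ∀ y ∈ B, w.count (some y) = 2)
    (hw : ∀ y, some y ∈ w → y ∈ B) (x : V) :
    gain x w = 2 * (Finset.univ.filter fun y => y ≠ x ∧ y ∈ B ∧ meets x y w = true).card := by
  rw [gain, countP_any, mul_comm, ← smul_eq_mul, ← Finset.sum_const]
  have : ∀ y, meets x y w = true → y ∈ B := fun y hy =>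
    hw y (List.count_pos_iff.1 (Nat.pos_of_ne_zero (meets_count_right hy)))
  refine Finset.sum_congr ?_ ?_
  · ext y
    simp only [Finset.mem_filter, Finset.mem_univ, true_and, Bool.and_eq_true, decide_eq_true_eq]
    exact ⟨fun h => ⟨h.1, this y h.2, h.2⟩, fun h => ⟨h.1, h.2.2⟩⟩
  · intro y hy
    simp only [Finset.mem_filter, Finset.mem_univ, true_and] at hy
    exact hB y hy.2.1

/-- The new pairs join `x` to vertices outside `P`, in both orders. Pairs of `x` with vertices of
`P` have been counted before, so each intersecting pair is counted when its first vertex is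
forgotten. -/
theorem val_insert {P : Finset V} {x : V} (hx : x ∉ P) (w : Word V) :
    val (insert x P) w = val P w +
      2 * (Finset.univ.filter fun y => y ≠ x ∧ y ∉ P ∧ meets x y w = true).card := by
  classical
  set S := Finset.univ.filter fun y => y ≠ x ∧ y ∉ P ∧ meets x y w = true with hS
  have h1 : (Finset.univ.filter fun p : V × V =>
      p.1 ≠ p.2 ∧ (p.1 ∈ insert x P ∨ p.2 ∈ insert x P) ∧ meets p.1 p.2 w = true) =
      ((Finset.univ.filter fun p : V × V =>
        p.1 ≠ p.2 ∧ (p.1 ∈ P ∨ p.2 ∈ P) ∧ meets p.1 p.2 w = true) ∪ S.image fun y => (x, y)) ∪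
        S.image fun y => (y, x) := by
    ext ⟨a, b⟩
    simp only [Finset.mem_filter, Finset.mem_univ, true_and, Finset.mem_union, Finset.mem_image,
      Prod.mk.injEq, hS, Finset.mem_insert]
    constructor
    · rintro ⟨h1, h2, h3⟩
      by_cases ha : a ∈ P
      · exact .inl (.inl ⟨h1, .inl ha, h3⟩)
      by_cases hb : b ∈ P
      · exact .inl (.inl ⟨h1, .inr hb, h3⟩)
      by_cases hax : a = x
      · subst hax
        exact .inl (.inr ⟨b, ⟨Ne.symm h1, hb, h3⟩, rfl, rfl⟩)
      · have hbx : b = x := by tauto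
        subst hbx
        exact .inr ⟨a, ⟨h1, ha, by rwa [meets_comm]⟩, rfl, rfl⟩
    · rintro ((⟨h1, h2, h3⟩ | ⟨y, ⟨h1, h2, h3⟩, rfl, rfl⟩) | ⟨y, ⟨h1, h2, h3⟩, rfl, rfl⟩)
      · exact ⟨h1, by tauto, h3⟩
      · exact ⟨Ne.symm h1, by tauto, h3⟩
      · exact ⟨h1, by tauto, by rwa [meets_comm]⟩
  rw [val, h1, Finset.card_union_of_disjoint, Finset.card_union_of_disjoint,
    Finset.card_image_of_injective, Finset.card_image_of_injective, val]
  · ring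
  · intro a b h; simpa using h
  · intro a b h; simpa using h
  · rw [Finset.disjoint_left]
    rintro ⟨a, b⟩ h h2
    simp only [Finset.mem_filter, Finset.mem_univ, true_and, Finset.mem_image,
      Prod.mk.injEq, hS] at h h2
    obtain ⟨y, ⟨h3, h4, h5⟩, rfl, rfl⟩ := h2
    tauto
  · rw [Finset.disjoint_left]
    rintro ⟨a, b⟩ h h2
    simp only [Finset.mem_filter, Finset.mem_univ, true_and, Finset.mem_image,
      Prod.mk.injEq, hS, Finset.mem_union] at h h2
    obtain ⟨y, ⟨h3, h4, h5⟩, rfl, rfl⟩ := h2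
    rcases h with h | ⟨z, ⟨h6, h7, h8⟩, rfl, rfl⟩
    · tauto
    · exact h3 rfl

/-- A formula for the values at a union, provided the words tell the same about the vertices that
matter. -/
theorem val_union {P₁ P₂ : Finset V} {w w₁ w₂ : Word V}
    (h₁ : ∀ u v, u ∉ P₂ → v ∉ P₂ → meets u v w = meets u v w₁)
    (h₂ : ∀ u v, u ∉ P₁ → v ∉ P₁ → meets u v w = meets u v w₂)
    (hc : ∀ u ∈ P₁, ∀ v ∈ P₂, meets u v w = false)
    (h₁₂ : ∀ u ∈ P₁, ∀ v ∈ P₂, meets u v w₁ = false)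
    (h₂₁ : ∀ u ∈ P₁, ∀ v ∈ P₂, meets u v w₂ = false)
    (hd : Disjoint P₁ P₂) : val (P₁ ∪ P₂) w = val P₁ w₁ + val P₂ w₂ := by
  have hd' : ∀ u, u ∈ P₁ → u ∉ P₂ := fun u h h' => Finset.disjoint_left.1 hd h h'
  rw [val, val, val, ← Finset.card_union_of_disjoint]
  · congr 1
    ext ⟨a, b⟩
    simp only [Finset.mem_filter, Finset.mem_univ, true_and, Finset.mem_union]
    have e1 := h₁ a b
    have e2 := h₂ a b
    have e3 := hc a
    have e3' := hc b
    have e4 := h₁₂ a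
    have e4' := h₁₂ b
    have e5 := h₂₁ a
    have e5' := h₂₁ b
    have da := hd' a
    have db := hd' b
    simp only [meets_comm b] at e4' e5' e3'
    by_cases a1 : a ∈ P₁ <;> by_cases a2 : a ∈ P₂ <;> by_cases b1 : b ∈ P₁ <;>
      by_cases b2 : b ∈ P₂ <;> simp_all
  · rw [Finset.disjoint_left]
    rintro ⟨a, b⟩ h h'
    simp only [Finset.mem_filter, Finset.mem_univ, true_and] at h h'
    have e4 := h₁₂ a
    have e4' := h₁₂ b
    have da := hd' a
    have db := hd' b
    simp only [meets_comm b] at e4'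
    by_cases a1 : a ∈ P₁ <;> by_cases a2 : a ∈ P₂ <;> by_cases b1 : b ∈ P₁ <;>
      by_cases b2 : b ∈ P₂ <;> simp_all

-- Completeness. A fixed word of an interval subgraph of `G` is projected to every node, and the
-- transition lemmas for `canon` show that the projections obey the rules of `Der`. Separation
-- provides their hypotheses, because intersecting vertices are neighbours.
open NiceTree in
theorem der_canon {G : SimpleGraph V} {w : Word V} (hw : ∀ v, w.count (some v) = 2)
    (hG : ∀ u v, u ≠ v → meets u v w = true → G.Adj u v) {t : NiceTree V} (ht : t.Separated G) :
    Der G t (canon t.past t.bag w) (val t.past w) := by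
  induction t with
  | leaf =>
    have h1 : ∀ w : Word V, canon ∅ ∅ w = [] := fun w => by
      induction w with
      | nil => rfl
      | cons a w ih => rw [canon]; simp [ih, Cov]
    have h2 : val ∅ w = 0 := by simp [val]
    rw [past, bag, h1, h2]
    exact .leaf
  | introduce x t ih =>
    refine .introduce x (ih ht.2.2) ((canon_introduce ht.2.1 ht.1 ht.2.2.disjoint (hw x).le
      fun u hu => ?_).2.2 (hw x))
    rw [← Bool.not_eq_true]
    intro h
    have hne : u ≠ x := by rintro rfl; exact ht.2.1 hu
    -- A past vertex that meets `x` would be its neighbour, but neighbours of past vertices are in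
    -- the past or in the bag, where `x` is not yet.
    have := ht.2.2.mem hu (hG u x hne h)
    rw [Finset.mem_union] at this
    exact this.elim ht.2.1 ht.1
  | forget x t ih =>
    have hd := ht.2.2.disjoint
    have hx : x ∉ t.past := fun h => Finset.disjoint_left.1 hd h ht.1
    have hb : insert x (t.bag.erase x) = t.bag := Finset.insert_erase ht.1
    have := canon_forget (P := t.past) hx (Finset.notMem_erase x t.bag)
      (hd.mono_right (Finset.erase_subset _ _)) w
    rw [hb] at this
    rw [past, bag, this]
    have hv : val (insert x t.past) w =
        val t.past w + gain x (canon t.past t.bag w) := by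
      rw [val_insert hx, gain_eq (fun y hy => by rw [count_canon hy, hw])
        (fun y hy => mem_canon hy)]
      congr 3
      ext y
      simp only [Finset.mem_filter, Finset.mem_univ, true_and]
      -- The vertices outside the past that meet `x` are neighbours of `x` and hence lie in the bag,
      -- so the word shows all of them.
      refine and_congr_right fun hyx => ⟨fun h => ?_, fun h => ?_⟩
      · have h2 := ht.2.1 y (hG x y (Ne.symm hyx) h.2)
        have h3 : y ∈ t.bag := (Finset.mem_union.1 h2).resolve_left h.1
        exact ⟨h3, by rw [meets_canon ht.1 h3]; exact h.2⟩
      · rw [meets_canon ht.1 h.1] at h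
        exact ⟨fun h' => Finset.disjoint_left.1 hd h' h.1, h.2⟩
    rw [hv]
    refine .forget x (ih ht.2.2) fun y hy hm h => hG x y (Ne.symm hy) ?_
    rwa [meets_canon ht.1 (mem_canon hm)] at h
  | join t₁ t₂ ih₁ ih₂ =>
    have hc : ∀ u ∈ t₁.past, ∀ v ∈ t₂.past, meets u v w = false := fun u hu v hv => by
      rw [← Bool.not_eq_true]
      intro h
      have hne : u ≠ v := by rintro rfl; exact Finset.disjoint_left.1 ht.2.1 hu hv
      rcases Finset.mem_union.1 (ht.2.2.1.mem hu (hG u v hne h)) with h | h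
      · exact Finset.disjoint_left.1 ht.2.1 h hv
      · rw [ht.1] at h
        exact Finset.disjoint_left.1 ht.2.2.2.disjoint hv h
    have hv : val (t₁.past ∪ t₂.past) w = val t₁.past w + val t₂.past w :=
      val_union (fun _ _ _ _ => rfl) (fun _ _ _ _ => rfl) hc hc hc ht.2.1
    have := Der.join (ih₁ ht.2.2.1) (ih₂ ht.2.2.2) (σ := canon (t₁.past ∪ t₂.past) t₁.bag w)
      (by rw [← ht.1]; exact joins_canon ht.2.2.1.disjoint (ht.1 ▸ ht.2.2.2.disjoint) ht.2.1 hc)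
    rw [← hv] at this
    exact this

end Word

/-! ### Soundness: witnesses and the moves that change them -/

namespace Word

variable {V : Type*} [DecidableEq V]

/-- The letters that are kept when the vertices in `P` are forgotten. -/
def keep (P : Finset V) (a : Option V) : Bool := a.all (· ∉ P)

/-- Ends of intervals of vertices in `P` occur only where the colour is odd, and the colour changes
only where no such interval is open. -/
def Ok (P : Finset V) : Word V → Prop
  | [] => True
  | none :: w => ¬ Cov P w ∧ Ok P w
  | some u :: w => (u ∈ P → par w = true) ∧ Ok P w

section basics

variable {P : Finset V}

theorem opn_append (v : V) (u w : Word V) : opn v (u ++ w) = xor (opn v u) (opn v w) := by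
  induction u with
  | nil => simp [opn]
  | cons a u ih =>
    rw [List.cons_append]
    simp only [opn, ih]
    split_ifs <;> simp

theorem opn_of_notMem {v : V} {w : Word V} (h : some v ∉ w) : opn v w = false := by
  rw [opn_eq_count, List.count_eq_zero_of_not_mem h]
  rfl

theorem cov_congr {w w' : Word V} (h : ∀ u ∈ P, opn u w = opn u w') : Cov P w ↔ Cov P w' :=
  exists_congr fun u => and_congr_right fun hu => by rw [h u hu]

theorem Ok.right {u w : Word V} (h : Ok P (u ++ w)) : Ok P w := by
  induction u with
  | nil => exact h
  | cons a u ih => cases a <;> exact ih h.2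

theorem Ok.tail {a : Option V} {w : Word V} (h : Ok P (a :: w)) : Ok P w := Ok.right (u := [a]) h

/-- The conditions at the letters of `u` depend on what follows only through its parity and the
intervals of `P` that are open there. -/
theorem Ok.replace {u w w' : Word V} (h : Ok P (u ++ w')) (hp : par w = par w')
    (ho : ∀ v ∈ P, opn v w = opn v w') (hw : Ok P w) : Ok P (u ++ w) := by
  induction u with
  | nil => exact hw
  | cons a u ih =>
    have hc : Cov P (u ++ w) ↔ Cov P (u ++ w') :=
      cov_congr fun v hv => by rw [opn_append, opn_append, ho v hv]
    cases a with
    | none => exact ⟨fun h' => h.1 (hc.1 h'), ih h.2⟩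
    | some a => exact ⟨fun h' => by
      change par (u ++ w) = true
      rw [par_append, hp, ← par_append]; exact h.1 h', ih h.2⟩

/-- Only one direction of the correspondence between colour and coverage is required of witnesses:
an odd stretch need not be covered. This freedom is what allows stars to be inserted and removed. -/
theorem Ok.not_cov {w : Word V} (h : Ok P w) (hp : par w = false) : ¬ Cov P w := by
  induction w with
  | nil => exact cov_nil P
  | cons a w ih =>
    cases a with
    | none => rw [cov_skip (by simp)]; exact h.1
    | some a =>
      rw [cov_skip]
      · exact ih h.2 hp
      · intro u hu e
        obtain rfl : a = u := by simpa using e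
        have := h.1 hu
        simp only [par] at hp
        rw [hp] at this
        simp at this

theorem Ok.not_opn {w : Word V} (h : Ok P w) (hp : par w = false) {u : V} (hu : u ∈ P) :
    opn u w = false := by
  rw [← Bool.not_eq_true]
  exact fun ho => h.not_cov hp ⟨u, hu, ho⟩

theorem par_of_notMem {w : Word V} (h : none ∉ w) : par w = false := by
  induction w with
  | nil => rfl
  | cons a w ih =>
    cases a with
    | none => simp at h
    | some a => exact ih (by simpa using h)

/-- Ends of forgotten vertices occur only at odd colour, so between stars an even stretch hides none
of them. -/
theorem Ok.eq_nil {y w : Word V} (h : Ok P (y ++ w)) (hn : none ∉ y)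
    (hy : ∀ u, some u ∈ y → u ∈ P) (hp : par w = false) : y = [] := by
  cases y with
  | nil => rfl
  | cons a y =>
    cases a with
    | none => simp at hn
    | some a =>
      have := h.1 (hy a (by simp))
      change par (y ++ w) = true at this
      rw [par_append, hp, par_of_notMem (by simpa using hn)] at this
      simp at this

theorem par_filter {p : Option V → Bool} (hp : p none = true) (w : Word V) :
    par (w.filter p) = par w := by
  induction w with
  | nil => rfl
  | cons a w ih =>
    cases a with
    | none => simp [List.filter_cons, hp, par, ih]
    | some a => by_cases h : p (some a) = true <;> simp [List.filter_cons, h, par, ih]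

theorem opn_congr {w w' : Word V} (h : w.filter Option.isSome = w'.filter Option.isSome) (v : V) :
    opn v w = opn v w' := by
  rw [← opn_filter (p := Option.isSome) rfl, h, opn_filter rfl]

theorem meets_congr {w w' : Word V} (h : w.filter Option.isSome = w'.filter Option.isSome)
    (u v : V) : meets u v w = meets u v w' := by
  rw [← meets_filter (p := Option.isSome) rfl rfl, h, meets_filter rfl rfl]

theorem count_congr {w w' : Word V} (h : w.filter Option.isSome = w'.filter Option.isSome)
    (v : V) : w.count (some v) = w'.count (some v) := by
  rw [← List.count_filter (p := Option.isSome) rfl, h, List.count_filter rfl]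

theorem meets_append {u v : V} {y w : Word V}
    (h : ∀ s, s <:+ y → opn u (s ++ w) = false ∨ opn v (s ++ w) = false) :
    meets u v (y ++ w) = meets u v w := by
  induction y with
  | nil => rfl
  | cons a y ih =>
    rw [List.cons_append, meets, ih fun s hs => h s (hs.trans (List.suffix_cons a y))]
    have := h (a :: y) List.suffix_rfl
    rw [List.cons_append] at this
    rcases this with h | h <;> simp [h]

theorem nrm_append_replicate (k : ℕ) (w : Word V) :
    nrm (List.replicate k none ++ w) = nst k (nrm w) := by
  induction k with
  | zero => rfl
  | succ k ih => rw [List.replicate_succ, List.cons_append, nrm, ih, nst]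

end basics

/-- `σ` can be refined to a word in which the vertices in `P` and `B` have intervals, which tells
where the intervals of the vertices in `P` are open, in which these intersect only intervals of
neighbours, and whose value is `v`. -/
def Wit [Fintype V] (G : SimpleGraph V) (P B : Finset V) (σ : Word V) (v : ℕ) : Prop :=
  ∃ Z : Word V, (∀ u ∈ P ∪ B, Z.count (some u) = 2) ∧ (∀ u, u ∉ P ∪ B → Z.count (some u) = 0) ∧
    Ok P Z ∧ par Z = false ∧ Z.filter (keep P) = σ ∧
    (∀ u ∈ P, ∀ w, w ≠ u → meets u w Z = true → G.Adj u w) ∧ val P Z = v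

section moves

variable [Fintype V] {G : SimpleGraph V} {P B : Finset V} {v : ℕ}

theorem val_congr {w w' : Word V} (h : ∀ a b, a ∈ P ∨ b ∈ P → meets a b w = meets a b w') :
    val P w = val P w' := by
  unfold val
  congr 1
  ext p
  simp only [Finset.mem_filter, Finset.mem_univ, true_and]
  refine and_congr_right fun _ => and_congr_right fun h' => by rw [h _ _ h']

/-- At an even place no interval of `P` is open, and the two stars enclose an empty odd stretch.
Intersections ignore stars. -/
theorem Wit.insert_stars {u s : Word V} (h : Wit G P B (u ++ s) v) (hs : par s = false) :
    Wit G P B (u ++ none :: none :: s) v := by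
  obtain ⟨Z, h1, h2, h3, h4, h5, h6, h7⟩ := h
  obtain ⟨y, z, rfl, rfl, rfl⟩ := List.filter_eq_append_iff.1 h5
  have hl : (y ++ none :: none :: z).filter Option.isSome = (y ++ z).filter Option.isSome := by
    simp
  rw [par_filter rfl] at hs
  refine ⟨y ++ none :: none :: z, fun u hu => by rw [count_congr hl]; exact h1 u hu,
    fun u hu => by rw [count_congr hl]; exact h2 u hu, ?_, ?_, by simp [keep], fun u hu w hw => by
    rw [meets_congr hl]; exact h6 u hu w hw, by
    rw [← h7]; exact val_congr fun a b _ => meets_congr hl a b⟩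
  · have hc := h3.right.not_cov hs
    exact h3.replace (by simp [par]) (by simp) ⟨by rwa [cov_skip (by simp)], hc, h3.right⟩
  · rw [← h4, par_append, par_append]; simp [par]

theorem Ok.remove_stars {u w : Word V} (h : Ok P (u ++ none :: none :: w)) : Ok P (u ++ w) :=
  h.replace (by simp [par]) (by simp) h.right.2.2

/-- Of the two stretches of the witness between three stars with no bag letter in between, one is
even and therefore empty; its two bounding stars can be erased. -/
theorem Wit.remove_stars {u s : Word V} (h : Wit G P B (u ++ none :: none :: none :: s) v) :
    Wit G P B (u ++ none :: s) v := by
  obtain ⟨Z, h1, h2, h3, h4, h5, h6, h7⟩ := h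
  obtain ⟨y, z, rfl, rfl, e1⟩ := List.filter_eq_append_iff.1 h5
  obtain ⟨a₀, z, rfl, ha₀, -, e2⟩ := List.filter_eq_cons_iff.1 e1
  obtain ⟨a₁, z, rfl, ha₁, -, e3⟩ := List.filter_eq_cons_iff.1 e2
  obtain ⟨a₂, z, rfl, ha₂, -, rfl⟩ := List.filter_eq_cons_iff.1 e3
  have hkeep : ∀ {a : Word V}, (∀ x ∈ a, ¬ keep P x = true) → none ∉ a ∧
      (∀ u, some u ∈ a → u ∈ P) ∧ a.filter (keep P) = [] := fun {a} ha =>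
    ⟨fun h => ha _ h rfl, fun u hu => by simpa [keep] using ha _ hu,
      List.filter_eq_nil_iff.2 ha⟩
  have fin : ∀ Z' : Word V, Z'.filter Option.isSome =
      (y ++ (a₀ ++ none :: (a₁ ++ none :: (a₂ ++ none :: z)))).filter Option.isSome → Ok P Z' →
      par Z' = par (y ++ (a₀ ++ none :: (a₁ ++ none :: (a₂ ++ none :: z)))) →
      Z'.filter (keep P) = y.filter (keep P) ++ none :: z.filter (keep P) →
      Wit G P B (y.filter (keep P) ++ none :: z.filter (keep P)) v := fun Z' hl ho hp hf =>
    ⟨Z', fun u hu => by rw [count_congr hl]; exact h1 u hu,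
    fun u hu => by rw [count_congr hl]; exact h2 u hu, ho, hp.trans h4, hf, fun u hu w hw => by
    rw [meets_congr hl]; exact h6 u hu w hw, by
    rw [← h7]; exact val_congr fun a b _ => meets_congr hl a b⟩
  obtain ⟨n0, m0, f0⟩ := hkeep ha₀
  obtain ⟨n1, m1, f1⟩ := hkeep ha₁
  obtain ⟨n2, m2, f2⟩ := hkeep ha₂
  cases hz : par z with
  | false =>
    -- If the colour right of the three stars is even, the even stretch is the left one.
    have o1 : Ok P (a₁ ++ none :: (a₂ ++ none :: z)) := h3.right.right.tail
    obtain rfl := o1.eq_nil n1 m1 (by rw [par, par_append, par_of_notMem n2, par, hz]; rfl)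
    refine fin (y ++ (a₀ ++ (a₂ ++ none :: z))) (by simp) ?_ (by simp [par_append, par])
      (by simp [f0, f2, keep])
    have := Ok.remove_stars (u := y ++ a₀) (w := a₂ ++ none :: z) (by simpa using h3)
    simpa using this
  | true =>
    -- If it is odd, the even stretch is the right one.
    have o1 : Ok P (a₂ ++ none :: z) := h3.right.right.tail.right.tail
    obtain rfl := o1.eq_nil n2 m2 (by rw [par, hz]; rfl)
    refine fin (y ++ (a₀ ++ none :: (a₁ ++ z))) (by simp) ?_ (by simp [par_append, par])
      (by simp [f0, f1, keep])
    have := Ok.remove_stars (u := y ++ a₀ ++ none :: a₁) (w := z) (by simpa using h3)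
    simpa using this

theorem Wit.ncons {u s : Word V} {a : Option V} (h : Wit G P B (u ++ a :: s) v) :
    Wit G P B (u ++ ncons a s) v := by
  cases a with
  | some a => rwa [ncons_some]
  | none =>
    rcases ncons_none_eq s with e | ⟨r, rfl, e⟩ <;> rw [e]
    · exact h
    · exact h.remove_stars

theorem Wit.nrm {u s : Word V} (h : Wit G P B (u ++ s) v) : Wit G P B (u ++ nrm s) v := by
  induction s generalizing u with
  | nil => exact h
  | cons a s ih =>
    have := ih (u := u ++ [a]) (by simpa using h)
    exact Wit.ncons (by simpa using this)

theorem Wit.ncons_ncons {u s : Word V} (h : Wit G P B (u ++ s) v) (hs : par s = false) :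
    Wit G P B (u ++ Word.ncons none (Word.ncons none s)) v := by
  have := Wit.ncons (u := u ++ [none]) (a := none) (by simpa using h.insert_stars hs)
  exact Wit.ncons (by simpa using this)

/-- From the right end of `x` to its left end the colour stays even, so no interval of `P` is open
there and `x` meets none of them. As `x` is not in `P` either, the value is unchanged. -/
theorem Wit.insert_vertex {x : V} (hP : x ∉ P) (hB : x ∉ B) {u m s : Word V}
    (h : Wit G P B (u ++ (m ++ s)) v) (hm : none ∉ m) (hs : par s = false) :
    Wit G P (insert x B) (u ++ some x :: (m ++ some x :: s)) v := by
  obtain ⟨Z, h1, h2, h3, h4, h5, h6, h7⟩ := h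
  obtain ⟨y, z, rfl, rfl, e1⟩ := List.filter_eq_append_iff.1 h5
  obtain ⟨q, z, rfl, rfl, rfl⟩ := List.filter_eq_append_iff.1 e1
  rw [par_filter rfl] at hs
  have hq : none ∉ q := fun h => hm (List.mem_filter.2 ⟨h, rfl⟩)
  have hx := h2 x (by simp [hP, hB])
  have hx' : some x ∉ y ∧ some x ∉ q ∧ some x ∉ z := by
    have := List.count_eq_zero.1 hx
    simpa using this
  have hxu : ∀ u ∈ P, x ≠ u := fun u hu e => hP (e ▸ hu)
  have o1 : Ok P (some x :: z) := ⟨fun h => absurd h hP, h3.right.right⟩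
  have o2 : Ok P (q ++ some x :: z) :=
    h3.right.replace (by simp [par]) (fun u hu => opn_ne (hxu u hu) z) o1
  have o3 : Ok P (y ++ some x :: (q ++ some x :: z)) :=
    h3.replace (by simp [par, par_append]) (fun u hu => by
      rw [opn_ne (hxu u hu), opn_append, opn_append, opn_ne (hxu u hu)])
      ⟨fun h => absurd h hP, o2⟩
  have hl : (y ++ some x :: (q ++ some x :: z)).filter (fun a => a ≠ some x) =
      (y ++ (q ++ z)).filter (fun a => a ≠ some x) := by simp
  have hmeet : ∀ a b, a ≠ x → b ≠ x → meets a b (y ++ some x :: (q ++ some x :: z)) =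
      meets a b (y ++ (q ++ z)) := fun a b ha hb => by
    rw [← meets_filter (p := fun a => a ≠ some x) (by simpa using ha) (by simpa using hb), hl,
      meets_filter (by simpa using ha) (by simpa using hb)]
  have hcount : ∀ a, a ≠ x → (y ++ some x :: (q ++ some x :: z)).count (some a) =
      (y ++ (q ++ z)).count (some a) := fun a ha => by
    rw [← List.count_filter (p := fun a => a ≠ some x) (by simpa using ha), hl,
      List.count_filter (by simpa using ha)]
  have hmx : ∀ u ∈ P, meets u x (y ++ some x :: (q ++ some x :: z)) = false := fun u hu => by
    have hqs : ∀ s, s <:+ q → opn u (s ++ some x :: z) = false := fun s hs' => by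
      obtain ⟨r, rfl⟩ := hs'
      have : Ok P (s ++ some x :: z) := Ok.right (u := r) (by simpa using o2)
      refine this.not_opn ?_ hu
      rw [par_append, par_of_notMem (fun h => hq (List.mem_append_right _ h)), par, hs]
      rfl
    have hoz : opn x z = false := opn_of_notMem hx'.2.2
    rw [show y ++ some x :: (q ++ some x :: z) = (y ++ [some x]) ++ (q ++ some x :: z) by simp,
      meets_append, meets_append (fun s hs => .inl (hqs s hs)), meets,
      show opn u (some x :: z) = false from hqs [] (by simp)]
    · simp only [Bool.false_and, Bool.false_or]
      rw [← Bool.not_eq_true]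
      intro h
      exact hx'.2.2 (List.count_pos_iff.1 (Nat.pos_of_ne_zero (meets_count_right h)))
    · intro s hs'
      rcases List.eq_nil_or_concat' s with rfl | ⟨r, b, rfl⟩
      · exact .inl (hqs q List.suffix_rfl)
      · obtain ⟨t, ht⟩ := hs'
        rw [← List.append_assoc] at ht
        obtain ⟨rfl, e⟩ := List.append_inj' ht rfl
        simp only [List.cons.injEq, and_true] at e
        subst e
        -- Left of both ends the interval of `x` is closed again.
        right
        rw [opn_append, opn_append, opn_append, opn_self, opn_self, hoz,
          opn_of_notMem (fun h => hx'.1 (List.mem_append_right _ h)), opn_of_notMem hx'.2.1]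
        rfl
  refine ⟨_, fun a ha => ?_, fun a ha => ?_, o3, ?_, by simp [keep, hP], fun u hu w hw => ?_, ?_⟩
  · by_cases hax : a = x
    · subst hax
      simp only [List.count_append, List.count_cons_self] at hx ⊢
      omega
    · rw [hcount a hax]; exact h1 a (by simpa [hax] using ha)
  · have hax : a ≠ x := by rintro rfl; simp at ha
    rw [hcount a hax]; exact h2 a (by simpa [hax] using ha)
  · rw [← h4]; simp [par_append, par]
  · by_cases hwx : w = x
    · subst hwx; rw [hmx u hu]; simp
    · rw [hmeet u w (hxu u hu).symm hwx]; exact h6 u hu w hw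
  · rw [← h7]
    have hx0 : ∀ b, meets b x (y ++ (q ++ z)) = false := fun b => by
      rw [← Bool.not_eq_true]
      exact fun h => meets_count_right h hx
    refine val_congr fun a b hab => ?_
    by_cases ha : a = x
    · subst ha
      rw [meets_comm, hmx b (hab.resolve_left hP), meets_comm, hx0]
    by_cases hb : b = x
    · subst hb
      rw [hmx a (hab.resolve_right hP), hx0]
    · exact hmeet a b ha hb

theorem mem_newEnd {x : V} {s l : Word V} (h : l ∈ newEnd x s) : par s = false ∧
    (l = some x :: s ∨ l = some x :: Word.ncons none (Word.ncons none s)) := by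
  unfold newEnd at h
  split_ifs at h with hp
  · simp at h
  · exact ⟨by simpa using hp, by simpa using h⟩

theorem mem_rights {x : V} {w l : Word V} (h : l ∈ rights x w) : ∃ m s r, none ∉ m ∧ w = m ++ s ∧
    par s = false ∧ l = m ++ some x :: r ∧ (r = s ∨ r = Word.ncons none (Word.ncons none s)) := by
  have hn : ∀ {w}, l ∈ newEnd x w → ∃ m s r, none ∉ m ∧ w = m ++ s ∧
    par s = false ∧ l = m ++ some x :: r ∧ (r = s ∨ r = Word.ncons none (Word.ncons none s)) := by
    intro w h
    obtain ⟨hp, h⟩ := mem_newEnd h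
    rcases h with rfl | rfl
    · exact ⟨[], w, w, by simp, rfl, hp, rfl, .inl rfl⟩
    · exact ⟨[], w, _, by simp, rfl, hp, rfl, .inr rfl⟩
  induction w generalizing l with
  | nil => exact hn h
  | cons a w ih =>
    cases a with
    | none => exact hn h
    | some a =>
      simp only [rights, List.mem_append, List.mem_map] at h
      rcases h with h | ⟨l', h, rfl⟩
      · exact hn h
      · obtain ⟨m, s, r, h1, rfl, h2, rfl, h3⟩ := ih h (fun {w} h' => by
          obtain ⟨hp, h⟩ := mem_newEnd h'
          rcases h with rfl | rfl
          · exact ⟨[], w, w, by simp, rfl, hp, rfl, .inl rfl⟩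
          · exact ⟨[], w, _, by simp, rfl, hp, rfl, .inr rfl⟩)
        exact ⟨some a :: m, s, r, by simpa using h1, rfl, h2, rfl, h3⟩

theorem Wit.intro {x : V} (hP : x ∉ P) (hB : x ∉ B) {u σ τ : Word V} (h : Wit G P B (u ++ σ) v)
    (hτ : τ ∈ intro x σ) : Wit G P (insert x B) (u ++ τ) v := by
  have key : ∀ {u σ τ : Word V}, Wit G P B (u ++ σ) v → τ ∈ leftEnd x (rights x σ) →
      Wit G P (insert x B) (u ++ τ) v := fun {u σ τ} h hτ => by
    obtain ⟨l, hl, hτ⟩ := mem_leftEnd.1 hτ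
    obtain ⟨m, s, r, hm, rfl, hs, rfl, hr⟩ := mem_rights hl
    have hr2 : par r = false ∧ Wit G P B (u ++ (m ++ r)) v := by
      rcases hr with rfl | rfl
      · exact ⟨hs, h⟩
      · refine ⟨by simp [par_ncons, par, hs], ?_⟩
        have := Wit.ncons_ncons (u := u ++ m) (by simpa using h) hs
        simpa using this
    have h2 := hr2.2.insert_vertex hP hB hm hr2.1
    rcases hτ with rfl | rfl
    · exact h2
    · refine h2.ncons_ncons ?_
      rw [par, par_append, par_of_notMem hm, par, hr2.1]
      rfl
  induction σ generalizing u τ with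
  | nil => exact key h hτ
  | cons a σ ih =>
    simp only [Word.intro, List.mem_append, List.mem_map] at hτ
    rcases hτ with hτ | ⟨τ, hτ, rfl⟩
    · exact key h hτ
    · have := ih (u := u ++ [a]) (by simpa using h) hτ
      exact Wit.ncons (by simpa using this)

end moves

end Word

/-! ### Soundness: recolouring and merging witnesses -/

namespace Word

variable {V : Type*} [DecidableEq V]

/-- Recolouring without shortening runs of stars. -/
def fgRaw (x : V) : Word V → Word V
  | [] => []
  | none :: w => if opn x w then fgRaw x w else none :: fgRaw x w
  | some y :: w =>
    if y = x then (if par w then fgRaw x w else none :: fgRaw x w) else some y :: fgRaw x w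

/-- Recolouring that keeps the forgotten vertex. -/
def fgKeep (x : V) : Word V → Word V
  | [] => []
  | none :: w => if opn x w then fgKeep x w else none :: fgKeep x w
  | some y :: w =>
    if y = x then (if par w then some x :: fgKeep x w
      else if opn x w then none :: some x :: fgKeep x w else some x :: none :: fgKeep x w)
    else some y :: fgKeep x w

theorem fg_eq_nrm (x : V) (w : Word V) : fg x w = nrm (fgRaw x w) := by
  induction w with
  | nil => rfl
  | cons a w ih =>
    cases a with
    | none => rw [fg, fgRaw]; split_ifs <;> simp [nrm, ih]
    | some a => rw [fg, fgRaw]; split_ifs <;> simp [nrm, ih]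

theorem fgKeep_letters (x : V) (w : Word V) :
    (fgKeep x w).filter Option.isSome = w.filter Option.isSome := by
  induction w with
  | nil => rfl
  | cons a w ih =>
    cases a with
    | none => rw [fgKeep]; split_ifs <;> simp [ih]
    | some a => rw [fgKeep]; split_ifs with h <;> simp [ih, h]

/-- The new colour is odd where the old one is odd or the interval of `x` is open. The star that
replaces an end of `x` is put outside of its interval, so that the end itself has odd colour. -/
theorem par_fgKeep (x : V) (w : Word V) : par (fgKeep x w) = (par w || opn x w) := by
  induction w with
  | nil => rfl
  | cons a w ih =>
    cases a with
    | none => rw [fgKeep]; split_ifs with h <;> simp [ih, h, par]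
    | some a =>
      rw [fgKeep]
      split_ifs with h1 h2 h3
      · subst h1; simp [ih, h2, par]
      · subst h1; simp [ih, h2, h3, par]
      · subst h1; simp [ih, h2, h3, par]
      · simp [ih, par, opn_ne h1]

theorem ok_fgKeep {P : Finset V} {x : V} {w : Word V} (h : Ok P w) :
    Ok (insert x P) (fgKeep x w) := by
  have hc : ∀ {w}, Ok P w → opn x w = false → ¬ Cov P w → ¬ Cov (insert x P) (fgKeep x w) := by
    rintro w ho hx hc ⟨u, hu, h⟩
    rw [opn_congr (fgKeep_letters x w)] at h
    rcases Finset.mem_insert.1 hu with rfl | hu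
    · rw [hx] at h; simp at h
    · exact hc ⟨u, hu, h⟩
  induction w with
  | nil => trivial
  | cons a w ih =>
    have ih' := ih h.tail
    cases a with
    | none =>
      rw [fgKeep]
      split_ifs with h1
      · exact ih'
      · exact ⟨hc h.tail (by simpa using h1) h.1, ih'⟩
    | some a =>
      rw [fgKeep]
      split_ifs with h1 h2 h3
      · exact ⟨fun _ => by rw [par_fgKeep, h2]; rfl, ih'⟩
      · refine ⟨?_, fun _ => by rw [par_fgKeep, h3]; simp, ih'⟩
        rintro ⟨u, hu, ho⟩
        by_cases hux : u = x
        · subst hux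
          rw [opn_self, opn_congr (fgKeep_letters u w), h3] at ho
          simp at ho
        · rw [opn_ne (Ne.symm hux), opn_congr (fgKeep_letters x w)] at ho
          exact h.tail.not_cov (by simpa using h2)
            ⟨u, (Finset.mem_insert.1 hu).resolve_left hux, ho⟩
      · refine ⟨fun _ => ?_, hc h.tail (by simpa using h3) (h.tail.not_cov (by simpa using h2)),
          ih'⟩
        rw [par, par_fgKeep]
        simp [h2, h3]
      · refine ⟨fun hm => ?_, ih'⟩
        rw [par_fgKeep, h.1 ((Finset.mem_insert.1 hm).resolve_left h1)]
        rfl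

theorem filter_fgKeep {P : Finset V} {x : V} (hx : x ∉ P) (w : Word V) :
    (fgKeep x w).filter (keep (insert x P)) = fgRaw x (w.filter (keep P)) := by
  have e1 : ∀ w : Word V, opn x (w.filter (keep P)) = opn x w := fun w =>
    opn_filter (by simpa [keep] using hx) w
  have e2 : ∀ w : Word V, par (w.filter (keep P)) = par w := fun w => par_filter rfl w
  induction w with
  | nil => rfl
  | cons a w ih =>
    cases a with
    | none =>
      rw [List.filter_cons_of_pos (by rfl), fgKeep, fgRaw, e1, ← ih]
      split_ifs
      · rfl
      · rw [List.filter_cons_of_pos (by rfl)]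
    | some a =>
      by_cases ha : a = x
      · subst ha
        rw [List.filter_cons_of_pos (by simpa [keep] using hx), fgKeep, fgRaw, e2, ← ih,
          if_pos rfl, if_pos rfl]
        split_ifs <;> simp [keep]
      · rw [fgKeep, if_neg ha]
        by_cases haP : a ∈ P
        · rw [List.filter_cons_of_neg (by simp [keep, haP]),
            List.filter_cons_of_neg (by simp [keep, haP]), ih]
        · rw [List.filter_cons_of_pos (by simp [keep, haP, ha]),
            List.filter_cons_of_pos (by simp [keep, haP]), ih, fgRaw, if_neg ha]

section join

variable {P₁ P₂ : Finset V}

/-- Stars and ends of vertices in `P₁` may be put in front of a common refinement where no interval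
of `P₂` is open: then no intersection across the two sets arises, and the conditions carry over from
the first word because parity and open intervals agree. -/
theorem Ok.block {y w w' : Word V} (hd : Disjoint P₁ P₂) (hy : ∀ u, some u ∈ y → u ∈ P₁)
    (h : Ok P₁ (y ++ w')) (ho : ∀ u ∈ P₁, opn u w = opn u w') (hp : par w = par w')
    (hc : ∀ u ∈ P₂, opn u w = false) (hw : Ok (P₁ ∪ P₂) w)
    (hm : ∀ u ∈ P₁, ∀ v ∈ P₂, meets u v w = false) :
    Ok (P₁ ∪ P₂) (y ++ w) ∧ ∀ u ∈ P₁, ∀ v ∈ P₂, meets u v (y ++ w) = false := by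
  have hy2 : ∀ s, s <:+ y → ∀ u ∈ P₂, opn u (s ++ w) = false := fun s hs u hu => by
    rw [opn_append, hc u hu, opn_of_notMem
      (fun h => Finset.disjoint_left.1 hd (hy u (hs.mem h)) hu)]
    rfl
  constructor
  · induction y with
    | nil => exact hw
    | cons a y ih =>
      have ih := ih (fun u hu => hy u (List.mem_cons_of_mem _ hu)) h.tail
        (fun s hs => hy2 s (hs.trans (List.suffix_cons a y)))
      cases a with
      | none =>
        refine ⟨?_, ih⟩
        rintro ⟨u, hu, h'⟩
        rcases Finset.mem_union.1 hu with hu | hu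
        · exact h.1 ⟨u, hu, by
            change opn u (y ++ w) = true at h'
            change opn u (y ++ w') = true
            rw [opn_append] at h' ⊢; rwa [← ho u hu]⟩
        · have := hy2 y (List.suffix_cons _ y) u hu
          change opn u (y ++ w) = true at h'
          rw [this] at h'
          simp at h'
      | some a =>
        refine ⟨fun _ => ?_, ih⟩
        have := h.1 (hy a (by simp))
        change par (y ++ w') = true at this
        change par (y ++ w) = true
        rwa [par_append, hp, ← par_append]
  · intro u hu v hv
    rw [meets_append fun s hs => .inr (hy2 s hs v hv)]
    exact hm u hu v hv

/-- `Z` is a common refinement of the words `Z₁` and `Z₂`, in which the vertices of `P₁` and `P₂`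
have been forgotten. -/
structure Lift (P₁ P₂ : Finset V) (Z₁ Z₂ Z : Word V) : Prop where
  ok : Ok (P₁ ∪ P₂) Z
  par_eq : par Z = xor (par Z₁) (par Z₂)
  cross : ∀ u ∈ P₁, ∀ v ∈ P₂, meets u v Z = false
  left : Z.filter (fun a => a.any (· ∉ P₂)) = Z₁.filter Option.isSome
  right : Z.filter (fun a => a.any (· ∉ P₁)) = Z₂.filter Option.isSome

theorem Lift.symm {Z₁ Z₂ Z : Word V} (h : Lift P₁ P₂ Z₁ Z₂ Z) : Lift P₂ P₁ Z₂ Z₁ Z where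
  ok := by rw [Finset.union_comm]; exact h.ok
  par_eq := by rw [h.par_eq, Bool.xor_comm]
  cross u hu v hv := by rw [meets_comm]; exact h.cross v hv u hu
  left := h.right
  right := h.left

theorem Lift.opn_left {Z₁ Z₂ Z : Word V} (h : Lift P₁ P₂ Z₁ Z₂ Z) {u : V} (hu : u ∉ P₂) :
    opn u Z = opn u Z₁ := by
  rw [← opn_filter (p := fun a => a.any (· ∉ P₂)) (by simpa using hu), h.left, opn_filter rfl]

theorem Lift.meets_left {Z₁ Z₂ Z : Word V} (h : Lift P₁ P₂ Z₁ Z₂ Z) {u v : V} (hu : u ∉ P₂)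
    (hv : v ∉ P₂) : meets u v Z = meets u v Z₁ := by
  rw [← meets_filter (p := fun a => a.any (· ∉ P₂)) (by simpa using hu) (by simpa using hv),
    h.left, meets_filter rfl rfl]

theorem Lift.count_left {Z₁ Z₂ Z : Word V} (h : Lift P₁ P₂ Z₁ Z₂ Z) {u : V} (hu : u ∉ P₂) :
    Z.count (some u) = Z₁.count (some u) := by
  rw [← List.count_filter (p := fun a => a.any (· ∉ P₂)) (by simpa using hu), h.left,
    List.count_filter rfl]

/-- The content of one gap of the second word is cut into `U` and `W`, and the content `X` of the
same gap of the first word goes in between. The three blocks are added from the right, each at a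
place where the other colour is even, unless the block is empty. -/
theorem Lift.insert {Y₁ Y₂ Y X U W : Word V} (hd : Disjoint P₁ P₂) (h : Lift P₁ P₂ Y₁ Y₂ Y)
    (hX : ∀ u, some u ∈ X → u ∈ P₁) (hUW : ∀ u, some u ∈ U ++ W → u ∈ P₂)
    (h1 : Ok P₁ (X ++ Y₁)) (h2 : Ok P₂ (U ++ W ++ Y₂)) (hp : par (W ++ Y₂) = false)
    (hW : W = [] ∨ par Y₁ = false) (hU : U = [] ∨ par (X ++ Y₁) = false) :
    Lift P₁ P₂ (X ++ Y₁) (U ++ W ++ Y₂) (U ++ X ++ W ++ Y) := by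
  have d1 : ∀ u ∈ P₁, u ∉ P₂ := fun u h h' => Finset.disjoint_left.1 hd h h'
  have d2 : ∀ u ∈ P₂, u ∉ P₁ := fun u h h' => Finset.disjoint_left.1 hd h' h
  have hpY := h.par_eq
  rw [List.append_assoc] at h2
  have oW : ∀ u ∈ P₁, opn u W = false := fun u hu =>
    opn_of_notMem fun hm => d1 u hu (hUW u (List.mem_append_right _ hm))
  have oX : ∀ u ∈ P₂, opn u X = false := fun u hu => opn_of_notMem fun hm => d2 u hu (hX u hm)
  have A : Ok (P₁ ∪ P₂) (W ++ Y) ∧ ∀ u ∈ P₁, ∀ v ∈ P₂, meets u v (W ++ Y) = false := by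
    rcases hW with rfl | hW
    · exact ⟨h.ok, h.cross⟩
    · have := Ok.block (w := Y) hd.symm (fun u hu => hUW u (List.mem_append_right _ hu)) h2.right
        (fun u hu => h.symm.opn_left (d2 u hu)) (by rw [hpY, hW]; simp) (fun u hu => by
          rw [h.opn_left (d1 u hu)]; exact h1.right.not_opn hW hu)
        (by rw [Finset.union_comm]; exact h.ok) h.symm.cross
      rw [Finset.union_comm] at this
      exact ⟨this.1, fun u hu v hv => by rw [meets_comm]; exact this.2 v hv u hu⟩
  have pW : par (W ++ Y) = par Y₁ := by
    rw [par_append] at hp ⊢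
    rw [hpY]
    revert hp
    cases par W <;> cases par Y₁ <;> cases par Y₂ <;> simp
  have oWY : ∀ u ∈ P₁, opn u (W ++ Y) = opn u Y₁ := fun u hu => by
    rw [opn_append, oW u hu, h.opn_left (d1 u hu)]; simp
  have oWY2 : ∀ u ∈ P₂, opn u (W ++ Y) = opn u (W ++ Y₂) := fun u hu => by
    rw [opn_append, opn_append, h.symm.opn_left (d2 u hu)]
  have B := Ok.block (w := W ++ Y) hd hX h1 oWY pW (fun u hu => by
    rw [oWY2 u hu]; exact h2.right.not_opn hp hu) A.1 A.2
  have C : Ok (P₁ ∪ P₂) (U ++ (X ++ (W ++ Y))) ∧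
      ∀ u ∈ P₁, ∀ v ∈ P₂, meets u v (U ++ (X ++ (W ++ Y))) = false := by
    rcases hU with rfl | hU
    · exact B
    · have := Ok.block (w := X ++ (W ++ Y)) hd.symm
        (fun u hu => hUW u (List.mem_append_left _ hu)) h2 (fun u hu => by
          rw [opn_append, oX u hu, oWY2 u hu]; simp)
        (by rw [par_append, pW, ← par_append, hU, hp]) (fun u hu => by
          rw [opn_append, oWY u hu, ← opn_append]; exact h1.not_opn hU hu)
        (by rw [Finset.union_comm]; exact B.1)
        (fun u hu v hv => by rw [meets_comm]; exact B.2 v hv u hu)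
      rw [Finset.union_comm] at this
      exact ⟨this.1, fun u hu v hv => by rw [meets_comm]; exact this.2 v hv u hu⟩
  have f1 : ∀ {A : Word V} {P Q : Finset V}, (∀ u, some u ∈ A → u ∈ P) → (∀ u ∈ P, u ∉ Q) →
      A.filter (fun a => a.any (· ∉ Q)) = A.filter Option.isSome := fun {A P Q} hA hPQ =>
    List.filter_congr fun a ha => by
      cases a with
      | none => rfl
      | some a => simpa using hPQ a (hA a ha)
  have f2 : ∀ {A : Word V} {P : Finset V}, (∀ u, some u ∈ A → u ∈ P) →
      A.filter (fun a => a.any (· ∉ P)) = [] := fun {A P} hA =>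
    List.filter_eq_nil_iff.2 fun a ha => by
      cases a with
      | none => simp
      | some a => simpa using hA a ha
  have hU2 : ∀ u, some u ∈ U → u ∈ P₂ := fun u hu => hUW u (List.mem_append_left _ hu)
  have hW2 : ∀ u, some u ∈ W → u ∈ P₂ := fun u hu => hUW u (List.mem_append_right _ hu)
  refine ⟨by simpa using C.1, ?_, by simpa using C.2, ?_, ?_⟩
  · simp only [par_append, hpY]
    cases par U <;> cases par X <;> cases par W <;> cases par Y₁ <;> cases par Y₂ <;> rfl
  · simp only [List.filter_append, f2 hU2, f2 hW2, f1 hX d1, h.left]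
    simp
  · simp only [List.filter_append, f1 hU2 d2, f1 hW2 d2, f2 hX, h.right]
    simp

/-- The colour becomes even just left of the rightmost star of `X`. -/
theorem exists_even_split {X Y : Word V} (hX : none ∈ X) (hY : par Y = true) :
    ∃ U W, X = U ++ W ∧ par (W ++ Y) = false := by
  induction X with
  | nil => simp at hX
  | cons a X ih =>
    by_cases h : none ∈ X
    · obtain ⟨U, W, rfl, h'⟩ := ih h
      exact ⟨a :: U, W, rfl, h'⟩
    · obtain rfl : none = a := by simpa [h] using hX
      exact ⟨[], none :: X, rfl, by rw [List.cons_append, par, par_append, par_of_notMem h, hY]; rfl⟩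

/-- This is why `gapOk` suffices. If both colours right of the gap are even, one content can be
placed entirely to the right of the other. If one colour is odd and there are stars of its word in
the gap, the other content is placed where this colour is even. If there are none, `gapOk` leaves no
stars for the other content, which is then empty, being at even colour. -/
theorem Lift.gap {Y₁ Y₂ Y X₁ X₂ : Word V} {t d : ℕ} (hd : Disjoint P₁ P₂)
    (h : Lift P₁ P₂ Y₁ Y₂ Y) (ht : X₁.filter (keep P₁) = List.replicate t none)
    (hdd : X₂.filter (keep P₂) = List.replicate d none) (h1 : Ok P₁ (X₁ ++ Y₁))
    (h2 : Ok P₂ (X₂ ++ Y₂)) (hg : gapOk (par Y₁) t (par Y₂) d)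
    (hp : ¬ (par (X₁ ++ Y₁) = true ∧ par (X₂ ++ Y₂) = true)) :
    ∃ X, Lift P₁ P₂ (X₁ ++ Y₁) (X₂ ++ Y₂) (X ++ Y) ∧
      X.filter (keep (P₁ ∪ P₂)) = List.replicate (t + d) none := by
  have hlet : ∀ {P : Finset V} {X : Word V} {t : ℕ}, X.filter (keep P) = List.replicate t none →
      (∀ u, some u ∈ X → u ∈ P) ∧ (t ≠ 0 → none ∈ X) ∧ (t = 0 → none ∉ X) := by
    intro P X t ht
    have hm : ∀ a, a ∈ X ∧ keep P a = true ↔ t ≠ 0 ∧ a = none := fun a => by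
      rw [← List.mem_filter, ht, List.mem_replicate]
    refine ⟨fun u hu => ?_, fun h => ((hm none).2 ⟨h, rfl⟩).1, fun h h' =>
      ((hm none).1 ⟨h', rfl⟩).1 h⟩
    by_contra hP
    simpa using ((hm (some u)).1 ⟨hu, by simpa [keep] using hP⟩).2
  obtain ⟨m1, n1, z1⟩ := hlet ht
  obtain ⟨m2, n2, z2⟩ := hlet hdd
  have f : ∀ {A : Word V} {P : Finset V}, (∀ u, some u ∈ A → u ∈ P) → P ⊆ P₁ ∪ P₂ →
      A.filter (keep (P₁ ∪ P₂)) = A.filter (keep P) := fun {A P} hA hP =>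
    List.filter_congr fun a ha => by
      cases a with
      | none => rfl
      | some a =>
        have h1 := hA a ha
        have h2 := hP h1
        simp only [keep, Option.all_some, h1, h2, not_true_eq_false]
  have s1 : P₁ ⊆ P₁ ∪ P₂ := Finset.subset_union_left
  have s2 : P₂ ⊆ P₁ ∪ P₂ := Finset.subset_union_right
  -- It is enough to cut one of the two contents so that the other one fits in between.
  suffices hs : (∃ U W, X₂ = U ++ W ∧ par (W ++ Y₂) = false ∧ (W = [] ∨ par Y₁ = false) ∧
      (U = [] ∨ par (X₁ ++ Y₁) = false)) ∨ (∃ U W, X₁ = U ++ W ∧ par (W ++ Y₁) = false ∧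
      (W = [] ∨ par Y₂ = false) ∧ (U = [] ∨ par (X₂ ++ Y₂) = false)) by
    rcases hs with ⟨U, W, rfl, k1, k2, k3⟩ | ⟨U, W, rfl, k1, k2, k3⟩
    · refine ⟨U ++ X₁ ++ W, h.insert hd m1 m2 h1 h2 k1 k2 k3, ?_⟩
      have m3 : ∀ u, some u ∈ U → u ∈ P₂ := fun u hu => m2 u (List.mem_append_left _ hu)
      have m4 : ∀ u, some u ∈ W → u ∈ P₂ := fun u hu => m2 u (List.mem_append_right _ hu)
      rw [List.filter_append, List.filter_append, f m1 s1, f m3 s2, f m4 s2, ht]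
      rw [List.filter_append] at hdd
      obtain ⟨h3, h4, h5⟩ := List.append_eq_replicate_iff.1 hdd
      rw [h4, h5, ← List.replicate_add, ← List.replicate_add]
      congr 1
      omega
    · refine ⟨U ++ X₂ ++ W, (h.symm.insert hd.symm m2 m1 h2 h1 k1 k2 k3).symm, ?_⟩
      have m3 : ∀ u, some u ∈ U → u ∈ P₁ := fun u hu => m1 u (List.mem_append_left _ hu)
      have m4 : ∀ u, some u ∈ W → u ∈ P₁ := fun u hu => m1 u (List.mem_append_right _ hu)
      rw [List.filter_append, List.filter_append, f m2 s2, f m3 s1, f m4 s1, hdd]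
      rw [List.filter_append] at ht
      obtain ⟨h3, h4, h5⟩ := List.append_eq_replicate_iff.1 ht
      rw [h4, h5, ← List.replicate_add, ← List.replicate_add]
      congr 1
      omega
  obtain ⟨g1, g2, g3⟩ := hg
  cases c1 : par Y₁ <;> cases c2 : par Y₂ <;> rw [c1, c2] at g1 <;> rw [c1] at g2 <;>
    rw [c2] at g3
  -- Both colours are even on the right, and not both are odd on the left. The content after which
  -- the colour is even goes to the right.
  · cases l1 : par (X₁ ++ Y₁)
    · exact .inl ⟨X₂, [], by simp, c2, .inl rfl, .inr rfl⟩
    · refine .inl ⟨[], X₂, by simp, ?_, .inr rfl, .inl rfl⟩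
      simpa [l1] using hp
  · by_cases hd0 : d = 0
    · have := h1.eq_nil (z1 (g3 hd0 rfl)) m1 c1
      exact .inr ⟨[], [], by simp [this], c1, .inl rfl, .inl rfl⟩
    · cases l2 : par (X₂ ++ Y₂)
      · exact .inl ⟨[], X₂, by simp, l2, .inr rfl, .inl rfl⟩
      -- The second colour is odd on both sides of the gap but changes inside; the first content
      -- goes to an even place in between.
      · obtain ⟨U, W, e, hW⟩ := exists_even_split (n2 hd0) c2
        refine .inl ⟨U, W, e, hW, .inr rfl, .inr ?_⟩
        simpa [l2] using hp
  · by_cases ht0 : t = 0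
    · have := h2.eq_nil (z2 (g2 ht0 rfl)) m2 c2
      exact .inl ⟨[], [], by simp [this], c2, .inl rfl, .inl rfl⟩
    · cases l1 : par (X₁ ++ Y₁)
      · exact .inr ⟨[], X₁, by simp, l1, .inr rfl, .inl rfl⟩
      · obtain ⟨U, W, e, hW⟩ := exists_even_split (n1 ht0) c1
        refine .inr ⟨U, W, e, hW, .inr rfl, .inr ?_⟩
        simpa [l1] using hp
  · simp at g1

/-- The cut is made directly in front of a kept letter, so that all hidden letters of a gap belong
to the gap. -/
theorem exists_trim {p : Option V → Bool} {Z A B : Word V} (h : Z.filter p = A ++ B) :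
    ∃ X Y, Z = X ++ Y ∧ X.filter p = A ∧ Y.filter p = B ∧ ∀ a s, Y = a :: s → p a = true := by
  obtain ⟨X, Y, rfl, h1, h2⟩ := List.filter_eq_append_iff.1 h
  clear h
  induction Y generalizing X with
  | nil => exact ⟨X, [], rfl, h1, h2, by simp⟩
  | cons a Y ih =>
    by_cases ha : p a = true
    · exact ⟨X, a :: Y, rfl, h1, h2, by rintro b s ⟨⟩; exact ha⟩
    · obtain ⟨X', Y', e, h⟩ := ih (X ++ [a]) (by simp [h1, ha]) (by simpa [ha] using h2)
      exact ⟨X', Y', by rw [← e]; simp, h⟩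

/-- The refinement is built from the right, gap by gap. Common bag letters are neutral: they belong
to neither set, so they change neither coverage nor colour. Shortening the runs of the refinement
gives the merged word. -/
theorem Merge.lift (hd : Disjoint P₁ P₂) {w₁ w₂ w : Word V} (h : Merge w₁ w₂ w) :
    ∀ Z₁ Z₂, Z₁.filter (keep P₁) = w₁ → Z₂.filter (keep P₂) = w₂ →
      (∀ a s, Z₁ = a :: s → keep P₁ a = true) → (∀ a s, Z₂ = a :: s → keep P₂ a = true) →
      Ok P₁ Z₁ → Ok P₂ Z₂ → ¬ (par Z₁ = true ∧ par Z₂ = true) →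
      ∃ Z, Lift P₁ P₂ Z₁ Z₂ Z ∧ nrm (Z.filter (keep (P₁ ∪ P₂))) = w := by
  induction h with
  | nil =>
    intro Z₁ Z₂ e1 e2 t1 t2 _ _ _
    have hnil : ∀ {P : Finset V} {Z : Word V}, Z.filter (keep P) = [] →
        (∀ a s, Z = a :: s → keep P a = true) → Z = [] := fun {P Z} h1 h2 => by
      cases Z with
      | nil => rfl
      | cons a s => exact absurd (h2 a s rfl) (List.filter_eq_nil_iff.1 h1 a (by simp))
    rw [hnil e1 t1, hnil e2 t2]
    exact ⟨[], ⟨trivial, rfl, by simp [meets], rfl, rfl⟩, rfl⟩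
  | @cons w₁ w₂ w a t d hm ht hd2 hg ih =>
    intro Z₁ Z₂ e1 e2 t1 t2 o1 o2 hp
    have hhead : ∀ {P : Finset V} {Z : Word V} {r : Word V},
        Z.filter (keep P) = some a :: r → (∀ a s, Z = a :: s → keep P a = true) →
        a ∉ P ∧ ∃ s, Z = some a :: s ∧ s.filter (keep P) = r := fun {P Z r} h1 h2 => by
      cases Z with
      | nil => simp at h1
      | cons b s =>
        have hb := h2 b s rfl
        rw [List.filter_cons_of_pos hb, List.cons.injEq] at h1
        obtain ⟨rfl, h1⟩ := h1
        exact ⟨by simpa [keep] using hb, s, rfl, h1⟩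
    obtain ⟨a1, s₁, rfl, e1'⟩ := hhead e1 t1
    obtain ⟨a2, s₂, rfl, e2'⟩ := hhead e2 t2
    obtain ⟨X₁, Y₁, rfl, x1, y1, t1⟩ := exists_trim e1'
    obtain ⟨X₂, Y₂, rfl, x2, y2, t2⟩ := exists_trim e2'
    have p1 : par Y₁ = par w₁ := by rw [← y1, par_filter rfl]
    have p2 : par Y₂ = par w₂ := by rw [← y2, par_filter rfl]
    obtain ⟨Y, hY, hn⟩ := ih Y₁ Y₂ y1 y2 t1 t2 o1.tail.right o2.tail.right
      (by rw [p1, p2]; exact hg.1)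
    obtain ⟨X, hX, hf⟩ := hY.gap hd x1 x2 o1.tail o2.tail (by rw [p1, p2]; exact hg) hp
    refine ⟨some a :: (X ++ Y), ⟨⟨fun h => ?_, hX.ok⟩, hX.par_eq, fun u hu v hv => ?_, ?_, ?_⟩, ?_⟩
    · rcases Finset.mem_union.1 h with h | h
      exacts [absurd h a1, absurd h a2]
    · rw [meets_skip, hX.cross u hu v hv]
      · intro e; rw [Option.some_inj] at e; exact a1 (e ▸ hu)
      · intro e; rw [Option.some_inj] at e; exact a2 (e ▸ hv)
    · rw [List.filter_cons_of_pos (by simpa using a2), List.filter_cons_of_pos rfl, hX.left]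
    · rw [List.filter_cons_of_pos (by simpa using a1), List.filter_cons_of_pos rfl, hX.right]
    · rw [List.filter_cons_of_pos (by simp [keep, a1, a2]), nrm, ncons_some, List.filter_append,
        hf, nrm_append_replicate, hn]

theorem Joins.lift (hd : Disjoint P₁ P₂) {Z₁ Z₂ σ : Word V}
    (h : Joins (Z₁.filter (keep P₁)) (Z₂.filter (keep P₂)) σ) (o1 : Ok P₁ Z₁) (o2 : Ok P₂ Z₂)
    (hp : ¬ (par Z₁ = true ∧ par Z₂ = true)) :
    ∃ Z, Lift P₁ P₂ Z₁ Z₂ Z ∧ nrm (Z.filter (keep (P₁ ∪ P₂))) = σ := by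
  obtain ⟨w₁, w₂, w, t, d, hm, ht, hd2, hg, e1, e2, rfl⟩ := h
  obtain ⟨X₁, Y₁, rfl, x1, y1, t1⟩ := exists_trim e1
  obtain ⟨X₂, Y₂, rfl, x2, y2, t2⟩ := exists_trim e2
  have p1 : par Y₁ = par w₁ := by rw [← y1, par_filter rfl]
  have p2 : par Y₂ = par w₂ := by rw [← y2, par_filter rfl]
  obtain ⟨Y, hY, hn⟩ := hm.lift hd Y₁ Y₂ y1 y2 t1 t2 o1.right o2.right
    (by rw [p1, p2]; exact hg.1)
  obtain ⟨X, hX, hf⟩ := hY.gap hd x1 x2 o1 o2 (by rw [p1, p2]; exact hg) hp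
  exact ⟨X ++ Y, hX, by rw [List.filter_append, hf, nrm_append_replicate, hn]⟩

end join

/-! ### Soundness of all derivations -/

section witness

variable [Fintype V] {G : SimpleGraph V}

/-- Only stars of the witness are changed, so its intersections remain. What `x` meets is either a
past vertex, where adjacency was known, or a bag vertex, visible in `σ`, where it has just been
tested. -/
theorem Wit.forget {P B : Finset V} {σ : Word V} {v : ℕ} {x : V} (hP : x ∉ P) (hB : x ∈ B)
    (hd : Disjoint P B) (h : Wit G P B σ v)
    (hadj : ∀ y, y ≠ x → some y ∈ σ → meets x y σ = true → G.Adj x y) :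
    Wit G (insert x P) (B.erase x) (fg x σ) (v + gain x σ) := by
  rw [fg_eq_nrm]
  refine Wit.nrm (u := []) ?_
  obtain ⟨Z, h1, h2, h3, h4, rfl, h6, rfl⟩ := h
  have hl := fgKeep_letters x Z
  have hPB : insert x P ∪ B.erase x = P ∪ B := by
    ext y
    simp only [Finset.mem_union, Finset.mem_insert, Finset.mem_erase]
    by_cases hy : y = x
    · subst hy; simp [hB]
    · simp [hy]
  have hk : ∀ {y}, y ∉ P → keep P (some y) = true := fun {y} hy => by simpa [keep] using hy
  have hpos : ∀ {a b}, meets a b Z = true → b ∈ P ∪ B := fun {a b} h => by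
    by_contra hb; exact meets_count_right h (h2 b hb)
  have hB2 : ∀ y ∈ B, y ∉ P := fun y h h' => Finset.disjoint_left.1 hd h' h
  have hadj2 : ∀ y, y ≠ x → y ∉ P → meets x y Z = true → G.Adj x y := fun y hy hyP hm => by
    refine hadj y hy ?_ (by rwa [meets_filter (hk hP) (hk hyP)])
    exact List.mem_filter.2 ⟨List.count_pos_iff.1 (Nat.pos_of_ne_zero (meets_count_right hm)),
      hk hyP⟩
  refine ⟨fgKeep x Z, fun u hu => ?_, fun u hu => ?_, ok_fgKeep h3, ?_, filter_fgKeep hP Z,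
    fun u hu w hw hm => ?_, ?_⟩
  · rw [count_congr hl]; exact h1 u (hPB ▸ hu)
  · rw [count_congr hl]; exact h2 u (hPB ▸ hu)
  · rw [par_fgKeep, h4, opn_eq_count, h1 x (Finset.mem_union_right _ hB)]; rfl
  · rw [meets_congr hl] at hm
    rcases Finset.mem_insert.1 hu with rfl | hu
    · by_cases hwP : w ∈ P
      · exact (h6 w hwP u (Ne.symm hw) (by rwa [meets_comm])).symm
      · exact hadj2 w hw hwP hm
    · exact h6 u hu w hw hm
  · rw [val_congr fun a b _ => meets_congr hl a b, val_insert hP, gain_eq (B := B)]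
    · congr 3
      ext y
      simp only [Finset.mem_filter, Finset.mem_univ, true_and]
      refine and_congr_right fun hyx => ⟨fun h => ?_, fun h => ?_⟩
      · refine ⟨(Finset.mem_union.1 (hpos h.2)).resolve_left h.1, ?_⟩
        rw [meets_filter (hk hP) (hk h.1)]; exact h.2
      · rw [meets_filter (hk hP) (hk (hB2 y h.1))] at h
        exact ⟨hB2 y h.1, h.2⟩
    · intro y hy
      rw [List.count_filter (hk (hB2 y hy))]
      exact h1 y (Finset.mem_union_right _ hy)
    · intro y hy
      rw [List.mem_filter] at hy
      by_contra hyB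
      have := h2 y (by simp [hyB, keep] at hy ⊢; exact hy.2)
      exact List.count_eq_zero.1 this hy.1

/-- In the common refinement, intersections that involve `P₁` are those of the first witness and
intersections that involve `P₂` those of the second; across there are none. So adjacency carries
over and the values add up. -/
theorem Wit.join {P₁ P₂ B : Finset V} {σ₁ σ₂ σ : Word V} {v₁ v₂ : ℕ} (h₁ : Wit G P₁ B σ₁ v₁)
    (h₂ : Wit G P₂ B σ₂ v₂) (h : Joins σ₁ σ₂ σ) (hd : Disjoint P₁ P₂) (d1 : Disjoint P₁ B)
    (d2 : Disjoint P₂ B) : Wit G (P₁ ∪ P₂) B σ (v₁ + v₂) := by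
  obtain ⟨Z₁, a1, a2, a3, a4, rfl, a6, rfl⟩ := h₁
  obtain ⟨Z₂, b1, b2, b3, b4, rfl, b6, rfl⟩ := h₂
  obtain ⟨Z, hZ, rfl⟩ := h.lift hd a3 b3 (by simp [a4])
  refine Wit.nrm (u := []) ?_
  have e1 : ∀ u ∈ P₁, u ∉ P₂ := fun u h h' => Finset.disjoint_left.1 hd h h'
  have e2 : ∀ u ∈ P₂, u ∉ P₁ := fun u h h' => Finset.disjoint_left.1 hd h' h
  have n1 : ∀ u ∈ P₂, Z₁.count (some u) = 0 := fun u hu => a2 u (by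
    have := e2 u hu
    have := Finset.disjoint_left.1 d2 hu
    simp [*])
  have n2 : ∀ u ∈ P₁, Z₂.count (some u) = 0 := fun u hu => b2 u (by
    have := e1 u hu
    have := Finset.disjoint_left.1 d1 hu
    simp [*])
  refine ⟨Z, fun u hu => ?_, fun u hu => ?_, hZ.ok, by rw [hZ.par_eq, a4, b4]; rfl, rfl,
    fun u hu w hw hm => ?_, ?_⟩
  · by_cases h2 : u ∈ P₂
    · rw [hZ.symm.count_left (e2 u h2)]; exact b1 u (Finset.mem_union_left _ h2)
    · rw [hZ.count_left h2]; exact a1 u (by simpa [h2] using hu)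
  · simp only [Finset.mem_union, not_or] at hu
    rw [hZ.count_left hu.1.2]; exact a2 u (by simp [hu])
  · by_cases h2 : u ∈ P₂
    · by_cases hw1 : w ∈ P₁
      · rw [meets_comm, hZ.cross w hw1 u h2] at hm; simp at hm
      · rw [hZ.symm.meets_left (e2 u h2) hw1] at hm
        exact b6 u h2 w hw hm
    · have h1 : u ∈ P₁ := (Finset.mem_union.1 hu).resolve_right h2
      by_cases hw1 : w ∈ P₂
      · rw [hZ.cross u h1 w hw1] at hm; simp at hm
      · rw [hZ.meets_left h2 hw1] at hm
        exact a6 u h1 w hw hm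
  · refine val_union (fun u v hu hv => hZ.meets_left hu hv)
      (fun u v hu hv => hZ.symm.meets_left hu hv) hZ.cross (fun u _ v hv => ?_)
      (fun u hu v _ => ?_) hd
    · rw [← Bool.not_eq_true]; exact fun h => meets_count_right h (n1 v hv)
    · rw [← Bool.not_eq_true]; exact fun h => meets_count h (n2 u hu)

-- Soundness: every derived word comes with an arrangement of intervals that attains its value.
open NiceTree in
theorem _root_.NiceTree.Der.wit {t : NiceTree V} {σ : Word V} {v : ℕ} (h : Der G t σ v)
    (ht : t.Separated G) : Wit G t.past t.bag σ v := by
  induction h with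
  | leaf =>
    exact ⟨[], by simp [past, bag], by simp, trivial, rfl, rfl, by simp [past], by simp [val, past]⟩
  | introduce x h hτ ih => exact Wit.intro (u := []) ht.2.1 ht.1 (ih ht.2.2) hτ
  | forget x h hadj ih =>
    have hd := ht.2.2.disjoint
    exact Wit.forget (fun h => Finset.disjoint_left.1 hd h ht.1) ht.1 hd (ih ht.2.2) hadj
  | join h₁ h₂ hj ih₁ ih₂ =>
    exact Wit.join (ih₁ ht.2.2.1) (ht.1 ▸ ih₂ ht.2.2.2) hj ht.2.1 ht.2.2.1.disjoint
      (ht.1 ▸ ht.2.2.2.disjoint)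

end witness

end Word

/-! ### Bags of a tree decomposition separate past from future -/

namespace NiceTree

variable {V : Type*}

theorem subtree_append (t : NiceTree V) (p q : List Bool) :
    t.subtree (p ++ q) = (t.subtree p).bind (·.subtree q) := by
  induction p generalizing t with
  | nil => cases t <;> simp [subtree]
  | cons b p ih =>
    cases t <;> cases b <;> simp [subtree, ih]

variable [DecidableEq V]

theorem bag_subset {t : NiceTree V} (ht : t.WellFormed) {q : List Bool} {s : NiceTree V}
    (h : t.subtree q = some s) : s.bag ⊆ t.past ∪ t.bag := by
  induction t generalizing q with
  | leaf =>
    rcases q with _ | ⟨b, q⟩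
    · simp only [subtree, Option.some.injEq] at h; subst h; simp
    · simp [subtree] at h
  | introduce x t ih =>
    rcases q with _ | ⟨_ | _, q⟩
    · simp only [subtree, Option.some.injEq] at h; subst h; simp
    · refine (ih ht.2 (by simpa [subtree] using h)).trans fun y hy => ?_
      simp only [past, bag, Finset.mem_union, Finset.mem_insert] at hy ⊢
      tauto
    · simp [subtree] at h
  | forget x t ih =>
    rcases q with _ | ⟨_ | _, q⟩
    · simp only [subtree, Option.some.injEq] at h; subst h; simp
    · refine (ih ht.2 (by simpa [subtree] using h)).trans fun y hy => ?_
      simp only [past, bag, Finset.mem_union, Finset.mem_insert, Finset.mem_erase] at hy ⊢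
      tauto
    · simp [subtree] at h
  | join t₁ t₂ ih₁ ih₂ =>
    rcases q with _ | ⟨_ | _, q⟩
    · simp only [subtree, Option.some.injEq] at h; subst h; simp
    · refine (ih₁ ht.2.1 (by simpa [subtree] using h)).trans fun y hy => ?_
      simp only [past, bag, Finset.mem_union] at hy ⊢
      tauto
    · refine (ih₂ ht.2.2 (by simpa [subtree] using h)).trans fun y hy => ?_
      rw [← ht.1] at hy
      simp only [past, bag, Finset.mem_union] at hy ⊢
      tauto

theorem exists_bag_of_past {t : NiceTree V} (ht : t.WellFormed) {x : V} (hx : x ∈ t.past) :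
    ∃ q s, t.subtree q = some s ∧ x ∈ s.bag := by
  induction t with
  | leaf => simp [past] at hx
  | introduce y t ih =>
    obtain ⟨q, s, h⟩ := ih ht.2 hx
    exact ⟨false :: q, s, by simpa [subtree] using h⟩
  | forget y t ih =>
    rcases Finset.mem_insert.1 hx with rfl | hx
    · exact ⟨[false], t, by cases t <;> simp [subtree], ht.1⟩
    · obtain ⟨q, s, h⟩ := ih ht.2 hx
      exact ⟨false :: q, s, by simpa [subtree] using h⟩
  | join t₁ t₂ ih₁ ih₂ =>
    rcases Finset.mem_union.1 hx with hx | hx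
    · obtain ⟨q, s, h⟩ := ih₁ ht.2.1 hx
      exact ⟨false :: q, s, by simpa [subtree] using h⟩
    · obtain ⟨q, s, h⟩ := ih₂ ht.2.2 hx
      exact ⟨true :: q, s, by simpa [subtree] using h⟩

/-- A walk that leaves the subtree at `p ++ [b]` visits its root and the parent of the root. -/
theorem mem_support_of_leave {t : NiceTree V} {i j : t.Node} (w : t.graph.Walk i j)
    {p : List Bool} {b : Bool} (hi : p ++ [b] <+: i.1) (hj : ¬ p ++ [b] <+: j.1) :
    (∃ m ∈ w.support, m.1 = p ++ [b]) ∧ ∃ m ∈ w.support, m.1 = p := by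
  induction w with
  | nil => exact absurd hi hj
  | @cons i k j hik w ih =>
    by_cases hk : p ++ [b] <+: k.1
    · obtain ⟨⟨m, hm, e⟩, m', hm', e'⟩ := ih hk hj
      exact ⟨⟨m, by simp [hm], e⟩, m', by simp [hm'], e'⟩
    · rcases hik with ⟨c, e⟩ | ⟨c, e⟩
      · exact absurd (e ▸ hi.trans (List.prefix_append _ _)) hk
      · have h2 : p ++ [b] = k.1 ++ [c] := by
          rw [e] at hi
          exact (List.prefix_concat_iff.1 hi).resolve_right hk
        refine ⟨⟨i, SimpleGraph.Walk.start_mem_support _, by rw [e, h2]⟩, k,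
          List.mem_cons_of_mem _ w.start_mem_support, ?_⟩
        exact (List.append_inj' h2 rfl).1.symm

section

variable {t : NiceTree V} {G : SimpleGraph V}

theorem bagAt_eq {p : List Bool} {s : NiceTree V} (h : t.subtree p = some s)
    (hp : (t.subtree p).isSome) : t.bagAt ⟨p, hp⟩ = s.bag := by
  simp [bagAt, h]

/-- A path between nodes inside and outside of a subtree uses the edge above its root, and the bags
containing `x` are closed under paths. -/
theorem IsNiceTreeDecomposition.mem_bag (ht : t.IsNiceTreeDecomposition G) {x : V}
    {p i j : List Bool} {b : Bool} {s s' si sj : NiceTree V} (hs : t.subtree (p ++ [b]) = some s)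
    (hs' : t.subtree p = some s') (hi : t.subtree i = some si) (hj : t.subtree j = some sj)
    (hpi : p ++ [b] <+: i) (hpj : ¬ p ++ [b] <+: j) (hxi : x ∈ si.bag) (hxj : x ∈ sj.bag) :
    x ∈ s.bag ∧ x ∈ s'.bag := by
  classical
  have hT := ht.isTreeDecomposition
  let I : t.Node := ⟨i, by rw [hi]; rfl⟩
  let J : t.Node := ⟨j, by rw [hj]; rfl⟩
  obtain ⟨w⟩ := hT.isTree.connected.preconnected I J
  have hp := w.toPath.2
  have hb := hT.mem_of_path x I J _ hp (by rw [bagAt_eq hi]; exact hxi)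
    (by rw [bagAt_eq hj]; exact hxj)
  obtain ⟨⟨m, hm, e⟩, m', hm', e'⟩ := mem_support_of_leave (w.toPath : t.graph.Walk I J) hpi hpj
  constructor
  · have h := hb m hm
    obtain ⟨m, hmm⟩ := m
    obtain rfl : m = _ := e
    rwa [bagAt_eq hs] at h
  · have h := hb m' hm'
    obtain ⟨m', hmm⟩ := m'
    obtain rfl : m' = _ := e'
    rwa [bagAt_eq hs'] at h

theorem wellFormed_subtree (ht : t.WellFormed) {p : List Bool} {s : NiceTree V}
    (h : t.subtree p = some s) : s.WellFormed := by
  induction p generalizing t with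
  | nil =>
    have : t = s := by cases t <;> simpa [subtree] using h
    exact this ▸ ht
  | cons b p ih =>
    cases t <;> cases b <;> simp only [subtree, reduceCtorEq] at h
    exacts [ih ht.2 h, ih ht.2 h, ih ht.2.1 h, ih ht.2.2 h]

/-- A vertex forgotten below a node occurs in a bag below it. If it also occurs outside, `mem_bag`
puts it into the bag on the connecting edge, which is impossible for a vertex introduced only now or
forgotten in both branches of a join. A neighbour of a forgotten `x` shares a bag with `x`, and this
bag must be below the forget node, whose own bag lacks `x`. -/
theorem IsNiceTreeDecomposition.separated_subtree (ht : t.IsNiceTreeDecomposition G)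
    (s : NiceTree V) : ∀ p, t.subtree p = some s → s.Separated G := by
  have hnil : ∀ s : NiceTree V, s.subtree [] = some s := fun s => by cases s <;> rfl
  have hpre : ∀ (p : List Bool) (b : Bool), ¬ p ++ [b] <+: p := fun p b h => by
    have := h.length_le
    simp at this
  induction s with
  | leaf => intro p _; trivial
  | introduce x s ih =>
    intro p h
    have h1 : t.subtree (p ++ [false]) = some s := by
      rw [subtree_append, h]; simp [subtree, hnil]
    have hwf := wellFormed_subtree ht.wellFormed h
    refine ⟨hwf.1, fun hx => ?_, ih _ h1⟩
    obtain ⟨q, r, hq, hxr⟩ := exists_bag_of_past hwf.2 hx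
    have h2 : t.subtree (p ++ [false] ++ q) = some r := by rw [subtree_append, h1]; exact hq
    exact hwf.1 (ht.mem_bag h1 h h2 h (List.prefix_append _ _) (hpre _ _) hxr (by simp [bag])).1
  | forget x s ih =>
    intro p h
    have h1 : t.subtree (p ++ [false]) = some s := by
      rw [subtree_append, h]; simp [subtree, hnil]
    have hwf := wellFormed_subtree ht.wellFormed h
    refine ⟨hwf.1, fun y hy => ?_, ih _ h1⟩
    obtain ⟨⟨i, hi⟩, hxi, hyi⟩ := ht.isTreeDecomposition.exists_bag x y hy
    obtain ⟨r, hr⟩ := Option.isSome_iff_exists.1 hi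
    rw [bagAt_eq hr] at hxi hyi
    by_cases hp : p ++ [false] <+: i
    · obtain ⟨q, rfl⟩ := hp
      rw [subtree_append, h1] at hr
      exact bag_subset hwf.2 hr hyi
    · have := (ht.mem_bag h1 h h1 hr List.prefix_rfl hp hwf.1 hxi).2
      simp [bag] at this
  | join s₁ s₂ ih₁ ih₂ =>
    intro p h
    have h1 : t.subtree (p ++ [false]) = some s₁ := by
      rw [subtree_append, h]; simp [subtree, hnil]
    have h2 : t.subtree (p ++ [true]) = some s₂ := by
      rw [subtree_append, h]; simp [subtree, hnil]
    have hwf := wellFormed_subtree ht.wellFormed h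
    refine ⟨hwf.1, ?_, ih₁ _ h1, ih₂ _ h2⟩
    rw [Finset.disjoint_left]
    intro x hx1 hx2
    obtain ⟨q, r, hq, hxr⟩ := exists_bag_of_past hwf.2.1 hx1
    obtain ⟨q', r', hq', hxr'⟩ := exists_bag_of_past hwf.2.2 hx2
    have g1 : t.subtree (p ++ [false] ++ q) = some r := by rw [subtree_append, h1]; exact hq
    have g2 : t.subtree (p ++ [true] ++ q') = some r' := by rw [subtree_append, h2]; exact hq'
    have := (ht.mem_bag h1 h g1 g2 (List.prefix_append _ _) (by simp) hxr hxr').1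
    exact Finset.disjoint_left.1 (ih₁ _ h1).disjoint hx1 this

theorem IsNiceTreeDecomposition.separated (ht : t.IsNiceTreeDecomposition G) : t.Separated G :=
  ht.separated_subtree t [] (by cases t <;> rfl)

/-- The root bag is empty, so everything that occurs in some bag has been forgotten at the root.
Only isolated vertices can be missing. -/
theorem IsNiceTreeDecomposition.mem_past (ht : t.IsNiceTreeDecomposition G) {u v : V}
    (h : G.Adj u v) : u ∈ t.past := by
  obtain ⟨⟨i, hi⟩, hui, -⟩ := ht.isTreeDecomposition.exists_bag u v h
  obtain ⟨r, hr⟩ := Option.isSome_iff_exists.1 hi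
  rw [bagAt_eq hr] at hui
  have := bag_subset ht.wellFormed hr hui
  rwa [ht.root_bag, Finset.union_empty] at this

/-- The pairs of vertices that lie in a common bag. -/
def bagPairs : NiceTree V → Finset (V × V)
  | leaf => ∅
  | introduce x t => (introduce x t).bag ×ˢ (introduce x t).bag ∪ t.bagPairs
  | forget x t => (forget x t).bag ×ˢ (forget x t).bag ∪ t.bagPairs
  | join t₁ t₂ => t₁.bag ×ˢ t₁.bag ∪ (t₁.bagPairs ∪ t₂.bagPairs)

theorem mem_bagPairs {q : List Bool} {s : NiceTree V} (h : t.subtree q = some s) {u v : V}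
    (hu : u ∈ s.bag) (hv : v ∈ s.bag) : (u, v) ∈ t.bagPairs := by
  induction q generalizing t with
  | nil =>
    have : t = s := by cases t <;> simpa [subtree] using h
    subst this
    cases t with
    | leaf => simp [bag] at hu
    | introduce x t => exact Finset.mem_union_left _ (by simp [hu, hv])
    | forget x t => exact Finset.mem_union_left _ (by simp [hu, hv])
    | join t₁ t₂ => exact Finset.mem_union_left _ (Finset.mem_product.2 ⟨hu, hv⟩)
  | cons b p ih =>
    cases t <;> cases b <;> simp only [subtree, reduceCtorEq] at h
    · exact Finset.mem_union_right _ (ih h)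
    · exact Finset.mem_union_right _ (ih h)
    · exact Finset.mem_union_right _ (Finset.mem_union_left _ (ih h))
    · exact Finset.mem_union_right _ (Finset.mem_union_right _ (ih h))

theorem card_bagPairs {b : ℕ} (h : t.maxBagCard ≤ b) : t.bagPairs.card ≤ t.numNodes * b ^ 2 := by
  have hp : ∀ {s : Finset V}, s.card ≤ b → (s ×ˢ s).card ≤ b ^ 2 := fun {s} hs => by
    rw [Finset.card_product, sq]; exact Nat.mul_le_mul hs hs
  induction t with
  | leaf => simp [bagPairs]
  | introduce x t ih =>
    simp only [maxBagCard, max_le_iff] at h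
    refine (Finset.card_union_le _ _).trans ?_
    have := ih h.2
    have := hp h.1
    rw [numNodes, Nat.add_mul]; omega
  | forget x t ih =>
    simp only [maxBagCard, max_le_iff] at h
    refine (Finset.card_union_le _ _).trans ?_
    have := ih h.2
    have := hp h.1
    rw [numNodes, Nat.add_mul]; omega
  | join t₁ t₂ ih₁ ih₂ =>
    simp only [maxBagCard, max_le_iff] at h
    refine (Finset.card_union_le _ _).trans ?_
    have := ih₁ h.2.1
    have := ih₂ h.2.2
    have h3 := hp h.1
    have := Finset.card_union_le t₁.bagPairs t₂.bagPairs
    rw [bag] at h3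
    rw [numNodes, Nat.add_mul, Nat.add_mul]; omega

/-- Each edge is a pair inside some bag. Reading the edge list therefore fits into the time bound.
-/
theorem IsNiceTreeDecomposition.length_edgeList {n : ℕ} {t : NiceTree (Fin n)}
    {G : SimpleGraph (Fin n)} {E : List (Fin n × Fin n)} (ht : t.IsNiceTreeDecomposition G)
    (hE : IsEdgeList E G) : E.length ≤ t.numNodes * t.maxBagCard ^ 2 := by
  refine le_trans ?_ (card_bagPairs le_rfl)
  rw [← List.toFinset_card_of_nodup hE.2.of_map]
  refine Finset.card_le_card fun e he => ?_
  have hadj : G.Adj e.1 e.2 := by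
    rw [← SimpleGraph.mem_edgeSet, hE.1]
    exact List.mem_map_of_mem (f := fun a => s(a.1, a.2)) (List.mem_toFinset.1 he)
  obtain ⟨⟨i, hi⟩, hui, hvi⟩ := ht.isTreeDecomposition.exists_bag _ _ hadj
  obtain ⟨r, hr⟩ := Option.isSome_iff_exists.1 hi
  rw [bagAt_eq hr] at hui hvi
  exact mem_bagPairs hr hui hvi

end

end NiceTree

/-! ### Words and interval representations -/

namespace Word

section positions

variable {V : Type*} [DecidableEq V]

theorem opn_drop {w : Word V} {v : V} {i j : ℕ} (hij : i < j)
    (h : ∀ m, w[m]? = some (some v) ↔ m = i ∨ m = j) (m : ℕ) :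
    opn v (w.drop m) = decide (i < m ∧ m ≤ j) := by
  have hj : j < w.length := by
    by_contra hj
    have := (h j).2 (.inr rfl)
    rw [List.getElem?_eq_none (by omega)] at this
    simp at this
  obtain hm | hm := le_or_gt w.length m
  · rw [List.drop_eq_nil_of_le hm, opn, eq_comm, decide_eq_false_iff_not]
    omega
  · obtain ⟨k, hk⟩ := Nat.exists_eq_add_of_le hm.le
    induction k generalizing m with
    | zero => omega
    | succ k ih =>
      rw [List.drop_eq_getElem_cons hm, opn]
      have hm1 : opn v (w.drop (m + 1)) = decide (i < m + 1 ∧ m + 1 ≤ j) := by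
        obtain h1 | h1 := le_or_gt w.length (m + 1)
        · rw [List.drop_eq_nil_of_le h1, opn, eq_comm, decide_eq_false_iff_not]
          omega
        · exact ih (m + 1) h1 (by omega)
      have := h m
      rw [List.getElem?_eq_getElem hm, Option.some_inj] at this
      rw [hm1]
      split_ifs with h2
      · rw [← decide_not, decide_eq_decide]
        have := this.1 h2
        omega
      · rw [decide_eq_decide]
        have := mt this.2 h2
        omega

theorem meets_iff_drop (u v : V) (w : Word V) : meets u v w = true ↔
    ∃ m, opn u (w.drop m) = true ∧ opn v (w.drop m) = true := by
  induction w with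
  | nil => simp [meets, opn]
  | cons a w ih =>
    simp only [meets, Bool.or_eq_true, Bool.and_eq_true, ih]
    constructor
    · rintro (h | ⟨m, h⟩)
      · exact ⟨0, h⟩
      · exact ⟨m + 1, h⟩
    · rintro ⟨m | m, h⟩
      · exact .inl h
      · exact .inr ⟨m, h⟩

theorem meets_iff {w : Word V} {u v : V} {i j i' j' : ℕ} (hij : i < j)
    (h : ∀ m, w[m]? = some (some u) ↔ m = i ∨ m = j) (hij' : i' < j')
    (h' : ∀ m, w[m]? = some (some v) ↔ m = i' ∨ m = j') :
    meets u v w = true ↔ i < j' ∧ i' < j := by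
  simp only [meets_iff_drop, opn_drop hij h, opn_drop hij' h', decide_eq_true_eq]
  constructor
  · rintro ⟨m, h⟩; omega
  -- Both intervals are open just right of the later of the two left ends.
  · intro h; exact ⟨max i i' + 1, by omega⟩

theorem exists_positions {w : Word V} {v : V} (h : w.count (some v) = 2) :
    ∃ i j : ℕ, i < j ∧ ∀ m, w[m]? = some (some v) ↔ m = i ∨ m = j := by
  have h0 : ∀ w : Word V, w.count (some v) = 0 → ∀ m, w[m]? ≠ some (some v) := fun w h m hm =>
    List.count_eq_zero.1 h (List.mem_of_getElem? hm)
  have h1 : ∀ w : Word V, w.count (some v) = 1 → ∃ j : ℕ, ∀ m, w[m]? = some (some v) ↔ m = j := by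
    intro w h
    induction w with
    | nil => simp at h
    | cons a w ih =>
      by_cases ha : a = some v
      · subst ha
        rw [List.count_cons_self] at h
        refine ⟨0, fun m => ?_⟩
        rcases m with _ | m
        · simp
        · simpa using h0 w (by omega) m
      · rw [List.count_cons_of_ne (by simpa using ha)] at h
        obtain ⟨j, hj⟩ := ih h
        refine ⟨j + 1, fun m => ?_⟩
        rcases m with _ | m
        · simpa using ha
        · simpa using hj m
  induction w with
  | nil => simp at h
  | cons a w ih =>
    by_cases ha : a = some v
    · subst ha
      rw [List.count_cons_self] at h
      obtain ⟨j, hj⟩ := h1 w (by omega)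
      refine ⟨0, j + 1, by omega, fun m => ?_⟩
      rcases m with _ | m
      · simp
      · simpa using hj m
    · rw [List.count_cons_of_ne (by simpa using ha)] at h
      obtain ⟨i, j, hij, hj⟩ := ih h
      refine ⟨i + 1, j + 1, by omega, fun m => ?_⟩
      rcases m with _ | m
      · simpa using ha
      · simpa using hj m

/-- The points are ordered by the positions of the letters, shifted by one to leave room for `⊥`.
Distinct points have distinct keys because a position carries only one letter. -/
theorem exists_representation {w : Word V} (hw : ∀ v, w.count (some v) = 2) :
    ∃ π : IntervalRepresentation V, ∀ u v, π.graph.Adj u v ↔ u ≠ v ∧ meets u v w = true := by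
  choose i j hij h using fun v => exists_positions (hw v)
  have hj : ∀ v, j v < w.length := fun v => by
    by_contra hj
    have := (h v (j v)).2 (.inr rfl)
    rw [List.getElem?_eq_none (by omega)] at this
    simp at this
  let key : LR V → ℕ
    | .bot => 0
    | .l v => i v + 1
    | .r v => j v + 1
    | .top => w.length + 1
  have hinj : Function.Injective key := by
    have e : ∀ {u v : V} {m : ℕ}, w[m]? = some (some u) → w[m]? = some (some v) → u = v := fun h1 h2 => by
      rw [h1] at h2; simpa using h2
    have hi1 : ∀ v, w[i v]? = some (some v) := fun v => (h v _).2 (.inl rfl)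
    have hj1 : ∀ v, w[j v]? = some (some v) := fun v => (h v _).2 (.inr rfl)
    have hne : ∀ u v, i u ≠ j v := fun u v huv => by
      obtain rfl := e (hi1 u) (huv ▸ hj1 v)
      exact absurd huv (hij u).ne
    rintro (_ | u | u | _) (_ | v | v | _) huv
    any_goals rfl
    all_goals simp only [key] at huv
    all_goals try
      have := hij u
    all_goals try
      have := hij v
    all_goals try
      have := hj u
    all_goals try
      have := hj v
    all_goals try omega
    · exact congrArg _ (e (hi1 u) (by rw [show i u = i v by omega]; exact hi1 v))
    · exact absurd (show i u = j v by omega) (hne u v)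
    · exact absurd (show i v = j u by omega) (hne v u)
    · exact congrArg _ (e (hj1 u) (by rw [show j u = j v by omega]; exact hj1 v))
  have hlt : ∀ a b, (LinearOrder.lift' key hinj).lt a b ↔ key a < key b := fun a b => Iff.rfl
  refine ⟨⟨LinearOrder.lift' key hinj, fun v => ?_, fun v => ?_, fun v => ?_, ?_⟩, fun u v => ?_⟩
  · rw [hlt]; simp [key]
  · rw [hlt]; simp [key, hij]
  · rw [hlt]; simp [key, hj]
  · rw [hlt]; simp [key]
  · rw [meets_iff (hij u) (h u) (hij v) (h v)]
    simp only [IntervalRepresentation.graph, IntervalRepresentation.Intersect]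
    rw [hlt, hlt]
    simp [key]

/-- The points are listed in increasing order and replaced by their vertices. The two extreme points
become stars, which no intersection depends on. -/
theorem exists_word [Finite V] (π : IntervalRepresentation V) :
    ∃ w : Word V, (∀ v, w.count (some v) = 2) ∧
      ∀ u v, π.graph.Adj u v ↔ u ≠ v ∧ meets u v w = true := by
  let f : LR V → Option V
    | .bot => none
    | .l v => some v
    | .r v => some v
    | .top => none
  have : Finite (LR V) := by
    let g : LR V → Option (Option (V ⊕ V))
      | .bot => none
      | .l v => some (some (.inl v))
      | .r v => some (some (.inr v))
      | .top => some none
    refine Finite.of_injective g ?_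
    rintro (_ | u | u | _) (_ | v | v | _) huv <;> simp [g] at huv <;> simp [huv]
  let _ := Fintype.ofFinite (LR V)
  let _ := π.order
  let e := Fintype.orderIsoFinOfCardEq (LR V) rfl
  have hf : ∀ a v, f a = some v ↔ a = .l v ∨ a = .r v := by
    rintro (_ | u | u | _) v <;> simp [f]
  have hpos : ∀ v m, (List.ofFn (f ∘ e))[m]? = some (some v) ↔
      m = (e.symm (.l v) : ℕ) ∨ m = (e.symm (.r v) : ℕ) := fun v m => by
    rw [List.getElem?_ofFn]
    split_ifs with hm
    · simp only [Option.some_inj, Function.comp, hf]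
      refine or_congr ?_ ?_ <;>
      · constructor
        · intro h; rw [← h]; simp
        · intro h
          rw [show (⟨m, hm⟩ : Fin _) = e.symm _ from Fin.ext h]
          simp
    · simp only [reduceCtorEq, false_iff]
      rintro (rfl | rfl) <;> exact hm (Fin.is_lt _)
  have hlt : ∀ v, (e.symm (.l v) : ℕ) < e.symm (.r v) := fun v =>
    e.symm.strictMono (π.l_lt_r v)
  refine ⟨List.ofFn (f ∘ e), fun v => ?_, fun u v => ?_⟩
  · have h1 : List.ofFn (f ∘ e) = (List.ofFn e).map f := List.map_ofFn.symm
    have h2 : List.Perm ((List.ofFn e).filter (fun a => f a = some v)) [.l v, .r v] := by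
      rw [List.perm_ext_iff_of_nodup ((List.nodup_ofFn.2 e.injective).filter _) (by simp)]
      intro a
      simp [hf, List.mem_ofFn, e.surjective a]
    rw [h1, List.count, List.countP_map, List.countP_eq_length_filter]
    rw [show 2 = ([LR.l v, LR.r v] : List (LR V)).length from rfl, ← h2.length_eq]
    congr 2
    ext a
    by_cases ha : f a = some v <;> simp [ha]
  · rw [meets_iff (hlt u) (hpos u) (hlt v) (hpos v)]
    refine and_congr_right fun _ => and_congr ?_ ?_ <;>
    · exact e.symm.lt_iff_lt.symm

end positions

/-! ### Largest derivable value and deletion number -/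

section optimum

variable {V : Type*} [DecidableEq V] [Fintype V] {G : SimpleGraph V} {t : NiceTree V}

theorem two_mul_edges (G : SimpleGraph V) :
    2 * G.edgeSet.ncard = {p : V × V | G.Adj p.1 p.2}.ncard := by
  classical
  rw [← SimpleGraph.coe_edgeFinset, Set.ncard_coe_finset, ← G.dart_card_eq_twice_card_edges,
    ← Nat.card_eq_fintype_card, ← Nat.card_coe_set_eq]
  exact Nat.card_congr ⟨fun d => ⟨d.toProd, d.adj⟩, fun p => ⟨p.1, p.2⟩, fun _ => rfl, fun _ => rfl⟩

/-- All pairs counted are edges of `G`. Hence sums of values may be capped at twice the number of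
edges without any loss. -/
theorem val_le {P B : Finset V} {σ : Word V} {v : ℕ} (h : Wit G P B σ v) :
    v ≤ 2 * G.edgeSet.ncard := by
  obtain ⟨Z, -, -, -, -, -, h, rfl⟩ := h
  rw [two_mul_edges, val, ← Set.ncard_coe_finset]
  refine Set.ncard_le_ncard ?_ (Set.toFinite _)
  rintro ⟨a, b⟩ hab
  simp only [Finset.coe_filter, Finset.mem_univ, true_and, Set.mem_ofPred_eq] at hab ⊢
  rcases hab.2.1 with ha | hb
  · exact h a ha b (Ne.symm hab.1) hab.2.2
  · exact (h b hb a hab.1 (by rw [meets_comm]; exact hab.2.2)).symm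

theorem val_eq {P : Finset V} {w : Word V} {G' : SimpleGraph V}
    (h : ∀ u v, G'.Adj u v ↔ u ≠ v ∧ meets u v w = true)
    (hP : ∀ u v, G'.Adj u v → u ∈ P) : val P w = 2 * G'.edgeSet.ncard := by
  rw [two_mul_edges, val, ← Set.ncard_coe_finset]
  congr 1
  ext ⟨a, b⟩
  simp only [Finset.coe_filter, Finset.mem_univ, true_and, Set.mem_ofPred_eq, h]
  exact ⟨fun h => ⟨h.1, h.2.2⟩, fun h' => ⟨h'.1, .inl (hP a b ((h a b).2 h')), h'.2⟩⟩

theorem exists_der (ht : t.IsNiceTreeDecomposition G) {G' : SimpleGraph V} (h : G' ≤ G)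
    (hG' : IsIntervalGraph G') : ∃ σ, t.Der G σ (2 * G'.edgeSet.ncard) := by
  obtain ⟨π, rfl⟩ := hG'
  obtain ⟨w, hw, hπ⟩ := exists_word π
  refine ⟨canon t.past t.bag w, ?_⟩
  rw [← val_eq hπ fun u v huv => ht.mem_past (h huv)]
  exact der_canon hw (fun u v huv hm => h ((hπ u v).2 ⟨huv, hm⟩)) ht.separated

/-- The word in which the vertices of `R` have pairwise disjoint intervals. -/
def apart (R : List V) : Word V := R.flatMap fun v => [some v, some v]

theorem opn_apart (R : List V) (u : V) : opn u (apart R) = false := by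
  induction R with
  | nil => rfl
  | cons a R ih =>
    rw [apart, List.flatMap_cons, ← apart]
    simp only [List.cons_append, List.nil_append, opn, ih]
    split_ifs <;> rfl

theorem meets_apart (R : List V) {u v : V} (huv : u ≠ v) : meets u v (apart R) = false := by
  induction R with
  | nil => rfl
  | cons a R ih =>
    rw [apart, List.flatMap_cons, ← apart]
    simp only [List.cons_append, List.nil_append, meets, opn, ih, opn_apart]
    by_cases h1 : a = u
    · have h2 : a ≠ v := h1 ▸ huv
      simp [h2]
    · simp [h1]

theorem count_apart (R : List V) (u : V) : (apart R).count (some u) = 2 * R.count u := by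
  induction R with
  | nil => rfl
  | cons a R ih =>
    rw [apart, List.flatMap_cons, ← apart]
    simp only [List.cons_append, List.nil_append, List.count_cons, ih, beq_iff_eq,
      Option.some_inj]
    split_ifs <;> omega

/-- Needed so that some value is derivable at the root and a maximum exists. -/
theorem isIntervalGraph_bot : IsIntervalGraph (⊥ : SimpleGraph V) := by
  obtain ⟨π, hπ⟩ := exists_representation (w := apart (Finset.univ : Finset V).toList) fun v => by
    rw [count_apart, List.count_eq_one_of_mem (Finset.nodup_toList _) (by simp)]
  refine ⟨π, SimpleGraph.ext (funext fun u => funext fun v => propext ?_)⟩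
  rw [hπ, SimpleGraph.bot_adj, iff_false]
  rintro ⟨huv, h⟩
  rw [meets_apart _ huv] at h
  exact absurd h (by simp)

/-- At the root the witness contains the intervals of all vertices that occur in bags, and its value
counts all of its intersections. The remaining vertices get pairwise disjoint intervals beside it.
-/
theorem exists_graph (ht : t.IsNiceTreeDecomposition G) {σ : Word V} {v : ℕ}
    (h : t.Der G σ v) : ∃ G' ≤ G, IsIntervalGraph G' ∧ 2 * G'.edgeSet.ncard = v := by
  obtain ⟨Z, h1, h2, -, -, -, h6, rfl⟩ := h.wit ht.separated
  rw [ht.root_bag, Finset.union_empty] at h1 h2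
  set R : List V := (Finset.univ \ t.past).toList with hR
  let Y : Word V := apart R
  have hRc : ∀ u, R.count u = if u ∈ t.past then 0 else 1 := fun u => by
    split_ifs with hu
    · exact List.count_eq_zero.2 (by simp [hR, hu])
    · exact List.count_eq_one_of_mem (Finset.nodup_toList _) (by simp [hR, hu])
  have hm : ∀ u v, u ≠ v → meets u v (Z ++ Y) = meets u v Z := by
    intro u v huv
    clear h1 h2 h6 h
    induction Z with
    | nil => exact meets_apart R huv
    | cons a Z ih =>
      rw [List.cons_append, meets, meets, ih]
      simp only [← List.cons_append, opn_append, Y, opn_apart, Bool.xor_false]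
  have hc : ∀ v, (Z ++ Y).count (some v) = 2 := fun v => by
    rw [List.count_append, count_apart, hRc]
    split_ifs with hv
    · rw [h1 v hv]
    · rw [h2 v hv]
  have hcov : ∀ u v, meets u v Z = true → u ∈ t.past := fun u v huv => by
    by_contra hu
    exact meets_count huv (h2 u hu)
  obtain ⟨π, hπ⟩ := exists_representation hc
  have hπ2 : ∀ u v, π.graph.Adj u v ↔ u ≠ v ∧ meets u v Z = true := fun u v => by
    rw [hπ]
    exact and_congr_right fun h => by rw [hm u v h]
  refine ⟨π.graph, fun u v huv => ?_, ⟨π, rfl⟩, ?_⟩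
  · have := (hπ2 u v).1 huv
    exact h6 u (hcov u v this.2) v (Ne.symm this.1) this.2
  · rw [val_eq hπ2 fun u v huv => hcov u v ((hπ2 u v).1 huv).2]

theorem deletionNumber_of_isGreatest (ht : t.IsNiceTreeDecomposition G) {M : ℕ}
    (hM : IsGreatest {v | ∃ σ, t.Der G σ v} M) :
    IsIntervalEdgeDeletionNumber G (G.edgeSet.ncard - M / 2) := by
  have hle : ∀ G' ≤ G, G'.edgeSet.ncard ≤ G.edgeSet.ncard := fun G' h =>
    Set.ncard_le_ncard (SimpleGraph.edgeSet_mono h) (Set.toFinite _)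
  constructor
  · obtain ⟨σ, h⟩ := hM.1
    obtain ⟨G', h1, h2, h3⟩ := exists_graph ht h
    refine ⟨G', h1, h2, ?_⟩
    have := hle G' h1
    omega
  · rintro c ⟨G', h1, h2, h3⟩
    have := hM.2 (exists_der ht h1 h2)
    omega

end optimum

end Word

/-! ### Counting the words of a bag -/

namespace Word

section counting

variable {V : Type*}

/-- The letters of a word other than stars. -/
def letters : Word V → List V
  | [] => []
  | none :: w => letters w
  | some a :: w => a :: letters w

/-- The words without three stars in a row with given letters. -/
def withStars : List V → List (Word V)
  | [] => [[], [none], [none, none]]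
  | a :: l => (withStars l).map (some a :: ·) ++ ((withStars l).map (none :: some a :: ·) ++
      (withStars l).map (none :: none :: some a :: ·))

theorem length_withStars (l : List V) : (withStars l).length = 3 ^ (l.length + 1) := by
  induction l with
  | nil => rfl
  | cons a l ih => simp only [withStars, List.length_append, List.length_map, ih,
      List.length_cons]; ring

theorem mem_withStars {w : Word V} (h : Norm w) : w ∈ withStars (letters w) := by
  have hl : ∀ a {w : Word V}, w ∈ withStars (letters w) →
      some a :: w ∈ withStars (a :: letters w) ∧
      none :: some a :: w ∈ withStars (a :: letters w) ∧
      none :: none :: some a :: w ∈ withStars (a :: letters w) := fun a w h => by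
    simp [withStars, h, letters]
  match w, h with
  | [], _ => simp [withStars, letters]
  | [none], _ => simp [withStars, letters]
  | [none, none], _ => simp [withStars, letters]
  | none :: none :: none :: w, h => exact absurd rfl (h.2 w)
  | some a :: w, h => exact (hl a (mem_withStars h.tail)).1
  | none :: some a :: w, h => exact (hl a (mem_withStars h.tail.tail)).2.1
  | none :: none :: some a :: w, h => exact (hl a (mem_withStars h.tail.tail.tail)).2.2

theorem Norm.length_le {w : Word V} (h : Norm w) :
    w.length ≤ 3 * (letters w).length + 2 := by
  match w, h with
  | [], _ => simp [letters]
  | [none], _ => simp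
  | [none, none], _ => simp
  | none :: none :: none :: w, h => exact absurd rfl (h.2 w)
  | some a :: w, h =>
    have := Norm.length_le h.tail
    simp only [List.length_cons, letters] at this ⊢
    omega
  | none :: some a :: w, h =>
    have := Norm.length_le h.tail.tail
    simp only [List.length_cons, letters] at this ⊢
    omega
  | none :: none :: some a :: w, h =>
    have := Norm.length_le h.tail.tail.tail
    simp only [List.length_cons, letters] at this ⊢
    omega

/-- The lists that arise by inserting `x` once. -/
def insertOnce (x : V) : List V → List (List V)
  | [] => [[x]]
  | a :: l => (x :: a :: l) :: (insertOnce x l).map (a :: ·)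

/-- The lists that arise by inserting `x` twice. -/
def insertTwice (x : V) : List V → List (List V)
  | [] => [[x, x]]
  | a :: l => (insertOnce x (a :: l)).map (x :: ·) ++ (insertTwice x l).map (a :: ·)

theorem length_insertOnce (x : V) (l : List V) : (insertOnce x l).length = l.length + 1 := by
  induction l with
  | nil => rfl
  | cons a l ih => simp [insertOnce, ih]

/-- Two equal elements go into the gaps of `l` with repetition, which gives a binomial coefficient
of `l.length + 2` over two. -/
theorem length_insertTwice (x : V) (l : List V) :
    2 * (insertTwice x l).length = (l.length + 1) * (l.length + 2) := by
  induction l with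
  | nil => rfl
  | cons a l ih =>
    simp only [insertTwice, List.length_append, List.length_map, length_insertOnce,
      List.length_cons, Nat.mul_add, ih]
    ring

/-- The lists in which the elements of the given list are inserted twice. -/
def doubled : List V → List (List V)
  | [] => [[]]
  | x :: b => (doubled b).flatMap (insertTwice x)

variable [DecidableEq V]

theorem length_of_mem_insertTwice {x : V} {l m : List V} (h : m ∈ insertTwice x l) :
    m.length = l.length + 2 := by
  have h1 : ∀ {l m : List V}, m ∈ insertOnce x l → m.length = l.length + 1 := fun {l m} h => by
    induction l generalizing m with
    | nil => simp only [insertOnce, List.mem_singleton] at h; simp [h]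
    | cons a l ih =>
      simp only [insertOnce, List.mem_cons, List.mem_map] at h
      rcases h with rfl | ⟨s, hs, rfl⟩
      · simp
      · simp [ih hs]
  induction l generalizing m with
  | nil => simp only [insertTwice, List.mem_singleton] at h; simp [h]
  | cons a l ih =>
    simp only [insertTwice, List.mem_append, List.mem_map] at h
    rcases h with ⟨s, hs, rfl⟩ | ⟨s, hs, rfl⟩
    · simp [h1 hs]
    · simp [ih hs]

/-- Doubling the next element multiplies the number of lists by `(2 m + 1) (2 m + 2) / 2`, where `m`
elements are there already; the product is `(2 b)! / 2 ^ b`. -/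
theorem length_doubled (b : List V) : 2 ^ b.length * (doubled b).length = (2 * b.length).factorial ∧
    ∀ l ∈ doubled b, l.length = 2 * b.length := by
  induction b with
  | nil => simp [doubled]
  | cons x b ih =>
    obtain ⟨ih1, ih2⟩ := ih
    constructor
    · rw [doubled, List.length_flatMap, List.length_cons, pow_succ, mul_assoc]
      have : ∀ L : List (List V), (∀ l ∈ L, l.length = 2 * b.length) →
          2 * (L.map fun l => (insertTwice x l).length).sum =
            L.length * ((2 * b.length + 1) * (2 * b.length + 2)) := fun L hL => by
        induction L with
        | nil => simp
        | cons l L ih =>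
          have h1 := length_insertTwice x l
          rw [hL l (by simp)] at h1
          rw [List.map_cons, List.sum_cons, Nat.mul_add, ih fun l hl => hL l (by simp [hl]), h1,
            List.length_cons]
          ring
      rw [this _ ih2, ← mul_assoc, ih1, show 2 * (b.length + 1) = 2 * b.length + 1 + 1 by ring,
        Nat.factorial_succ, Nat.factorial_succ]
      ring
    · intro l hl
      obtain ⟨m, hm, h⟩ := List.mem_flatMap.1 hl
      rw [length_of_mem_insertTwice h, ih2 m hm, List.length_cons]
      ring

theorem mem_insertTwice {x : V} {l : List V} (h : l.count x = 2) :
    l ∈ insertTwice x (l.filter (· ≠ x)) := by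
  have h0 : ∀ l : List V, l.count x = 0 → l.filter (· ≠ x) = l := fun l h =>
    List.filter_eq_self.2 fun a ha => by
      have := List.count_eq_zero.1 h
      have hne : a ≠ x := by rintro rfl; exact this ha
      simpa using hne
  have ho : ∀ l : List V, x :: l ∈ insertOnce x l := fun l => by cases l <;> simp [insertOnce]
  have h1 : ∀ l : List V, l.count x = 1 → l ∈ insertOnce x (l.filter (· ≠ x)) := by
    intro l h
    induction l with
    | nil => simp at h
    | cons a l ih =>
      by_cases ha : a = x
      · subst ha
        rw [List.count_cons_self] at h
        rw [List.filter_cons_of_neg (by simp), h0 l (by omega)]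
        exact ho l
      · rw [List.count_cons_of_ne (by simpa using ha)] at h
        rw [List.filter_cons_of_pos (by simpa using ha), insertOnce]
        exact List.mem_cons_of_mem _ (List.mem_map_of_mem (ih h))
  have hs : ∀ {l m : List V}, m ∈ insertOnce x l → x :: m ∈ insertTwice x l := fun {l m} hm => by
    cases l with
    | nil => simpa [insertOnce, insertTwice] using hm
    | cons a l => exact List.mem_append_left _ (List.mem_map_of_mem hm)
  induction l with
  | nil => simp at h
  | cons a l ih =>
    by_cases ha : a = x
    · subst ha
      rw [List.count_cons_self] at h
      rw [List.filter_cons_of_neg (by simp)]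
      exact hs (h1 l (by omega))
    · rw [List.count_cons_of_ne (by simpa using ha)] at h
      rw [List.filter_cons_of_pos (by simpa using ha), insertTwice]
      exact List.mem_append_right _ (List.mem_map_of_mem (ih h))

theorem mem_doubled {b l : List V} (hb : b.Nodup) (h : ∀ x ∈ b, l.count x = 2)
    (hl : ∀ x, x ∉ b → l.count x = 0) : l ∈ doubled b := by
  induction b generalizing l with
  | nil =>
    have : l = [] := List.eq_nil_iff_forall_not_mem.2 fun a => List.count_eq_zero.1 (hl a (by simp))
    simp [doubled, this]
  | cons x b ih =>
    rw [List.nodup_cons] at hb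
    refine List.mem_flatMap.2 ⟨l.filter (· ≠ x), ih hb.2 (fun y hy => ?_) (fun y hy => ?_),
      mem_insertTwice (h x (by simp))⟩
    · have : y ≠ x := by rintro rfl; exact hb.1 hy
      rw [List.count_filter (by simpa using this)]
      exact h y (by simp [hy])
    · by_cases hyx : y = x
      · subst hyx; simp [List.count_eq_zero]
      · rw [List.count_filter (by simpa using hyx)]
        exact hl y (by simp [hy, hyx])

/-- The words that may occur at a node with the bag `B`. -/
noncomputable def bagWords (B : Finset V) : List (Word V) := (doubled B.toList).flatMap withStars

/-- There are `2 * B.card` letters and hence one more gap, and each gap has none, one or two stars.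
-/
theorem length_bagWords (B : Finset V) : 2 ^ B.card * (bagWords B).length =
    (2 * B.card).factorial * 3 ^ (2 * B.card + 1) := by
  obtain ⟨h1, h2⟩ := length_doubled B.toList
  rw [Finset.length_toList] at h1 h2
  have : ∀ L : List (List V), (∀ l ∈ L, l.length = 2 * B.card) →
      (L.map fun l => (withStars l).length).sum = L.length * 3 ^ (2 * B.card + 1) := fun L hL => by
    induction L with
    | nil => simp
    | cons l L ih =>
      rw [List.map_cons, List.sum_cons, ih fun l hl => hL l (by simp [hl]), length_withStars,
        hL l (by simp), List.length_cons]
      ring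
  rw [bagWords, List.length_flatMap, this _ h2, ← mul_assoc, h1]

theorem count_letters (w : Word V) (v : V) :
    (letters w).count v = w.count (some v) := by
  induction w with
  | nil => rfl
  | cons a w ih => cases a <;> simp [List.count_cons, ih, letters]

theorem mem_bagWords {B : Finset V} {w : Word V} (hn : Norm w)
    (h : ∀ x ∈ B, w.count (some x) = 2) (hw : ∀ x, x ∉ B → w.count (some x) = 0) :
    w ∈ bagWords B :=
  List.mem_flatMap.2 ⟨letters w, mem_doubled (Finset.nodup_toList B)
    (fun x hx => by rw [count_letters]; exact h x (by simpa using hx))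
    (fun x hx => by rw [count_letters]; exact hw x (by simpa using hx)), mem_withStars hn⟩

end counting

section derived

variable {V : Type*} [DecidableEq V] {G : SimpleGraph V}

open NiceTree

theorem _root_.NiceTree.Der.norm {t : NiceTree V} {σ : Word V} {v : ℕ} (h : Der G t σ v) :
    Norm σ := by
  induction h with
  | leaf => trivial
  | introduce x h hτ ih => exact norm_intro ih hτ
  | forget x h _ _ => exact norm_fg x _
  | join h₁ h₂ hj ih₁ ih₂ =>
    obtain ⟨w₁, w₂, w, t, d, hm, -, -, -, -, -, rfl⟩ := hj
    exact hm.head.2.2.2.nst _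

variable [Fintype V]

theorem Wit.count {P B : Finset V} (hd : Disjoint P B) {σ : Word V} {v : ℕ} (h : Wit G P B σ v) :
    (∀ x ∈ B, σ.count (some x) = 2) ∧ ∀ x, x ∉ B → σ.count (some x) = 0 := by
  obtain ⟨Z, h1, h2, -, -, rfl, -, -⟩ := h
  constructor
  · intro x hx
    rw [List.count_filter (by simpa [keep] using fun h => Finset.disjoint_left.1 hd h hx)]
    exact h1 x (Finset.mem_union_right _ hx)
  · intro x hx
    by_cases hP : x ∈ P
    · exact List.count_eq_zero.2 fun h => by simp [keep, hP] at h
    · rw [List.count_filter (by simpa [keep] using hP)]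
      exact h2 x (by simp [hP, hx])

theorem _root_.NiceTree.Der.mem_bagWords {t : NiceTree V} {σ : Word V} {v : ℕ} (h : Der G t σ v)
    (ht : t.Separated G) : σ ∈ bagWords t.bag :=
  Word.mem_bagWords h.norm ((h.wit ht).count ht.disjoint).1 ((h.wit ht).count ht.disjoint).2

theorem _root_.NiceTree.Der.length_letters {t : NiceTree V} {σ : Word V} {v : ℕ} (h : Der G t σ v)
    (ht : t.Separated G) : (letters σ).length = 2 * t.bag.card := by
  have h1 := countP_any (fun _ => true) σ
  have h2 : σ.countP (fun a => a.any fun _ => true) = (letters σ).length := by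
    clear h1 h
    induction σ with
    | nil => rfl
    | cons a σ ih =>
      cases a with
      | none => rw [List.countP_cons_of_neg (by simp), ih, letters]
      | some a => rw [List.countP_cons_of_pos (by simp), ih, letters, List.length_cons]
  have h3 := (h.wit ht).count ht.disjoint
  rw [← h2, h1, Finset.filter_true_of_mem (by simp), ← Finset.sum_subset t.bag.subset_univ
    (fun x _ hx => h3.2 x hx), Finset.sum_congr rfl h3.1]
  simp [mul_comm]

end derived

/-! ### Enumerating introductions and joins -/

section lists

variable {V : Type*} [DecidableEq V]

/-- `rights` and `intro` with the words in the order in which a loop finds them. -/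
def rightsLoop (x : V) : Word V → List (Word V)
  | [] => newEnd x []
  | none :: w => newEnd x (none :: w)
  | some a :: w => ((rightsLoop x w).map (some a :: ·)).reverse ++ newEnd x (some a :: w)

def leftLoop (x : V) (l b : List (Word V)) : List (Word V) :=
  (l.map (some x :: ·)).reverse ++
    ((l.map fun w => ncons none (ncons none (some x :: w))).reverse ++ b)

def introLoop (x : V) : Word V → List (Word V)
  | [] => leftLoop x (rightsLoop x []) []
  | a :: w => leftLoop x (rightsLoop x (a :: w)) (((introLoop x w).map (ncons a)).reverse ++ [])

theorem rightsLoop_perm (x : V) (w : Word V) : (rightsLoop x w).Perm (rights x w) := by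
  induction w with
  | nil => exact .refl _
  | cons a w ih =>
    cases a with
    | none => exact .refl _
    | some a =>
      exact (List.perm_append_comm).trans (((List.reverse_perm _).trans (ih.map _)).append_left _)

theorem leftLoop_perm {x : V} {l l' : List (Word V)} (h : l.Perm l') (b : List (Word V)) :
    (leftLoop x l b).Perm (leftEnd x l' ++ b) := by
  rw [leftLoop, leftEnd, List.append_assoc]
  exact ((List.reverse_perm _).trans (h.map _)).append
    (((List.reverse_perm _).trans (h.map _)).append_right _)

theorem introLoop_perm (x : V) (w : Word V) : (introLoop x w).Perm (intro x w) := by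
  induction w with
  | nil =>
    have := leftLoop_perm (x := x) (rightsLoop_perm x []) []
    rwa [List.append_nil] at this
  | cons a w ih =>
    refine (leftLoop_perm (rightsLoop_perm x (a :: w)) _).trans (List.Perm.append_left _ ?_)
    rw [List.append_nil]
    exact (List.reverse_perm _).trans (ih.map _)

theorem length_newEnd (x : V) (w : Word V) : (newEnd x w).length ≤ 2 := by
  unfold newEnd; split_ifs <;> simp

theorem length_rightsLoop (x : V) (w : Word V) :
    (rightsLoop x w).length ≤ 2 * (w.length + 1) := by
  induction w with
  | nil => exact length_newEnd x []
  | cons a w ih =>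
    cases a with
    | none => exact (length_newEnd x _).trans (by omega)
    | some a =>
      have := length_newEnd x (some a :: w)
      simp only [rightsLoop, List.length_append, List.length_reverse, List.length_map,
        List.length_cons]
      omega

/-- There are at most quadratically many choices for the two ends, and each end has two variants,
with or without additional stars. -/
theorem length_introLoop (x : V) (w : Word V) :
    (introLoop x w).length ≤ 4 * (w.length + 1) * (w.length + 1) := by
  induction w with
  | nil =>
    have := length_rightsLoop x []
    simp only [introLoop, leftLoop, List.length_append, List.length_reverse, List.length_map,
      List.length_nil] at this ⊢
    omega
  | cons a w ih =>
    have := length_rightsLoop x (a :: w)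
    simp only [introLoop, leftLoop, List.length_append, List.length_reverse, List.length_map,
      List.length_nil, List.length_cons] at this ⊢
    nlinarith

/-- A word that is merged with the part of another one that has been read, the result, and the
parity of the first word. -/
abbrev Partial (V : Type*) := Word V × Word V × Bool

def gapTest (c : Bool) (t : ℕ) (e : Bool) (d : ℕ) : Bool :=
  !(c && e) && !(t == 0 && c && d != 0) && !(d == 0 && e && t != 0)

theorem gapTest_iff {c e : Bool} {t d : ℕ} : gapTest c t e d = true ↔ gapOk c t e d := by
  unfold gapTest gapOk
  cases c <;> cases e <;> simp
  · tauto
  · tauto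

/-- Adding a gap with `d` stars. -/
def extendGap (c : Bool) (t : ℕ) (p : Partial V) (d : ℕ) (l : List (Partial V)) :
    List (Partial V) :=
  if gapTest c t p.2.2 d then
    (List.replicate d none ++ p.1, nst t (nst d p.2.1), xor (d % 2 = 1) p.2.2) :: l
  else l

/-- Adding all gaps. -/
def closeGap (c : Bool) (t : ℕ) (l : List (Partial V)) : List (Partial V) :=
  l.foldl (fun acc p => extendGap c t p 0 (extendGap c t p 1 (extendGap c t p 2 acc))) []

/-- The number of stars at the beginning of a word, the parity of the rest, and what can be merged
with the rest. -/
def joinState : Word V → ℕ × Bool × List (Partial V)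
  | [] => (0, false, [([], [], false)])
  | none :: w => (min ((joinState w).1 + 1) 2, (joinState w).2)
  | some a :: w => (0, xor ((joinState w).1 % 2 = 1) (joinState w).2.1,
      ((closeGap (joinState w).2.1 (joinState w).1 (joinState w).2.2).map fun p =>
        (some a :: p.1, some a :: p.2.1, p.2.2)).reverse ++ [])

def joinList (w : Word V) : List (Partial V) :=
  closeGap (joinState w).2.1 (joinState w).1 (joinState w).2.2

theorem nst_add (s t : ℕ) (w : Word V) : nst (s + t) w = nst s (nst t w) := by
  induction s with
  | zero => rw [Nat.zero_add]; rfl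
  | succ s ih => rw [Nat.add_right_comm, nst, nst, ih]

theorem mem_extendGap {c : Bool} {t d : ℕ} {p q : Partial V} {l : List (Partial V)} :
    q ∈ extendGap c t p d l ↔ q ∈ l ∨ (gapOk c t p.2.2 d ∧
      q = (List.replicate d none ++ p.1, nst (t + d) p.2.1, xor (d % 2 = 1) p.2.2)) := by
  unfold extendGap
  rw [nst_add]
  split_ifs with h
  · rw [List.mem_cons, gapTest_iff.1 h |> eq_true]; tauto
  · rw [gapTest_iff] at h; tauto

theorem mem_closeGap {c : Bool} {t : ℕ} {q : Partial V} {l : List (Partial V)} :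
    q ∈ closeGap c t l ↔ ∃ p ∈ l, ∃ d ≤ 2, gapOk c t p.2.2 d ∧
      q = (List.replicate d none ++ p.1, nst (t + d) p.2.1, xor (d % 2 = 1) p.2.2) := by
  have : ∀ l acc : List (Partial V), q ∈ l.foldl
      (fun acc p => extendGap c t p 0 (extendGap c t p 1 (extendGap c t p 2 acc))) acc ↔
      q ∈ acc ∨ ∃ p ∈ l, ∃ d ≤ 2, gapOk c t p.2.2 d ∧
      q = (List.replicate d none ++ p.1, nst (t + d) p.2.1, xor (d % 2 = 1) p.2.2) := by
    intro l
    induction l with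
    | nil => simp
    | cons p l ih =>
      intro acc
      rw [List.foldl_cons, ih, mem_extendGap, mem_extendGap, mem_extendGap]
      simp only [List.mem_cons, exists_eq_or_imp]
      have : ∀ φ : ℕ → Prop, (∃ d ≤ 2, φ d) ↔ φ 0 ∨ φ 1 ∨ φ 2 := fun φ => by
        constructor
        · rintro ⟨d, hd, h⟩
          interval_cases d <;> simp [h]
        · rintro (h | h | h)
          exacts [⟨0, by simp, h⟩, ⟨1, by simp, h⟩, ⟨2, by simp, h⟩]
      rw [this (fun d => gapOk c t p.2.2 d ∧ q = (List.replicate d none ++ p.1,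
        nst (t + d) p.2.1, xor (d % 2 = 1) p.2.2))]
      tauto
  rw [closeGap, this]
  simp

theorem length_closeGap (c : Bool) (t : ℕ) (l : List (Partial V)) :
    (closeGap c t l).length ≤ 3 * l.length := by
  have h1 : ∀ p d (l : List (Partial V)), (extendGap c t p d l).length ≤ l.length + 1 :=
    fun p d l => by unfold extendGap; split_ifs <;> simp
  have : ∀ l acc : List (Partial V), (l.foldl
      (fun acc p => extendGap c t p 0 (extendGap c t p 1 (extendGap c t p 2 acc))) acc).length ≤
      acc.length + 3 * l.length := by
    intro l
    induction l with
    | nil => simp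
    | cons p l ih =>
      intro acc
      have a1 := h1 p 0 (extendGap c t p 1 (extendGap c t p 2 acc))
      have a2 := h1 p 1 (extendGap c t p 2 acc)
      have a3 := h1 p 2 acc
      have := ih (extendGap c t p 0 (extendGap c t p 1 (extendGap c t p 2 acc)))
      rw [List.foldl_cons, List.length_cons]
      omega
  have h := this l []
  rwa [List.length_nil, Nat.zero_add] at h

theorem length_joinState (w : Word V) :
    (joinState w).2.2.length ≤ 3 ^ (letters w).length := by
  induction w with
  | nil => simp [joinState, letters]
  | cons a w ih =>
    cases a with
    | none => simpa [joinState, letters] using ih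
    | some a =>
      have := length_closeGap (joinState w).2.1 (joinState w).1 (joinState w).2.2
      simp only [joinState, List.append_nil, List.length_reverse, List.length_map,
        letters, List.length_cons, pow_succ]
      omega

theorem length_joinList (w : Word V) :
    (joinList w).length ≤ 3 ^ ((letters w).length + 1) := by
  have := length_closeGap (joinState w).2.1 (joinState w).1 (joinState w).2.2
  have := length_joinState w
  rw [joinList, pow_succ]
  omega

theorem replicate_append_inj {t t' : ℕ} {u u' : Word V} (hu : ∀ s, u ≠ none :: s)
    (hu' : ∀ s, u' ≠ none :: s) (e : List.replicate t none ++ u = List.replicate t' none ++ u') :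
    t = t' ∧ u = u' := by
  induction t generalizing t' with
  | zero =>
    cases t' with
    | zero => exact ⟨rfl, e⟩
    | succ t' => exact absurd e (hu _)
  | succ t iht =>
    cases t' with
    | zero => exact absurd e.symm (hu' _)
    | succ t' =>
      simp only [List.replicate_succ, List.cons_append, List.cons.injEq, true_and] at e
      obtain ⟨rfl, h⟩ := iht e
      exact ⟨rfl, h⟩

/-- Reading `w` from its end, the current run of stars is only counted. At the next letter the gap
is complete, and every partial partner is extended by every admissible number of stars. -/
theorem joinState_spec {w : Word V} (h : Norm w) : ∃ w₁, (∀ s, w₁ ≠ none :: s) ∧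
    (joinState w).1 ≤ 2 ∧ w = List.replicate (joinState w).1 none ++ w₁ ∧
    (joinState w).2.1 = par w₁ ∧
    ∀ p : Partial V, p ∈ (joinState w).2.2 ↔ Merge w₁ p.1 p.2.1 ∧ p.2.2 = par p.1 := by
  induction w with
  | nil =>
    refine ⟨[], by simp, by simp [joinState], rfl, rfl, fun p => ?_⟩
    simp only [joinState, List.mem_singleton]
    constructor
    · rintro rfl; exact ⟨.nil, rfl⟩
    · rintro ⟨h1, h2⟩
      obtain ⟨a, b, c⟩ := p
      simp only at h1 h2
      cases h1
      simp [h2, par]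
  | cons a w ih =>
    obtain ⟨w₁, h0, h1, h2, h3, h4⟩ := ih h.tail
    cases a with
    | none =>
      -- A normal word has no third star in a row, so the cap at two is not reached.
      have hlt : (joinState w).1 + 1 ≤ 2 := by
        by_contra hlt
        have h5 : (joinState w).1 = 2 := by omega
        rw [h5] at h2
        exact h.2 _ h2
      have hm : min ((joinState w).1 + 1) 2 = (joinState w).1 + 1 := by omega
      refine ⟨w₁, h0, by simp [joinState], ?_, h3, h4⟩
      rw [joinState, hm, List.replicate_succ, List.cons_append, ← h2]
    | some a =>
      refine ⟨some a :: w, by simp, by simp [joinState], rfl, ?_, fun p => ?_⟩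
      · rw [par]
        conv_rhs => rw [h2, par_replicate]
        rw [joinState, h3]
      · simp only [joinState, List.append_nil, List.mem_reverse, List.mem_map, mem_closeGap]
        constructor
        · rintro ⟨_, ⟨q, hq, d, hd, hg, rfl⟩, rfl⟩
          obtain ⟨hm, hp⟩ := (h4 q).1 hq
          refine ⟨?_, ?_⟩
          · have e : some a :: w = some a :: (List.replicate (joinState w).1 none ++ w₁) := by
              rw [← h2]
            rw [e]
            exact hm.cons a _ d h1 hd (by rw [← h3, ← hp]; exact hg)
          · simp only [par]
            rw [par_replicate, hp]
        · obtain ⟨σ, o, e⟩ := p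
          rintro ⟨hm, hp⟩
          simp only at hm hp
          generalize hw : some a :: w = w' at hm
          cases hm with
          | nil => simp at hw
          | @cons v₁ v₂ v b t d hm ht hd hg =>
            simp only [List.cons.injEq, Option.some.injEq] at hw
            obtain ⟨rfl, hw⟩ := hw
            obtain ⟨rfl, rfl⟩ := replicate_append_inj h0 hm.head.1 (h2.symm.trans hw)
            refine ⟨_, ⟨(v₂, v, par v₂), (h4 _).2 ⟨hm, rfl⟩, d, hd, ?_, rfl⟩, ?_⟩
            · rw [h3]; exact hg
            · rw [hp]
              simp only [par, par_replicate]

/-- So a join node enumerates the possible partners of each word of the first child and looks them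
up for the second child, instead of testing all pairs of words. -/
theorem mem_joinList {w : Word V} (h : Norm w) (σ o : Word V) :
    (∃ e, (σ, o, e) ∈ joinList w) ↔ Joins w σ o := by
  obtain ⟨w₁, h0, h1, h2, h3, h4⟩ := joinState_spec h
  simp only [joinList, mem_closeGap]
  constructor
  · rintro ⟨e, p, hp, d, hd, hg, he⟩
    obtain ⟨hm, hpar⟩ := (h4 p).1 hp
    simp only [Prod.mk.injEq] at he
    refine ⟨w₁, p.1, p.2.1, _, d, hm, h1, hd, ?_, h2, he.1, he.2.1⟩
    rw [← h3, ← hpar]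
    exact hg
  · rintro ⟨v₁, v₂, v, t, d, hm, ht, hd, hg, e1, rfl, rfl⟩
    have hh := hm.head.1
    obtain ⟨rfl, rfl⟩ : (joinState w).1 = t ∧ w₁ = v₁ := by
      exact replicate_append_inj h0 hm.head.1 (h2.symm.trans e1)
    exact ⟨_, (v₂, v, par v₂), (h4 _).2 ⟨hm, rfl⟩, d, hd, by rw [h3]; exact hg, rfl⟩

end lists

end Word

/-! ### Encodings, and programs for introducing and forgetting -/

namespace TreeLang

open Word

section lookup

variable {I : ℕ → ℕ → ℕ} {L : List (ℕ × Dat)} {x : ℕ} {v : Dat} {p q r s t u : ℕ × Dat}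

theorem Pu.v0 : Pu I ((x, v) :: L) (varE x) v 1 := Pu.var (by simp)
theorem Pu.v1 : Pu I (p :: (x, v) :: L) (varE x) v 1 := Pu.var (by simp)
theorem Pu.v2 : Pu I (p :: q :: (x, v) :: L) (varE x) v 1 := Pu.var (by simp)
theorem Pu.v3 : Pu I (p :: q :: r :: (x, v) :: L) (varE x) v 1 := Pu.var (by simp)
theorem Pu.v4 : Pu I (p :: q :: r :: s :: (x, v) :: L) (varE x) v 1 := Pu.var (by simp)
theorem Pu.v5 : Pu I (p :: q :: r :: s :: t :: (x, v) :: L) (varE x) v 1 := Pu.var (by simp)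
theorem Pu.v6 {o : ℕ × Dat} : Pu I (o :: p :: q :: r :: s :: t :: (x, v) :: L) (varE x) v 1 :=
  Pu.var (by simp)

end lookup

section encoding

variable {n : ℕ}

def encO : Option (Fin n) → Dat
  | none => .num 1
  | some v => .num (v + 2)

def encW (w : Word (Fin n)) : Dat := encL (w.map encO)

def encB (b : Bool) : Dat := .num b.toNat

theorem encO_injective : Function.Injective (encO (n := n)) := by
  rintro (_ | a) (_ | b) h <;> simp [encO] at h ⊢
  exact Fin.ext h

theorem encL_injective : Function.Injective encL := by
  intro a
  induction a with
  | nil => intro b h; cases b <;> simp [encL] at h ⊢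
  | cons x a ih =>
    intro b h
    cases b with
    | nil => simp [encL] at h
    | cons y b =>
      simp only [encL, Dat.cons.injEq] at h
      rw [h.1, ih h.2]

theorem encW_injective : Function.Injective (encW (n := n)) :=
  encL_injective.comp (List.map_injective_iff.2 encO_injective)

theorem encO_eq_star {a : Option (Fin n)} : encO a = .num 1 ↔ a = none := by
  cases a <;> simp [encO]

theorem encB_eq_one {b : Bool} : encB b = .num 1 ↔ b = true := by
  cases b <;> simp [encB]

@[simp] theorem encW_cons (a : Option (Fin n)) (w : Word (Fin n)) :
    encW (a :: w) = .cons (encO a) (encW w) := rfl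

end encoding

section pure

variable {n : ℕ} {I : ℕ → ℕ → ℕ} {L : List (ℕ × Dat)}

def nconsV (a w : ℕ) : T :=
  ifEqE (varE a) (numE 1) (ifEqE (fstE (varE w)) (numE 1)
    (ifEqE (fstE (sndE (varE w))) (numE 1) (sndE (varE w)) (pairE (varE a) (varE w)))
    (pairE (varE a) (varE w))) (pairE (varE a) (varE w))

/-- Short words need no separate test: the empty list is `num 0`, all of whose components are `num
0`, whereas the star is `num 1`. -/
theorem Pu.ncons {a w : ℕ} {x : Option (Fin n)} {s : Word (Fin n)} (ha : (a, encO x) ∈ L)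
    (hw : (w, encW s) ∈ L) : Pu I L (nconsV a w) (encW (ncons x s)) 20 := by
  have h1 : Pu I L (pairE (varE a) (varE w)) (.cons (encO x) (encW s)) 3 :=
    Pu.pair (Pu.var ha) (Pu.var hw)
  have h2 : Pu I L (sndE (varE w)) (encW s).snd 2 := Pu.snd (Pu.var hw)
  have h3 : Pu I L (fstE (varE w)) (encW s).fst 2 := Pu.fst (Pu.var hw)
  refine (Pu.ifEq (c := 15) (Pu.var ha) (Pu.num 1) (fun e1 => ?_) (fun e1 => ?_)).congr rfl
    (by omega)
  · refine (Pu.ifEq (c := 9) h3 (Pu.num 1) (fun e2 => ?_) (fun e2 => ?_)).congr rfl (by omega)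
    · refine (Pu.ifEq (c := 3) (Pu.fst h2) (Pu.num 1) (fun e3 => ?_) (fun e3 => ?_)).congr rfl
        (by omega)
      · refine h2.congr ?_ (by omega)
        obtain rfl := encO_eq_star.1 e1
        rcases s with _ | ⟨_ | b, _ | ⟨_ | d, s⟩⟩ <;>
          simp_all [encW, encL, encO, Dat.fst, Dat.snd, Word.ncons]
      · refine h1.congr ?_ (by omega)
        obtain rfl := encO_eq_star.1 e1
        rcases s with _ | ⟨_ | b, _ | ⟨_ | d, s⟩⟩ <;>
          simp_all [encW, encL, encO, Dat.fst, Dat.snd, Word.ncons]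
    · refine h1.congr ?_ (by omega)
      obtain rfl := encO_eq_star.1 e1
      rcases s with _ | ⟨_ | b, s⟩ <;>
        simp_all [encW, encL, encO, Dat.fst, Dat.snd, Word.ncons]
  · refine h1.congr ?_ (by omega)
    rcases x with _ | x
    · exact absurd rfl e1
    · simp

/-- The negation of the truth value `p`. -/
def notV (p : ℕ) : T := ifEqE (varE p) (numE 1) (numE 0) (numE 1)

theorem Pu.not {p : ℕ} {b : Bool} (hp : (p, encB b) ∈ L) : Pu I L (notV p) (encB (!b)) 6 := by
  refine (Pu.ifEq (c := 2) (Pu.var hp) (Pu.num 1) (fun e => ?_) (fun e => ?_)).congr rfl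
    (by omega)
  · rw [encB_eq_one.1 e]; exact (Pu.num 0).congr rfl (by omega)
  · rw [Bool.eq_false_iff.2 (fun h => e (encB_eq_one.2 h))]; exact Pu.num 1

/-- Updating a parity `p` that counts the letter `x`, when the letter `a` is read. -/
def toggleV (x : T) (a p : ℕ) : T := ifEqE (varE a) x (notV p) (varE p)

theorem Pu.togglePar {a p : ℕ} {y : Option (Fin n)} {s : Word (Fin n)} (ha : (a, encO y) ∈ L)
    (hp : (p, encB (par s)) ∈ L) : Pu I L (toggleV (numE 1) a p) (encB (par (y :: s))) 10 := by
  refine (Pu.ifEq (c := 6) (Pu.var ha) (Pu.num 1) (fun e => ?_) (fun e => ?_)).congr rfl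
    (by omega)
  · rw [encO_eq_star.1 e]; exact Pu.not hp
  · cases y with
    | none => exact absurd rfl e
    | some y => exact (Pu.var hp).congr rfl (by omega)

theorem Pu.toggleOpn {x a p : ℕ} {v : Fin n} {y : Option (Fin n)} {s : Word (Fin n)}
    (hx : (x, encO (some v)) ∈ L) (ha : (a, encO y) ∈ L) (hp : (p, encB (opn v s)) ∈ L) :
    Pu I L (toggleV (varE x) a p) (encB (opn v (y :: s))) 9 := by
  refine (Pu.ifEq (c := 6) (Pu.var ha) (Pu.var hx) (fun e => ?_) (fun e => ?_)).congr rfl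
    (by omega)
  · rw [encO_injective e, opn_self]; exact Pu.not hp
  · have : y ≠ some v := fun h => e (by rw [h])
    simp only [opn, this, if_false]
    exact (Pu.var hp).congr rfl (by omega)

def newEndV (x p w : ℕ) : T :=
  ifEqE (varE p) (numE 1) (numE 0) (letE (numE 1) fun st => letE (nconsV st w) fun w₁ =>
    letE (nconsV st w₁) fun w₂ => pairE (pairE (varE x) (varE w))
      (pairE (pairE (varE x) (varE w₂)) (numE 0)))

theorem Pu.newEnd {x p w : ℕ} {v : Fin n} {s : Word (Fin n)} (hx : (x, encO (some v)) ∈ L)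
    (hp : (p, encB (par s)) ∈ L) (hw : (w, encW s) ∈ L) :
    Pu I L (newEndV x p w) (encL ((Word.newEnd v s).map encW)) 65 := by
  refine (Pu.ifEq (c := 57) (Pu.var hp) (Pu.num 1) (fun e => ?_) (fun e => ?_)).congr rfl
    (by omega)
  · rw [Word.newEnd, if_pos (encB_eq_one.1 e)]
    exact (Pu.num 0).congr rfl (by omega)
  · rw [Word.newEnd, if_neg fun h => e (encB_eq_one.2 h)]
    refine (Pu.lett (Pu.num 1) fun st => Pu.lett (Pu.ncons (x := none) (s := s) (by simp [encO])
      (by simp [hw])) fun w₁ => Pu.lett (Pu.ncons (x := none) (s := Word.ncons none s)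
        (by simp [encO]) (by simp)) fun w₂ => Pu.pair (Pu.pair (Pu.var (v := encO (some v))
          (by simp [hx])) (Pu.var (v := encW s) (by simp [hw]))) (Pu.pair
            (Pu.pair (Pu.var (v := encO (some v)) (by simp [hx])) Pu.v0) (Pu.num 0))).congr rfl
            (by omega)

def leftV (x l b : ℕ) : T :=
  mapOntoE (varE l) (mapOntoE (varE l) (varE b) fun w => letE (numE 1) fun st =>
    letE (pairE (varE x) (varE w)) fun y => letE (nconsV st y) fun z => nconsV st z)
    fun w => pairE (varE x) (varE w)

theorem Pu.left {x l b : ℕ} {v : Fin n} {ls bs : List (Word (Fin n))}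
    (hx : (x, encO (some v)) ∈ L) (hl : (l, encL (ls.map encW)) ∈ L)
    (hb : (b, encL (bs.map encW)) ∈ L) :
    Pu I L (leftV x l b) (encL ((leftLoop v ls bs).map encW)) (60 * ls.length + 5) := by
  refine (Pu.mapOnto (c := 3) (g := (some v :: ·)) (Pu.var hl) (Pu.mapOnto (c := 48)
    (g := fun w => Word.ncons none (Word.ncons none (some v :: w))) (Pu.var hl) (Pu.var hb)
      fun s xi ai r _ => ?_) fun s xi ai r _ => ?_).congr rfl (by omega)
  · exact (Pu.lett (Pu.num 1) fun st => Pu.lett (Pu.pair (Pu.var (v := encO (some v))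
      (by simp [hx])) Pu.v1) fun y => Pu.lett (Pu.ncons (x := none) (s := some v :: s)
        (by simp [encO]) (by simp)) fun z => Pu.ncons (x := none)
          (s := Word.ncons none (some v :: s)) (by simp [encO]) (by simp)).congr rfl (by omega)
  · exact (Pu.pair (Pu.var (v := encO (some v)) (by simp [hx])) Pu.v0).congr rfl (by omega)

/-- The words that arise from `σ` by introducing `x`. -/
def introV (x σ : ℕ) : T :=
  sndE (sndE (sndE (foldrE (varE σ)
    (letE (numE 0) fun z => letE (newEndV x z z) fun r => letE (leftV x r z) fun i =>
      pairE (varE z) (pairE (varE z) (pairE (varE r) (varE i))))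
    fun a acc => letE (pairE (varE a) (fstE (varE acc))) fun w =>
      letE (fstE (sndE (varE acc))) fun p₀ => letE (toggleV (numE 1) a p₀) fun p =>
      letE (newEndV x p w) fun e =>
      letE (ifEqE (varE a) (numE 1) (varE e)
        (mapOntoE (fstE (sndE (sndE (varE acc)))) (varE e) fun u => pairE (varE a) (varE u)))
        fun r =>
      letE (mapOntoE (sndE (sndE (sndE (varE acc)))) (numE 0) fun u => nconsV a u) fun b =>
      letE (leftV x r b) fun i => pairE (varE w) (pairE (varE p) (pairE (varE r) (varE i))))))

/-- A single fold from the end carries the suffix read so far, its parity, and the two lists of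
words with one and with both ends of the vertex placed. -/
theorem Pu.intro {x σ : ℕ} {v : Fin n} {s : Word (Fin n)} (hx : (x, encO (some v)) ∈ L)
    (hs : (σ, encW s) ∈ L) :
    Pu I L (introV x σ) (encL ((introLoop v s).map encW)) (1000 * (s.length + 1) ^ 3) := by
  let F : Word (Fin n) → Dat := fun w => .cons (encW w) (.cons (encB (par w))
    (.cons (encL ((rightsLoop v w).map encW)) (encL ((introLoop v w).map encW))))
  have base : Pu I L (letE (numE 0) fun z => letE (newEndV x z z) fun r =>
      letE (leftV x r z) fun i => pairE (varE z) (pairE (varE z) (pairE (varE r) (varE i))))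
      (F []) 220 := by
    refine (Pu.lett (Pu.num 0) fun z => Pu.lett (Pu.newEnd (v := v) (s := []) (by simp [hx])
      (by simp [encB, par]) (by simp [encW, encL])) fun r => Pu.lett (Pu.left (v := v)
        (ls := Word.newEnd v []) (bs := []) (by simp [hx]) (by simp) (by simp [encL])) fun i =>
          Pu.pair Pu.v2 (Pu.pair Pu.v2 (Pu.pair Pu.v1 Pu.v0))).congr rfl ?_
    have := length_newEnd v []
    omega
  have hlen : ∀ w : Word (Fin n), w.length ≤ s.length → (rightsLoop v w).length ≤
      2 * (s.length + 1) ∧ (introLoop v w).length ≤ 4 * (s.length + 1) * (s.length + 1) :=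
    fun w hw => ⟨(length_rightsLoop v w).trans (by omega), (length_introLoop v w).trans
      (Nat.mul_le_mul (by omega) (by omega))⟩
  have hstep := Pu.foldr (I := I) (L := L) (enc := encO) (xs := s) (Pu.var hs) F base
    -- The quadratically many words found so far are extended by the current letter, which dominates
    -- the cost of an iteration.
    (c := 400 * (s.length + 1) * (s.length + 1))
    (f := fun a acc => letE (pairE (varE a) (fstE (varE acc))) fun w =>
      letE (fstE (sndE (varE acc))) fun p₀ => letE (toggleV (numE 1) a p₀) fun p =>
      letE (newEndV x p w) fun e =>
      letE (ifEqE (varE a) (numE 1) (varE e)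
        (mapOntoE (fstE (sndE (sndE (varE acc)))) (varE e) fun u => pairE (varE a) (varE u)))
        fun r =>
      letE (mapOntoE (sndE (sndE (sndE (varE acc)))) (numE 0) fun u => nconsV a u) fun b =>
      letE (leftV x r b) fun i => pairE (varE w) (pairE (varE p) (pairE (varE r) (varE i))))
    fun a w xi ai hsuf => ?_
  · refine (Pu.snd (Pu.snd (Pu.snd hstep))).congr rfl ?_
    have h1 : s.length * (400 * (s.length + 1) * (s.length + 1) + 5) ≤
        400 * (s.length + 1) ^ 3 + 5 * (s.length + 1) :=
      (Nat.mul_le_mul_right _ (show s.length ≤ s.length + 1 by omega)).trans (le_of_eq (by ring))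
    have h2 : s.length + 1 ≤ (s.length + 1) ^ 3 := Nat.le_self_pow (by simp) _
    omega
  have hl1 := hsuf.length_le
  simp only [List.length_cons] at hl1
  obtain ⟨hr, hi⟩ := hlen w (by omega)
  obtain ⟨hr', -⟩ := hlen (a :: w) (by simpa using hl1)
  refine (Pu.lett (Pu.pair Pu.v0 (Pu.fst Pu.v1)) fun W => Pu.lett (Pu.fst (Pu.snd Pu.v2))
    fun p₀ => Pu.lett (Pu.togglePar (y := a) (s := w) (by simp) (by simp [F, Dat.fst, Dat.snd]))
    fun p => Pu.lett (Pu.newEnd (v := v) (s := a :: w) (by simp [hx]) (by simp)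
      (by simp [F, Dat.fst])) fun e =>
    Pu.lett (va := encL ((rightsLoop v (a :: w)).map encW))
      (Pu.ifEq (c := 6 * (rightsLoop v w).length + 10) Pu.v4 (Pu.num 1)
      (fun e1 => Pu.v0.congr ?_ (by omega)) (fun e1 => ?_)) fun r =>
    Pu.lett (Pu.mapOnto (enc := encW) (enc' := encW) (xs := introLoop v w) (ys := [])
      (g := Word.ncons a) (c := 20) (ca := 4) (cb := 1)
      ((Pu.snd (Pu.snd (Pu.snd Pu.v6))).congr rfl (by omega)) (Pu.num 0)
      fun u xi ai r _ => Pu.ncons (x := a) (s := u) (by simp) (by simp)) fun b =>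
    Pu.lett (Pu.left (v := v) (ls := rightsLoop v (a :: w))
      (bs := ((introLoop v w).map (Word.ncons a)).reverse ++ []) (by simp [hx]) (by simp) (by simp))
    fun i => Pu.pair Pu.v6 (Pu.pair Pu.v4 (Pu.pair Pu.v2 Pu.v0))).congr rfl ?_
  · obtain rfl := encO_eq_star.1 e1
    rfl
  · cases a with
    | none => exact absurd rfl e1
    | some a =>
      exact (Pu.mapOnto (enc := encW) (enc' := encW) (xs := rightsLoop v w)
        (ys := Word.newEnd v (some a :: w)) (g := (some a :: ·)) (c := 3) (ca := 4)
        ((Pu.fst (Pu.snd (Pu.snd Pu.v5))).congr rfl (by omega)) Pu.v0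
        fun u xi ai r _ => (Pu.pair (Pu.var (v := encO (some a)) (by simp)) Pu.v0).congr
          rfl (by omega)).congr rfl (by omega)
  · nlinarith

/-- The word that arises from `σ` by forgetting `x`. -/
def fgV (x σ : ℕ) : T :=
  fstE (foldrE (varE σ) (letE (numE 0) fun z => pairE (varE z) (pairE (varE z) (varE z)))
    fun a acc => letE (fstE (varE acc)) fun w => letE (fstE (sndE (varE acc))) fun p =>
      letE (sndE (sndE (varE acc))) fun o => letE (numE 1) fun st =>
      letE (toggleV (numE 1) a p) fun p' => letE (toggleV (varE x) a o) fun o' =>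
      pairE (ifEqE (varE a) (numE 1) (ifEqE (varE o) (numE 1) (varE w) (nconsV st w))
        (ifEqE (varE a) (varE x) (ifEqE (varE p) (numE 1) (varE w) (nconsV st w))
          (pairE (varE a) (varE w)))) (pairE (varE p') (varE o')))

/-- The fold carries the recoloured suffix together with the parity of the suffix and whether the
forgotten interval is open; these two decide about the next star. -/
theorem Pu.fg {x σ : ℕ} {v : Fin n} {s : Word (Fin n)} (hx : (x, encO (some v)) ∈ L)
    (hs : (σ, encW s) ∈ L) :
    Pu I L (fgV x σ) (encW (Word.fg v s)) (120 * s.length + 20) := by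
  let F : Word (Fin n) → Dat := fun w => .cons (encW (Word.fg v w)) (.cons (encB (par w))
    (encB (opn v w)))
  refine (Pu.fst (Pu.foldr (enc := encO) (xs := s) (Pu.var hs) F (c := 100) (cb := 7)
    ((Pu.lett (Pu.num 0) fun z => Pu.pair Pu.v0 (Pu.pair Pu.v0 Pu.v0)).congr rfl (by omega))
    fun a w xi ai _ => ?_)).congr rfl (by omega)
  refine (Pu.lett (Pu.fst Pu.v1) fun W => Pu.lett (Pu.fst (Pu.snd Pu.v2)) fun p =>
    Pu.lett (Pu.snd (Pu.snd Pu.v3)) fun o => Pu.lett (Pu.num 1) fun st =>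
    Pu.lett (Pu.togglePar (y := a) (s := w) (by simp) (by simp [F, Dat.fst, Dat.snd])) fun p' =>
    Pu.lett (Pu.toggleOpn (v := v) (y := a) (s := w) (by simp [hx]) (by simp)
      (by simp [F, Dat.fst, Dat.snd])) fun o' =>
    Pu.pair (va := encW (Word.fg v (a :: w))) (ca := 36) ?_ (Pu.pair Pu.v1 Pu.v0)).congr rfl
      (by omega)
  have hw : (W, encW (Word.fg v w)) ∈ ((o', encB (opn v (a :: w))) :: (p', encB (par (a :: w))) ::
    (st, Dat.num 1) :: (o, (F w).snd.snd) :: (p, (F w).snd.fst) :: (W, (F w).fst) ::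
      (xi, encO a) :: (ai, F w) :: L) := by simp [F, Dat.fst]
  have hn := Pu.ncons (I := I) (a := st) (x := none) (by simp [encO]) hw
  refine (Pu.ifEq (c := 30) (Pu.var (v := encO a) (by simp)) (Pu.num 1) (fun e1 => ?_)
    (fun e1 => ?_)).congr rfl (by omega)
  · obtain rfl := encO_eq_star.1 e1
    refine (Pu.ifEq (c := 20) Pu.v3 (Pu.num 1) (fun e2 => ?_) (fun e2 => ?_)).congr rfl
      (by omega)
    · rw [Word.fg, if_pos (encB_eq_one.1 e2)]
      exact (Pu.var hw).congr rfl (by omega)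
    · rw [Word.fg, if_neg (fun h => e2 (encB_eq_one.2 h))]
      exact hn
  · rcases a with _ | a
    · exact absurd rfl e1
    refine (Pu.ifEq (c := 24) (Pu.var (v := encO (some a)) (by simp)) (Pu.var (v := encO (some v))
      (by simp [hx])) (fun e2 => ?_) (fun e2 => ?_)).congr rfl (by omega)
    · obtain rfl := Option.some_injective _ (encO_injective e2)
      refine (Pu.ifEq (c := 20) Pu.v4 (Pu.num 1) (fun e3 => ?_) (fun e3 => ?_)).congr rfl
        (by omega)
      · rw [Word.fg, if_pos rfl, if_pos (encB_eq_one.1 e3)]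
        exact (Pu.var hw).congr rfl (by omega)
      · rw [Word.fg, if_pos rfl, if_neg (fun h => e3 (encB_eq_one.2 h))]
        exact hn
    · have : a ≠ v := by rintro rfl; exact e2 rfl
      rw [Word.fg, if_neg this]
      exact (Pu.pair (Pu.var (v := encO (some a)) (by simp)) (Pu.var hw)).congr rfl (by omega)

def meetsV (x y σ : ℕ) : T :=
  sndE (sndE (foldrE (varE σ) (letE (numE 0) fun z => pairE (varE z) (pairE (varE z) (varE z)))
    fun a acc => letE (fstE (varE acc)) fun p => letE (fstE (sndE (varE acc))) fun q =>
      letE (toggleV (varE x) a p) fun p' => letE (toggleV (varE y) a q) fun q' =>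
      pairE (varE p') (pairE (varE q') (ifEqE (varE p') (numE 1) (ifEqE (varE q') (numE 1) (numE 1)
        (sndE (sndE (varE acc)))) (sndE (sndE (varE acc)))))))

theorem Pu.meets {x y σ : ℕ} {u v : Fin n} {s : Word (Fin n)} (hx : (x, encO (some u)) ∈ L)
    (hy : (y, encO (some v)) ∈ L) (hs : (σ, encW s) ∈ L) :
    Pu I L (meetsV x y σ) (encB (Word.meets u v s)) (80 * s.length + 20) := by
  let F : Word (Fin n) → Dat := fun w => .cons (encB (opn u w)) (.cons (encB (opn v w))
    (encB (Word.meets u v w)))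
  refine (Pu.snd (Pu.snd (Pu.foldr (enc := encO) (xs := s) (Pu.var hs) F (c := 60) (cb := 7)
    ((Pu.lett (Pu.num 0) fun z => Pu.pair Pu.v0 (Pu.pair Pu.v0 Pu.v0)).congr rfl (by omega))
    fun a w xi ai _ => ?_))).congr rfl (by omega)
  refine (Pu.lett (Pu.fst Pu.v1) fun p => Pu.lett (Pu.fst (Pu.snd Pu.v2)) fun q =>
    Pu.lett (Pu.toggleOpn (v := u) (y := a) (s := w) (by simp [hx]) (by simp)
      (by simp [F, Dat.fst, Dat.snd])) fun p' =>
    Pu.lett (Pu.toggleOpn (v := v) (y := a) (s := w) (by simp [hy]) (by simp)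
      (by simp [F, Dat.fst, Dat.snd])) fun q' =>
    Pu.pair Pu.v1 (Pu.pair Pu.v0 (vb := encB (Word.meets u v (a :: w))) (cb := 12) ?_)).congr rfl
      (by omega)
  refine (Pu.ifEq (c := 8) Pu.v1 (Pu.num 1) (fun e1 => ?_) (fun e1 => ?_)).congr rfl (by omega)
  · refine (Pu.ifEq (c := 3) Pu.v0 (Pu.num 1) (fun e2 => ?_) (fun e2 => ?_)).congr rfl (by omega)
    · rw [Word.meets, encB_eq_one.1 e1, encB_eq_one.1 e2]
      exact (Pu.num 1).congr rfl (by omega)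
    · rw [Word.meets, Bool.eq_false_iff.2 (fun h => e2 (encB_eq_one.2 h))]
      exact (Pu.snd (Pu.snd Pu.v5)).congr (by simp [F, Dat.snd]) (by omega)
  · rw [Word.meets, Bool.eq_false_iff.2 (fun h => e1 (encB_eq_one.2 h))]
    exact (Pu.snd (Pu.snd Pu.v5)).congr (by simp [F, Dat.snd]) (by omega)

end pure

end TreeLang

/-! ### The program for joins -/

namespace TreeLang

open Word

section join

variable {n : ℕ} {I : ℕ → ℕ → ℕ} {L : List (ℕ × Dat)}

def encP (p : Partial (Fin n)) : Dat := .cons (encW p.1) (.cons (encW p.2.1) (encB p.2.2))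

def testV (d c t e : ℕ) : T :=
  if d = 0 then ifEqE (varE c) (numE 1) (ifEqE (varE e) (numE 1) (numE 0) (numE 1))
    (ifEqE (varE e) (numE 1) (ifEqE (varE t) (numE 0) (numE 1) (numE 0)) (numE 1))
  else ifEqE (varE c) (numE 1) (ifEqE (varE e) (numE 1) (numE 0)
    (ifEqE (varE t) (numE 0) (numE 0) (numE 1))) (numE 1)

theorem Pu.test (d : ℕ) {c t e t₀ : ℕ} {c₀ e₀ : Bool} (hc : (c, encB c₀) ∈ L)
    (ht : (t, .num t₀) ∈ L) (he : (e, encB e₀) ∈ L) :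
    Pu I L (testV d c t e) (encB (gapTest c₀ t₀ e₀ d)) 20 := by
  have r0 : ∀ {b : Bool}, b = false → Pu I L (numE 0) (encB b) 2 := fun h => by
    subst h; exact (Pu.num 0).congr rfl (by omega)
  have r1 : ∀ {b : Bool}, b = true → Pu I L (numE 1) (encB b) 2 := fun h => by
    subst h; exact Pu.num 1
  have n1 : ∀ {b : Bool}, encB b ≠ .num 1 → b = false := fun h =>
    Bool.eq_false_iff.2 fun h' => h (encB_eq_one.2 h')
  have t0 : (Dat.num t₀ = .num 0) ↔ t₀ = 0 := by simp
  unfold testV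
  split_ifs with hd
  · subst hd
    refine (Pu.ifEq (c := 14) (Pu.var hc) (Pu.num 1) (fun e1 => ?_) (fun e1 => ?_)).congr rfl
      (by omega)
    · refine (Pu.ifEq (c := 2) (Pu.var he) (Pu.num 1) (fun e2 => r0 ?_) (fun e2 => r1 ?_)).congr
        rfl (by omega)
      · simp [gapTest, encB_eq_one.1 e1, encB_eq_one.1 e2]
      · simp [gapTest, encB_eq_one.1 e1, n1 e2]
    · refine (Pu.ifEq (c := 6) (Pu.var he) (Pu.num 1) (fun e2 => ?_) (fun e2 => (r1 ?_).congr rfl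
        (by omega))).congr rfl (by omega)
      · refine (Pu.ifEq (c := 2) (Pu.var ht) (Pu.num 0) (fun e3 => r1 ?_) (fun e3 => r0 ?_)).congr
          rfl (by omega)
        · simp [gapTest, n1 e1, encB_eq_one.1 e2, t0.1 e3]
        · replace e3 := mt t0.2 e3
          simp [gapTest, n1 e1, encB_eq_one.1 e2, e3]
      · simp [gapTest, n1 e1, n1 e2]
  · refine (Pu.ifEq (c := 14) (Pu.var hc) (Pu.num 1) (fun e1 => ?_) (fun e1 => (r1 ?_).congr rfl
      (by omega))).congr rfl (by omega)
    · refine (Pu.ifEq (c := 6) (Pu.var he) (Pu.num 1) (fun e2 => (r0 ?_).congr rfl (by omega))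
        (fun e2 => ?_)).congr rfl (by omega)
      · simp [gapTest, encB_eq_one.1 e1, encB_eq_one.1 e2]
      · refine (Pu.ifEq (c := 2) (Pu.var ht) (Pu.num 0) (fun e3 => r0 ?_) (fun e3 => r1 ?_)).congr
          rfl (by omega)
        · simp [gapTest, encB_eq_one.1 e1, n1 e2, t0.1 e3, hd]
        · replace e3 := mt t0.2 e3
          simp [gapTest, encB_eq_one.1 e1, n1 e2, e3, hd]
    · simp [gapTest, n1 e1, hd]

/-- Prepending `d` stars without shortening. -/
def starsV (st : ℕ) (w : T) : ℕ → T
  | 0 => w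
  | d + 1 => pairE (varE st) (starsV st w d)

theorem Pu.stars {st c : ℕ} {w : T} {s : Word (Fin n)} (hst : (st, encO (none : Option (Fin n))) ∈ L)
    (hw : Pu I L w (encW s) c) (d : ℕ) :
    Pu I L (starsV st w d) (encW (List.replicate d none ++ s)) (c + 2 * d) := by
  induction d with
  | zero => exact hw
  | succ d ih => exact (Pu.pair (Pu.var hst) ih).congr rfl (by omega)

def nstV (st w : ℕ) : ℕ → T
  | 0 => varE w
  | d + 1 => letE (nstV st w d) fun u => nconsV st u

theorem Pu.nst {st w : ℕ} {s : Word (Fin n)} (hst : (st, encO (none : Option (Fin n))) ∈ L)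
    (hw : (w, encW s) ∈ L) (d : ℕ) :
    Pu I L (nstV st w d) (encW (Word.nst d s)) (1 + 21 * d) := by
  induction d with
  | zero => exact (Pu.var hw).congr rfl (by omega)
  | succ d ih =>
    exact (Pu.lett ih fun u => Pu.ncons (x := none) (s := Word.nst d s) (by simp [hst])
      (by simp)).congr rfl (by omega)

/-- The number `d` is fixed in the program text, but `t` is a value known only at run time. So the
words with zero, one and two more stars are all computed, and `t` selects among them. -/
def extendV (d c t p l : ℕ) : T :=
  letE (sndE (sndE (varE p))) fun e => ifEqE (testV d c t e) (numE 1)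
    (letE (numE 1) fun st => letE (fstE (sndE (varE p))) fun o => letE (nstV st o d) fun u =>
      letE (nconsV st u) fun u₁ => letE (nconsV st u₁) fun u₂ =>
      pairE (pairE (starsV st (fstE (varE p)) d) (pairE
        (ifEqE (varE t) (numE 0) (varE u) (ifEqE (varE t) (numE 1) (varE u₁) (varE u₂)))
        (if d % 2 = 1 then notV e else varE e))) (varE l))
    (varE l)

theorem Pu.extend {d c t p l t₀ : ℕ} {c₀ : Bool} {q : Partial (Fin n)} {l₀ : List (Partial (Fin n))}
    (hd : d ≤ 2) (ht2 : t₀ ≤ 2) (hc : (c, encB c₀) ∈ L) (ht : (t, .num t₀) ∈ L)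
    (hp : (p, encP q) ∈ L) (hl : (l, encL (l₀.map encP)) ∈ L) :
    Pu I L (extendV d c t p l) (encL ((extendGap c₀ t₀ q d l₀).map encP)) 180 := by
  refine (Pu.lett (Pu.snd (Pu.snd (Pu.var hp))) fun e => Pu.ifEq (c := 150)
    (Pu.test d (c₀ := c₀) (t₀ := t₀) (e₀ := q.2.2) (by simp [hc]) (by simp [ht])
      (by simp [encP, Dat.snd])) (Pu.num 1) (fun e1 => ?_) (fun e1 => ?_)).congr rfl (by omega)
  · rw [extendGap, if_pos (encB_eq_one.1 e1)]
    refine (Pu.lett (Pu.num 1) fun st => Pu.lett (Pu.fst (Pu.snd (Pu.var (v := encP q)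
      (by simp [hp])))) fun o => Pu.lett (Pu.nst (s := q.2.1) (by simp [encO])
        (by simp [encP, Dat.fst, Dat.snd]) d) fun u =>
      Pu.lett (Pu.ncons (x := none) (s := Word.nst d q.2.1) (by simp [encO]) (by simp)) fun u₁ =>
      Pu.lett (Pu.ncons (x := none) (s := Word.ncons none (Word.nst d q.2.1)) (by simp [encO])
        (by simp)) fun u₂ =>
      Pu.pair (vb := encL (l₀.map encP)) (Pu.pair (va := encW (List.replicate d none ++ q.1))
        (ca := 6) ?_ (Pu.pair (va := encW (Word.nst t₀ (Word.nst d q.2.1))) (ca := 10)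
          (vb := encB (xor (d % 2 = 1) q.2.2)) (cb := 6) ?_ ?_)) (Pu.var (by simp [hl]))).congr rfl
      (by omega)
    · exact (Pu.stars (by simp [encO]) ((Pu.fst (Pu.var (v := encP q) (by simp [hp]))).congr rfl
        le_rfl) d).congr rfl (by omega)
    · refine (Pu.ifEq (c := 5) (Pu.var (v := .num t₀) (by simp [ht])) (Pu.num 0) (fun e2 => ?_)
        (fun e2 => ?_)).congr rfl (by omega)
      · obtain rfl : t₀ = 0 := by simpa using e2
        exact Pu.v2.congr rfl (by omega)
      · refine (Pu.ifEq (c := 1) (Pu.var (v := .num t₀) (by simp [ht])) (Pu.num 1) (fun e3 => ?_)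
          (fun e3 => ?_)).congr rfl (by omega)
        · obtain rfl : t₀ = 1 := by simpa using e3
          exact Pu.v1
        · obtain rfl : t₀ = 2 := by
            simp only [ne_eq, Dat.num.injEq] at e2 e3
            omega
          exact Pu.v0
    · split_ifs with h
      · exact (Pu.not (b := q.2.2) (by simp [encP, Dat.snd])).congr (by simp [h]) le_rfl
      · exact (Pu.var (v := encB q.2.2) (by simp [encP, Dat.snd])).congr (by simp [h]) (by omega)
  · rw [extendGap, if_neg fun h => e1 (encB_eq_one.2 h)]
    exact (Pu.var (by simp [hl])).congr rfl (by omega)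

def closeV (c t l : ℕ) : T :=
  loopE (varE l) (numE 0) fun p acc => letE (extendV 2 c t p acc) fun a =>
    letE (extendV 1 c t p a) fun b => extendV 0 c t p b

theorem Pu.close {c t l t₀ : ℕ} {c₀ : Bool} {l₀ : List (Partial (Fin n))} (ht2 : t₀ ≤ 2)
    (hc : (c, encB c₀) ∈ L) (ht : (t, .num t₀) ∈ L) (hl : (l, encL (l₀.map encP)) ∈ L) :
    Pu I L (closeV c t l) (encL ((closeGap c₀ t₀ l₀).map encP)) (560 * l₀.length + 5) := by
  have := Pu.foldl (I := I) (Pu.var hl) (fun w => encL ((closeGap c₀ t₀ w.reverse).map encP))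
    (c := 550) (i := numE 0) (f := fun p acc => letE (extendV 2 c t p acc) fun a =>
    letE (extendV 1 c t p a) fun b => extendV 0 c t p b) (Pu.num 0) fun p w xi ai _ => ?_
  · refine (this.congr ?_ (by omega))
    rw [List.reverse_reverse]
  · refine (Pu.lett (Pu.extend (c₀ := c₀) (q := p) (d := 2) (l₀ := closeGap c₀ t₀ w.reverse) le_rfl ht2
      (by simp [hc]) (by simp [ht]) (by simp) (by simp)) fun a => Pu.lett (Pu.extend (c₀ := c₀) (q := p)
      (d := 1) (l₀ := extendGap c₀ t₀ p 2 (closeGap c₀ t₀ w.reverse)) (by omega) ht2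
      (by simp [hc]) (by simp [ht]) (by simp) (by simp)) fun b => Pu.extend (c₀ := c₀) (q := p)
      (d := 0) (l₀ := extendGap c₀ t₀ p 1 (extendGap c₀ t₀ p 2 (closeGap c₀ t₀ w.reverse)))
      (by omega) ht2 (by simp [hc]) (by simp [ht]) (by simp) (by simp)).congr ?_ (by omega)
    rw [List.reverse_cons]
    simp only [closeGap, List.foldl_append, List.foldl_cons, List.foldl_nil]

/-- What can be merged with the word `σ`. -/
def joinV (σ : ℕ) : T :=
  letE (foldrE (varE σ)
    (letE (numE 0) fun z => pairE (varE z) (pairE (varE z)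
      (pairE (pairE (varE z) (pairE (varE z) (varE z))) (varE z))))
    fun a acc => letE (fstE (varE acc)) fun t => letE (fstE (sndE (varE acc))) fun c =>
      letE (sndE (sndE (varE acc))) fun l =>
      ifEqE (varE a) (numE 1)
        (pairE (addE (varE t) (numE 1) (numE 2)) (pairE (varE c) (varE l)))
        (letE (closeV c t l) fun m =>
          pairE (numE 0) (pairE (ifEqE (varE t) (numE 1) (notV c) (varE c))
            (mapOntoE (varE m) (numE 0) fun p => pairE (pairE (varE a) (fstE (varE p)))
              (pairE (pairE (varE a) (fstE (sndE (varE p)))) (sndE (sndE (varE p))))))))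
    fun r => letE (fstE (varE r)) fun t => letE (fstE (sndE (varE r))) fun c =>
      letE (sndE (sndE (varE r))) fun l => closeV c t l

theorem joinState_le (w : Word (Fin n)) : (joinState w).1 ≤ 2 := by
  rcases w with _ | ⟨_ | a, w⟩ <;> simp [joinState]

theorem letters_suffix {w s : Word (Fin n)} (h : w <:+ s) :
    (letters w).length ≤ (letters s).length := by
  obtain ⟨u, rfl⟩ := h
  induction u with
  | nil => exact le_rfl
  | cons a u ih =>
    cases a with
    | none => exact ih
    | some a => exact ih.trans (by simp [letters])

/-- Each of the `s.length` iterations handles at most `3 ^ (letters s).length` partial partners at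
constant cost. -/
theorem Pu.join {σ : ℕ} {s : Word (Fin n)} (hs : (σ, encW s) ∈ L) :
    Pu I L (joinV σ) (encL ((joinList s).map encP))
      (2000 * (s.length + 1) * 3 ^ (letters s).length) := by
  let F : Word (Fin n) → Dat := fun w => .cons (.num (joinState w).1)
    (.cons (encB (joinState w).2.1) (encL ((joinState w).2.2.map encP)))
  have hK : 1 ≤ 3 ^ (letters s).length := Nat.one_le_pow _ _ (by omega)
  refine (Pu.lett (Pu.foldr (enc := encO) (xs := s) (Pu.var hs) F (cb := 13)
    (c := 900 * 3 ^ (letters s).length)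
    ((Pu.lett (Pu.num 0) fun z => Pu.pair Pu.v0 (Pu.pair Pu.v0 (Pu.pair (Pu.pair Pu.v0
      (Pu.pair Pu.v0 Pu.v0)) Pu.v0))).congr rfl (by omega)) fun a w xi ai hsuf => ?_) fun r =>
    Pu.lett (Pu.fst Pu.v0) fun t => Pu.lett (Pu.fst (Pu.snd Pu.v1)) fun c =>
    Pu.lett (Pu.snd (Pu.snd Pu.v2)) fun l => Pu.close (c₀ := (joinState s).2.1)
      (l₀ := (joinState s).2.2) (joinState_le s) (by simp [F, Dat.fst, Dat.snd])
      (by simp [F, Dat.fst, Dat.snd]) (by simp [F, Dat.fst, Dat.snd])).congr rfl ?_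
  · have hlen : (joinState w).2.2.length ≤ 3 ^ (letters s).length :=
      (length_joinState w).trans (Nat.pow_le_pow_right (by omega)
        (letters_suffix ((List.suffix_cons a w).trans hsuf)))
    have hlen2 := length_closeGap (joinState w).2.1 (joinState w).1 (joinState w).2.2
    refine (Pu.lett (Pu.fst Pu.v1) fun t => Pu.lett (Pu.fst (Pu.snd Pu.v2)) fun c =>
      Pu.lett (Pu.snd (Pu.snd Pu.v3)) fun l => Pu.ifEq (c := 640 * 3 ^ (letters s).length + 60)
        Pu.v3 (Pu.num 1) (fun e1 => ?_) (fun e1 => ?_)).congr rfl (by omega)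
    · obtain rfl := encO_eq_star.1 e1
      exact (Pu.pair (Pu.add Pu.v2 (Pu.num 1) (Pu.num 2)) (Pu.pair Pu.v1 Pu.v0)).congr rfl
        (by omega)
    · rcases a with _ | a
      · exact absurd rfl e1
      refine (Pu.lett (Pu.close (c₀ := (joinState w).2.1) (l₀ := (joinState w).2.2)
        (joinState_le w) (by simp [F, Dat.fst, Dat.snd])
        (by simp [F, Dat.fst, Dat.snd]) (by simp [F, Dat.fst, Dat.snd])) fun m =>
        Pu.pair (Pu.num 0) (Pu.pair (va := encB (xor ((joinState w).1 % 2 = 1) (joinState w).2.1))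
          (Pu.ifEq (c := 6) Pu.v3 (Pu.num 1) (fun e2 => ?_) (fun e2 => ?_))
          (Pu.mapOnto (enc := encP) (enc' := encP) (xs := closeGap (joinState w).2.1
            (joinState w).1 (joinState w).2.2) (ys := []) (c := 14)
            (g := fun p => (some a :: p.1, some a :: p.2.1, p.2.2)) Pu.v0 (Pu.num 0)
            fun p xi' ai' r _ => ?_))).congr rfl ?_
      · have : (joinState w).1 = 1 := by simpa [F, Dat.fst] using e2
        exact (Pu.not (b := (joinState w).2.1) (by simp [F, Dat.fst, Dat.snd])).congr
          (by simp [this]) le_rfl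
      · have h1 : (joinState w).1 ≠ 1 := by simpa [F, Dat.fst] using e2
        have h2 := joinState_le w
        have h3 : ¬ (joinState w).1 % 2 = 1 := by omega
        exact Pu.v2.congr (by simp [F, Dat.fst, Dat.snd, h3]) (by omega)
      · exact (Pu.pair (Pu.pair (Pu.var (v := encO (some a)) (by simp)) (Pu.fst Pu.v0))
          (Pu.pair (Pu.pair (Pu.var (v := encO (some a)) (by simp)) (Pu.fst (Pu.snd Pu.v0)))
            (Pu.snd (Pu.snd Pu.v0)))).congr rfl (by omega)
      · omega
  · have hlen := length_joinState s
    generalize 3 ^ (letters s).length = K at *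
    generalize (joinState s).2.2.length = k at *
    generalize s.length = m at *
    nlinarith [Nat.mul_le_mul_left m hK]

end join

end TreeLang

namespace TreeLang

open Word NiceTree

/-! #### Tables in the dictionary -/

section tables

variable {n : ℕ} {I : ℕ → ℕ → ℕ} {L : List (ℕ × Dat)} {δ δ' δ₀ : Dict}

def adjKey (u v : Fin n) : Dat := .cons (.num (u + 2)) (.num (v + 2))

def tabKey (w : Word (Fin n)) (i : ℕ) : Dat := .cons (encW w) (.num i)

theorem tabKey_inj {w w' : Word (Fin n)} {i i' : ℕ} (h : tabKey w i = tabKey w' i') :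
    w = w' ∧ i = i' := by
  simp only [tabKey, Dat.cons.injEq, Dat.num.injEq] at h
  exact ⟨encW_injective h.1, h.2⟩

/-- One dictionary holds both the adjacency matrix and all tables. The first component of a table
key is a pair or `num 0`, that of an adjacency key a number from two on. -/
theorem adjKey_ne_tabKey (u v : Fin n) (w : Word (Fin n)) (i : ℕ) : adjKey u v ≠ tabKey w i := by
  intro h
  simp only [tabKey, adjKey, Dat.cons.injEq] at h
  cases w <;> simp [encW, encL] at h

/-- The words in `tw` have the table entries number `i`; each one is the largest value that the
word has in `S`. -/
structure IsTable (δ : Dict) (i : ℕ) (tw : List (Word (Fin n))) (S : Word (Fin n) → ℕ → Prop) :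
    Prop where
  nodup : tw.Nodup
  entry : ∀ w, (w ∉ tw ∧ δ (tabKey w i) = .num 0 ∧ ∀ v, ¬ S w v) ∨
    (w ∈ tw ∧ ∃ v, δ (tabKey w i) = .cons (.num v) (.num 0) ∧ IsGreatest {v | S w v} v)

/-- `δ'` agrees with `δ` outside of table `i`. -/
def Frame (i : ℕ) (δ δ' : Dict) : Prop :=
  ∀ k, (∀ w : Word (Fin n), k ≠ tabKey w i) → δ' k = δ k

theorem IsTable.frame {i j : ℕ} {tw : List (Word (Fin n))} {S : Word (Fin n) → ℕ → Prop}
    (h : IsTable δ i tw S) (hf : Frame (n := n) j δ δ') (hij : i ≠ j) : IsTable δ' i tw S :=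
  ⟨h.nodup, fun w => by
    rw [hf (tabKey w i) fun w' e => hij (tabKey_inj e).2]
    exact h.entry w⟩

/-- A table keeps only maxima, so passing to a larger relation is harmless as long as every new
value is dominated by an old one. This is how values computed from the best entries of the children
represent all derivations. -/
theorem IsTable.congr {i : ℕ} {tw : List (Word (Fin n))} {S S' : Word (Fin n) → ℕ → Prop}
    (h : IsTable δ i tw S) (h1 : ∀ w v, S w v → S' w v)
    (h2 : ∀ w v, S' w v → ∃ v', v ≤ v' ∧ S w v') : IsTable δ i tw S' :=
  ⟨h.nodup, fun w => by
    rcases h.entry w with ⟨h3, h4, h5⟩ | ⟨h3, v, h4, h5⟩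
    · exact Or.inl ⟨h3, h4, fun v hv => by
        obtain ⟨v', -, hv'⟩ := h2 w v hv
        exact h5 v' hv'⟩
    · refine Or.inr ⟨h3, v, h4, h1 _ _ h5.1, fun v' hv' => ?_⟩
      obtain ⟨v'', hle, hv''⟩ := h2 w v' hv'
      exact hle.trans (h5.2 hv'')⟩

/-- A table has been built on top of `δ₀`. -/
def TabPost (δ₀ : Dict) (i : ℕ) (S : Word (Fin n) → ℕ → Prop) (v : Dat) (δ : Dict) : Prop :=
  ∃ tw, v = encL (tw.map encW) ∧ IsTable δ i tw S ∧ Frame (n := n) i δ₀ δ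

theorem TabPost.congr {i : ℕ} {S S' : Word (Fin n) → ℕ → Prop} {v : Dat}
    (h : TabPost δ₀ i S v δ) (hS : ∀ w v, S w v ↔ S' w v) : TabPost δ₀ i S' v δ := by
  obtain ⟨tw, h1, h2, h3⟩ := h
  exact ⟨tw, h1, h2.congr (fun w v => (hS w v).1) fun w v h => ⟨v, le_rfl, (hS w v).2 h⟩, h3⟩

theorem TabPost.empty {i : ℕ} (h : ∀ w : Word (Fin n), δ (tabKey w i) = .num 0) :
    TabPost (n := n) δ i (fun _ _ => False) (.num 0) δ :=
  ⟨[], rfl, ⟨List.nodup_nil, fun w => Or.inl ⟨by simp, h w, by simp⟩⟩, fun _ _ => rfl⟩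

/-- Values are wrapped in a pair, so that the value zero is different from the default `num 0` of a
missing entry. A word joins the list of the table only at its first insertion. -/
def insertV (w x i tw : ℕ) : T :=
  letE (pairE (varE w) (varE i)) fun k => letE (getE (varE k)) fun old =>
    ifEqE (varE old) (numE 0)
      (letE (putE (varE k) (pairE (varE x) (numE 0))) fun _ => pairE (varE w) (varE tw))
      (ifLtE (fstE (varE old)) (varE x)
        (letE (putE (varE k) (pairE (varE x) (numE 0))) fun _ => varE tw) (varE tw))

theorem frame_update {i : ℕ} (w : Word (Fin n)) (d : Dat) (h : Frame (n := n) i δ₀ δ) :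
    Frame (n := n) i δ₀ (Function.update δ (tabKey w i) d) := fun k hk => by
  rw [Function.update_of_ne (hk w)]
  exact h k hk

theorem IsTable.update {i x : ℕ} {w : Word (Fin n)} {tw tw' : List (Word (Fin n))}
    {S : Word (Fin n) → ℕ → Prop} (h : IsTable δ i tw S) (hx : ∀ v, S w v → v ≤ x)
    (hn : tw'.Nodup) (hm : ∀ w', w' ∈ tw' ↔ w' = w ∨ w' ∈ tw) :
    IsTable (Function.update δ (tabKey w i) (.cons (.num x) (.num 0))) i tw'
      (fun w' v => S w' v ∨ (w' = w ∧ v = x)) := ⟨hn, fun w' => by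
  by_cases e : w' = w
  · subst e
    refine Or.inr ⟨(hm _).2 (Or.inl rfl), x, by simp, Or.inr ⟨rfl, rfl⟩, fun v hv => ?_⟩
    rcases hv with hv | ⟨-, rfl⟩
    · exact hx v hv
    · exact le_rfl
  · rw [Function.update_of_ne fun h => e (tabKey_inj h).1, hm]
    simpa [e] using h.entry w'⟩

theorem Ev.insert {wi xi ii ti i x : ℕ} {w : Word (Fin n)} {S : Word (Fin n) → ℕ → Prop}
    {vt : Dat} (ht : TabPost δ₀ i S vt δ) (hw : (wi, encW w) ∈ L) (hx : (xi, .num x) ∈ L)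
    (hi : (ii, .num i) ∈ L) (hti : (ti, vt) ∈ L) :
    Ev I L δ (insertV wi xi ii ti) 40
      (TabPost δ₀ i fun w' v => S w' v ∨ (w' = w ∧ v = x)) := by
  obtain ⟨tw, rfl, h1, h2⟩ := ht
  refine (Ev.letPu (c := 36) (Pu.pair (Pu.var hw) (Pu.var hi)) fun k => Ev.lett (c := 33)
    (Ev.get (Q := fun v δ' => v = δ (tabKey w i) ∧ δ' = δ) Pu.v0 ⟨rfl, rfl⟩)
    fun old v δ' h => ?_).mono (by omega) fun _ _ h => h
  obtain ⟨rfl, rfl⟩ := h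
  refine (Ev.ifEq (c := 20) Pu.v0 (Pu.num 0) (fun e => ?_) (fun e => ?_)).mono (by omega)
    fun _ _ h => h
  · have hn : w ∉ tw ∧ ∀ v, ¬ S w v := by
      rcases h1.entry w with h | ⟨-, v, h, -⟩
      · exact ⟨h.1, h.2.2⟩
      · simp [h] at e
    refine (Ev.lett (c := 3) (Ev.put (Q := fun _ δ'' => δ'' = Function.update δ' (tabKey w i)
      (.cons (.num x) (.num 0))) Pu.v1 (Pu.pair (Pu.var (by simp [hx])) (Pu.num 0)) rfl)
      fun _ _ δ'' h => ?_).mono (by omega) fun _ _ h => h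
    subst h
    refine (Pu.pair (Pu.var (v := encW w) (by simp [hw]))
      (Pu.var (v := encL (tw.map encW)) (by simp [hti]))).ev ?_ |>.mono (by omega) fun _ _ h => h
    exact ⟨w :: tw, rfl, h1.update (fun v hv => absurd hv (hn.2 v)) (h1.nodup.cons hn.1)
      (by simp), frame_update w _ h2⟩
  · obtain ⟨hm, v, hv, hg⟩ : w ∈ tw ∧ ∃ v, δ' (tabKey w i) = .cons (.num v) (.num 0) ∧
        IsGreatest {v | S w v} v := by
      rcases h1.entry w with h | h
      · exact absurd h.2.1 e
      · exact h
    refine (Ev.ifLt (c := 11) (Pu.fst Pu.v0) (Pu.var (v := .num x) (by simp [hx]))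
      (fun e => ?_) (fun e => ?_)).mono (by omega) fun _ _ h => h
    · simp only [hv, Dat.fst, Dat.toNat] at e
      refine (Ev.lett (c := 3) (Ev.put (Q := fun _ δ'' => δ'' = Function.update δ' (tabKey w i)
        (.cons (.num x) (.num 0))) Pu.v1 (Pu.pair (Pu.var (by simp [hx])) (Pu.num 0)) rfl)
        fun _ _ δ'' h => ?_).mono (by omega) fun _ _ h => h
      subst h
      refine (Pu.var (v := encL (tw.map encW)) (by simp [hti])).ev ?_ |>.mono (by omega)
        fun _ _ h => h
      exact ⟨tw, rfl, h1.update (fun v' hv' => (hg.2 hv').trans e.le) h1.nodup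
        (by simp only [iff_or_self, forall_eq]; exact hm), frame_update w _ h2⟩
    · simp only [hv, Dat.fst, Dat.toNat, not_lt] at e
      refine (Pu.var (v := encL (tw.map encW)) (by simp [hti])).ev ?_ |>.mono (by omega)
        fun _ _ h => h
      refine ⟨tw, rfl, h1.congr (fun _ _ h => Or.inl h) fun w' v' h => ?_, h2⟩
      rcases h with h | ⟨rfl, rfl⟩
      · exact ⟨v', le_rfl, h⟩
      · exact ⟨v, e, hg.1⟩

theorem Ev.tableLoop {α : Type*} {enc : α → Dat} {l e : T} {f : ℕ → ℕ → T} {xs : List α}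
    {i c ca cb : ℕ} {S : Word (Fin n) → ℕ → Prop} (C : α → Word (Fin n) → ℕ → Prop)
    (hl : Pu I L l (encL (xs.map enc)) ca) (hi : Ev I L δ e cb (TabPost δ₀ i S))
    (hstep : ∀ a ∈ xs, ∀ S' xi ai v δ', TabPost δ₀ i S' v δ' →
      Ev I ((xi, enc a) :: (ai, v) :: L) δ' (f xi ai) c
        (TabPost δ₀ i fun w v => S' w v ∨ C a w v)) :
    Ev I L δ (loopE l e f) (ca + cb + 1 + xs.length * (c + 1))
      (TabPost δ₀ i fun w v => S w v ∨ ∃ a ∈ xs, C a w v) := by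
  have := Ev.loop (f := f) hl (steps_encL _) hi (fun r v δ' => ∃ us ys, xs = us ++ ys ∧
    r = ys.map enc ∧ TabPost δ₀ i (fun w v => S w v ∨ ∃ a ∈ us, C a w v) v δ')
    (fun v δ' h => ⟨[], xs, rfl, rfl, h.congr (by simp)⟩) (c := c)
    (Q := TabPost δ₀ i fun w v => S w v ∨ ∃ a ∈ xs, C a w v) ?_ ?_
  · simpa using this
  · rintro x r acc δ' xi ai ⟨us, ys, h1, h2, h3⟩
    cases ys with
    | nil => simp at h2
    | cons a ys =>
      simp only [List.map_cons, List.cons.injEq] at h2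
      obtain ⟨rfl, rfl⟩ := h2
      refine (hstep a (by simp [h1]) _ xi ai acc δ' h3).mono le_rfl fun v δ'' h => ?_
      refine ⟨us ++ [a], ys, by simp [h1], rfl, h.congr fun w v => ?_⟩
      simp only [List.mem_append, List.mem_singleton, or_assoc, or_and_right, exists_or,
        exists_eq_left]
  · rintro v δ' ⟨us, ys, h1, h2, h3⟩
    obtain rfl : ys = [] := by simpa using h2.symm
    rw [List.append_nil] at h1
    rwa [h1]

end tables

/-! #### The tables of the nodes -/

section nodes

variable {n : ℕ} {I : ℕ → ℕ → ℕ} {L : List (ℕ × Dat)} {δ δ' : Dict} {G : SimpleGraph (Fin n)}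

/-- The single zero serves as the empty word, as its value and as the empty list of words. -/
theorem Ev.leafNode {zi ii i : ℕ} (hz : (zi, .num 0) ∈ L) (hi : (ii, .num i) ∈ L)
    (hf : ∀ w : Word (Fin n), δ (tabKey w i) = .num 0) :
    Ev I L δ (insertV zi zi ii zi) 40 (TabPost δ i (Der G NiceTree.leaf)) :=
  (Ev.insert (w := []) (TabPost.empty hf) hz hz hi hz).mono le_rfl fun v δ' h =>
    h.congr fun w v => ⟨fun h => by
      obtain ⟨rfl, rfl⟩ := h.resolve_left id
      exact .leaf, fun h => by cases h; simp⟩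

/-- The value of `w` in the table `i` of `δ`. -/
theorem IsTable.best {i : ℕ} {tw : List (Word (Fin n))} {S : Word (Fin n) → ℕ → Prop}
    (h : IsTable δ i tw S) {w : Word (Fin n)} (hw : w ∈ tw) :
    ∃ v, δ (tabKey w i) = .cons (.num v) (.num 0) ∧ IsGreatest {v | S w v} v :=
  ((h.entry w).resolve_left fun h => h.1 hw).2

theorem IsTable.mem {i v : ℕ} {tw : List (Word (Fin n))} {S : Word (Fin n) → ℕ → Prop}
    (h : IsTable δ i tw S) {w : Word (Fin n)} (hw : S w v) : w ∈ tw := by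
  rcases h.entry w with h | h
  · exact absurd hw (h.2.2 v)
  · exact h.1

def introNode (x j tw i : ℕ) : T :=
  loopE (varE tw) (numE 0) fun σ acc => letE (getE (pairE (varE σ) (varE j))) fun e =>
    letE (fstE (varE e)) fun s => loopE (introV x σ) (varE acc) fun τ acc' => insertV τ s i acc'

/-- The words that can be derived from `σ` do not depend on its value, which is handed on unchanged;
so only the best value of each `σ` matters. -/
theorem Ev.introNode {xi ji ti ii i j ℓ : ℕ} {x : Fin n} {tw : List (Word (Fin n))}
    {t : NiceTree (Fin n)} (hx : (xi, encO (some x)) ∈ L) (hj : (ji, .num j) ∈ L)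
    (ht : (ti, encL (tw.map encW)) ∈ L) (hi : (ii, .num i) ∈ L)
    (hf : ∀ w : Word (Fin n), δ (tabKey w i) = .num 0) (hij : j ≠ i)
    (htab : IsTable δ j tw (Der G t)) (hℓ : ∀ σ ∈ tw, σ.length ≤ ℓ) :
    Ev I L δ (introNode xi ji ti ii) (3 + tw.length * (1300 * (ℓ + 1) ^ 3))
      (TabPost δ i (Der G (.introduce x t))) := by
  refine (Ev.tableLoop (c := 1300 * (ℓ + 1) ^ 3 - 1)
    (fun σ τ v => δ (tabKey σ j) = .cons (.num v) (.num 0) ∧ τ ∈ Word.intro x σ)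
    (Pu.var ht) ((Pu.num 0).ev (TabPost.empty hf)) fun σ hσ S σi ai va δ₁ hS => ?_).mono ?_ ?_
  · obtain ⟨s, hs, -⟩ := htab.best hσ
    -- Writing table `i` leaves table `j` intact, so the child can be read while the new table
    -- grows.
    have hs₁ : δ₁ (.cons (encW σ) (.num j)) = .cons (.num s) (.num 0) := by
      obtain ⟨_, -, -, hfr⟩ := hS
      exact (hfr _ fun w e => hij (tabKey_inj (w := σ) e).2).trans hs
    refine (Ev.lett (c := 2 + (1000 * (ℓ + 1) ^ 3 + 2 + 4 * (ℓ + 1) * (ℓ + 1) * 41) + 1)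
      (Ev.get (Q := fun v δ' => v = .cons (.num s) (.num 0) ∧ δ' = δ₁)
        (Pu.pair Pu.v0 (Pu.var (v := .num j) (by simp [hj]))) ⟨hs₁, rfl⟩) fun e v δ₂ h => ?_).mono
        ?_ fun _ _ h => h
    · obtain ⟨rfl, rfl⟩ := h
      refine Ev.letPu (Pu.fst Pu.v0) fun si => ?_
      have hlen := length_introLoop x σ
      have hσl := hℓ σ hσ
      refine ((Ev.tableLoop (c := 40) (fun τ w v => w = τ ∧ v = s) (Pu.intro (v := x) (s := σ)
        (by simp [hx]) (by simp)) ((Pu.var (v := va) (by simp)).ev hS)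
        fun τ hτ S' τi ai' v' δ₃ hS' => Ev.insert hS' (by simp) (by simp [Dat.fst]) (by simp [hi])
          (by simp)).mono ?_ fun v δ₄ h => h.congr fun w v => ?_)
      · have h1 : (introLoop x σ).length ≤ 4 * (ℓ + 1) * (ℓ + 1) := hlen.trans (by gcongr)
        have h2 : (σ.length + 1) ^ 3 ≤ (ℓ + 1) ^ 3 := by gcongr
        omega
      · simp only [(introLoop_perm x σ).mem_iff, hs, Dat.cons.injEq, Dat.num.injEq, and_true]
        constructor
        · rintro (h | ⟨τ, h1, rfl, rfl⟩)
          · exact Or.inl h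
          · exact Or.inr ⟨rfl, h1⟩
        · rintro (h | ⟨rfl, h1⟩)
          · exact Or.inl h
          · exact Or.inr ⟨w, h1, rfl, rfl⟩
    · have : 1 ≤ (ℓ + 1) ^ 3 := Nat.one_le_pow _ _ (by omega)
      have : 4 * (ℓ + 1) * (ℓ + 1) * 41 ≤ 164 * (ℓ + 1) ^ 3 := by
        nlinarith [Nat.zero_le ((ℓ + 1) * (ℓ + 1) * ℓ)]
      omega
  · have : 1 ≤ (ℓ + 1) ^ 3 := Nat.one_le_pow _ _ (by omega)
    rw [Nat.sub_add_cancel (by omega)]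
  · rintro v δ₁ ⟨tw', h1, h2, h3⟩
    refine ⟨tw', h1, h2.congr ?_ ?_, h3⟩
    · rintro τ v (h | ⟨σ, hσ, h4, h5⟩)
      · exact h.elim
      obtain ⟨s, hs, hg⟩ := htab.best hσ
      rw [h4] at hs
      simp only [Dat.cons.injEq, Dat.num.injEq, and_true] at hs
      subst hs
      exact .introduce x hg.1 h5
    · rintro τ v (_ | ⟨_, hd, hτ⟩)
      rename_i σ
      obtain ⟨s, hs, hg⟩ := htab.best (htab.mem hd)
      exact ⟨s, hg.2 hd, Or.inr ⟨σ, htab.mem hd, hs, hτ⟩⟩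

end nodes

end TreeLang

namespace TreeLang

open Word NiceTree

section nodes

variable {n : ℕ} {I : ℕ → ℕ → ℕ} {L : List (ℕ × Dat)} {δ δ' : Dict} {G : SimpleGraph (Fin n)}

/-- The dictionary holds the adjacency matrix of `G`. -/
def HasAdj (G : SimpleGraph (Fin n)) (δ : Dict) : Prop :=
  ∀ u v, δ (adjKey u v) = .num 1 ↔ G.Adj u v

/-- Whether some letter of `σ` meets `x` without being a neighbour, and the gain of forgetting
`x`. -/
def gainV (x σ cap : ℕ) : T :=
  loopE (varE σ) (pairE (numE 0) (numE 0)) fun a acc => ifEqE (varE a) (numE 1) (varE acc)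
    (ifEqE (varE a) (varE x) (varE acc) (letE (meetsV x a σ) fun m =>
      ifEqE (varE m) (numE 1) (letE (getE (pairE (varE x) (varE a))) fun e =>
        ifEqE (varE e) (numE 1)
          (pairE (fstE (varE acc)) (addE (sndE (varE acc)) (numE 1) (varE cap)))
          (pairE (numE 1) (sndE (varE acc)))) (varE acc)))

/-- A flag records whether some letter meets `x` without being a neighbour. Once it is set, the word
is rejected, and nothing is claimed about the counter any more. -/
theorem Ev.gain {xi si ci M : ℕ} {x : Fin n} {σ : Word (Fin n)} (hx : (xi, encO (some x)) ∈ L)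
    (hσ : (si, encW σ) ∈ L) (hc : (ci, .num M) ∈ L) (hδ : HasAdj G δ) :
    Ev I L δ (gainV xi si ci) (100 * (σ.length + 1) * (σ.length + 1))
      fun v δ' => δ' = δ ∧ ∃ b c, v = .cons (encB b) (.num c) ∧
        (b = false ↔ ∀ y, y ≠ x → some y ∈ σ → meets x y σ = true → G.Adj x y) ∧
        (b = false → c = min (Word.gain x σ) M) := by
  let hit : Option (Fin n) → Bool := fun a => a.any fun y => y ≠ x && meets x y σ
  let R : Word (Fin n) → Dat → Prop := fun u v => ∃ b c, v = .cons (encB b) (.num c) ∧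
    (b = false ↔ ∀ y, y ≠ x → some y ∈ u → meets x y σ = true → G.Adj x y) ∧
    (b = false → c = min (u.countP hit) M)
  have key : ∀ (a : Option (Fin n)) (u : Word (Fin n)) (acc : Dat) (xi' ai : ℕ), R u acc →
      Ev I ((xi', encO a) :: (ai, acc) :: L) δ (ifEqE (varE xi') (numE 1) (varE ai)
        (ifEqE (varE xi') (varE xi) (varE ai) (letE (meetsV xi xi' si) fun m =>
          ifEqE (varE m) (numE 1) (letE (getE (pairE (varE xi) (varE xi'))) fun e =>
          ifEqE (varE e) (numE 1)
            (pairE (fstE (varE ai)) (addE (sndE (varE ai)) (numE 1) (varE ci)))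
            (pairE (numE 1) (sndE (varE ai)))) (varE ai)))) (80 * σ.length + 70)
        fun v δ' => δ' = δ ∧ R (u ++ [a]) v := by
    rintro a u acc xi' ai ⟨b, c, rfl, hb, hc'⟩
    have skip : (∀ y, a = some y → y = x ∨ meets x y σ = false) → R (u ++ [a])
        (.cons (encB b) (.num c)) := fun h => by
      refine ⟨b, c, rfl, ?_, fun hf => ?_⟩
      · rw [hb]
        refine ⟨fun h' y hy hm hxy => ?_, fun h' y hy hm => h' y hy (by simp [hm])⟩
        rcases List.mem_append.1 hm with hm | hm
        · exact h' y hy hm hxy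
        · rcases h y ((List.mem_singleton.1 hm).symm) with h | h
          · exact absurd h hy
          · rw [h] at hxy; simp at hxy
      · rw [List.countP_append]
        have : hit a = false := by
          cases a with
          | none => rfl
          | some y => rcases h y rfl with h | h <;> simp [hit, h]
        rw [hc' hf]; simp [this]
    refine (Ev.ifEq (c := 80 * σ.length + 60) (Pu.var (v := encO a) (by simp)) (Pu.num 1) (fun e => ?_)
      (fun e => ?_)).mono (by omega) fun _ _ h => h
    · obtain rfl := encO_eq_star.1 e
      exact (Pu.v1.ev ⟨rfl, skip (by simp)⟩).mono (by omega) fun _ _ h => h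
    · rcases a with _ | y
      · exact absurd rfl e
      refine (Ev.ifEq (c := 80 * σ.length + 57) (Pu.var (v := encO (some y)) (by simp)) (Pu.var (v := encO (some x))
        (by simp [hx])) (fun e' => ?_) (fun e' => ?_)).mono (by omega) fun _ _ h => h
      · have : y = x := by simpa using encO_injective e'
        exact (Pu.v1.ev ⟨rfl, skip (by simp [this])⟩).mono (by omega) fun _ _ h => h
      have hyx : y ≠ x := fun h => e' (by rw [h])
      refine (Ev.letPu (c := 30) (Pu.meets (u := x) (v := y) (s := σ) (by simp [hx]) (by simp)
        (by simp [hσ])) fun m => ?_).mono (by omega) fun _ _ h => h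
      refine (Ev.ifEq (c := 26) Pu.v0 (Pu.num 1) (fun em => ?_) (fun em => ?_)).mono (by omega)
        fun _ _ h => h
      · rw [encB_eq_one] at em
        have hhit : hit (some y) = true := by simp [hit, hyx, em]
        refine (Ev.lett (c := 16) (Ev.get (Q := fun v δ' => v = δ (adjKey x y) ∧ δ' = δ)
          (va := adjKey x y) (Pu.pair (Pu.var (v := encO (some x)) (by simp [hx]))
          (Pu.var (v := encO (some y)) (by simp))) ⟨rfl, rfl⟩)
          fun ei v δ' h => ?_).mono (by omega) fun _ _ h => h
        obtain ⟨rfl, rfl⟩ := h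
        refine (Ev.ifEq (c := 10) Pu.v0 (Pu.num 1) (fun ee => ?_) (fun ee => ?_)).mono (by omega)
          fun _ _ h => h
        · refine (Pu.pair (Pu.fst Pu.v3) (Pu.add (Pu.snd Pu.v3) (Pu.num 1)
            (Pu.var (v := .num M) (by simp [hc])))).ev ⟨rfl, b, _, rfl, ?_, fun hf => ?_⟩ |>.mono (by omega)
            fun _ _ h => h
          · rw [hb]
            refine ⟨fun h' z hz hm hxz => ?_, fun h' z hz hm => h' z hz (by simp [hm])⟩
            rcases List.mem_append.1 hm with hm | hm
            · exact h' z hz hm hxz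
            · obtain rfl : z = y := by simpa using hm
              exact (hδ _ _).1 ee
          · simp only [Dat.fst, Dat.snd, Dat.toNat, List.countP_append, List.countP_singleton,
              hhit, if_true]
            have := hc' hf
            omega
        · refine (Pu.pair (Pu.num 1) (Pu.snd Pu.v3)).ev ⟨rfl, true, c, rfl, ?_, by simp⟩ |>.mono (by omega)
            fun _ _ h => h
          · simp only [Bool.true_eq_false, false_iff, not_forall]
            exact ⟨y, hyx, by simp, em, fun h => ee ((hδ _ _).2 h)⟩
      · exact (Pu.v2.ev ⟨rfl, skip (by
          rintro z ⟨⟩; right; simpa [encB_eq_one] using em)⟩).mono (by omega) fun _ _ h => h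
  refine (Ev.loop (c := 80 * σ.length + 70) (xs := σ.map encO) (Pu.var hσ) (steps_encL _)
    ((Pu.pair (Pu.num 0) (Pu.num 0)) δ) (fun r v δ' => δ' = δ ∧ ∃ u w, σ = u ++ w ∧
      r = w.map encO ∧ R u v) ?_ ?_ ?_).mono ?_ fun _ _ h => h
  · rintro v δ' ⟨rfl, rfl⟩
    exact ⟨rfl, [], σ, rfl, rfl, false, 0, rfl, by simp, by simp⟩
  · rintro d r acc δ' xi' ai ⟨rfl, u, w, h1, h2, h3⟩
    cases w with
    | nil => simp at h2
    | cons a w =>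
      simp only [List.map_cons, List.cons.injEq] at h2
      obtain ⟨rfl, rfl⟩ := h2
      exact (key a u acc xi' ai h3).mono le_rfl fun v δ'' h =>
        ⟨h.1, u ++ [a], w, by simp [h1], rfl, h.2⟩
  · rintro v δ' ⟨rfl, u, w, h1, h2, b, c, h3, h4, h5⟩
    obtain rfl : w = [] := by simpa using h2.symm
    rw [List.append_nil] at h1
    subst h1
    exact ⟨rfl, b, c, h3, h4, h5⟩
  · rw [List.length_map]
    nlinarith

def forgetNode (x j tw i cap : ℕ) : T :=
  loopE (varE tw) (numE 0) fun σ acc => letE (getE (pairE (varE σ) (varE j))) fun e =>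
    letE (fstE (varE e)) fun s => letE (gainV x σ cap) fun g =>
      ifEqE (fstE (varE g)) (numE 1) (varE acc)
        (letE (addE (varE s) (sndE (varE g)) (varE cap)) fun v => letE (fgV x σ) fun τ =>
          insertV τ v i acc)

/-- Adding the gain preserves the order of values, so again the best value of each word suffices.
Different words may become equal, and the table keeps the larger value. -/
theorem Ev.forgetNode {xi ji ti ii ci i j ℓ M : ℕ} {x : Fin n} {tw : List (Word (Fin n))}
    {t : NiceTree (Fin n)} (hx : (xi, encO (some x)) ∈ L) (hj : (ji, .num j) ∈ L)
    (ht : (ti, encL (tw.map encW)) ∈ L) (hi : (ii, .num i) ∈ L) (hc : (ci, .num M) ∈ L)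
    (hδ : HasAdj G δ) (hM : ∀ τ v, Der G (.forget x t) τ v → v ≤ M)
    (hf : ∀ w : Word (Fin n), δ (tabKey w i) = .num 0) (hij : j ≠ i)
    (htab : IsTable δ j tw (Der G t)) (hℓ : ∀ σ ∈ tw, σ.length ≤ ℓ) :
    Ev I L δ (forgetNode xi ji ti ii ci) (3 + tw.length * (400 * (ℓ + 1) ^ 2))
      (TabPost δ i (Der G (.forget x t))) := by
  have hpos : 1 ≤ (ℓ + 1) ^ 2 := Nat.one_le_pow _ _ (by omega)
  refine (Ev.tableLoop (c := 400 * (ℓ + 1) ^ 2 - 1)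
    (fun σ τ v => ∃ s, δ (tabKey σ j) = .cons (.num s) (.num 0) ∧
      (∀ y, y ≠ x → some y ∈ σ → meets x y σ = true → G.Adj x y) ∧ τ = Word.fg x σ ∧
      v = s + Word.gain x σ)
    (Pu.var ht) ((Pu.num 0).ev (TabPost.empty hf)) fun σ hσ S σi ai va δ₁ hS => ?_).mono ?_ ?_
  · obtain ⟨s, hs, hg⟩ := htab.best hσ
    have hs₁ : δ₁ (.cons (encW σ) (.num j)) = .cons (.num s) (.num 0) := by
      obtain ⟨_, -, -, hfr⟩ := hS
      exact (hfr _ fun w e => hij (tabKey_inj (w := σ) e).2).trans hs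
    have hδ₁ : HasAdj G δ₁ := fun u v => by
      obtain ⟨_, -, -, hfr⟩ := hS
      rw [hfr _ fun w => adjKey_ne_tabKey u v w i]
      exact hδ u v
    have hσl := hℓ σ hσ
    have hσ2 : 100 * (σ.length + 1) * (σ.length + 1) ≤ 100 * (ℓ + 1) ^ 2 := by
      rw [pow_two, ← mul_assoc]; gcongr
    have hσ1 : σ.length + 1 ≤ (ℓ + 1) ^ 2 := by nlinarith
    refine (Ev.lett (c := 320 * (ℓ + 1) ^ 2)
      (Ev.get (Q := fun v δ' => v = .cons (.num s) (.num 0) ∧ δ' = δ₁)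
        (Pu.pair Pu.v0 (Pu.var (v := .num j) (by simp [hj]))) ⟨hs₁, rfl⟩) fun e v δ₂ h => ?_).mono
        (by omega) fun _ _ h => h
    obtain ⟨rfl, rfl⟩ := h
    refine (Ev.letPu (c := 310 * (ℓ + 1) ^ 2) (Pu.fst Pu.v0) fun sj => ?_).mono (by omega)
      fun _ _ h => h
    refine (Ev.lett (c := 200 * (ℓ + 1) ^ 2) (Ev.gain (G := G) (x := x) (σ := σ) (M := M)
      (by simp [hx]) (by simp) (by simp [hc]) hδ₁) fun gi v δ₂ h => ?_).mono (by omega)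
      fun _ _ h => h
    obtain ⟨rfl, b, c, rfl, hb, hbc⟩ := h
    refine (Ev.ifEq (c := 190 * (ℓ + 1) ^ 2) (Pu.fst Pu.v0) (Pu.num 1) (fun e1 => ?_)
      (fun e1 => ?_)).mono (by omega) fun _ _ h => h
    · refine (Pu.var (v := va) (by simp)).ev (hS.congr fun w v => ?_) |>.mono (by omega)
        fun _ _ h => h
      have hb' : b = true := by simpa [Dat.fst, encB_eq_one] using e1
      refine ⟨Or.inl, ?_⟩
      rintro (h | ⟨_, _, h, _⟩)
      · exact h
      · rw [hb.2 h] at hb'; simp at hb'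
    · have hb' : b = false := by simpa [Dat.fst, encB_eq_one] using e1
      -- The sum is itself a derivable value, so the cap is not active.
      have hle : s + Word.gain x σ ≤ M := hM _ _ (.forget x hg.1 (hb.1 hb'))
      refine (Ev.letPu (c := 180 * (ℓ + 1) ^ 2) (Pu.add (Pu.var (v := .num s) (by simp [Dat.fst]))
        (Pu.snd Pu.v0) (Pu.var (v := .num M) (by simp [hc]))) fun vi => ?_).mono (by omega)
        fun _ _ h => h
      have hv : min ((Dat.num s).toNat + (Dat.cons (encB b) (.num c)).snd.toNat)
          (Dat.num M).toNat = s + Word.gain x σ := by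
        have := hbc hb'
        simp only [Dat.toNat, Dat.snd]
        omega
      rw [hv]
      refine (Ev.letPu (c := 40) (Pu.fg (v := x) (s := σ) (by simp [hx]) (by simp))
        fun τi => ?_).mono (by omega) fun _ _ h => h
      refine (Ev.insert (w := Word.fg x σ) (x := s + Word.gain x σ) hS (by simp) (by simp)
        (by simp [hi]) (by simp)).mono le_rfl fun v δ₃ h => h.congr fun w v => ?_
      simp only [hs, Dat.cons.injEq, Dat.num.injEq, and_true, exists_eq_left']
      exact or_congr_right ⟨fun h => ⟨hb.1 hb', h⟩, fun h => h.2⟩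
  · rw [Nat.sub_add_cancel (by omega)]
  · rintro v δ₁ ⟨tw', h1, h2, h3⟩
    refine ⟨tw', h1, h2.congr ?_ ?_, h3⟩
    · rintro τ v (h | ⟨σ, hσ, s, h4, h5, rfl, rfl⟩)
      · exact h.elim
      obtain ⟨s', hs, hg⟩ := htab.best hσ
      rw [h4] at hs
      simp only [Dat.cons.injEq, Dat.num.injEq, and_true] at hs
      subst hs
      exact .forget x hg.1 h5
    · rintro τ v (_ | _ | @⟨_, σ, v, _, hd, hadj⟩)
      obtain ⟨s, hs, hg⟩ := htab.best (htab.mem hd)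
      exact ⟨_, Nat.add_le_add_right (hg.2 hd) _, Or.inr ⟨σ, htab.mem hd, s, hs, hadj, rfl, rfl⟩⟩

def joinNode (tw j₁ j₂ i cap : ℕ) : T :=
  loopE (varE tw) (numE 0) fun σ acc => letE (getE (pairE (varE σ) (varE j₁))) fun e =>
    letE (fstE (varE e)) fun s => loopE (joinV σ) (varE acc) fun p acc' =>
      letE (getE (pairE (fstE (varE p)) (varE j₂))) fun e' =>
        ifEqE (varE e') (numE 0) (varE acc')
          (letE (addE (varE s) (fstE (varE e')) (varE cap)) fun v =>
            letE (fstE (sndE (varE p))) fun τ => insertV τ v i acc')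

/-- Each word of the first table is completed by its possible partners; one dictionary access tells
whether a partner is in the second table. The size of the second table does not enter the cost. -/
theorem Ev.joinNode {ji₁ ji₂ ti ii ci i j₁ j₂ ℓ q M : ℕ} {tw tw₂ : List (Word (Fin n))}
    {t₁ t₂ : NiceTree (Fin n)} (hj₁ : (ji₁, .num j₁) ∈ L) (hj₂ : (ji₂, .num j₂) ∈ L)
    (ht : (ti, encL (tw.map encW)) ∈ L) (hi : (ii, .num i) ∈ L) (hc : (ci, .num M) ∈ L)
    (hM : ∀ τ v, Der G (.join t₁ t₂) τ v → v ≤ M)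
    (hf : ∀ w : Word (Fin n), δ (tabKey w i) = .num 0) (hij₁ : j₁ ≠ i) (hij₂ : j₂ ≠ i)
    (htab₁ : IsTable δ j₁ tw (Der G t₁)) (htab₂ : IsTable δ j₂ tw₂ (Der G t₂))
    (hℓ : ∀ σ ∈ tw, σ.length ≤ ℓ) (hq : ∀ σ ∈ tw, (letters σ).length ≤ q) :
    Ev I L δ (joinNode ti ji₁ ji₂ ii ci) (3 + tw.length * (2300 * (ℓ + 1) * 3 ^ q))
      (TabPost δ i (Der G (.join t₁ t₂))) := by
  have hpos : 1 ≤ 3 ^ q := Nat.one_le_pow _ _ (by omega)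
  have hpos' : 3 ^ q ≤ (ℓ + 1) * 3 ^ q := Nat.le_mul_of_pos_left _ (by omega)
  rw [mul_assoc]
  refine (Ev.tableLoop (c := 2300 * ((ℓ + 1) * 3 ^ q) - 1)
    (fun σ τ v => ∃ s₁ s₂ σ₂, δ (tabKey σ j₁) = .cons (.num s₁) (.num 0) ∧
      δ (tabKey σ₂ j₂) = .cons (.num s₂) (.num 0) ∧ Joins σ σ₂ τ ∧ v = s₁ + s₂)
    (Pu.var ht) ((Pu.num 0).ev (TabPost.empty hf)) fun σ hσ S σi ai va δ₁ hS => ?_).mono ?_ ?_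
  · obtain ⟨s, hs, hg⟩ := htab₁.best hσ
    have hs₁ : δ₁ (.cons (encW σ) (.num j₁)) = .cons (.num s) (.num 0) := by
      obtain ⟨_, -, -, hfr⟩ := hS
      exact (hfr _ fun w e => hij₁ (tabKey_inj (w := σ) e).2).trans hs
    have hσl := hℓ σ hσ
    have hσq : 3 ^ (letters σ).length ≤ 3 ^ q := Nat.pow_le_pow_right (by omega) (hq σ hσ)
    have hjl : (joinList σ).length ≤ 3 * 3 ^ q := by
      have := length_joinList σ
      rw [pow_succ] at this
      omega
    have hjc : 2000 * (σ.length + 1) * 3 ^ (letters σ).length ≤ 2000 * ((ℓ + 1) * 3 ^ q) := by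
      rw [mul_assoc]; gcongr
    refine (Ev.lett (c := 2290 * ((ℓ + 1) * 3 ^ q))
      (Ev.get (Q := fun v δ' => v = .cons (.num s) (.num 0) ∧ δ' = δ₁)
        (Pu.pair Pu.v0 (Pu.var (v := .num j₁) (by simp [hj₁]))) ⟨hs₁, rfl⟩)
        fun e v δ₂ h => ?_).mono (by omega) fun _ _ h => h
    obtain ⟨rfl, rfl⟩ := h
    refine (Ev.letPu (c := 2280 * ((ℓ + 1) * 3 ^ q)) (Pu.fst Pu.v0) fun sj => ?_).mono (by omega)
      fun _ _ h => h
    refine ((Ev.tableLoop (c := 70) (fun p w v => ∃ s₂,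
      δ (tabKey p.1 j₂) = .cons (.num s₂) (.num 0) ∧ w = p.2.1 ∧ v = s + s₂)
      (Pu.join (s := σ) (by simp)) ((Pu.var (v := va) (by simp)).ev hS)
      fun p hp S' pi ai' v' δ₃ hS' => ?_).mono ?_ fun v δ₄ h => h.congr fun w v => ?_)
    · have hd : ∃ d, δ (tabKey p.1 j₂) = d ∧ δ₃ (.cons (encW p.1) (.num j₂)) = d := by
        obtain ⟨_, -, -, hfr⟩ := hS'
        exact ⟨_, rfl, hfr _ fun w e => hij₂ (tabKey_inj (w := p.1) e).2⟩
      obtain ⟨d, hd, hd₃⟩ := hd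
      refine (Ev.lett (c := 62) (Ev.get (Q := fun v δ' => v = d ∧ δ' = δ₃)
        (va := .cons (encW p.1) (.num j₂)) (Pu.pair (Pu.fst Pu.v0)
        (Pu.var (v := .num j₂) (by simp [hj₂]))) ⟨hd₃, rfl⟩) fun e v δ₄ h => ?_).mono (by omega)
        fun _ _ h => h
      obtain ⟨rfl, rfl⟩ := h
      refine (Ev.ifEq (c := 55) Pu.v0 (Pu.num 0) (fun e => ?_) (fun e => ?_)).mono (by omega)
        fun _ _ h => h
      · exact (Pu.v2.ev (hS'.congr fun w v => by simp [hd, e])).mono (by omega) fun _ _ h => h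
      · obtain ⟨s₂, hs₂, hg₂⟩ := ((htab₂.entry p.1).resolve_left fun h => e (hd ▸ h.2.1)).2
        obtain rfl := hd.symm.trans hs₂
        -- As for forget nodes, the sum is derivable and the cap is not active.
        have hle : s + s₂ ≤ M := hM _ _ (.join hg.1 hg₂.1
          ((mem_joinList hg.1.norm p.1 p.2.1).1 ⟨p.2.2, hp⟩))
        refine (Ev.letPu (c := 46) (Pu.add (Pu.var (v := .num s) (by simp [Dat.fst]))
          (Pu.fst Pu.v0) (Pu.var (v := .num M) (by simp [hc]))) fun vi => ?_).mono (by omega)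
          fun _ _ h => h
        have hv : min ((Dat.num s).toNat + (Dat.cons (.num s₂) (.num 0)).fst.toNat)
            (Dat.num M).toNat = s + s₂ := by
          simp only [Dat.toNat, Dat.fst]
          omega
        rw [hv]
        refine (Ev.letPu (c := 40) (Pu.fst (Pu.snd Pu.v2)) fun τi => ?_).mono (by omega)
          fun _ _ h => h
        refine (Ev.insert (w := p.2.1) (x := s + s₂) hS' (by simp [encP, Dat.fst, Dat.snd])
          (by simp) (by simp [hi]) (by simp)).mono le_rfl fun v δ₃ h => h.congr fun w v => ?_
        simp [hd]
    · nlinarith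
    · simp only [hs, Dat.cons.injEq, Dat.num.injEq, and_true]
      constructor
      · rintro (h | ⟨p, hp, s₂, h1, rfl, rfl⟩)
        · exact Or.inl h
        · exact Or.inr ⟨s, s₂, p.1, rfl, h1, (mem_joinList hg.1.norm _ _).1 ⟨p.2.2, hp⟩, rfl⟩
      · rintro (h | ⟨_, s₂, σ₂, rfl, h1, h2, rfl⟩)
        · exact Or.inl h
        · obtain ⟨b, hb⟩ := (mem_joinList hg.1.norm _ _).2 h2
          exact Or.inr ⟨_, hb, s₂, h1, rfl, rfl⟩
  · rw [Nat.sub_add_cancel (by omega)]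
  · rintro v δ₁ ⟨tw', h1, h2, h3⟩
    refine ⟨tw', h1, h2.congr ?_ ?_, h3⟩
    · rintro τ v (h | ⟨σ, hσ, s₁, s₂, σ₂, h4, h5, h6, rfl⟩)
      · exact h.elim
      obtain ⟨s', hs, hg⟩ := htab₁.best hσ
      rw [h4] at hs
      simp only [Dat.cons.injEq, Dat.num.injEq, and_true] at hs
      subst hs
      obtain ⟨s', hs, hg₂⟩ := ((htab₂.entry σ₂).resolve_left fun h => by simp [h.2.1] at h5).2
      rw [h5] at hs
      simp only [Dat.cons.injEq, Dat.num.injEq, and_true] at hs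
      subst hs
      exact .join hg.1 hg₂.1 h6
    · rintro τ v (_ | _ | _ | ⟨hd₁, hd₂, hj⟩)
      obtain ⟨s, hs, hg⟩ := htab₁.best (htab₁.mem hd₁)
      obtain ⟨s₂, hs₂, hg₂⟩ := htab₂.best (htab₂.mem hd₂)
      exact ⟨_, Nat.add_le_add (hg.2 hd₁) (hg₂.2 hd₂),
        Or.inr ⟨_, htab₁.mem hd₁, s, s₂, _, hs, hs₂, hj, rfl⟩⟩

end nodes

end TreeLang

/-! ### Postorder codes as programs of a stack machine -/

namespace NiceTree

variable {n : ℕ} {G : SimpleGraph (Fin n)}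

/-- From the stack `ts`, the instructions that are left lead to the stack that consists of `t`. -/
inductive Reach (t : NiceTree (Fin n)) : List (NiceTree (Fin n)) → List (ℕ × ℕ) → Prop
  | done : Reach t [t] []
  | leaf {ts r} : Reach t (leaf :: ts) r → Reach t ts ((0, 0) :: r)
  | introduce {x s ts r} : Reach t (introduce x s :: ts) r → Reach t (s :: ts) ((1, (x : ℕ)) :: r)
  | forget {x s ts r} : Reach t (forget x s :: ts) r → Reach t (s :: ts) ((2, (x : ℕ)) :: r)
  | join {s₁ s₂ ts r} : Reach t (join s₁ s₂ :: ts) r → Reach t (s₂ :: s₁ :: ts) ((3, 0) :: r)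

/-- Running the postorder code of `s` has the net effect of pushing `s` onto the stack. -/
theorem Reach.code {t : NiceTree (Fin n)} (s : NiceTree (Fin n)) :
    ∀ {ts : List (NiceTree (Fin n))} {r : List (ℕ × ℕ)}, Reach t (s :: ts) r →
      Reach t ts (s.code ++ r) := by
  induction s with
  | leaf => exact fun h => .leaf h
  | introduce x s ih =>
    intro ts r h
    rw [NiceTree.code, List.append_assoc]
    exact ih (.introduce h)
  | forget x s ih =>
    intro ts r h
    rw [NiceTree.code, List.append_assoc]
    exact ih (.forget h)
  | join s₁ s₂ ih₁ ih₂ =>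
    intro ts r h
    rw [NiceTree.code, List.append_assoc, List.append_assoc]
    exact ih₁ (ih₂ (.join h))

/-- The properties of the subtrees that bound the cost of the algorithm. -/
structure Fits (G : SimpleGraph (Fin n)) (b : ℕ) (path : Prop) (s : NiceTree (Fin n)) : Prop where
  separated : s.Separated G
  card_le : s.maxBagCard ≤ b
  isPath : path → s.IsPath

/-- Whatever is on the stack ends up as a subtree of `t` and so inherits separation, small bags and
the absence of joins. The induction runs backwards from the final stack. -/
theorem Reach.fits {t : NiceTree (Fin n)} {b : ℕ} {path : Prop} (ht : Fits G b path t)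
    {ts : List (NiceTree (Fin n))} {r : List (ℕ × ℕ)} (h : Reach t ts r) :
    ∀ s ∈ ts, Fits G b path s := by
  induction h with
  | done => simpa using ht
  | leaf _ ih => exact fun s hs => ih s (by simp [hs])
  | introduce _ ih =>
    intro s hs
    rcases List.mem_cons.1 hs with rfl | hs
    · obtain ⟨h1, h2, h3⟩ := ih _ List.mem_cons_self
      exact ⟨h1.2.2, (le_max_right _ _).trans h2, h3⟩
    · exact ih s (by simp [hs])
  | forget _ ih =>
    intro s hs
    rcases List.mem_cons.1 hs with rfl | hs
    · obtain ⟨h1, h2, h3⟩ := ih _ List.mem_cons_self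
      exact ⟨h1.2.2, (le_max_right _ _).trans h2, h3⟩
    · exact ih s (by simp [hs])
  | join _ ih =>
    intro s hs
    have hm := ih _ List.mem_cons_self
    obtain ⟨h1, h2, h3⟩ := hm
    simp only [maxBagCard, max_le_iff] at h2
    rcases List.mem_cons.1 hs with rfl | hs
    · exact ⟨h1.2.2.2, h2.2.2, fun hp => (h3 hp).elim⟩
    rcases List.mem_cons.1 hs with rfl | hs
    · exact ⟨h1.2.2.1, h2.2.1, fun hp => (h3 hp).elim⟩
    · exact ih s (by simp [hs])

theorem card_bag_le (s : NiceTree (Fin n)) : s.bag.card ≤ s.maxBagCard := by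
  cases s with
  | leaf => simp [bag, maxBagCard]
  | introduce x s => exact le_max_left _ _
  | forget x s => exact le_max_left _ _
  | join s₁ s₂ => exact le_max_left _ _

theorem length_code (s : NiceTree (Fin n)) : s.code.length = s.numNodes := by
  induction s with
  | leaf => rfl
  | introduce x s ih => simp [code, numNodes, ih]
  | forget x s ih => simp [code, numNodes, ih]
  | join s₁ s₂ ih₁ ih₂ => simp [code, numNodes, ih₁, ih₂, add_assoc]

end NiceTree

/-! ### One step of the machine -/

namespace TreeLang

open Word NiceTree

section machine

variable {n : ℕ} {I : ℕ → ℕ → ℕ} {L : List (ℕ × Dat)} {δ δ' : Dict} {G : SimpleGraph (Fin n)}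
  {b : ℕ} {path : Prop}

/-- Every word in the table is derived, hence a word of the bag, and no word is listed twice. -/
theorem IsTable.length_le {i : ℕ} {tw : List (Word (Fin n))} {s : NiceTree (Fin n)}
    (h : IsTable δ i tw (Der G s)) (hs : Fits G b path s) :
    tw.length ≤ (bagWords s.bag).length := by
  classical
  refine (List.subperm_of_subset h.nodup fun w hw => ?_).length_le
  obtain ⟨v, -, hv⟩ := h.best hw
  exact hv.1.mem_bagWords hs.separated

theorem IsTable.length_letters_le {i : ℕ} {tw : List (Word (Fin n))} {s : NiceTree (Fin n)}
    (h : IsTable δ i tw (Der G s)) (hs : Fits G b path s) {w : Word (Fin n)} (hw : w ∈ tw) :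
    (letters w).length ≤ 2 * b := by
  obtain ⟨v, -, hv⟩ := h.best hw
  rw [hv.1.length_letters hs.separated]
  exact Nat.mul_le_mul_left 2 ((card_bag_le s).trans hs.card_le)

theorem IsTable.length_word_le {i : ℕ} {tw : List (Word (Fin n))} {s : NiceTree (Fin n)}
    (h : IsTable δ i tw (Der G s)) (hs : Fits G b path s) {w : Word (Fin n)} (hw : w ∈ tw) :
    w.length ≤ 6 * b + 2 := by
  have h1 := h.length_letters_le hs hw
  obtain ⟨v, -, hv⟩ := h.best hw
  have := hv.1.norm.length_le
  omega

/-- `e` describes the table of the root of `s`. -/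
def Entry (G : SimpleGraph (Fin n)) (δ : Dict) (c : ℕ) (s : NiceTree (Fin n)) (e : Dat) : Prop :=
  ∃ j tw, e = .cons (.num j) (encL (tw.map encW)) ∧ j < c ∧ IsTable δ j tw (Der G s)

/-- The state `acc` of the machine stands for the stack `ts`, and `r` instructions are left. -/
def MachineInv (G : SimpleGraph (Fin n)) (N r : ℕ) (ts : List (NiceTree (Fin n))) (acc : Dat)
    (δ : Dict) : Prop :=
  ∃ c es, acc = .cons (.num c) (encL es) ∧ c + r = N ∧ HasAdj G δ ∧
    (∀ (w : Word (Fin n)) j, c ≤ j → δ (tabKey w j) = .num 0) ∧ List.Forall₂ (Entry G δ c) ts es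

def pushV (c tw st N : ℕ) : T :=
  pairE (addE (varE c) (numE 1) (varE N)) (pairE (pairE (varE c) (varE tw)) (varE st))

theorem Ev.push {ci ti si Ni c N r : ℕ} {vt : Dat} {es : List Dat} {s : NiceTree (Fin n)}
    {ts : List (NiceTree (Fin n))} (hc : (ci, .num c) ∈ L) (ht : (ti, vt) ∈ L)
    (hs : (si, encL es) ∈ L) (hN : (Ni, .num N) ∈ L) (hr : c + (r + 1) = N) (hδ : HasAdj G δ)
    (hf : ∀ (w : Word (Fin n)) j, c ≤ j → δ (tabKey w j) = .num 0)
    (hes : List.Forall₂ (Entry G δ c) ts es) (hT : TabPost δ c (Der G s) vt δ') :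
    Ev I L δ' (pushV ci ti si Ni) 20 (MachineInv G N r (s :: ts)) := by
  obtain ⟨tw, rfl, h1, h2⟩ := hT
  refine (Pu.pair (Pu.add (Pu.var hc) (Pu.num 1) (Pu.var hN)) (Pu.pair (Pu.pair (Pu.var hc)
    (Pu.var ht)) (Pu.var hs))).ev ⟨c + 1, .cons (.num c) (encL (tw.map encW)) :: es, ?_, by omega,
      fun u v => ?_, fun w j hj => ?_, .cons ⟨c, tw, rfl, by omega, h1⟩ ?_⟩ |>.mono (by omega)
      fun _ _ h => h
  -- The counter of tables never exceeds the number of nodes, so the cap is not active.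
  · have : min (c + 1) N = c + 1 := by omega
    simp only [Dat.toNat, this, encL]
  · rw [h2 _ fun w => adjKey_ne_tabKey u v w c]
    exact hδ u v
  · rw [h2 _ fun w' e => absurd (tabKey_inj e).2 (by omega)]
    exact hf w j (by omega)
  · refine hes.imp fun s' e h => ?_
    obtain ⟨j, tw', h3, h4, h5⟩ := h
    exact ⟨j, tw', h3, by omega, h5.frame h2 (by omega)⟩

def stepV (d acc N cap : ℕ) : T :=
  letE (fstE (varE d)) fun k => letE (sndE (varE d)) fun x => letE (fstE (varE acc)) fun c =>
  letE (sndE (varE acc)) fun st => letE (numE 0) fun z => letE (fstE (fstE (varE st))) fun j =>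
  letE (sndE (fstE (varE st))) fun tw => letE (sndE (varE st)) fun st' =>
  ifEqE (varE k) (numE 2) (letE (insertV z z c z) fun t => pushV c t st N)
    (ifEqE (varE k) (numE 3) (letE (introNode x j tw c) fun t => pushV c t st' N)
      (ifEqE (varE k) (numE 4) (letE (forgetNode x j tw c cap) fun t => pushV c t st' N)
        (letE (fstE (fstE (varE st'))) fun j₁ => letE (sndE (fstE (varE st'))) fun tw₁ =>
          letE (sndE (varE st')) fun st'' => letE (joinNode tw₁ j₁ j c cap) fun t =>
            pushV c t st'' N)))

def encI (p : ℕ × ℕ) : Dat := .cons (.num (p.1 + 2)) (.num (p.2 + 2))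

/-- The cost is the size `S` of a table times the work per word. The factor `J` pays for the
partners at join nodes and may be one for a path. Kinds of nodes are compared with numbers larger by
two because of the shift of all inputs. -/
theorem Ev.step {di ai Ni ci N S J r : ℕ} {d : ℕ × ℕ} {acc : Dat} {t : NiceTree (Fin n)}
    {ts : List (NiceTree (Fin n))} {rest : List (ℕ × ℕ)} (hd : (di, encI d) ∈ L)
    (ha : (ai, acc) ∈ L) (hN : (Ni, .num N) ∈ L) (hc : (ci, .num (2 * G.edgeSet.ncard)) ∈ L)
    (ht : Fits G b path t) (hS : ∀ B : Finset (Fin n), B.card ≤ b → (bagWords B).length ≤ S)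
    (hJ : path ∨ 3 ^ (2 * b) ≤ J) (hJ1 : 1 ≤ J)
    (hr : Reach t ts (d :: rest)) (hI : MachineInv G N (r + 1) ts acc δ) :
    Ev I L δ (stepV di ai Ni ci) (S * (2300 * (6 * b + 3) ^ 3 * J) + 150)
      fun v δ' => ∃ ts', Reach t ts' rest ∧ MachineInv G N r ts' v δ' := by
  obtain ⟨c, es, rfl, hcr, hδ, hf, hes⟩ := hI
  have hP : ∀ s ts', Reach t (s :: ts') rest → Fits G b path s := fun s ts' h =>
    h.fits ht s List.mem_cons_self
  have hcap : ∀ s, Fits G b path s → ∀ τ v, Der G s τ v → v ≤ 2 * G.edgeSet.ncard :=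
    fun s hs τ v h => val_le (h.wit hs.separated)
  have hb1 : 1 ≤ 6 * b + 3 := by omega
  set K := S * (2300 * (6 * b + 3) ^ 3 * J) with hK
  refine (Ev.letPu (Pu.fst (Pu.var hd)) fun ki => Ev.letPu
    (Pu.snd ((Pu.var hd).weak _)) fun xi => Ev.letPu
    (Pu.fst (((Pu.var ha).weak _).weak _)) fun ci' => Ev.letPu (Pu.snd ((((Pu.var ha).weak _).weak _).weak _)) fun si =>
    Ev.letPu (Pu.num 0) fun zi => Ev.letPu (Pu.fst (Pu.fst Pu.v1))
    fun ji => Ev.letPu (Pu.snd (Pu.fst Pu.v2)) fun ti => Ev.letPu (c := K + 95)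
    (Pu.snd Pu.v3) fun si' => ?_).mono (by omega) fun _ _ h => h
  cases hr with
  | leaf hr =>
    refine (Ev.ifEq (c := 80) (Pu.var (v := .num 2) (by simp [encI, Dat.fst])) (Pu.num 2)
      (fun _ => ?_) (fun e => absurd rfl e)).mono (by omega) fun _ _ h => h
    refine (Ev.lett (Ev.leafNode (G := G) (i := c) (by simp) (by simp [Dat.fst])
      fun w => hf w c le_rfl) fun tv v δ' hT => ?_).mono (le_refl (40 + 39 + 1)) fun _ _ h => h
    exact (Ev.push (by simp [Dat.fst]) (by simp) (by simp [Dat.snd]) (by simp [hN]) hcr hδ hf hes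
      hT).mono (by omega) fun v δ'' h => ⟨_, hr, h⟩
  | @introduce x s ts _ hr =>
    obtain ⟨e, es, ⟨j, tw, rfl, hj, htab⟩, hes', rfl⟩ := List.forall₂_cons_left_iff.1 hes
    have hs : Fits G b path s := Reach.fits ht (.introduce hr) s List.mem_cons_self
    have hlen := (htab.length_le hs).trans (hS _ ((card_bag_le s).trans hs.card_le))
    refine (Ev.ifEq (c := K + 40) (Pu.var (v := .num 3) (by simp [encI, Dat.fst])) (Pu.num 2)
      (fun h => by simp at h) (fun _ => ?_)).mono (by omega) fun _ _ h => h
    refine (Ev.ifEq (c := K + 30) (Pu.var (v := .num 3) (by simp [encI, Dat.fst])) (Pu.num 3)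
      (fun _ => ?_) (fun h => by simp at h)).mono (by omega) fun _ _ h => h
    refine (Ev.lett (Ev.introNode (G := G) (i := c) (j := j) (ℓ := 6 * b + 2) (x := x) (tw := tw)
      (t := s) (by simp [encI, encO, Dat.snd]) (by simp [encL, Dat.fst, Dat.snd])
      (by simp [encL, Dat.fst, Dat.snd]) (by simp [Dat.fst]) (fun w => hf w c le_rfl) (by omega)
      htab fun σ hσ => htab.length_word_le hs hσ) fun tv v δ' hT => (Ev.push (by simp [Dat.fst])
      (by simp) (by simp [encL, Dat.snd]) (by simp [hN]) hcr hδ hf hes' hT).mono le_rfl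
      fun v δ'' h => ⟨_, hr, h⟩).mono ?_ fun _ _ h => h
    have : tw.length * (1300 * (6 * b + 2 + 1) ^ 3) ≤ K := by
      refine Nat.mul_le_mul hlen ?_
      rw [mul_assoc]
      exact Nat.mul_le_mul (by omega) (Nat.le_mul_of_pos_right _ hJ1)
    omega
  | @forget x s ts _ hr =>
    obtain ⟨e, es, ⟨j, tw, rfl, hj, htab⟩, hes', rfl⟩ := List.forall₂_cons_left_iff.1 hes
    have hs : Fits G b path s := Reach.fits ht (.forget hr) s List.mem_cons_self
    have hlen := (htab.length_le hs).trans (hS _ ((card_bag_le s).trans hs.card_le))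
    refine (Ev.ifEq (c := K + 60) (Pu.var (v := .num 4) (by simp [encI, Dat.fst])) (Pu.num 2)
      (fun h => by simp at h) (fun _ => ?_)).mono (by omega) fun _ _ h => h
    refine (Ev.ifEq (c := K + 50) (Pu.var (v := .num 4) (by simp [encI, Dat.fst])) (Pu.num 3)
      (fun h => by simp at h) (fun _ => ?_)).mono (by omega) fun _ _ h => h
    refine (Ev.ifEq (c := K + 40) (Pu.var (v := .num 4) (by simp [encI, Dat.fst])) (Pu.num 4)
      (fun _ => ?_) (fun h => by simp at h)).mono (by omega) fun _ _ h => h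
    refine (Ev.lett (Ev.forgetNode (G := G) (i := c) (j := j) (ℓ := 6 * b + 2) (x := x) (tw := tw)
      (t := s) (by simp [encI, encO, Dat.snd]) (by simp [encL, Dat.fst, Dat.snd])
      (by simp [encL, Dat.fst, Dat.snd]) (by simp [Dat.fst]) (by simp [hc]) hδ
      (hcap _ (hP _ _ hr)) (fun w => hf w c le_rfl) (by omega)
      htab fun σ hσ => htab.length_word_le hs hσ) fun tv v δ' hT => (Ev.push (by simp [Dat.fst])
      (by simp) (by simp [encL, Dat.snd]) (by simp [hN]) hcr hδ hf hes' hT).mono le_rfl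
      fun v δ'' h => ⟨_, hr, h⟩).mono ?_ fun _ _ h => h
    have : tw.length * (400 * (6 * b + 2 + 1) ^ 2) ≤ K := by
      refine Nat.mul_le_mul hlen ?_
      rw [mul_assoc]
      exact Nat.mul_le_mul (by omega) ((Nat.pow_le_pow_right hb1 (by omega)).trans
        (Nat.le_mul_of_pos_right _ hJ1))
    omega
  | @join s₁ s₂ ts _ hr =>
    obtain ⟨e₂, es, ⟨j₂, tw₂, rfl, hj₂, htab₂⟩, hes', rfl⟩ := List.forall₂_cons_left_iff.1 hes
    obtain ⟨e₁, es, ⟨j₁, tw₁, rfl, hj₁, htab₁⟩, hes'', rfl⟩ := List.forall₂_cons_left_iff.1 hes'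
    have hs₁ : Fits G b path s₁ := Reach.fits ht (.join hr) s₁ (by simp)
    have hlen := (htab₁.length_le hs₁).trans (hS _ ((card_bag_le s₁).trans hs₁.card_le))
    -- A path contains no join node, so here the second alternative for `J` holds.
    have hJ' : 3 ^ (2 * b) ≤ J := hJ.resolve_left fun h => (hP _ _ hr).isPath h
    refine (Ev.ifEq (c := K + 80) (Pu.var (v := .num 5) (by simp [encI, Dat.fst])) (Pu.num 2)
      (fun h => by simp at h) (fun _ => ?_)).mono (by omega) fun _ _ h => h
    refine (Ev.ifEq (c := K + 70) (Pu.var (v := .num 5) (by simp [encI, Dat.fst])) (Pu.num 3)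
      (fun h => by simp at h) (fun _ => ?_)).mono (by omega) fun _ _ h => h
    refine (Ev.ifEq (c := K + 60) (Pu.var (v := .num 5) (by simp [encI, Dat.fst])) (Pu.num 4)
      (fun h => by simp at h) (fun _ => ?_)).mono (by omega) fun _ _ h => h
    refine (Ev.letPu (Pu.fst (Pu.fst Pu.v0)) fun ji₁ => Ev.letPu
      (Pu.snd (Pu.fst Pu.v1)) fun ti₁ => Ev.letPu (c := K + 42) (Pu.snd Pu.v2) fun si'' =>
      ?_).mono (by omega) fun _ _ h => h
    refine (Ev.lett (Ev.joinNode (G := G) (i := c) (j₁ := j₁) (j₂ := j₂) (ℓ := 6 * b + 2)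
      (tw := tw₁) (tw₂ := tw₂) (t₁ := s₁) (t₂ := s₂) (by simp [encL, Dat.fst, Dat.snd])
      (by simp [encL, Dat.fst, Dat.snd]) (by simp [encL, Dat.fst, Dat.snd]) (by simp [Dat.fst])
      (by simp [hc]) (hcap _ (hP _ _ hr)) (fun w => hf w c le_rfl) (by omega) (by omega)
      htab₁ htab₂ (fun σ hσ => htab₁.length_word_le hs₁ hσ)
      fun σ hσ => htab₁.length_letters_le hs₁ hσ) fun tv v δ' hT => (Ev.push (by simp [Dat.fst])
      (by simp) (by simp [encL, Dat.snd]) (by simp [hN]) hcr hδ hf hes'' hT).mono le_rfl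
      fun v δ'' h => ⟨_, hr, h⟩).mono ?_ fun _ _ h => h
    have : tw₁.length * (2300 * (6 * b + 2 + 1) * 3 ^ (2 * b)) ≤ K := by
      refine Nat.mul_le_mul hlen (Nat.mul_le_mul (Nat.mul_le_mul_left _ ?_) hJ')
      calc 6 * b + 2 + 1 = (6 * b + 3) ^ 1 := by ring
        _ ≤ _ := Nat.pow_le_pow_right hb1 (by omega)
    omega

end machine

end TreeLang

/-! ### Reading the input, and the whole evaluation -/

namespace TreeLang

open Word NiceTree

section solve

variable {n : ℕ} {I : ℕ → ℕ → ℕ} {L : List (ℕ × Dat)} {δ δ' : Dict} {G : SimpleGraph (Fin n)}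
  {b : ℕ} {path : Prop}

/-- A loop over the numbers below `m`, in decreasing order. -/
theorem Ev.countdown {l i : T} {f : ℕ → ℕ → T} {m c ca cb : ℕ} {Q Q' : Dat → Dict → Prop}
    (hl : Pu I L l (.num m) ca) (hi : Ev I L δ i cb Q') (J : ℕ → Dat → Dict → Prop)
    (h0 : ∀ v δ', Q' v δ' → J m v δ')
    (hstep : ∀ j acc δ' xi ai, j < m → J (j + 1) acc δ' →
      Ev I ((xi, .num j) :: (ai, acc) :: L) δ' (f xi ai) c (J j))
    (hQ : ∀ v δ', J 0 v δ' → Q v δ') :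
    Ev I L δ (loopE l i f) (ca + cb + 1 + m * (c + 1)) Q := by
  have := Ev.loop (f := f) (c := c) hl (steps_num m) hi (fun r v δ' => ∃ j ≤ m,
    r = (List.range j).reverse.map .num ∧ J j v δ') (fun v δ' h => ⟨m, le_rfl, rfl, h0 v δ' h⟩)
    (Q := Q) ?_ ?_
  · simpa using this
  · rintro x r acc δ' xi ai ⟨j, hj, h1, h2⟩
    cases j with
    | zero => simp at h1
    | succ j =>
      simp only [List.range_succ, List.reverse_append, List.reverse_cons, List.reverse_nil,
        List.nil_append, List.cons_append, List.map_cons, List.cons.injEq] at h1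
      obtain ⟨rfl, rfl⟩ := h1
      exact (hstep j acc δ' xi ai hj h2).mono le_rfl fun v δ'' h => ⟨j, by omega, rfl, h⟩
  · rintro v δ' ⟨j, hj, h1, h2⟩
    obtain rfl : j = 0 := by simpa using h1.symm
    exact hQ v δ' h2

def readAdjV (m : ℕ) : T :=
  loopE (varE m) (numE 0) fun i _ => letE (inpE 0 (varE i)) fun u => letE (inpE 1 (varE i)) fun v =>
    letE (putE (pairE (varE u) (varE v)) (numE 1)) fun _ =>
      putE (pairE (varE v) (varE u)) (numE 1)

/-- `k` is the key of the edge number `i`. -/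
def IsEdgeKey (I : ℕ → ℕ → ℕ) (i : ℕ) (k : Dat) : Prop :=
  k = .cons (.num (I 0 i + 2)) (.num (I 1 i + 2)) ∨ k = .cons (.num (I 1 i + 2)) (.num (I 0 i + 2))

-- Each edge is entered in both orders. The loop counts down, so when `j` is the counter, exactly
-- the edges from `j` on have been entered. Table entries are still at their default afterwards.
open Classical in
theorem Ev.readAdj {mi m : ℕ} (hm : (mi, .num m) ∈ L)
    (hE : ∀ u v : Fin n, G.Adj u v ↔ ∃ i < m, IsEdgeKey I i (adjKey u v)) :
    Ev I L (fun _ => .num 0) (readAdjV mi) (3 + m * 30) fun _ δ =>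
      HasAdj G δ ∧ ∀ (w : Word (Fin n)) i, δ (tabKey w i) = .num 0 := by
  refine (Ev.countdown (c := 29) (Pu.var hm) ((Pu.num 0) fun _ => .num 0) (fun j _ δ =>
    ∀ k, δ k = if ∃ i, j ≤ i ∧ i < m ∧ IsEdgeKey I i k then .num 1 else .num 0) ?_ ?_ ?_).mono
    (by omega) fun _ _ h => h
  · rintro v δ ⟨rfl, rfl⟩ k
    rw [if_neg]
    rintro ⟨i, h1, h2, -⟩
    omega
  · intro j acc δ xi ai hj h
    refine (Ev.letPu (c := 24) (Pu.inp (by omega) Pu.v0) fun ui => ?_).mono (by omega)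
      fun _ _ h => h
    refine (Ev.letPu (c := 20) (Pu.inp (by omega) Pu.v1) fun vi => ?_).mono (by omega)
      fun _ _ h => h
    refine (Ev.lett (c := 10) (Ev.put (Q := fun _ δ' => δ' = Function.update δ
      (.cons (.num (I 0 j + 2)) (.num (I 1 j + 2))) (.num 1)) (Pu.pair Pu.v1 Pu.v0) (Pu.num 1) rfl)
      fun x v δ' hδ' => ?_).mono (by omega) fun _ _ h => h
    refine (Ev.put (Pu.pair Pu.v1 Pu.v2) (Pu.num 1) ?_).mono (by omega) fun _ _ h => h
    subst hδ'
    intro k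
    have hiff : (∃ i, j ≤ i ∧ i < m ∧ IsEdgeKey I i k) ↔ IsEdgeKey I j k ∨
        ∃ i, j + 1 ≤ i ∧ i < m ∧ IsEdgeKey I i k := by
      constructor
      · rintro ⟨i, h1, h2, h3⟩
        rcases h1.eq_or_lt with rfl | h1
        · exact Or.inl h3
        · exact Or.inr ⟨i, h1, h2, h3⟩
      · rintro (h | ⟨i, h1, h2⟩)
        · exact ⟨j, le_rfl, hj, h⟩
        · exact ⟨i, by omega, h2⟩
    have hk : IsEdgeKey I j k ↔ k = .cons (.num (I 0 j + 2)) (.num (I 1 j + 2)) ∨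
      k = .cons (.num (I 1 j + 2)) (.num (I 0 j + 2)) := Iff.rfl
    rw [Function.update_apply, Function.update_apply, h k]
    simp only [hiff, hk, Dat.snd]
    clear hiff hk h
    generalize (∃ i, j + 1 ≤ i ∧ i < m ∧ IsEdgeKey I i k) = p
    split_ifs <;> simp_all
  · intro v δ h
    refine ⟨fun u v => ?_, fun w i => ?_⟩
    · rw [h, hE]
      split_ifs with h' <;> simpa using h'
    · rw [h, if_neg]
      rintro ⟨i', -, -, h | h⟩
      all_goals
        simp only [tabKey, Dat.cons.injEq] at h
        cases w <;> simp [encW, encL] at h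

def readCodeV (N : ℕ) : T :=
  loopE (varE N) (numE 0) fun i acc =>
    pairE (pairE (inpE 2 (varE i)) (inpE 3 (varE i))) (varE acc)

/-- Counting down while consing produces the instructions in their original order. -/
theorem Pu.readCode {Ni : ℕ} {code : List (ℕ × ℕ)} (hN : (Ni, .num code.length) ∈ L)
    (h2 : ∀ i (h : i < code.length), I 2 i = code[i].1)
    (h3 : ∀ i (h : i < code.length), I 3 i = code[i].2) :
    Pu I L (readCodeV Ni) (encL (code.map encI)) (3 + code.length * 8) := fun δ => by
  refine (Ev.countdown (c := 7) (Pu.var hN) ((Pu.num 0) δ) (fun j v δ' =>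
    v = encL ((code.drop j).map encI) ∧ δ' = δ) ?_ ?_ ?_).mono (by omega) fun _ _ h => h
  · rintro v δ' ⟨rfl, rfl⟩
    simp [encL]
  · rintro j acc δ' xi ai hj ⟨rfl, rfl⟩
    refine (Pu.pair (Pu.pair (Pu.inp (by omega) Pu.v0) (Pu.inp (by omega) Pu.v0)) Pu.v1).ev
      ⟨?_, rfl⟩ |>.mono (by omega) fun _ _ h => h
    rw [List.drop_eq_getElem_cons hj, h2 j hj, h3 j hj]
    rfl
  · rintro v δ' ⟨rfl, rfl⟩
    exact ⟨by simp, rfl⟩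

def tableMaxV (tw j : ℕ) : T :=
  loopE (varE tw) (numE 0) fun w acc => letE (getE (pairE (varE w) (varE j))) fun e =>
    letE (fstE (varE e)) fun s => ifLtE (varE acc) (varE s) (varE s) (varE acc)

/-- The running maximum starts from zero, which need not be a value. At the end it is attained
nevertheless: if it is still zero, then any existing value is at most zero. -/
theorem Ev.tableMax {ti ji j : ℕ} {tw : List (Word (Fin n))} {S : Word (Fin n) → ℕ → Prop}
    (ht : (ti, encL (tw.map encW)) ∈ L) (hj : (ji, .num j) ∈ L) (htab : IsTable δ j tw S)
    (hne : ∃ w v, S w v) :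
    Ev I L δ (tableMaxV ti ji) (3 + tw.length * 20) fun v _ =>
      ∃ m, v = .num m ∧ IsGreatest {v | ∃ w, S w v} m := by
  refine (Ev.loop (c := 19) (Pu.var ht) (steps_encL _) ((Pu.num 0) δ) (fun r v δ' => δ' = δ ∧
    ∃ us ws m, tw = us ++ ws ∧ r = ws.map encW ∧ v = .num m ∧ (∀ w ∈ us, ∀ v, S w v → v ≤ m) ∧
      (m = 0 ∨ ∃ w, S w m)) ?_ ?_ ?_).mono ?_ fun _ _ h => h
  · rintro v δ' ⟨rfl, rfl⟩
    exact ⟨rfl, [], tw, 0, rfl, rfl, rfl, by simp, Or.inl rfl⟩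
  · rintro x r acc δ' xi ai ⟨rfl, us, ws, m, h1, h2, rfl, h3, h4⟩
    cases ws with
    | nil => simp at h2
    | cons w ws =>
      simp only [List.map_cons, List.cons.injEq] at h2
      obtain ⟨rfl, rfl⟩ := h2
      obtain ⟨s, hs, hg⟩ := htab.best (w := w) (by simp [h1])
      refine (Ev.lett (c := 10) (Ev.get (Q := fun v δ'' => v = .cons (.num s) (.num 0) ∧ δ'' = δ')
        (Pu.pair Pu.v0 (Pu.var (v := .num j) (by simp [hj]))) ⟨hs, rfl⟩)
        fun ei v δ'' h => ?_).mono (by omega) fun _ _ h => h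
      obtain ⟨rfl, rfl⟩ := h
      refine (Ev.letPu (c := 4) (Pu.fst Pu.v0) fun si => ?_).mono (by omega) fun _ _ h => h
      refine (Ev.ifLt (c := 1) Pu.v3 Pu.v0 (fun e => Pu.v0.ev ⟨rfl, us ++ [w], ws, s, by simp [h1],
        rfl, rfl, ?_, Or.inr ⟨w, hg.1⟩⟩) (fun e => Pu.v3.ev ⟨rfl, us ++ [w], ws, m, by simp [h1],
        rfl, rfl, ?_, h4⟩)).mono (by omega) fun _ _ h => h
      all_goals
        simp only [Dat.fst, Dat.toNat] at e
        intro w' hw' v hv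
        rcases List.mem_append.1 hw' with hw' | hw'
        · have := h3 w' hw' v hv
          omega
        · obtain rfl := List.mem_singleton.1 hw'
          have : v ≤ s := hg.2 hv
          omega
  · rintro v δ' ⟨rfl, us, ws, m, h1, h2, rfl, h3, h4⟩
    obtain rfl : ws = [] := by simpa using h2.symm
    rw [List.append_nil] at h1
    subst h1
    have hub : ∀ w v, S w v → v ≤ m := fun w v h => h3 w (htab.mem h) v h
    refine ⟨m, rfl, ?_, fun v ⟨w, h⟩ => hub w v h⟩
    rcases h4 with rfl | h4
    · obtain ⟨w, v, h⟩ := hne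
      have := hub w v h
      obtain rfl : v = 0 := by omega
      exact ⟨w, h⟩
    · exact h4
  · rw [List.length_map]

def solveV (m N cap : ℕ) : T :=
  letE (readAdjV m) fun _ => letE (readCodeV N) fun codes =>
    letE (loopE (varE codes) (pairE (numE 0) (numE 0)) fun d acc => stepV d acc N cap) fun r =>
      letE (sndE (fstE (sndE (varE r)))) fun tw => letE (fstE (fstE (sndE (varE r)))) fun j =>
        tableMaxV tw j

theorem Ev.solve {mi Ni ci m S J : ℕ} {t : NiceTree (Fin n)} (hm : (mi, .num m) ∈ L)
    (hN : (Ni, .num t.code.length) ∈ L) (hc : (ci, .num (2 * G.edgeSet.ncard)) ∈ L)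
    (hE : ∀ u v : Fin n, G.Adj u v ↔ ∃ i < m, IsEdgeKey I i (adjKey u v))
    (h2 : ∀ i (h : i < t.code.length), I 2 i = t.code[i].1)
    (h3 : ∀ i (h : i < t.code.length), I 3 i = t.code[i].2)
    (ht : Fits G b path t) (hS : ∀ B : Finset (Fin n), B.card ≤ b → (bagWords B).length ≤ S)
    (hJ : path ∨ 3 ^ (2 * b) ≤ J) (hJ1 : 1 ≤ J) (hne : ∃ w v, Der G t w v) :
    Ev I L (fun _ => .num 0) (solveV mi Ni ci)
      (m * 30 + t.code.length * (S * (2300 * (6 * b + 3) ^ 3 * J) + 160) + S * 20 + 40) fun v _ =>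
      ∃ M, v = .num M ∧ IsGreatest {v | ∃ w, Der G t w v} M := by
  set K := S * (2300 * (6 * b + 3) ^ 3 * J) with hK
  have hmain : ∀ (δ : Dict) (x ri : ℕ) (v : Dat), HasAdj G δ →
      (∀ (w : Word (Fin n)) i, δ (tabKey w i) = .num 0) →
      Ev I ((ri, encL (t.code.map encI)) :: (x, v) :: L) δ
        (loopE (varE ri) (pairE (numE 0) (numE 0)) fun d acc => stepV d acc Ni ci)
        (5 + t.code.length * (K + 151)) (MachineInv G t.code.length 0 [t]) := by
    intro δ x ri v hδ hf
    refine (Ev.loop (c := K + 150) Pu.v0 (steps_encL _) ((Pu.pair (Pu.num 0) (Pu.num 0)) δ)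
      (fun r v δ' => ∃ ts rest, r = rest.map encI ∧ Reach t ts rest ∧
        MachineInv G t.code.length rest.length ts v δ') ?_ ?_ ?_).mono (by simp)
        fun _ _ h => h
    · rintro v δ' ⟨rfl, rfl⟩
      refine ⟨[], t.code, rfl, ?_, 0, [], rfl, by omega, hδ, fun w i _ => hf w i, .nil⟩
      simpa using Reach.code t .done
    · rintro d r acc δ' xi ai ⟨ts, rest, h1, h2, h3⟩
      cases rest with
      | nil => simp at h1
      | cons d rest =>
        simp only [List.map_cons, List.cons.injEq] at h1
        obtain ⟨rfl, rfl⟩ := h1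
        refine (Ev.step (acc := acc) (d := d) (r := rest.length) (by simp) (by simp) (by simp [hN])
          (by simp [hc]) ht hS hJ hJ1 h2 h3).mono le_rfl fun v δ'' h => ?_
        obtain ⟨ts', h4, h5⟩ := h
        exact ⟨ts', rest, rfl, h4, h5⟩
    · rintro v δ' ⟨ts, rest, h1, h2, h3⟩
      obtain rfl : rest = [] := by simpa using h1.symm
      cases h2
      exact h3
  refine (Ev.lett (c := t.code.length * (K + 159) + S * 20 + 36) (Ev.readAdj hm hE)
    fun x v δ h => ?_).mono ?_ fun _ _ h => h
  · refine (Ev.letPu (c := t.code.length * (K + 151) + S * 20 + 30)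
      (Pu.readCode (code := t.code) (by simp [hN]) h2 h3) fun ri => ?_).mono ?_ fun _ _ h => h
    · refine (Ev.lett (c := S * 20 + 20) (hmain δ x ri v h.1 h.2)
        fun fi v δ' hM => ?_).mono (by omega) fun _ _ h => h
      obtain ⟨c, es, rfl, -, -, -, hes⟩ := hM
      obtain ⟨e, es, ⟨j, tw, rfl, hj, htab⟩, hes', rfl⟩ := List.forall₂_cons_left_iff.1 hes
      have hlen := (htab.length_le ht).trans (hS _ ((card_bag_le t).trans ht.card_le))
      refine (Ev.letPu (c := S * 20 + 12) (Pu.snd (Pu.fst (Pu.snd Pu.v0))) fun ti => ?_).mono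
        (by omega) fun _ _ h => h
      refine (Ev.letPu (c := S * 20 + 3) (Pu.fst (Pu.fst (Pu.snd Pu.v1))) fun ji => ?_).mono
        (by omega) fun _ _ h => h
      exact (Ev.tableMax (tw := tw) (j := j) (by simp [encL, Dat.fst, Dat.snd])
        (by simp [encL, Dat.fst, Dat.snd]) htab hne).mono (by omega) fun _ _ h => h
    · nlinarith
  · nlinarith

end solve

end TreeLang

namespace TreeLang

open RAM NiceTree Word

/-! ### The program and its running time -/

section program

variable {n : ℕ} {G : SimpleGraph (Fin n)} {E : List (Fin n × Fin n)} {t : NiceTree (Fin n)}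

/-- The edge deletion number of the graph in the input. -/
def program : Program :=
  .seq (.const 4 2) <| .seq (.const 5 1) <| .seq (.op .add 10 1 1) <| .seq (.op .add 11 2 2) <|
  .seq (.op .add 12 10 10) <| .seq (compile (solveV 0 1 2 3) 3) <| .seq (.op .div 0 13 4) <|
  .seq (.op .div 0 0 4) (.op .sub 0 1 0)

theorem length_eq_ncard (hE : IsEdgeList E G) : E.length = G.edgeSet.ncard := by
  classical
  have : G.edgeSet = ((E.map fun a => s(a.1, a.2)).toFinset : Set (Sym2 (Fin n))) := by
    ext e
    rw [hE.1 e]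
    simp
  rw [this, Set.ncard_coe_finset, List.toFinset_card_of_nodup hE.2, List.length_map]

theorem getD_le {l : List ℕ} {c : ℕ} (h : ∀ x ∈ l, x ≤ c) (i : ℕ) : l.getD i 0 ≤ c := by
  rw [List.getD_eq_getElem?_getD]
  by_cases hi : i < l.length
  · rw [List.getElem?_eq_getElem hi]
    exact h _ (List.getElem_mem hi)
  · rw [List.getElem?_eq_none (by omega)]
    exact Nat.zero_le c

theorem le_of_mem_code {p : ℕ × ℕ} (h : p ∈ t.code) : p.1 ≤ 3 ∧ p.2 ≤ n := by
  induction t with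
  | leaf => simp [code] at h; subst h; simp
  | introduce x t ih =>
    rcases List.mem_append.1 h with h | h
    · exact ih h
    · simp at h; subst h; simp [x.2.le]
  | forget x t ih =>
    rcases List.mem_append.1 h with h | h
    · exact ih h
    · simp at h; subst h; simp [x.2.le]
  | join t₁ t₂ ih₁ ih₂ =>
    rcases List.mem_append.1 h with h | h
    · rcases List.mem_append.1 h with h | h
      · exact ih₁ h
      · exact ih₂ h
    · simp at h; subst h; simp

theorem inputState_arr_le (A i : ℕ) : (inputState E t).arr A i ≤ n + 3 := by
  match A with
  | 0 =>
    refine getD_le (fun x hx => ?_) i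
    obtain ⟨e, -, rfl⟩ := List.mem_map.1 hx
    have := e.1.2
    omega
  | 1 =>
    refine getD_le (fun x hx => ?_) i
    obtain ⟨e, -, rfl⟩ := List.mem_map.1 hx
    have := e.2.2
    omega
  | 2 =>
    refine getD_le (fun x hx => ?_) i
    obtain ⟨e, he, rfl⟩ := List.mem_map.1 hx
    have := le_of_mem_code he
    omega
  | 3 =>
    refine getD_le (fun x hx => ?_) i
    obtain ⟨e, he, rfl⟩ := List.mem_map.1 hx
    have := le_of_mem_code he
    omega
  | A + 4 => exact Nat.zero_le _

theorem adj_iff_isEdgeKey (hE : IsEdgeList E G) (u v : Fin n) :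
    G.Adj u v ↔ ∃ i < E.length, IsEdgeKey (inputState E t).arr i (adjKey u v) := by
  have h0 : ∀ i (h : i < E.length), (inputState E t).arr 0 i = (E[i].1 : ℕ) := fun i h => by
    simp [inputState, List.getD_eq_getElem?_getD, h]
  have h1 : ∀ i (h : i < E.length), (inputState E t).arr 1 i = (E[i].2 : ℕ) := fun i h => by
    simp [inputState, List.getD_eq_getElem?_getD, h]
  have hk : ∀ i (h : i < E.length), IsEdgeKey (inputState E t).arr i (adjKey u v) ↔
      s(u, v) = s(E[i].1, E[i].2) := fun i h => by
    simp only [IsEdgeKey, adjKey, h0 i h, h1 i h, Dat.cons.injEq, Dat.num.injEq,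
      Nat.add_right_cancel_iff, Fin.val_inj, Sym2.eq_iff]
  rw [← SimpleGraph.mem_edgeSet, hE.1, List.mem_iff_getElem]
  constructor
  · rintro ⟨i, hi, h⟩
    rw [List.length_map] at hi
    exact ⟨i, hi, (hk i hi).2 (by rw [← h, List.getElem_map])⟩
  · rintro ⟨i, hi, h⟩
    exact ⟨i, by rwa [List.length_map], by rw [List.getElem_map]; exact ((hk i hi).1 h).symm⟩

theorem inputState_code (i : ℕ) (h : i < t.code.length) :
    (inputState E t).arr 2 i = t.code[i].1 ∧ (inputState E t).arr 3 i = t.code[i].2 := by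
  constructor <;> simp [inputState, List.getD_eq_getElem?_getD, h]

/-- The cost of the evaluation. -/
def costBound (m N b S J : ℕ) : ℕ :=
  m * 30 + N * (S * (2300 * (6 * b + 3) ^ 3 * J) + 160) + S * 20 + 40

/-- The state in which the compiled term is started. -/
def startState (E : List (Fin n × Fin n)) (t : NiceTree (Fin n)) : State :=
  (((((inputState E t).setReg 4 2).setReg 5 1).setReg 10 (2 * E.length)).setReg 11
    (2 * t.numNodes)).setReg 12 (4 * E.length)

theorem startState_inv : Inv (inputState E t).arr (fun _ => .num 0) (startState E t) where
  zero := rfl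
  two := rfl
  odd := rfl
  hash x hx h := by
    have : x < 1 := hx
    omega
  hash' z h := absurd rfl h
  even _ _ := ⟨rfl, rfl⟩
  rep x hx h := by
    have : x < 1 := hx
    omega
  dict _ _ _ := rfl
  dict_default _ _ := rfl
  fresh _ _ _ := rfl
  inp _ _ := rfl

theorem startState_bounded {κ : ℕ} (hκ : 2 * n + 4 * E.length + 2 * t.numNodes + 10 ≤ κ) :
    Bounded κ (startState E t) where
  free := by
    have : (startState E t).reg 5 = 1 := rfl
    omega
  env i hi := by
    have h0 : ∀ i, 3 ≤ i → (inputState E t).reg i = 0 := fun i hi => by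
      match i, hi with
      | i + 3, _ => rfl
    simp only [startState, setReg_reg]
    split_ifs
    all_goals try omega
    rw [h0 i (by omega)]
    exact Nat.zero_le _
  arr A x := by
    have := inputState_arr_le (E := E) (t := t) A x
    have e : (startState E t).arr A x = (inputState E t).arr A x := rfl
    omega

/-- Numbers are represented by their doubles, so the arguments `m`, `N` and `2 m` enter as `2 m`, `2
N` and `4 m`. The result `2 M` is halved twice, as `M` counts ordered pairs, and subtracted from the
number of edges, which compiled code leaves in register `1`. -/
theorem program_halts {b S J κ K B : ℕ} {path : Prop} (hE : IsEdgeList E G)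
    (ht : t.IsNiceTreeDecomposition G) (hfit : Fits G b path t)
    (hS : ∀ B : Finset (Fin n), B.card ≤ b → (bagWords B).length ≤ S)
    (hJ : path ∨ 3 ^ (2 * b) ≤ J) (hJ1 : 1 ≤ J) (hκ : 2 * n + 4 * E.length + 2 * t.numNodes + 10 ≤ κ)
    (hK : κ + 4 * costBound E.length t.numNodes b S J ≤ K) (hB : (2 * K) * (2 * K) + 2 * K ≤ B) :
    Runs B program (inputState E t) (40 * costBound E.length t.numNodes b S J + 8) fun s =>
      IsIntervalEdgeDeletionNumber G (s.reg 0) := by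
  have hlen := length_eq_ncard hE
  have hcode := length_code t
  have hne : ∃ w v, Der G t w v := by
    obtain ⟨w, h⟩ := exists_der ht bot_le isIntervalGraph_bot
    exact ⟨w, _, h⟩
  have hev := Ev.solve (L := [(0, .num E.length), (1, .num t.code.length),
    (2, .num (2 * G.edgeSet.ncard))]) (mi := 0) (Ni := 1) (ci := 2) (m := E.length) (by simp)
    (by simp) (by simp) (adj_iff_isEdgeKey (t := t) hE) (fun i h => (inputState_code i h).1)
    (fun i h => (inputState_code i h).2) hfit hS hJ hJ1 hne
    [.num E.length, .num t.code.length, .num (2 * G.edgeSet.ncard)] (by simp)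
  rw [hcode, ← hlen, show ([Dat.num E.length, .num t.numNodes, .num (2 * E.length)]).length = 3
    from rfl] at hev
  obtain ⟨hcost, M, hM, hg⟩ := hev
  have hcost' : _ ≤ costBound E.length t.numNodes b S J := hcost
  have hrun := sim hB (solveV 0 1 2 3) [.num E.length, .num t.numNodes, .num (2 * E.length)]
    (fun _ => .num 0) (startState E t) κ (I := (inputState E t).arr) startState_inv (startState_bounded hκ) ?_ ?_ ?_
  · have hend : ∀ s, Post (inputState E t).arr 3 (κ + 4 * (eval (inputState E t).arr (solveV 0 1 2 3) [.num E.length, .num t.numNodes,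
        .num (2 * E.length)] fun _ => .num 0).2.2) (eval (inputState E t).arr (solveV 0 1 2 3) [.num E.length,
        .num t.numNodes, .num (2 * E.length)] fun _ => .num 0).2.1 (eval (inputState E t).arr (solveV 0 1 2 3)
        [.num E.length, .num t.numNodes, .num (2 * E.length)] fun _ => .num 0).1
        (startState E t) s → Runs B (.seq (.op .div 0 13 4) (.seq (.op .div 0 0 4)
          (.op .sub 0 1 0))) s 3 fun s => IsIntervalEdgeDeletionNumber G (s.reg 0) := by
      intro s h
      have h13 : s.reg 13 = 2 * M := by
        have := h.val
        rw [hM] at this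
        exact this
      have h4 : s.reg 4 = 2 := h.inv.two
      have h1 : s.reg 1 = E.length := h.same 1 (by omega) (by omega)
      have hb := h.bd.env 13 (by omega)
      rw [h13] at hb
      have e1 : Op.div.eval (s.reg 13) (s.reg 4) = M := by
        simp only [Op.eval, h13, h4]
        omega
      refine Runs.step (.op _ .div 0 13 4 (by rw [e1]; omega)) ?_
      rw [e1]
      have e2 : Op.div.eval ((s.setReg 0 M).reg 0) ((s.setReg 0 M).reg 4) = M / 2 := by
        simp [Op.eval, h4]
      refine Runs.step (.op _ .div 0 0 4 (by rw [e2]; omega)) ?_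
      rw [e2]
      have e3 : Op.sub.eval (((s.setReg 0 M).setReg 0 (M / 2)).reg 1)
          (((s.setReg 0 M).setReg 0 (M / 2)).reg 0) = E.length - M / 2 := by
        simp [Op.eval, h1]
      refine Runs.last (.op _ .sub 0 1 0 (by rw [e3]; omega)) ?_
      rw [e3]
      simp only [setReg_reg, if_true]
      rw [hlen]
      exact deletionNumber_of_isGreatest ht (by
        convert hg using 1)
    have hmid := Runs.seq hrun hend
    refine (Runs.step (.const _ 4 2 (by omega)) <| Runs.step (.const _ 5 1 (by omega)) <|
      Runs.step (.op _ .add 10 1 1 ?_) <| Runs.step (.op _ .add 11 2 2 ?_) <|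
      Runs.step (T := 40 * costBound E.length t.numNodes b S J + 3) (.op _ .add 12 10 10 ?_) <|
      ?_).mono (by omega) fun _ h => h
    · show E.length + E.length ≤ B
      omega
    · show t.numNodes + t.numNodes ≤ B
      omega
    · show E.length + E.length + (E.length + E.length) ≤ B
      omega
    · refine Runs.mono (T := 40 * (eval (inputState E t).arr (solveV 0 1 2 3) [.num E.length,
        .num t.numNodes, .num (2 * E.length)] fun _ => .num 0).2.2 + 3) ?_ (by omega) fun _ h => h
      have hstart : startState E t = (((((inputState E t).setReg 4 2).setReg 5 1).setReg 10
          (E.length + E.length)).setReg 11 (t.numNodes + t.numNodes)).setReg 12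
          (E.length + E.length + (E.length + E.length)) := by
        rw [startState, show 2 * E.length = E.length + E.length by omega,
          show 2 * t.numNodes = t.numNodes + t.numNodes by omega,
          show 4 * E.length = E.length + E.length + (E.length + E.length) by omega]
      rw [hstart] at hmid
      exact hmid
  · intro i hi
    match i, hi with
    | 0, _ => rfl
    | 1, _ => rfl
    | 2, _ => show 4 * E.length = 2 * (2 * E.length); omega
  · intro A i _
    have := inputState_arr_le (E := E) (t := t) A i
    omega
  · omega

/-- A bound for the number of words in the table of a node whose bag has at most `b` vertices. -/
def tableBound (b : ℕ) : ℕ := (2 * b).factorial * 3 ^ (2 * b + 1) / 2 ^ b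

/-- The bound is increasing in the size of the bag: one more vertex doubles the left side and
multiplies the right side by at least nine times two. -/
theorem length_bagWords_le {b : ℕ} (B : Finset (Fin n)) (hB : B.card ≤ b) :
    (bagWords B).length ≤ tableBound b := by
  rw [tableBound, Nat.le_div_iff_mul_le (by positivity), mul_comm]
  obtain ⟨d, rfl⟩ := Nat.exists_eq_add_of_le hB
  have h := length_bagWords B
  generalize (bagWords B).length = l at *
  generalize B.card = c at *
  clear hB
  induction d with
  | zero => exact h.le
  | succ d ih =>
    have e1 : 2 ^ (c + (d + 1)) * l = 2 * (2 ^ (c + d) * l) := by ring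
    have e2 : (2 * (c + (d + 1))).factorial * 3 ^ (2 * (c + (d + 1)) + 1) =
        (2 * (c + d) + 2) * (2 * (c + d) + 1) * 9 *
          ((2 * (c + d)).factorial * 3 ^ (2 * (c + d) + 1)) := by
      rw [show 2 * (c + (d + 1)) = 2 * (c + d) + 1 + 1 by ring, Nat.factorial_succ,
        Nat.factorial_succ]
      ring
    rw [e1, e2]
    refine Nat.mul_le_mul ?_ ih
    nlinarith [Nat.zero_le (c + d)]

/-- The factor `2 ^ b` saved because the two ends of a vertex carry the same letter is used here: `9
^ b * J` need only be below `(2 * c) ^ b`. -/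
theorem tableBound_mul_le {b J c : ℕ} (h : 9 ^ b * J ≤ (2 * c) ^ b) :
    tableBound b * J ≤ 3 * (2 * b).factorial * c ^ b := by
  have h1 : 2 ^ b * tableBound b ≤ (2 * b).factorial * 3 ^ (2 * b + 1) := Nat.mul_div_le _ _
  refine Nat.le_of_mul_le_mul_left ?_ (show 0 < 2 ^ b by positivity)
  calc 2 ^ b * (tableBound b * J) = 2 ^ b * tableBound b * J := by ring
    _ ≤ (2 * b).factorial * 3 ^ (2 * b + 1) * J := Nat.mul_le_mul_right _ h1
    _ = 3 * (2 * b).factorial * (9 ^ b * J) := by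
      rw [pow_succ, pow_mul]; norm_num; ring
    _ ≤ 3 * (2 * b).factorial * (2 * c) ^ b := Nat.mul_le_mul_left _ h
    _ = _ := by rw [mul_pow]; ring

/-- The exponent six collects one factor `k + 1` from the number of nodes, three from the length of
the words, and two from comparing `(2 (k + 1))!` with `(2 k)!`. -/
theorem cost_le {n k a m N S J c : ℕ} (hn : 0 < n) (hN : N ≤ a * (k + 1) * n)
    (hm : m ≤ N * (k + 1) ^ 2) (hJ : 1 ≤ J)
    (hS : S * J ≤ 3 * (2 * (k + 1)).factorial * c ^ (k + 1)) (hc : 1 ≤ c) (hc' : c ≤ 128) :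
    2 * n + 4 * m + 2 * N + 10 + 40 * costBound m N (k + 1) S J + 10 ≤
      200000000000 * (a + 1) * (n * (2 * k).factorial * c ^ k * (k + 1) ^ 6) := by
  set b := k + 1 with hb
  have hb1 : 1 ≤ b := by omega
  set F := (2 * k).factorial * c ^ k with hF
  have hF1 : 1 ≤ F := Nat.mul_pos (Nat.factorial_pos _) (Nat.pow_pos hc)
  -- The constant is `3 * 128 * 4`: the last gap, one surplus factor `c`, and two new factors of the
  -- factorial, each at most `2 * (k + 1)`.
  have hW : S * J ≤ 1536 * (b ^ 2 * F) := by
    refine hS.trans ?_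
    have e : (2 * b).factorial = (2 * k + 2) * ((2 * k + 1) * (2 * k).factorial) := by
      rw [hb, show 2 * (k + 1) = 2 * k + 1 + 1 by ring, Nat.factorial_succ, Nat.factorial_succ]
    rw [e, hb, pow_succ]
    calc 3 * ((2 * k + 2) * ((2 * k + 1) * (2 * k).factorial)) * (c ^ k * c)
        = 3 * c * ((2 * k + 2) * (2 * k + 1)) * F := by rw [hF]; ring
      _ ≤ 3 * 128 * (4 * (k + 1) ^ 2) * F := by
        refine Nat.mul_le_mul_right _ (Nat.mul_le_mul (Nat.mul_le_mul_left _ hc') ?_)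
        nlinarith
      _ = _ := by ring
  have hSW : S ≤ 1536 * (b ^ 2 * F) := (Nat.le_mul_of_pos_right _ hJ).trans hW
  have hcube : (6 * b + 3) ^ 3 ≤ 729 * b ^ 3 := by
    calc (6 * b + 3) ^ 3 ≤ (9 * b) ^ 3 := Nat.pow_le_pow_left (by omega) 3
      _ = _ := by ring
  set X := n * F * b ^ 6 with hX
  have p1 : n ≤ X := by
    rw [hX, mul_assoc]
    exact Nat.le_mul_of_pos_right _ (Nat.mul_pos hF1 (Nat.pow_pos hb1))
  have p2 : N ≤ a * X := by
    refine hN.trans ?_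
    rw [hX, mul_assoc]
    refine Nat.mul_le_mul_left _ ?_
    calc b * n = n * 1 * b ^ 1 := by ring
      _ ≤ _ := Nat.mul_le_mul (Nat.mul_le_mul_left _ hF1) (Nat.pow_le_pow_right hb1 (by omega))
  have p3 : m ≤ a * X := by
    refine hm.trans ((Nat.mul_le_mul_right _ hN).trans ?_)
    rw [hX]
    calc a * b * n * b ^ 2 = a * (n * 1 * b ^ 3) := by ring
      _ ≤ _ := Nat.mul_le_mul_left _ (Nat.mul_le_mul (Nat.mul_le_mul_left _ hF1)
        (Nat.pow_le_pow_right hb1 (by omega)))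
  have p4 : S ≤ 1536 * X := by
    refine hSW.trans (Nat.mul_le_mul_left _ ?_)
    rw [hX]
    calc b ^ 2 * F = 1 * F * b ^ 2 := by ring
      _ ≤ _ := Nat.mul_le_mul (Nat.mul_le_mul_right _ hn) (Nat.pow_le_pow_right hb1 (by omega))
  -- The constant is `2300 * 729 * 1536`; forty times it is below the factor in the statement.
  have p5 : N * (S * (2300 * (6 * b + 3) ^ 3 * J)) ≤ 2575411200 * (a * X) := by
    calc N * (S * (2300 * (6 * b + 3) ^ 3 * J)) = N * (2300 * (6 * b + 3) ^ 3) * (S * J) := by ring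
      _ ≤ a * b * n * (2300 * (729 * b ^ 3)) * (1536 * (b ^ 2 * F)) := by gcongr
      _ = _ := by rw [hX]; ring
  have hX1 : 1 ≤ X := hn.trans_le p1
  have p6 : n * (2 * k).factorial * c ^ k * b ^ 6 = X := by rw [hX, hF]; ring
  have p7 : costBound m N b S J = m * 30 + (N * (S * (2300 * (6 * b + 3) ^ 3 * J)) + N * 160) +
      S * 20 + 40 := by rw [costBound, Nat.mul_add]
  rw [p6, p7, show 200000000000 * (a + 1) * X = 200000000000 * (a * X) + 200000000000 * X by ring]
  clear_value X
  omega

theorem program_haltsWithin {n a k c J C : ℕ} {α : ℝ} {path : Prop} {G : SimpleGraph (Fin n)}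
    {E : List (Fin n × Fin n)} {t : NiceTree (Fin n)} (hn : 0 < n) (hE : IsEdgeList E G)
    (ht : t.IsNiceTreeDecomposition G) (hk : t.width = k) (hN : t.numNodes ≤ a * (k + 1) * n)
    (hp : path → t.IsPath) (hJ : path ∨ 3 ^ (2 * (k + 1)) ≤ J) (hJ1 : 1 ≤ J)
    (h9 : 9 ^ (k + 1) * J ≤ (2 * c) ^ (k + 1)) (hc : 1 ≤ c) (hc' : c ≤ 128)
    (hα : (c : ℝ) ≤ 2 ^ α) (hC : C = 200000000000 * (a + 1)) :
    HaltsWithin program (inputState E t) (C *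
      (n * (2 * k).factorial * (2 : ℝ) ^ (α * k) *
        ((((Polynomial.X + 1) ^ 6 : Polynomial ℕ).eval k : ℕ)))) 4
      (IsIntervalEdgeDeletionNumber G) := by
  have hb : t.maxBagCard ≤ k + 1 := by
    have : t.maxBagCard - 1 = k := hk
    omega
  have hm : E.length ≤ t.numNodes * (k + 1) ^ 2 :=
    (ht.length_edgeList hE).trans (Nat.mul_le_mul_left _ (Nat.pow_le_pow_left hb 2))
  have hcost := cost_le hn hN hm hJ1 (tableBound_mul_le h9) hc hc'
  rw [← hC] at hcost
  clear hC
  set D := costBound E.length t.numNodes (k + 1) (tableBound (k + 1)) J with hD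
  set κ := 2 * n + 4 * E.length + 2 * t.numNodes + 10 with hκ
  set Z := κ + 40 * D + 10 with hZ
  obtain ⟨τ, s', h1, h2, h3⟩ := program_halts (K := Z) hE ht
    ⟨ht.separated, hb, hp⟩ length_bagWords_le hJ hJ1 le_rfl (by omega) le_rfl
  have hT : (Z : ℝ) ≤ C * (n * (2 * k).factorial * (2 : ℝ) ^ (α * k) *
      ((((Polynomial.X + 1) ^ 6 : Polynomial ℕ).eval k : ℕ))) := by
    refine (Nat.cast_le.2 hcost).trans ?_
    have hpow : (c : ℝ) ^ k ≤ 2 ^ (α * k) := by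
      rw [Real.rpow_mul (by norm_num), Real.rpow_natCast]
      exact pow_le_pow_left₀ (by positivity) hα k
    simp only [Polynomial.eval_pow, Polynomial.eval_add, Polynomial.eval_X, Polynomial.eval_one]
    push_cast
    gcongr
  have hτ : τ ≤ Z := by
    clear_value D
    clear hcost h9 hT
    omega
  refine ⟨_, τ, s', h1, le_trans (Nat.cast_le.2 hτ) hT, ?_, h3⟩
  refine le_trans ?_ (pow_le_pow_left₀ (Nat.cast_nonneg Z) hT 4)
  have hZ3 : 3 ≤ Z := by omega
  -- The numbers are quadratic in `Z`; as `Z` is at least three, the fourth power absorbs the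
  -- constant factors.
  have : 2 * Z * (2 * Z) + 2 * Z ≤ Z ^ 4 := by
    have e : Z ^ 4 = Z * Z * (Z * Z) := by ring
    rw [e]
    clear_value Z
    clear hcost h9
    nlinarith [Nat.mul_le_mul hZ3 hZ3, Nat.mul_le_mul_right Z hZ3]
  exact_mod_cast this

end program

end TreeLang

/-- One program solves Interval-Edge-Deletion on every graph `G` with `n ≥ 1` vertices that is
given with a nice tree decomposition of width `k` with `O(k n)` nodes, in time
`O(n (2k)! 2 ^ (7.76 k) poly(k))`, and even `O(n (2k)! 2 ^ (3.38 k) poly(k))` if the decomposition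
is a path decomposition. -/
theorem theorem1 :
    ∃ P : RAM.Program, ∀ a : ℕ, ∃ (C d : ℕ) (poly : Polynomial ℕ),
      ∀ (n k : ℕ) (G : SimpleGraph (Fin n)) (E : List (Fin n × Fin n)) (t : NiceTree (Fin n)),
        0 < n → IsEdgeList E G → t.IsNiceTreeDecomposition G → t.width = k →
        t.numNodes ≤ a * (k + 1) * n →
          RAM.HaltsWithin P (inputState E t)
            (C * (n * (2 * k).factorial * (2 : ℝ) ^ ((7.76 : ℝ) * k) * (poly.eval k : ℕ))) d
            (IsIntervalEdgeDeletionNumber G) ∧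
          (t.IsPath →
            RAM.HaltsWithin P (inputState E t)
              (C * (n * (2 * k).factorial * (2 : ℝ) ^ ((3.38 : ℝ) * k) * (poly.eval k : ℕ))) d
              (IsIntervalEdgeDeletionNumber G)) := by
  refine ⟨TreeLang.program, fun a => ⟨200000000000 * (a + 1), 4, (Polynomial.X + 1) ^ 6,
    fun n k G E t hn hE ht hk hN => ⟨?_, fun hp => ?_⟩⟩⟩
  -- With joins, `J = 9 ^ (k + 1)`, and `81 ≤ 2 * 128` with `128 = 2 ^ 7`.
  · refine TreeLang.program_haltsWithin (path := False) (c := 128) (J := 3 ^ (2 * (k + 1)))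
      hn hE ht hk hN False.elim (.inr le_rfl) (Nat.pow_pos (by omega)) ?_ (by omega) le_rfl ?_ rfl
    · rw [pow_mul, ← mul_pow]
      exact Nat.pow_le_pow_left (by norm_num) _
    · calc ((128 : ℕ) : ℝ) = 2 ^ (7 : ℝ) := by norm_num
        _ ≤ _ := Real.rpow_le_rpow_of_exponent_le (by norm_num) (by norm_num)
  -- Without joins, `J = 1`, and `9 ≤ 2 * 8` with `8 = 2 ^ 3`.
  · refine TreeLang.program_haltsWithin (path := True) (c := 8) (J := 1) hn hE ht hk hN
      (fun _ => hp) (.inl trivial) le_rfl ?_ (by omega) (by omega) ?_ rfl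
    · rw [mul_one]
      exact Nat.pow_le_pow_left (by norm_num) _
    · calc ((8 : ℕ) : ℝ) = 2 ^ (3 : ℝ) := by norm_num
        _ ≤ _ := Real.rpow_le_rpow_of_exponent_le (by norm_num) (by norm_num)
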